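/- **Conventions.** Algorithms are randomized random access programs under the logarithmic cost criterion (equivalent to a RAM with words of logarithmically many bits up to polylogarithmic factors); reading inputs and writing outputs is charged; $\tilde O$ hides polylogarithmic factors. The product $\vec u^\top M\vec v$ is taken over the Boolean semiring. *OuMv conjecture:* for no constant $\varepsilon>0$ is there an algorithm that preprocesses a Boolean $n\times n$ matrix $M$ in time polynomial in $n$ and then, for $n$ online pairs $(\vec u_k,\vec v_k)$, reports each $\vec u_k^\top M\vec v_k$ before the next pair arrives, in total time $O(n^{3-\varepsilon})$ and with error probability at most $1/3$. In $\gamma$-OuMv ($\gamma>0$ constant) $M$ is $n_1\times n_2$ with $n_1=\lfloor n_2^\gamma\rfloor$, and there are $n_3$ rounds. *Dynamic problem:* a problem $\mathcal P$ assigns to every initial data structure a size, a set $\mathcal X$ of possible updates and a set $\mathcal Q$ of possible queries; a request is an update or a query; every query has to be answered correctly on the current data structure before the next request is revealed. An update $x$ has *cyclic order* $c\ge1$ if inserting $c$ copies of $x$ at any place of any request sequence never changes the correct answers to the other queries. A sequence $\hat\rho\in(\mathcal X\cup\mathcal Q)^T$ is a *$d$-delayed* prediction for a set $S$ of request sequences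 of length $T$ if for every $\rho\in S$ there is a permutation $\pi$ of $[T]$ with $\hat\rho_i=\rho_{\pi(i)}$ and $|\pi^{-1}(i)-i|\le d$ for all $i$. *Local reducibility.* Let $u,q,n:\mathbb N\times\mathbb N\to\mathbb N$. $\mathcal P$ is *$(u,q)$-locally reducible from $\gamma$-OuMv with instance size $n(n_1,n_2)$* if $n(n_1,n_2)$ is polynomially bounded in $n_2$ and one of the following holds. (Fully dynamic) There is a sequence $B=B(n_1,n_2)$ of $u(n_1,n_2)$ updates and $q(n_1,n_2)$ queries, which together with $n_1$ is computable from $n_2$ in polynomial time, such that every update in $B$ has a cyclic order at most a constant $C$, and every $\gamma$-OuMv instance, for every number $n_3\ge1$ of rounds, is reduced to an initial data structure $D_0$ of size $n(n_1,n_2)$, for which all requests of $B$ are possible, and a request sequence $B_1'\circ\dots\circ B_{n_3}'$, where each $B_k'$ is a reordering of a sub-multiset of $B$. (Partially dynamic; put $C=0$) There are a number $n_3=\nu(n_2)\ge1$ of rounds and sequences $B_1,\dots,B_{n_3}$, each with $u(n_1,n_2)$ updates and $q(n_1,n_2)$ queries, such that no update occurs twice in $B_1\circ\dots\circ B_{n_3}$,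 these sequences and $n_1$ are computable from $n_2$ in polynomial time, and every $\gamma$-OuMv instance with $n_3$ rounds is reduced to an initial data structure $D_0$ of size $n(n_1,n_2)$, for which all requests of the $B_k$ are possible, and a request sequence $B_1'\circ\dots\circ B_{n_3}'$, where $B_k'$ is a reordering of $B_k$. In both cases the reduction is online and efficient: $D_0$ is computed from $M$ (and $n_1,n_2,n_3$) in time polynomial in $n_2+n_3$; on arrival of $(\vec u_k,\vec v_k)$ the block $B_k'$ is computed in time $\tilde O(u+q+n_1+n_2)$; and $\vec u_k^\top M\vec v_k$ is computed in time $\tilde O(q+1)$ from any correct answers to the queries in $B_1'\circ\dots\circ B_k'$. *Polynomially lower order.* For quantities $g_1,g_2$ depending on $n_2$ and constants $c_1,c_2,c_3\ge 0$, $f(n_2,n_3)=\tilde{\tilde o}(g_1^{c_1}g_2^{c_2}n_3^{c_3})$ means that for some constants $\varepsilon,N,K>0$, $f\le K(g_1^{c_1-\varepsilon}g_2^{c_2}n_3^{c_3}+g_1^{c_1}g_2^{c_2-\varepsilon}n_3^{c_3}+g_1^{c_1}g_2^{c_2}n_3^{c_3-\varepsilon})$ whenever $g_1,g_2,n_3>N$.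 **Theorem.** Assume the OuMv conjecture. Let $\gamma>0$ and let $\mathcal P$ be $(u,q)$-locally reducible from $\gamma$-OuMv with instance size $n(n_1,n_2)$, a function that is non-decreasing in both arguments, and let $C$ be as above. Let $t\in(0,1)$ be a constant and, for every $n_2$, let $n_1=\lfloor n_2^\gamma\rfloor$, $d_2=\lfloor n_2^t\rfloor$, $d_1=\lfloor d_2^\gamma\rfloor$, $n=n(n_1,n_2)$ and $\delta=(1+C)\,(u(d_1,d_2)+q(d_1,d_2))$. Then there are no functions $U,Q:\mathbb N\to\mathbb N$ and no algorithm that, for every $n_2\ge1$, solves $\mathcal P$ on instances of size at most $n$ with $\delta$-delayed predictions (given $\delta$, the instance and the prediction, with polynomial preprocessing time, and with probability at most $1/3$ of answering some query incorrectly) in update time $U(n)$ and query time $Q(n)$, such that $$n_3\big(u(d_1,d_2)\,U(n)+q(d_1,d_2)\,Q(n)\big)=\tilde{\tilde o}(d_1d_2n_3)\quad\text{or}\quad n_3\big(u(d_1,d_2)\,U(n)+q(d_1,d_2)\,Q(n)\big)=\tilde{\tilde o}(n_1^tn_2^tn_3).$$ Here the times may be amortized: it is enough that every request sequence with $a$ updates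 and $b$ queries is processed in total time at most $a\,U(n)+b\,Q(n)$. -/

import Mathlib

open MeasureTheory
open scoped ENNReal

namespace DynPred

/-! ### Machine model: random access programs under the logarithmic cost criterion -/

/-- Arithmetic on natural numbers: sum, truncated difference, product, integer quotient. -/
inductive ArithOp
  | plus
  | minus
  | times
  | quot

def ArithOp.apply : ArithOp → ℕ → ℕ → ℕ
  | .plus, a, b => a + b
  | .minus, a, b => a - b
  | .times, a, b => a * b
  | .quot, a, b => a / b

/-- Programs of a random access machine. A program has finitely many variables and finitely many
infinite arrays (both named by natural numbers), all holding natural numbers. -/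
inductive Prog
  | skip
  /-- `x := c` -/
  | const (x c : ℕ)
  /-- `x := y op z` -/
  | arith (op : ArithOp) (x y z : ℕ)
  /-- `x := a[y]`, where `a` is the name of an array and `y` a variable -/
  | load (x a y : ℕ)
  /-- `a[y] := z`, where `a` is the name of an array and `y`, `z` are variables -/
  | store (a y z : ℕ)
  /-- `x :=` the random bit number `y` -/
  | coin (x y : ℕ)
  | seq (p p' : Prog)
  /-- `if x ≠ 0 then p else p'` -/
  | ite (x : ℕ) (p p' : Prog)
  /-- `while x ≠ 0 do p` -/
  | loop (x : ℕ) (p : Prog)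

/-- The memory of a machine. -/
structure Memory where
  var : ℕ → ℕ
  arr : ℕ → ℕ → ℕ

/-- The initial memory. -/
def Memory.blank : Memory := ⟨fun _ => 0, fun _ _ => 0⟩

def Memory.setVar (s : Memory) (x v : ℕ) : Memory :=
  ⟨Function.update s.var x v, s.arr⟩

def Memory.setArr (s : Memory) (a i v : ℕ) : Memory :=
  ⟨s.var, Function.update s.arr a (Function.update (s.arr a) i v)⟩

/-- `Exec ω p s s' c`: with random bits `ω`, the program `p` started in memory `s` halts in
memory `s'` at cost `c`. An instruction costs one plus the number of bits of the numbers that it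
handles (logarithmic cost criterion); this agrees, up to polylogarithmic factors, with the unit
cost of a RAM whose words have logarithmically many bits. -/
inductive Exec (ω : ℕ → Bool) : Prog → Memory → Memory → ℕ → Prop
  | skip (s : Memory) : Exec ω .skip s s 1
  | const (s : Memory) (x c : ℕ) : Exec ω (.const x c) s (s.setVar x c) (1 + c.size)
  | arith (s : Memory) (op : ArithOp) (x y z : ℕ) :
      Exec ω (.arith op x y z) s (s.setVar x (op.apply (s.var y) (s.var z)))
        (1 + (s.var y).size + (s.var z).size)
  | load (s : Memory) (x a y : ℕ) :
      Exec ω (.load x a y) s (s.setVar x (s.arr a (s.var y)))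
        (1 + (s.var y).size + (s.arr a (s.var y)).size)
  | store (s : Memory) (a y z : ℕ) :
      Exec ω (.store a y z) s (s.setArr a (s.var y) (s.var z))
        (1 + (s.var y).size + (s.var z).size)
  | coin (s : Memory) (x y : ℕ) :
      Exec ω (.coin x y) s (s.setVar x (ω (s.var y)).toNat) (1 + (s.var y).size)
  | seq {p p' : Prog} {s s' s'' : Memory} {c c' : ℕ} :
      Exec ω p s s' c → Exec ω p' s' s'' c' → Exec ω (.seq p p') s s'' (c + c')
  | iteTrue {x : ℕ} {p p' : Prog} {s s' : Memory} {c : ℕ} :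
      s.var x ≠ 0 → Exec ω p s s' c → Exec ω (.ite x p p') s s' (1 + (s.var x).size + c)
  | iteFalse {x : ℕ} {p p' : Prog} {s s' : Memory} {c : ℕ} :
      s.var x = 0 → Exec ω p' s s' c → Exec ω (.ite x p p') s s' (1 + c)
  | loopDone {x : ℕ} {p : Prog} {s : Memory} :
      s.var x = 0 → Exec ω (.loop x p) s s 1
  | loopStep {x : ℕ} {p : Prog} {s s' s'' : Memory} {c c' : ℕ} :
      s.var x ≠ 0 → Exec ω p s s' c → Exec ω (.loop x p) s' s'' c' →
        Exec ω (.loop x p) s s'' (1 + (s.var x).size + c + c')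

/-- The cost of reading or writing a list of numbers. -/
def listCost (l : List ℕ) : ℕ := (l.map fun a => 1 + a.size).sum

/-- Input convention: the input is written to array `0`, its length to variable `0`. -/
def Memory.input (s : Memory) (l : List ℕ) : Memory :=
  ⟨Function.update s.var 0 l.length,
    Function.update s.arr 0 fun i => if h : i < l.length then l[i] else s.arr 0 i⟩

/-- Output convention: variable `1` holds the length of the output, array `1` its entries. -/
def Memory.output (s : Memory) : List ℕ := (List.range (s.var 1)).map (s.arr 1)

/-- `Call ω p s l s' o c`: called in memory `s` with input `l`, the program `p` halts in memory
`s'` with output `o`; the cost `c` includes reading the input and writing the output. -/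
def Call (ω : ℕ → Bool) (p : Prog) (s : Memory) (l : List ℕ) (s' : Memory) (o : List ℕ)
    (c : ℕ) : Prop :=
  ∃ c', Exec ω p (s.input l) s' c' ∧ o = s'.output ∧ c = listCost l + c' + listCost o

/-- Consecutive calls of `p` on the inputs `ls`, sharing the memory; `os` are the outputs (each
one produced before the next input is given) and `c` is the total cost. -/
inductive CallSeq (ω : ℕ → Bool) (p : Prog) :
    Memory → List (List ℕ) → Memory → List (List ℕ) → ℕ → Prop
  | nil (s : Memory) : CallSeq ω p s [] s [] 0
  | cons {s s' s'' : Memory} {l o : List ℕ} {ls os : List (List ℕ)} {c c' : ℕ} :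
      Call ω p s l s' o c → CallSeq ω p s' ls s'' os c' →
        CallSeq ω p s (l :: ls) s'' (o :: os) (c + c')

/-- An online algorithm: a preprocessing program, and a program that is called once for every
online input. -/
structure OnlineAlg where
  pre : Prog
  step : Prog

/-- `A.Run ω l ls os c₀ c`: after preprocessing `l` at cost `c₀`, the online inputs `ls` are
answered by `os` at total cost `c`. -/
def OnlineAlg.Run (A : OnlineAlg) (ω : ℕ → Bool) (l : List ℕ) (ls os : List (List ℕ))
    (c₀ c : ℕ) : Prop :=
  ∃ s o s', Call ω A.pre Memory.blank l s o c₀ ∧ CallSeq ω A.step s ls s' os c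

/-- The distribution of a sequence of independent fair coin flips. -/
noncomputable def coinMeasure : Measure (ℕ → Bool) :=
  Measure.infinitePi fun _ => (PMF.uniformOfFintype Bool).toMeasure

/-- Self-delimiting encoding of a list of lists. -/
def encList (L : List (List ℕ)) : List ℕ := L.length :: L.flatMap fun l => l.length :: l

/-- The entries of a Boolean vector. -/
def bits {n : ℕ} (v : Fin n → Bool) : List ℕ := List.ofFn fun i => (v i).toNat

/-- The entries of a Boolean matrix, row by row. -/
def matrixBits {m n : ℕ} (M : Matrix (Fin m) (Fin n) Bool) : List ℕ :=
  (List.ofFn fun i => bits (M i)).flatten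

/-! ### The OuMv problem and the OuMv conjecture -/

/-- The Boolean product `uᵀ M v`. -/
def uMv {m n : ℕ} (u : Fin m → Bool) (M : Matrix (Fin m) (Fin n) Bool) (v : Fin n → Bool) : Bool :=
  decide (∃ (i : Fin m) (j : Fin n), (u i && M i j && v j) = true)

/-- `A` solves the OuMv problem with error probability at most `1/3`, preprocessing time
polynomial in `n`, and total time `O(n ^ e)` for all `n` rounds. -/
def SolvesOuMv (A : OnlineAlg) (e : ℝ) : Prop :=
  ∃ K : ℕ, ∀ n : ℕ, 1 ≤ n → ∀ (M : Matrix (Fin n) (Fin n) Bool) (us vs : Fin n → Fin n → Bool),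
    (∀ ω, ∃ os c₀ c,
      A.Run ω (encList [[n], matrixBits M])
        (List.ofFn fun k => encList [bits (us k), bits (vs k)]) os c₀ c ∧
      c₀ ≤ K * n ^ K ∧ (c : ℝ) ≤ K * (n : ℝ) ^ e) ∧
    coinMeasure {ω | ∃ os c₀ c,
      A.Run ω (encList [[n], matrixBits M])
        (List.ofFn fun k => encList [bits (us k), bits (vs k)]) os c₀ c ∧
      os ≠ List.ofFn fun k => [(uMv (us k) M (vs k)).toNat]} ≤ 1 / 3

/-- The OuMv conjecture. -/
def OuMvConjecture : Prop :=
  ∀ ε : ℝ, 0 < ε → ¬ ∃ A : OnlineAlg, SolvesOuMv A (3 - ε)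

/-! ### Dynamic problems -/

/-- A dynamic problem. `Inst` is the type of data structures (instances); `updates x` and
`queries x` are the updates and queries that are possible when the initial data structure is `x`;
`IsAnswer x q a` says that `a` is a correct answer to the query `q` on `x`. -/
structure DynProblem where
  Inst : Type
  Upd : Type
  Qry : Type
  size : Inst → ℕ
  updates : Inst → Set Upd
  queries : Inst → Set Qry
  apply : Inst → Upd → Inst
  IsAnswer : Inst → Qry → List ℕ → Prop
  encInst : Inst → List ℕ
  encUpd : Upd → List ℕ
  encQry : Qry → List ℕ
  encInst_injective : Function.Injective encInst
  encUpd_injective : Function.Injective encUpd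
  encQry_injective : Function.Injective encQry

namespace DynProblem

variable (P : DynProblem)

/-- A request is an update or a query. -/
abbrev Req : Type := P.Upd ⊕ P.Qry

variable {P}

/-- Encoding of a request; the first entry tells updates from queries. -/
def encReq : P.Req → List ℕ
  | .inl x => 0 :: P.encUpd x
  | .inr q => 1 :: P.encQry q

/-- The requests that are possible when the initial data structure is `x₀`. -/
def Possible (x₀ : P.Inst) : P.Req → Prop
  | .inl x => x ∈ P.updates x₀
  | .inr q => q ∈ P.queries x₀

def numUpd (ρ : List P.Req) : ℕ := ρ.countP Sum.isLeft

def numQry (ρ : List P.Req) : ℕ := ρ.countP Sum.isRight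

/-- The data structure after a sequence of requests. -/
def after : P.Inst → List P.Req → P.Inst
  | x, [] => x
  | x, .inl y :: ρ => after (P.apply x y) ρ
  | x, .inr _ :: ρ => after x ρ

/-- `Correct x ρ as`: the list `as` consists of correct answers to the queries of the request
sequence `ρ` (in this order), when `ρ` is applied to `x`. -/
def Correct : P.Inst → List P.Req → List (List ℕ) → Prop
  | _, [], [] => True
  | _, [], _ :: _ => False
  | x, .inl y :: ρ, as => Correct (P.apply x y) ρ as
  | _, .inr _ :: _, [] => False
  | x, .inr q :: ρ, a :: as => P.IsAnswer x q a ∧ Correct x ρ as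

/-- Of the outputs `os`, one per request of `ρ`, those that were given for queries. -/
def queryOutputs (ρ : List P.Req) (os : List (List ℕ)) : List (List ℕ) :=
  ((ρ.zip os).filter fun p => p.1.isRight).map Prod.snd

/-- Inserting `c` copies of the update `x` into a request sequence never changes the correct
answers to the queries before and after them. (Queries before them are not affected anyway.) -/
def HasCyclicOrder (x : P.Upd) (c : ℕ) : Prop :=
  ∀ x₀ : P.Inst, x ∈ P.updates x₀ → ∀ ρ ρ' : List P.Req,
    (∀ r ∈ ρ, Possible x₀ r) → (∀ r ∈ ρ', Possible x₀ r) → ∀ q ∈ P.queries x₀, ∀ a,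
      P.IsAnswer (after x₀ (ρ ++ List.replicate c (.inl x) ++ ρ')) q a ↔
        P.IsAnswer (after x₀ (ρ ++ ρ')) q a

end DynProblem

open DynProblem

/-! ### Bounded delay predictions -/

/-- `ρ'` is a `d`-delayed prediction for the set `S` of request sequences of length `T`: each
`ρ ∈ S` can be reordered into `ρ'` by a permutation that is `d`-close to the identity. -/
def IsDelayed {R : Type} {T : ℕ} (d : ℕ) (ρ' : Fin T → R) (S : Set (Fin T → R)) : Prop :=
  ∀ ρ ∈ S, ∃ π : Equiv.Perm (Fin T), (∀ i, ρ (π i) = ρ' i) ∧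
    ∀ i, |((π⁻¹ i : Fin T) : ℤ) - ((i : Fin T) : ℤ)| ≤ d

/-- `A` solves `P` with bounded delay predictions, with polynomial preprocessing time, update time
`U` and query time `Q`. For each parameter `m ≥ 1` the instances are those of size at most `N m`
(so `U (N m)` and `Q (N m)` are time bounds for instances of size at most `N m`) and the
predictions are `δ m`-delayed; the bound `δ m` on the delay is told to the algorithm.
A request sequence with `a` updates and `b` queries has to be processed in total time
`a * U (N m) + b * Q (N m)`, which worst-case bounds per request imply. The probability that some
query is answered incorrectly is at most `1/3` for every request sequence. -/
def SolvesWithDelayed (P : DynProblem) (A : OnlineAlg) (N δ : ℕ → ℕ) (U Q : ℕ → ℕ) : Prop :=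
  ∃ K : ℕ, ∀ m : ℕ, 1 ≤ m → ∀ x₀ : P.Inst, P.size x₀ ≤ N m →
    ∀ (T : ℕ) (ρ' : Fin T → P.Req) (S : Set (Fin T → P.Req)),
      (∀ i, Possible x₀ (ρ' i)) → IsDelayed (δ m) ρ' S → ∀ ρ ∈ S,
        let l := encList ([δ m] :: P.encInst x₀ :: (List.ofFn ρ').map encReq)
        let ls := (List.ofFn ρ).map encReq
        (∀ ω, ∃ os c₀ c, A.Run ω l ls os c₀ c ∧
          c₀ ≤ K * (N m + listCost l) ^ K ∧
          c ≤ numUpd (List.ofFn ρ) * U (N m) + numQry (List.ofFn ρ) * Q (N m)) ∧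
        coinMeasure {ω | ∃ os c₀ c, A.Run ω l ls os c₀ c ∧
          ¬ Correct x₀ (List.ofFn ρ) (queryOutputs (List.ofFn ρ) os)} ≤ 1 / 3

/-! ### Locally reducible problems -/

/-- The number of rows `n₁ = ⌊n₂ ^ γ⌋` of a `γ`-OuMv instance. -/
noncomputable def rows (γ : ℝ) (n₂ : ℕ) : ℕ := ⌊(n₂ : ℝ) ^ γ⌋₊

/-- The programs of a reduction from `γ`-OuMv. -/
structure RedProgs where
  /-- computes `n₁` and the universal request sequence -/
  univ : Prog
  /-- computes the initial data structure -/
  pre : Prog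
  /-- computes the block of requests of a round from the vectors of the round -/
  enc : Prog
  /-- computes the result of a round from the answers to the queries of its block -/
  dec : Prog

/-- The reduction with programs `R` maps the given OuMv instance, with an `n₁ × n₂` matrix and
`n₃` rounds, to the data structure `D₀` and the request sequence `B 0 ∘ B 1 ∘ ⋯`.
The construction is online and efficient: `D₀` is computed from the matrix in polynomial time; in
each round `k`, the block `B k` is computed in time `Õ(u + q + n₁ + n₂)`, and the result of the
round is computed in time `Õ(q)` from any correct answers to the queries asked so far. The programs
share their memory, so they have access to what they have read or computed before. -/
def Simulates (P : DynProblem) (R : RedProgs) (K u q n₁ n₂ n₃ : ℕ)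
    (M : Matrix (Fin n₁) (Fin n₂) Bool) (us : Fin n₃ → Fin n₁ → Bool) (vs : Fin n₃ → Fin n₂ → Bool)
    (D₀ : P.Inst) (B : Fin n₃ → List P.Req) : Prop :=
  ∀ ω, ∃ s₀ c₀,
    Call ω R.pre Memory.blank (encList [[n₁, n₂, n₃], matrixBits M]) s₀ (P.encInst D₀) c₀ ∧
    c₀ ≤ K * (n₂ + n₃) ^ K ∧
    ∀ as : Fin n₃ → List (List ℕ),
      (∀ k, (as k).length = numQry (B k)) →
      Correct D₀ (List.ofFn B).flatten (List.ofFn as).flatten →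
      ∃ s : ℕ → Memory, s 0 = s₀ ∧ ∀ k : Fin n₃, ∃ s' c c',
        Call ω R.enc (s k) (encList [bits (us k), bits (vs k)]) s' (encList ((B k).map encReq)) c ∧
        c ≤ K * (u + q + n₁ + n₂) * (Nat.log 2 (n₂ + n₃) + 1) ^ K ∧
        Call ω R.dec s' (encList (as k)) (s (k + 1)) [(uMv (us k) M (vs k)).toNat] c' ∧
        c' ≤ K * (q + 1) * (Nat.log 2 (n₂ + n₃) + 1) ^ K

/-- Fully dynamic local reducibility: `P` is `(u, q)`-locally reducible from `γ`-OuMv through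
instances of size `n n₁ n₂`, and every update of the universal request sequence is cyclic of order
at most `C`. The universal request sequence consists of `n₃` copies of `B n₂`. -/
def FullyLocallyReducible (P : DynProblem) (γ : ℝ) (u q n : ℕ → ℕ → ℕ) (C : ℕ) : Prop :=
  ∃ (K : ℕ) (R : RedProgs) (B : ℕ → List P.Req), ∀ n₂ : ℕ, 1 ≤ n₂ →
    (∀ ω, ∃ s c,
      Call ω R.univ Memory.blank [n₂] s (encList ([rows γ n₂] :: (B n₂).map encReq)) c ∧
      c ≤ K * n₂ ^ K) ∧
    n (rows γ n₂) n₂ ≤ K * n₂ ^ K ∧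
    numUpd (B n₂) = u (rows γ n₂) n₂ ∧
    numQry (B n₂) = q (rows γ n₂) n₂ ∧
    (∀ x, Sum.inl x ∈ B n₂ → ∃ c, 1 ≤ c ∧ c ≤ C ∧ HasCyclicOrder x c) ∧
    ∀ n₃ : ℕ, 1 ≤ n₃ → ∀ (M : Matrix (Fin (rows γ n₂)) (Fin n₂) Bool)
      (us : Fin n₃ → Fin (rows γ n₂) → Bool) (vs : Fin n₃ → Fin n₂ → Bool),
      ∃ (D₀ : P.Inst) (B' : Fin n₃ → List P.Req),
        P.size D₀ = n (rows γ n₂) n₂ ∧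
        (∀ r ∈ B n₂, Possible D₀ r) ∧
        (∀ k, (B' k).Subperm (B n₂)) ∧
        Simulates P R K (u (rows γ n₂) n₂) (q (rows γ n₂) n₂) (rows γ n₂) n₂ n₃ M us vs D₀ B'

/-- Partially dynamic local reducibility: the blocks of the universal request sequence are
`B n₂ 0, B n₂ 1, …`, no update occurs twice in it, and in each round the whole block is used, in an
arbitrary order. Since every update occurs only once, the number of rounds that an instance of
size `n n₁ n₂` can serve is limited in general; it is some number `ν n₂ ≥ 1`. -/
def PartiallyLocallyReducible (P : DynProblem) (γ : ℝ) (u q n : ℕ → ℕ → ℕ) : Prop :=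
  ∃ (K : ℕ) (R : RedProgs) (ν : ℕ → ℕ) (B : (n₂ : ℕ) → Fin (ν n₂) → List P.Req),
    ∀ n₂ : ℕ, 1 ≤ n₂ → 1 ≤ ν n₂ ∧
    (∀ ω, ∃ s c,
      Call ω R.univ Memory.blank [n₂] s
        (encList ([rows γ n₂] :: List.ofFn fun k => encList ((B n₂ k).map encReq))) c ∧
      c ≤ K * n₂ ^ K) ∧
    n (rows γ n₂) n₂ ≤ K * n₂ ^ K ∧
    (∀ k, numUpd (B n₂ k) = u (rows γ n₂) n₂ ∧ numQry (B n₂ k) = q (rows γ n₂) n₂) ∧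
    ((List.ofFn (B n₂)).flatten.filter Sum.isLeft).Nodup ∧
    ∀ (M : Matrix (Fin (rows γ n₂)) (Fin n₂) Bool)
      (us : Fin (ν n₂) → Fin (rows γ n₂) → Bool) (vs : Fin (ν n₂) → Fin n₂ → Bool),
      ∃ (D₀ : P.Inst) (B' : Fin (ν n₂) → List P.Req),
        P.size D₀ = n (rows γ n₂) n₂ ∧
        (∀ k, ∀ r ∈ B n₂ k, Possible D₀ r) ∧
        (∀ k, (B' k).Perm (B n₂ k)) ∧
        Simulates P R K (u (rows γ n₂) n₂) (q (rows γ n₂) n₂) (rows γ n₂) n₂ (ν n₂) M us vs D₀ B'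

/-! ### Polynomially lower order -/

/-- `f = õõ(g₁ ^ c₁ * g₂ ^ c₂ * n₃ ^ c₃)`, where `f` depends on two parameters `n₂`, `n₃`, and `g₁`,
`g₂` are functions of `n₂`. -/
def PolyLower (f : ℕ → ℕ → ℕ) (g₁ g₂ : ℕ → ℕ) (c₁ c₂ c₃ : ℝ) : Prop :=
  ∃ (ε C : ℝ) (N : ℕ), 0 < ε ∧ 0 < C ∧ ∀ n₂ n₃ : ℕ, N < g₁ n₂ → N < g₂ n₂ → N < n₃ →
    (f n₂ n₃ : ℝ) ≤ C *
      ((g₁ n₂ : ℝ) ^ (c₁ - ε) * (g₂ n₂ : ℝ) ^ c₂ * (n₃ : ℝ) ^ c₃ +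
        (g₁ n₂ : ℝ) ^ c₁ * (g₂ n₂ : ℝ) ^ (c₂ - ε) * (n₃ : ℝ) ^ c₃ +
        (g₁ n₂ : ℝ) ^ c₁ * (g₂ n₂ : ℝ) ^ c₂ * (n₃ : ℝ) ^ (c₃ - ε))

/-- `d₂ = ⌊n₂ ^ t⌋` -/
noncomputable def dTwo (t : ℝ) (n₂ : ℕ) : ℕ := ⌊(n₂ : ℝ) ^ t⌋₊

/-- `d₁ = ⌊d₂ ^ γ⌋` -/
noncomputable def dOne (γ t : ℝ) (n₂ : ℕ) : ℕ := rows γ (dTwo t n₂)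

end DynPred

/-!
An algorithm that solves the dynamic problem with delayed predictions too quickly would refute the
OuMv conjecture, because an OuMv instance can be cut into small independent pieces, each of which
needs the dynamic algorithm for a single round only.

*The algorithm.* Let `M` be an `n × n` matrix. With `κ = ⌈γ⌉ + 1`, let `d` be the integral part of
`n ^ (1 / κ)`, and cut `M` into blocks with `⌊d ^ γ⌋` rows and `d` columns. The product `uᵀ M v` is
the disjunction of the products of the blocks (`uMv_blocks`). Preprocessing time is free as long as
it is polynomial, so one pair of machines is prepared in advance for every round, every block and
each of `120 * n.size` repetitions: one machine runs the reduction, the other one the dynamic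
algorithm. A pair serves its block in a single round and is never used again. The prediction that
the dynamic algorithm gets is the block `B` of `u + q` requests of the universal sequence; the
requests of the round are asked. Completed by the unused requests of `B`, they are a reordering of
`B`, hence within the delay `δ ≥ u + q` (`SingleRound.exists_specs`). Since only the first round of
the reduction is ever used, the fully and the partially dynamic case are treated alike: both provide
a `SingleRound`. What remains of the other rounds is that correct answers to their queries have to
exist, because a reduction promises nothing otherwise; they do, as an algorithm that errs with
probability at most `1/3` finds some (`SolvesPerm.exists_correct`, `Simulates.oneRound`).

*Programs on one machine.* All these machines live in the memory of one host. The program `sim m V`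
runs `V` on a virtual machine, with overhead logarithmic in the number of the machine (`runs_sim`),
and every virtual machine has random bits of its own. If the dynamic algorithm errs, then the
reduction has to decode wrong answers, and need not halt. Its programs are therefore replaced by
clocked versions, which get an amount of fuel and halt when it is used up (`exists_clkSpec`,
`exists_rcall`, `exists_rdec`). As an instruction is charged for the sizes of the numbers that it
handles before it handles them, every number is stored along with an estimate of its size. The host programs
are assembled from statements `ARuns` about registers and virtual machines; the results are
`call_preProg` for the preprocessing and `callSeq_stepProg` for the online rounds.

*Probability.* The runs on different pairs of machines are independent (`map_coins`), so the majority
over the repetitions is wrong with exponentially small probability (`infinitePi_card_le`,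
`coinMeasure_badCount_le`), and a union bound over all rounds and blocks gives total error at most
`1/3` (`union_bound`, `run_ouMvAlg`).

*Time.* As `t < 1`, every `d` is of the form `⌊m ^ t⌋` for some `m` that is polynomial in `d`
(`exists_dTwo_eq`). The dynamic algorithm is used with this parameter `m`, whose instances include
those for blocks of width `d` by monotonicity of the instance size. Both forms of the assumed bound
then say that one round on a block takes time `O(d ^ (1 + γ - η))` for some `η > 0`
(`exists_time_bound`). There are `O(n ^ 2 / d ^ (1 + γ))` blocks, so all blocks together take
`O(n ^ (2 - η / κ))` per round (`blocks_mul_time_le`). Polylogarithmic factors being absorbed in half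
of the saving, the `n` rounds take time `O(n ^ (3 - η / (2 κ)))`
(`SingleRound.exists_solvesOuMv`), which contradicts the OuMv conjecture.
-/

namespace DynPred

/-! ### Executions with cost bounds -/

theorem Exec.det {ω : ℕ → Bool} {p : Prog} {s s₁ : Memory} {c₁ : ℕ} (h₁ : Exec ω p s s₁ c₁) :
    ∀ {s₂ : Memory} {c₂ : ℕ}, Exec ω p s s₂ c₂ → s₁ = s₂ ∧ c₁ = c₂ := by
  induction h₁ with
  | skip | const | arith | load | store | coin =>
    intro s₂ c₂ h; cases h; exact ⟨rfl, rfl⟩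
  | seq _ _ ih ih' =>
    intro s₂ c₂ h
    cases h with
    | seq k k' =>
      obtain ⟨rfl, rfl⟩ := ih k
      obtain ⟨rfl, rfl⟩ := ih' k'
      exact ⟨rfl, rfl⟩
  | iteTrue hx _ ih =>
    intro s₂ c₂ h
    cases h with
    | iteTrue _ k => obtain ⟨rfl, rfl⟩ := ih k; exact ⟨rfl, rfl⟩
    | iteFalse hx' _ => exact absurd hx' hx
  | iteFalse hx _ ih =>
    intro s₂ c₂ h
    cases h with
    | iteTrue hx' _ => exact absurd hx hx'
    | iteFalse _ k => obtain ⟨rfl, rfl⟩ := ih k; exact ⟨rfl, rfl⟩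
  | loopDone hx =>
    intro s₂ c₂ h
    cases h with
    | loopDone _ => exact ⟨rfl, rfl⟩
    | loopStep hx' _ _ => exact absurd hx hx'
  | loopStep hx _ _ ih ih' =>
    intro s₂ c₂ h
    cases h with
    | loopDone hx' => exact absurd hx' hx
    | loopStep _ k k' =>
      obtain ⟨rfl, rfl⟩ := ih k
      obtain ⟨rfl, rfl⟩ := ih' k'
      exact ⟨rfl, rfl⟩

/-- Total correctness with a cost bound: started in `s`, the program `p` halts at cost at most `b`
in a memory that satisfies `Q`. -/
def Runs (ω : ℕ → Bool) (p : Prog) (s : Memory) (b : ℕ) (Q : Memory → Prop) : Prop :=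
  ∃ s' c, Exec ω p s s' c ∧ c ≤ b ∧ Q s'

section Runs

variable {ω : ℕ → Bool} {p p' : Prog} {s : Memory} {b b' : ℕ} {Q Q' : Memory → Prop}

theorem Runs.mono (h : Runs ω p s b Q) (hb : b ≤ b') (hQ : ∀ s', Q s' → Q' s') :
    Runs ω p s b' Q' := by
  obtain ⟨s', c, h1, h2, h3⟩ := h
  exact ⟨s', c, h1, h2.trans hb, hQ _ h3⟩

theorem Runs.cost_le (h : Runs ω p s b Q) (hb : b ≤ b') : Runs ω p s b' Q :=
  h.mono hb fun _ h => h

theorem Runs.seq (h : Runs ω p s b fun s' => Runs ω p' s' b' Q) :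
    Runs ω (.seq p p') s (b + b') Q := by
  obtain ⟨s', c, h1, h2, s'', c', h3, h4, h5⟩ := h
  exact ⟨s'', c + c', .seq h1 h3, by omega, h5⟩

theorem Runs.skip (h : Q s) : Runs ω .skip s 1 Q := ⟨_, _, .skip s, le_rfl, h⟩

theorem Runs.const {x c : ℕ} (h : Q (s.setVar x c)) : Runs ω (.const x c) s (1 + c.size) Q :=
  ⟨_, _, .const s x c, le_rfl, h⟩

theorem Runs.arith {op : ArithOp} {x y z : ℕ}
    (h : Q (s.setVar x (op.apply (s.var y) (s.var z)))) :
    Runs ω (.arith op x y z) s (1 + (s.var y).size + (s.var z).size) Q :=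
  ⟨_, _, .arith s op x y z, le_rfl, h⟩

theorem Runs.load {x a y : ℕ} (h : Q (s.setVar x (s.arr a (s.var y)))) :
    Runs ω (.load x a y) s (1 + (s.var y).size + (s.arr a (s.var y)).size) Q :=
  ⟨_, _, .load s x a y, le_rfl, h⟩

theorem Runs.store {a y z : ℕ} (h : Q (s.setArr a (s.var y) (s.var z))) :
    Runs ω (.store a y z) s (1 + (s.var y).size + (s.var z).size) Q :=
  ⟨_, _, .store s a y z, le_rfl, h⟩

theorem Runs.coin {x y : ℕ} (h : Q (s.setVar x (ω (s.var y)).toNat)) :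
    Runs ω (.coin x y) s (1 + (s.var y).size) Q :=
  ⟨_, _, .coin s x y, le_rfl, h⟩

theorem Runs.ite {x : ℕ} (h : s.var x ≠ 0 → Runs ω p s b Q) (h' : s.var x = 0 → Runs ω p' s b Q) :
    Runs ω (.ite x p p') s (1 + (s.var x).size + b) Q := by
  by_cases hx : s.var x = 0
  · obtain ⟨s', c, h1, h2, h3⟩ := h' hx
    exact ⟨s', _, .iteFalse hx h1, by omega, h3⟩
  · obtain ⟨s', c, h1, h2, h3⟩ := h hx
    exact ⟨s', _, .iteTrue hx h1, by omega, h3⟩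

theorem Runs.loop_done {x : ℕ} (hx : s.var x = 0) (h : Q s) : Runs ω (.loop x p) s 1 Q :=
  ⟨_, _, .loopDone hx, le_rfl, h⟩

theorem Runs.loop_step {x : ℕ} (hx : s.var x ≠ 0)
    (h : Runs ω p s b fun s' => Runs ω (.loop x p) s' b' Q) :
    Runs ω (.loop x p) s (1 + (s.var x).size + b + b') Q := by
  obtain ⟨s', c, h1, h2, s'', c', h3, h4, h5⟩ := h
  exact ⟨s'', _, .loopStep hx h1 h3, by omega, h5⟩

end Runs

@[simp] theorem Memory.setVar_var (s : Memory) (x v y : ℕ) :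
    (s.setVar x v).var y = if y = x then v else s.var y := by
  simp [Memory.setVar, Function.update_apply]

@[simp] theorem Memory.setVar_arr (s : Memory) (x v : ℕ) : (s.setVar x v).arr = s.arr := rfl

@[simp] theorem Memory.setArr_var (s : Memory) (a i v : ℕ) : (s.setArr a i v).var = s.var := rfl

theorem Memory.setArr_arr (s : Memory) (a i v a' i' : ℕ) :
    (s.setArr a i v).arr a' i' = if a' = a ∧ i' = i then v else s.arr a' i' := by
  unfold Memory.setArr
  by_cases h : a' = a
  · subst h; simp [Function.update_apply]
  · simp [h]

theorem Memory.setArr_arr_of_ne (s : Memory) (a i v a' : ℕ) (h : a' ≠ a) :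
    (s.setArr a i v).arr a' = s.arr a' := by
  funext i'; simp [Memory.setArr_arr, h]

theorem Memory.ext' {s s' : Memory} (h : ∀ x, s.var x = s'.var x)
    (h' : ∀ a i, s.arr a i = s'.arr a i) : s = s' := by
  cases s; cases s'
  simp only [Memory.mk.injEq]
  exact ⟨funext h, funext fun a => funext fun i => h' a i⟩

/-! ### Sizes of results of arithmetic operations -/

theorem size_add_le (a b : ℕ) : (a + b).size ≤ a.size + b.size + 1 := by
  rw [Nat.size_le]
  have ha := Nat.lt_size_self a
  have hb := Nat.lt_size_self b
  have h1 : 2 ^ a.size ≤ 2 ^ (a.size + b.size) := Nat.pow_le_pow_right (by norm_num) (by omega)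
  have h2 : 2 ^ b.size ≤ 2 ^ (a.size + b.size) := Nat.pow_le_pow_right (by norm_num) (by omega)
  rw [pow_succ]
  omega

theorem size_mul_le (a b : ℕ) : (a * b).size ≤ a.size + b.size := by
  rw [Nat.size_le, pow_add]
  exact Nat.mul_lt_mul'' (Nat.lt_size_self a) (Nat.lt_size_self b)

theorem size_apply_le (op : ArithOp) (a b : ℕ) :
    (op.apply a b).size ≤ a.size + b.size + 1 := by
  cases op
  · exact size_add_le a b
  · exact (Nat.size_le_size (Nat.sub_le a b)).trans (by omega)
  · exact (size_mul_le a b).trans (by omega)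
  · exact (Nat.size_le_size (Nat.div_le_self a b)).trans (by omega)

theorem size_le_self (a : ℕ) : a.size ≤ a := Nat.size_le.2 Nat.lt_two_pow_self

/-! ### Registers and virtual machines -/

/-- The place in the memory where cell `y` of an array of the virtual machine `p` is kept. It is an
injective function of `(p, y)` that needs no bound on the number of machines. -/
def cell (p y : ℕ) : ℕ := (p + y) * (p + y) + y

theorem cell_inj {p y p' y' : ℕ} (h : cell p y = cell p' y') : p = p' ∧ y = y' := by
  unfold cell at h
  have key : p + y = p' + y' := by
    rcases lt_trichotomy (p + y) (p' + y') with hlt | heq | hgt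
    · nlinarith
    · exact heq
    · nlinarith
  rw [key] at h
  omega

theorem cell_eq_iff {p y p' y' : ℕ} : cell p y = cell p' y' ↔ p = p' ∧ y = y' :=
  ⟨cell_inj, fun ⟨h, h'⟩ => h ▸ h' ▸ rfl⟩

/-- The memory of the virtual machine number `p`: its variable `x` is kept in cell `p` of the
array `2 x + 20`, and its array `a` in the cells `cell p _` of the array `2 a + 21`. -/
def vmem (s : Memory) (p : ℕ) : Memory :=
  ⟨fun x => s.arr (2 * x + 20) p, fun a y => s.arr (2 * a + 21) (cell p y)⟩

/-- What the host program sees of a memory: its registers (the variables from `10` on; the others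
are scratch variables), the virtual machines, and the input array. -/
structure St where
  reg : ℕ → ℕ
  vm : ℕ → Memory
  inp : ℕ → ℕ

/-- The host state of a memory. Register `y` is the variable `y + 10`. -/
def view (s : Memory) : St := ⟨fun y => s.var (y + 10), vmem s, s.arr 0⟩

/-- Total correctness with a cost bound, on the level of host states. -/
def ARuns (ω : ℕ → Bool) (p : Prog) (X : St) (b : ℕ) (Q : St → Prop) : Prop :=
  ∀ s, view s = X → Runs ω p s b fun s' => Q (view s')

section ARuns

variable {ω : ℕ → Bool} {p p' : Prog} {X : St} {b b' : ℕ} {Q Q' : St → Prop}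

theorem ARuns.mono (h : ARuns ω p X b Q) (hb : b ≤ b') (hQ : ∀ Y, Q Y → Q' Y) :
    ARuns ω p X b' Q' := fun s hs => (h s hs).mono hb fun _ h => hQ _ h

theorem ARuns.cost_le (h : ARuns ω p X b Q) (hb : b ≤ b') : ARuns ω p X b' Q :=
  h.mono hb fun _ h => h

theorem ARuns.seq (h : ARuns ω p X b fun Y => ARuns ω p' Y b' Q) :
    ARuns ω (.seq p p') X (b + b') Q := fun s hs =>
  Runs.seq ((h s hs).mono le_rfl fun s' h' => h' s' rfl)

theorem ARuns.skip (h : Q X) : ARuns ω .skip X 1 Q := fun _ hs => Runs.skip (hs ▸ h)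

theorem ARuns.ite {x : ℕ} (h : X.reg x ≠ 0 → ARuns ω p X b Q) (h' : X.reg x = 0 → ARuns ω p' X b Q) :
    ARuns ω (.ite (x + 10) p p') X (1 + (X.reg x).size + b) Q := by
  rintro s rfl
  exact Runs.ite (fun hx => h hx s rfl) (fun hx => h' hx s rfl)

theorem ARuns.loop_done {x : ℕ} (hx : X.reg x = 0) (h : Q X) : ARuns ω (.loop (x + 10) p) X 1 Q := by
  rintro s rfl
  exact Runs.loop_done hx h

theorem ARuns.loop_step {x : ℕ} (hx : X.reg x ≠ 0)
    (h : ARuns ω p X b fun Y => ARuns ω (.loop (x + 10) p) Y b' Q) :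
    ARuns ω (.loop (x + 10) p) X (1 + (X.reg x).size + b + b') Q := by
  rintro s rfl
  exact Runs.loop_step hx ((h s rfl).mono le_rfl fun s' h' => h' s' rfl)

/-- A loop that counts a register down to zero. -/
theorem ARuns.countdown {x : ℕ} (I : ℕ → St → Prop) (b : ℕ → ℕ) (lam : ℕ)
    (hx : ∀ k Y, I k Y → Y.reg x = k)
    (hstep : ∀ k Y, I (k + 1) Y → ARuns ω p Y (b k) (I k)) :
    ∀ (N : ℕ), N.size ≤ lam → ∀ X, I N X →
      ARuns ω (.loop (x + 10) p) X ((∑ k ∈ Finset.range N, b k) + N * (1 + lam) + 1) (I 0) := by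
  intro N
  induction N with
  | zero => intro _ X hX; exact (ARuns.loop_done (hx 0 X hX) hX).cost_le (by simp)
  | succ N ih =>
    intro hN X hX
    have hr := hx _ X hX
    refine (ARuns.loop_step (by omega) ((hstep N X hX).mono le_rfl fun Y hY =>
      ih ((Nat.size_le_size (Nat.le_succ N)).trans hN) Y hY)).cost_le ?_
    rw [hr, Finset.sum_range_succ]
    nlinarith

end ARuns

/-! ### Arithmetic expressions over registers -/

/-- Arithmetic expressions over the registers. -/
inductive Ex
  | var (x : ℕ)
  | num (k : ℕ)
  | op (o : ArithOp) (a b : Ex)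

namespace Ex

instance : Add Ex := ⟨Ex.op .plus⟩
instance : Sub Ex := ⟨Ex.op .minus⟩
instance : Mul Ex := ⟨Ex.op .times⟩
instance : Div Ex := ⟨Ex.op .quot⟩

/-- The value of an expression when register `x` holds `r x`. -/
def eval (r : ℕ → ℕ) : Ex → ℕ
  | var x => r x
  | num k => k
  | op o a b => o.apply (a.eval r) (b.eval r)

@[simp] theorem eval_var (r : ℕ → ℕ) (x : ℕ) : (var x).eval r = r x := rfl
@[simp] theorem eval_num (r : ℕ → ℕ) (x : ℕ) : (num x).eval r = x := rfl
@[simp] theorem eval_add (r : ℕ → ℕ) (a b : Ex) : (a + b).eval r = a.eval r + b.eval r := rfl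
@[simp] theorem eval_sub (r : ℕ → ℕ) (a b : Ex) : (a - b).eval r = a.eval r - b.eval r := rfl
@[simp] theorem eval_mul (r : ℕ → ℕ) (a b : Ex) : (a * b).eval r = a.eval r * b.eval r := rfl
@[simp] theorem eval_div (r : ℕ → ℕ) (a b : Ex) : (a / b).eval r = a.eval r / b.eval r := rfl

/-- Iterated product. -/
def pow (e : Ex) : ℕ → Ex
  | 0 => num 1
  | k + 1 => e.pow k * e

@[simp] theorem eval_pow (r : ℕ → ℕ) (e : Ex) (k : ℕ) : (e.pow k).eval r = e.eval r ^ k := by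
  induction k with
  | zero => rfl
  | succ k ih => rw [pow, eval_mul, ih, pow_succ]

/-- The number of scratch variables that the evaluation uses. -/
def depth : Ex → ℕ
  | var _ => 1
  | num _ => 1
  | op _ a b => max a.depth (b.depth + 1)

@[simp] theorem depth_var (x : ℕ) : (var x).depth = 1 := rfl
@[simp] theorem depth_num (x : ℕ) : (num x).depth = 1 := rfl
@[simp] theorem depth_add (a b : Ex) : (a + b).depth = max a.depth (b.depth + 1) := rfl
@[simp] theorem depth_sub (a b : Ex) : (a - b).depth = max a.depth (b.depth + 1) := rfl
@[simp] theorem depth_mul (a b : Ex) : (a * b).depth = max a.depth (b.depth + 1) := rfl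
@[simp] theorem depth_div (a b : Ex) : (a / b).depth = max a.depth (b.depth + 1) := rfl

theorem depth_pow_le (e : Ex) (k : ℕ) : (e.pow k).depth ≤ e.depth + 1 := by
  induction k with
  | zero => simp [pow]
  | succ k ih => simp [pow, ih]

/-- If all registers have size at most `lam`, the value has size at most `weight * lam`. -/
def weight : Ex → ℕ
  | var _ => 1
  | num k => k
  | op _ a b => a.weight + b.weight + 1

/-- If all registers have size at most `lam`, the evaluation costs at most `cc * lam`. -/
def cc : Ex → ℕ
  | var _ => 3
  | num k => 1 + k
  | op _ a b => a.cc + b.cc + 1 + a.weight + b.weight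

section

variable (x k : ℕ) (a b : Ex)

@[simp] theorem weight_var : (var x).weight = 1 := rfl
@[simp] theorem weight_num : (num k).weight = k := rfl
@[simp] theorem weight_add : (a + b).weight = a.weight + b.weight + 1 := rfl
@[simp] theorem weight_sub : (a - b).weight = a.weight + b.weight + 1 := rfl
@[simp] theorem weight_mul : (a * b).weight = a.weight + b.weight + 1 := rfl
@[simp] theorem weight_div : (a / b).weight = a.weight + b.weight + 1 := rfl
@[simp] theorem cc_var : (var x).cc = 3 := rfl
@[simp] theorem cc_num : (num k).cc = 1 + k := rfl
@[simp] theorem cc_add : (a + b).cc = a.cc + b.cc + 1 + a.weight + b.weight := rfl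
@[simp] theorem cc_sub : (a - b).cc = a.cc + b.cc + 1 + a.weight + b.weight := rfl
@[simp] theorem cc_mul : (a * b).cc = a.cc + b.cc + 1 + a.weight + b.weight := rfl
@[simp] theorem cc_div : (a / b).cc = a.cc + b.cc + 1 + a.weight + b.weight := rfl

end

theorem size_eval_le (r : ℕ → ℕ) (lam : ℕ) (hlam : 1 ≤ lam) (hr : ∀ y, (r y).size ≤ lam) (e : Ex) :
    (e.eval r).size ≤ e.weight * lam := by
  induction e with
  | var x => simpa [weight] using hr x
  | num k => exact (size_le_self k).trans (Nat.le_mul_of_pos_right _ hlam)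
  | op o a b iha ihb =>
    have := size_apply_le o (a.eval r) (b.eval r)
    simp only [eval, weight]
    nlinarith

/-- The program that writes the value of an expression to the scratch variable `t`. -/
def comp : Ex → ℕ → Prog
  | var x, t => .seq (.const t 0) (.arith .plus t t (x + 10))
  | num k, t => .const t k
  | op o a b, t => .seq (a.comp t) (.seq (b.comp (t + 1)) (.arith o t t (t + 1)))

/-- The intermediate results are kept in the scratch variables from `t` on, so that the evaluation
of the second operand does not overwrite the first one. There are ten of them, which limits the
depth. -/
theorem runs_comp {ω : ℕ → Bool} (lam : ℕ) (hlam : 1 ≤ lam) (e : Ex) :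
    ∀ (t : ℕ) (s : Memory), (∀ y, (s.var (y + 10)).size ≤ lam) → t + e.depth ≤ 10 →
      Runs ω (e.comp t) s (e.cc * lam) fun s' => s'.var t = e.eval (view s).reg ∧
        (∀ y, y < t ∨ 10 ≤ y → s'.var y = s.var y) ∧ s'.arr = s.arr := by
  induction e with
  | var x =>
    intro t s hs ht
    simp only [depth_var] at ht
    refine (Runs.seq (Runs.const (Runs.arith ?_))).cost_le ?_
    · refine ⟨?_, ?_, ?_⟩
      · have : x + 10 ≠ t := by omega
        simp [ArithOp.apply, view, this]
      · intro y hy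
        have : y ≠ t := by omega
        simp [this]
      · rfl
    · have : x + 10 ≠ t := by omega
      have := hs x
      simp [cc, *]
      omega
  | num k =>
    intro t s hs ht
    refine (Runs.const ?_).cost_le ?_
    · refine ⟨by simp, ?_, rfl⟩
      intro y hy
      simp only [depth_num] at ht
      have : y ≠ t := by omega
      simp [this]
    · have := size_le_self k
      simp only [cc]; nlinarith
  | op o a b iha ihb =>
    intro t s hs ht
    have ht' : t + max a.depth (b.depth + 1) ≤ 10 := ht
    have hsa := size_eval_le (view s).reg lam hlam hs a
    have hsb := size_eval_le (view s).reg lam hlam hs b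
    refine (Runs.seq ((iha t s hs (by omega)).mono le_rfl ?_) :
      Runs _ _ _ (a.cc * lam + (b.cc * lam + (1 + a.weight * lam + b.weight * lam))) _).cost_le ?_
    · rintro s1 ⟨h1, h2, h3⟩
      have hreg : ∀ y, s1.var (y + 10) = s.var (y + 10) := fun y => h2 _ (by omega)
      have hview : (view s1).reg = (view s).reg := funext hreg
      refine Runs.seq ((ihb (t + 1) s1 (fun y => by rw [hreg]; exact hs y) (by omega)).mono le_rfl ?_)
      rintro s2 ⟨k1, k2, k3⟩
      have e1 : s2.var t = a.eval (view s).reg := by rw [k2 t (by omega), h1]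
      have e2 : s2.var (t + 1) = b.eval (view s).reg := by rw [k1, hview]
      refine (Runs.arith ?_).cost_le (by rw [e1, e2]; omega)
      refine ⟨by simp [e1, e2, eval], ?_, by simp [k3, h3]⟩
      intro y hy
      have : y ≠ t := by omega
      simp only [Memory.setVar_var, this, if_false]
      rw [k2 y (by omega), h2 y hy]
    · simp only [cc]; nlinarith

end Ex

theorem vmem_congr {s s' : Memory} (h : s'.arr = s.arr) : vmem s' = vmem s := by
  funext p; simp [vmem, h]

/-- `x := e`, where `x` is a register. -/
def assign (x : ℕ) (e : Ex) : Prog :=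
  .seq (e.comp 0) (.seq (.const 9 0) (.arith .plus (x + 10) 0 9))

/-- All registers have size at most `lam`. -/
def RegBd (lam : ℕ) (r : ℕ → ℕ) : Prop := ∀ y, (r y).size ≤ lam

theorem RegBd.update {lam : ℕ} {r : ℕ → ℕ} (h : RegBd lam r) {x v : ℕ} (hv : v.size ≤ lam) :
    RegBd lam (Function.update r x v) := by
  intro y
  by_cases hy : y = x
  · subst hy; simpa using hv
  · simpa [hy] using h y

theorem view_setVar {s : Memory} {x v : ℕ} :
    view (s.setVar (x + 10) v) = { view s with reg := Function.update (view s).reg x v } := by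
  simp only [view, St.mk.injEq, Memory.setVar_arr, and_true]
  refine ⟨?_, vmem_congr rfl⟩
  funext y
  simp [Function.update_apply]

theorem view_eq_of {s s' : Memory} (h : ∀ y, 10 ≤ y → s'.var y = s.var y) (h' : s'.arr = s.arr) :
    view s' = view s := by
  simp only [view, St.mk.injEq, h', and_true]
  exact ⟨funext fun y => h _ (by omega), vmem_congr h'⟩

theorem ARuns.assign {ω : ℕ → Bool} {X : St} {Q : St → Prop} {lam : ℕ} (hlam : 1 ≤ lam)
    (hX : RegBd lam X.reg) {x : ℕ} {e : Ex} (he : e.depth ≤ 9)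
    (h : Q { X with reg := Function.update X.reg x (e.eval X.reg) }) :
    ARuns ω (assign x e) X ((e.cc + e.weight + 2) * lam) Q := by
  rintro s rfl
  refine (Runs.seq ((Ex.runs_comp lam hlam e 0 s hX (by omega)).mono le_rfl ?_) :
    Runs _ _ _ (e.cc * lam + (1 + (1 + e.weight * lam))) _).cost_le (by nlinarith)
  rintro s1 ⟨h1, h2, h3⟩
  have hreg : (view s1).reg = (view s).reg := funext fun y => h2 _ (by omega)
  have hsz := Ex.size_eval_le (view s).reg lam hlam hX e
  refine Runs.seq (Runs.cost_le (b := 1 + Nat.size 0) (Runs.const ((Runs.arith ?_).cost_le ?_))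
    (by simp))
  · have e1 : (view ((s1.setVar 9 0).setVar (x + 10) (ArithOp.plus.apply ((s1.setVar 9 0).var 0)
        ((s1.setVar 9 0).var 9)))) =
        { view s with reg := Function.update (view s).reg x (e.eval (view s).reg) } := by
      rw [view_setVar]
      have e2 : view (s1.setVar 9 0) = view s := by
        refine view_eq_of ?_ (by simpa using h3)
        intro y hy
        have : y ≠ 9 := by omega
        simp [this, h2 y (by omega)]
      rw [e2]
      simp [ArithOp.apply, h1]
    rw [e1]
    exact h
  · simp [h1, hsz]

/-! ### Running programs on virtual machines -/

/-- The host state after the memory of the virtual machine `p` has been changed to `σ`. -/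
def St.setVM (X : St) (p : ℕ) (σ : Memory) : St := { X with vm := Function.update X.vm p σ }

@[simp] theorem St.setVM_vm_self (X : St) (p : ℕ) (σ : Memory) : (X.setVM p σ).vm p = σ := by
  simp [St.setVM]
@[simp] theorem St.setVM_setVM (X : St) (p : ℕ) (σ σ' : Memory) :
    (X.setVM p σ).setVM p σ' = X.setVM p σ' := by simp [St.setVM]
theorem St.setVM_self (X : St) (p : ℕ) : X.setVM p (X.vm p) = X := by simp [St.setVM]

theorem view_scratch {s : Memory} {t v : ℕ} (ht : t < 10) : view (s.setVar t v) = view s :=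
  view_eq_of (fun y hy => by have : y ≠ t := by omega
                             simp [this]) rfl

theorem view_storeVar (s : Memory) (p x v : ℕ) :
    view (s.setArr (2 * x + 20) p v) = (view s).setVM p (((view s).vm p).setVar x v) := by
  simp only [view, St.setVM, St.mk.injEq, Memory.setArr_var, true_and]
  refine ⟨?_, Memory.setArr_arr_of_ne _ _ _ _ _ (by omega)⟩
  funext p'
  by_cases hp : p' = p
  · subst hp
    rw [Function.update_self]
    refine Memory.ext' (fun y => ?_) (fun a i => ?_)
    · simp [vmem, Memory.setArr_arr]
    · simp only [vmem, Memory.setArr_arr, Memory.setVar_arr]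
      rw [if_neg (by omega)]
  · rw [Function.update_of_ne hp]
    refine Memory.ext' (fun y => ?_) (fun a i => ?_)
    · simp [vmem, Memory.setArr_arr, hp]
    · simp only [vmem, Memory.setArr_arr]
      rw [if_neg (by omega)]

theorem view_storeArr (s : Memory) (p a i v : ℕ) :
    view (s.setArr (2 * a + 21) (cell p i) v) =
      (view s).setVM p (((view s).vm p).setArr a i v) := by
  simp only [view, St.setVM, St.mk.injEq, Memory.setArr_var, true_and]
  refine ⟨?_, Memory.setArr_arr_of_ne _ _ _ _ _ (by omega)⟩
  funext p'
  by_cases hp : p' = p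
  · subst hp
    rw [Function.update_self]
    refine Memory.ext' (fun y => ?_) (fun b j => ?_)
    · simp only [vmem, Memory.setArr_arr, Memory.setArr_var]
      rw [if_neg (by omega)]
    · simp [vmem, Memory.setArr_arr, cell_eq_iff]
  · rw [Function.update_of_ne hp]
    refine Memory.ext' (fun y => ?_) (fun b j => ?_)
    · simp only [vmem, Memory.setArr_arr]
      rw [if_neg (by omega)]
    · simp [vmem, Memory.setArr_arr, cell_eq_iff, hp]

theorem view_vm_arr (s : Memory) (p a y : ℕ) :
    ((view s).vm p).arr a y = s.arr (2 * a + 21) (cell p y) := rfl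

/-- `t := cell (reg m) v`, where `v` is another scratch variable. -/
def cellProg (m v t : ℕ) : Prog :=
  .seq (.arith .plus t (m + 10) v) (.seq (.arith .times t t t) (.arith .plus t t v))

theorem runs_cellProg {ω : ℕ → Bool} {m v t : ℕ} {s : Memory} {Q : Memory → Prop}
    (hv : v ≠ t) (h : Q (s.setVar t (cell (s.var (m + 10)) (s.var v)))) :
    Runs ω (cellProg m v t) s (15 + 9 * (s.var (m + 10)).size + 9 * (s.var v).size) Q := by
  have h1 := size_add_le (s.var (m + 10)) (s.var v)
  have h2 := size_mul_le (s.var (m + 10) + s.var v) (s.var (m + 10) + s.var v)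
  refine (Runs.seq (Runs.arith (Runs.seq (Runs.arith (Runs.arith ?_))))).cost_le ?_
  · convert h using 1
    refine Memory.ext' (fun y => ?_) (fun a i => rfl)
    by_cases hy : y = t <;> simp [hy, hv, ArithOp.apply, cell]
  · simp [hv, ArithOp.apply]
    omega

theorem size_cell_le (p y : ℕ) : (cell p y).size ≤ 3 * p.size + 3 * y.size + 3 := by
  unfold cell
  have h1 := size_add_le p y
  have h2 := size_mul_le (p + y) (p + y)
  have h3 := size_add_le ((p + y) * (p + y)) y
  omega

/-- The program that runs `V` on the virtual machine whose number is in the register `m`. -/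
def sim (m : ℕ) : Prog → Prog
  | .skip => .skip
  | .const x c => .seq (.const 0 c) (.store (2 * x + 20) (m + 10) 0)
  | .arith op x y z =>
    .seq (.load 0 (2 * y + 20) (m + 10)) (.seq (.load 1 (2 * z + 20) (m + 10))
      (.seq (.arith op 2 0 1) (.store (2 * x + 20) (m + 10) 2)))
  | .load x a y =>
    .seq (.load 0 (2 * y + 20) (m + 10)) (.seq (cellProg m 0 1)
      (.seq (.load 2 (2 * a + 21) 1) (.store (2 * x + 20) (m + 10) 2)))
  | .store a y z =>
    .seq (.load 0 (2 * y + 20) (m + 10)) (.seq (.load 2 (2 * z + 20) (m + 10))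
      (.seq (cellProg m 0 1) (.store (2 * a + 21) 1 2)))
  | .coin x y =>
    .seq (.load 0 (2 * y + 20) (m + 10)) (.seq (cellProg m 0 1)
      (.seq (.coin 2 1) (.store (2 * x + 20) (m + 10) 2)))
  | .seq p p' => .seq (sim m p) (sim m p')
  | .ite x p p' => .seq (.load 0 (2 * x + 20) (m + 10)) (.ite 0 (sim m p) (sim m p'))
  | .loop x p => .seq (.load 0 (2 * x + 20) (m + 10))
      (.loop 0 (.seq (sim m p) (.load 0 (2 * x + 20) (m + 10))))

/-- The random bits of the virtual machine `p`. -/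
def coins (ω : ℕ → Bool) (p : ℕ) : ℕ → Bool := fun y => ω (cell p y)

theorem Runs.seq_inv {ω : ℕ → Bool} {p p' : Prog} {s : Memory} {b : ℕ} {Q : Memory → Prop}
    (h : Runs ω (.seq p p') s b Q) :
    ∃ s1 c1 b', Exec ω p s s1 c1 ∧ c1 + b' ≤ b ∧ Runs ω p' s1 b' Q := by
  obtain ⟨s', c, h1, h2, h3⟩ := h
  cases h1 with
  | seq k k' => exact ⟨_, _, _, k, h2, _, _, k', le_rfl, h3⟩

/-- A simulated instruction costs the host a constant factor times the size of the machine number. A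
load, store or coin flip of the virtual machine needs the address `cell p y`, whose size is linear
in those of `p` and `y`. -/
theorem runs_sim {ω : ℕ → Bool} {m p : ℕ} {V : Prog} {σ σ' : Memory} {c : ℕ}
    (hV : Exec (coins ω p) V σ σ' c) :
    ∀ s : Memory, s.var (m + 10) = p → vmem s p = σ →
      Runs ω (sim m V) s (30 * (1 + p.size) * c) fun s' => view s' = (view s).setVM p σ' := by
  induction hV with
  | skip σ =>
    rintro s hm rfl
    exact (Runs.skip (St.setVM_self (view s) p).symm).cost_le (by nlinarith)
  | const σ x c =>
    rintro s hm rfl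
    refine (Runs.seq (Runs.const (Runs.store ?_))).cost_le ?_
    · simp only [Memory.setVar_var, if_true]
      rw [if_neg (by omega), hm, view_storeVar, view_scratch (by norm_num)]
      rfl
    · have : ¬ (m + 10 = 0) := by omega
      simp [hm]
      nlinarith
  | arith σ op x y z =>
    rintro s hm rfl
    have e1 : (vmem s p).var y = s.arr (2 * y + 20) p := rfl
    have e2 : (vmem s p).var z = s.arr (2 * z + 20) p := rfl
    have hsz := size_apply_le op (s.arr (2 * y + 20) p) (s.arr (2 * z + 20) p)
    refine (Runs.seq (Runs.load (Runs.seq (Runs.load (Runs.seq (Runs.arith (Runs.store ?_))))))).cost_le ?_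
    · simp only [Memory.setVar_var, Memory.setVar_arr]
      simp only [hm, show m + 10 ≠ 0 by omega, show m + 10 ≠ 1 by omega, show m + 10 ≠ 2 by omega]
      simp only [if_false, if_true, zero_ne_one, e1, e2]
      rw [view_storeVar, view_scratch (by norm_num), view_scratch (by norm_num),
        view_scratch (by norm_num)]
      rfl
    · simp only [Memory.setVar_var, Memory.setVar_arr]
      simp only [hm, show m + 10 ≠ 0 by omega, show m + 10 ≠ 1 by omega, show m + 10 ≠ 2 by omega]
      simp only [if_false, if_true, zero_ne_one, e1, e2]
      nlinarith
  | load σ x a y =>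
    rintro s hm rfl
    have e1 : (vmem s p).var y = s.arr (2 * y + 20) p := rfl
    have e2 : ∀ i, (vmem s p).arr a i = s.arr (2 * a + 21) (cell p i) := fun _ => rfl
    have hsz := size_cell_le p (s.arr (2 * y + 20) p)
    refine (Runs.seq (Runs.load (Runs.seq (runs_cellProg (by norm_num)
      (Runs.seq (Runs.load (Runs.store ?_))))))).cost_le ?_
    · simp only [Memory.setVar_var, Memory.setVar_arr]
      simp only [hm, show m + 10 ≠ 0 by omega, show m + 10 ≠ 1 by omega, show m + 10 ≠ 2 by omega]
      simp only [if_false, if_true, e1, e2]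
      rw [view_storeVar, view_scratch (by norm_num), view_scratch (by norm_num),
        view_scratch (by norm_num)]
      rfl
    · simp only [Memory.setVar_var, Memory.setVar_arr]
      simp only [hm, show m + 10 ≠ 0 by omega, show m + 10 ≠ 1 by omega, show m + 10 ≠ 2 by omega]
      simp only [if_false, if_true, e1, e2]
      nlinarith
  | store σ a y z =>
    rintro s hm rfl
    have e1 : (vmem s p).var y = s.arr (2 * y + 20) p := rfl
    have e2 : (vmem s p).var z = s.arr (2 * z + 20) p := rfl
    have hsz := size_cell_le p (s.arr (2 * y + 20) p)
    refine (Runs.seq (Runs.load (Runs.seq (Runs.load (Runs.seq (runs_cellProg (by norm_num)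
      (Runs.store ?_))))))).cost_le ?_
    · simp only [Memory.setVar_var, Memory.setVar_arr]
      simp only [hm, show m + 10 ≠ 0 by omega, show m + 10 ≠ 2 by omega,
        show (0 : ℕ) ≠ 2 by norm_num, show (2 : ℕ) ≠ 1 by norm_num]
      simp only [if_false, if_true, e1, e2]
      rw [view_storeArr, view_scratch (by norm_num), view_scratch (by norm_num),
        view_scratch (by norm_num)]
      rfl
    · simp only [Memory.setVar_var, Memory.setVar_arr]
      simp only [hm, show m + 10 ≠ 0 by omega, show m + 10 ≠ 2 by omega,
        show (0 : ℕ) ≠ 2 by norm_num, show (2 : ℕ) ≠ 1 by norm_num]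
      simp only [if_false, if_true, e1, e2]
      nlinarith
  | coin σ x y =>
    rintro s hm rfl
    have e1 : (vmem s p).var y = s.arr (2 * y + 20) p := rfl
    have hsz := size_cell_le p (s.arr (2 * y + 20) p)
    have hb : ∀ b : Bool, b.toNat.size ≤ 1 := by decide
    refine (Runs.seq (Runs.load (Runs.seq (runs_cellProg (by norm_num)
      (Runs.seq (Runs.coin (Runs.store ?_))))))).cost_le ?_
    · simp only [Memory.setVar_var]
      simp only [hm, show m + 10 ≠ 0 by omega, show m + 10 ≠ 1 by omega, show m + 10 ≠ 2 by omega]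
      simp only [if_false, if_true, e1]
      rw [view_storeVar, view_scratch (by norm_num), view_scratch (by norm_num),
        view_scratch (by norm_num)]
      rfl
    · simp only [Memory.setVar_var]
      simp only [hm, show m + 10 ≠ 0 by omega, show m + 10 ≠ 1 by omega, show m + 10 ≠ 2 by omega]
      simp only [if_false, if_true, e1]
      have := hb (ω (cell p (s.arr (2 * y + 20) p)))
      nlinarith
  | seq _ _ ih ih' =>
    rintro s hm rfl
    refine (Runs.seq ((ih s hm rfl).mono le_rfl fun s1 h1 => ?_)).cost_le (by rw [← mul_add])
    refine (ih' s1 ?_ ?_).mono le_rfl fun s2 h2 => ?_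
    · rw [← hm]; exact congrFun (congrArg St.reg h1) m
    · have := congrFun (congrArg St.vm h1) p
      rw [St.setVM_vm_self] at this; exact this
    · rw [h2, h1, St.setVM_setVM]
  | @iteTrue x _ _ _ _ c hx _ ih =>
    rintro s hm rfl
    have e1 : (vmem s p).var x = s.arr (2 * x + 20) p := rfl
    rw [e1] at hx ⊢
    refine (Runs.seq (Runs.load (Runs.ite (b := 30 * (1 + p.size) * c) (fun _ => ?_) ?_))).cost_le ?_
    · refine (ih _ ?_ ?_).mono le_rfl fun s2 h2 => ?_
      · simpa using hm
      · exact congrFun (vmem_congr rfl) p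
      · rw [h2, view_scratch (by norm_num)]
    · intro h; exact absurd h (by simpa [hm] using hx)
    · simp [hm]; nlinarith
  | @iteFalse x _ _ _ _ c hx _ ih =>
    rintro s hm rfl
    have e1 : (vmem s p).var x = s.arr (2 * x + 20) p := rfl
    rw [e1] at hx
    refine (Runs.seq (Runs.load (Runs.ite (b := 30 * (1 + p.size) * c) ?_ (fun _ => ?_)))).cost_le ?_
    · intro h; exact absurd hx (by simpa [hm] using h)
    · refine (ih _ ?_ ?_).mono le_rfl fun s2 h2 => ?_
      · simpa using hm
      · exact congrFun (vmem_congr rfl) p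
      · rw [h2, view_scratch (by norm_num)]
    · simp [hm, hx]; nlinarith
  | @loopDone x _ _ hx =>
    rintro s hm rfl
    have e1 : (vmem s p).var x = s.arr (2 * x + 20) p := rfl
    rw [e1] at hx
    refine (Runs.seq (Runs.load (Runs.loop_done ?_ ?_))).cost_le ?_
    · simp [hm, hx]
    · rw [view_scratch (by norm_num)]; exact (St.setVM_self (view s) p).symm
    · simp [hm, hx]
  | @loopStep x _ _ _ _ c c' hx _ _ ih ih' =>
    rintro s hm rfl
    have e1 : (vmem s p).var x = s.arr (2 * x + 20) p := rfl
    rw [e1] at hx ⊢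
    obtain ⟨s1, c1, g1, g2, g3⟩ := ih (s.setVar 0 (s.arr (2 * x + 20) p)) (by simpa using hm)
      (congrFun (vmem_congr rfl) p)
    rw [view_scratch (by norm_num)] at g3
    have hm1 : s1.var (m + 10) = p := by rw [← hm]; exact congrFun (congrArg St.reg g3) m
    obtain ⟨s2, c2, b', g4, g5, g6⟩ := (ih' s1 hm1 (by
      have := congrFun (congrArg St.vm g3) p
      rw [St.setVM_vm_self] at this; exact this)).seq_inv
    refine (Runs.seq (Runs.load (Runs.loop_step (b := c1 + c2) (b' := b') ?_ ?_))).cost_le ?_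
    · simpa [hm] using hx
    · rw [hm]
      refine ⟨s2, c1 + c2, .seq g1 g4, le_rfl, g6.mono le_rfl fun s3 h3 => ?_⟩
      rw [h3, g3, St.setVM_setVM]
    · simp [hm]; nlinarith

theorem ARuns.sim {ω : ℕ → Bool} {m : ℕ} {V : Prog} {X : St} {σ' : Memory} {c : ℕ}
    {Q : St → Prop} (hV : Exec (coins ω (X.reg m)) V (X.vm (X.reg m)) σ' c)
    (h : Q (X.setVM (X.reg m) σ')) :
    ARuns ω (sim m V) X (30 * (1 + (X.reg m).size) * c) Q := by
  rintro s rfl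
  exact (runs_sim hV s rfl rfl).mono le_rfl fun s' h' => h' ▸ h

/-! ### Clocked programs -/

/-- The memory of the program that is run under a clock: its variable `x` is kept in the variable
`2 x + 20`, its array `a` in the array `2 a + 2`. -/
def inner (τ : Memory) : Memory := ⟨fun x => τ.var (2 * x + 20), fun a => τ.arr (2 * a + 2)⟩

/-- The number `e` estimates the size of `v`, and has itself size at most `lam`. -/
def Fit (lam v e : ℕ) : Prop := v.size ≤ e ∧ e ≤ 2 * v.size + 1 ∧ e.size ≤ lam

/-- Every cell of the inner memory is accompanied by an estimate of the size of its content. -/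
def Shadowed (lam : ℕ) (τ : Memory) : Prop :=
  (∀ x, Fit lam (τ.var (2 * x + 20)) (τ.var (2 * x + 21))) ∧
    ∀ a i, Fit lam (τ.arr (2 * a + 2) i) (τ.arr (2 * a + 3) i)

theorem inner_congr {τ τ' : Memory} (h : ∀ x, 20 ≤ x → τ'.var x = τ.var x)
    (h' : ∀ a, 2 ≤ a → τ'.arr a = τ.arr a) : inner τ' = inner τ := by
  refine Memory.ext' (fun x => h _ (by omega)) (fun a i => ?_)
  exact congrFun (h' _ (by omega)) i

theorem Shadowed.congr {lam : ℕ} {τ τ' : Memory} (hs : Shadowed lam τ)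
    (h : ∀ x, 20 ≤ x → τ'.var x = τ.var x) (h' : ∀ a, 2 ≤ a → τ'.arr a = τ.arr a) :
    Shadowed lam τ' := by
  refine ⟨fun x => ?_, fun a i => ?_⟩
  · rw [h _ (by omega), h _ (by omega)]; exact hs.1 x
  · rw [h' _ (by omega), h' _ (by omega)]; exact hs.2 a i

theorem shadowed_blank (lam : ℕ) : Shadowed lam Memory.blank := by
  simp [Shadowed, Fit, Memory.blank]

theorem inner_setPair (τ : Memory) (x v e : ℕ) :
    inner ((τ.setVar (2 * x + 20) v).setVar (2 * x + 21) e) = (inner τ).setVar x v := by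
  refine Memory.ext' (fun y => ?_) (fun a i => rfl)
  have : ¬ 2 * y = 2 * x + 1 := by omega
  simp [inner, this]

theorem Shadowed.setPair {lam : ℕ} {τ : Memory} (hs : Shadowed lam τ) {x v e : ℕ}
    (h : Fit lam v e) : Shadowed lam ((τ.setVar (2 * x + 20) v).setVar (2 * x + 21) e) := by
  refine ⟨fun y => ?_, hs.2⟩
  have h1 : ¬ 2 * y = 2 * x + 1 := by omega
  have h2 : 2 * y + 21 ≠ 2 * x + 20 := by omega
  by_cases hy : y = x
  · subst hy; simpa using h
  · simpa [h1, h2, hy] using hs.1 y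

theorem inner_setPairArr (τ : Memory) (a i v e : ℕ) :
    inner ((τ.setArr (2 * a + 2) i v).setArr (2 * a + 3) i e) = (inner τ).setArr a i v := by
  refine Memory.ext' (fun y => rfl) (fun b j => ?_)
  have : ¬ 2 * b = 2 * a + 1 := by omega
  simp [inner, Memory.setArr_arr, this]

theorem Shadowed.setPairArr {lam : ℕ} {τ : Memory} (hs : Shadowed lam τ) {a i v e : ℕ}
    (h : Fit lam v e) :
    Shadowed lam ((τ.setArr (2 * a + 2) i v).setArr (2 * a + 3) i e) := by
  refine ⟨hs.1, fun b j => ?_⟩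
  have h1 : ¬ 2 * b = 2 * a + 1 := by omega
  have h2 : 2 * b + 3 ≠ 2 * a + 2 := by omega
  have := hs.2 b j
  by_cases hy : b = a ∧ j = i
  · obtain ⟨rfl, rfl⟩ := hy; simpa [Memory.setArr_arr, h1, h2] using h
  · simpa [Memory.setArr_arr, h1, h2, hy] using this

/-- Writes an estimate of the size of variable `2` to variable `3`. By repeated squaring it finds
the first number `2 ^ 2 ^ j` that exceeds variable `2`. -/
def est : Prog :=
  .seq (.const 3 1) (.seq (.const 4 2) (.seq (.const 6 1) (.seq (.arith .plus 7 2 6)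
    (.seq (.arith .minus 5 7 4)
      (.loop 5 (.seq (.arith .times 4 4 4) (.seq (.arith .plus 3 3 3) (.arith .minus 5 7 4))))))))

/-- Variable `4` holds `2 ^ e` when variable `3` holds `e`, and the number `k` of squarings that
remain is bounded by `v.size < e * 2 ^ k`. -/
theorem runs_est_loop {ω : ℕ → Bool} (k : ℕ) : ∀ s : Memory, s.var 4 = 2 ^ s.var 3 →
    s.var 7 = s.var 2 + 1 → s.var 5 = s.var 7 - s.var 4 → 1 ≤ s.var 3 →
    s.var 3 ≤ 2 * (s.var 2).size + 1 → (s.var 2).size < s.var 3 * 2 ^ k →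
    Runs ω (.loop 5 (.seq (.arith .times 4 4 4) (.seq (.arith .plus 3 3 3) (.arith .minus 5 7 4)))) s
      (k * (30 * ((s.var 2).size + 1)) + 1) fun s' =>
        (s.var 2).size ≤ s'.var 3 ∧ s'.var 3 ≤ 2 * (s.var 2).size + 1 ∧
        (∀ y, y < 3 ∨ 8 ≤ y → s'.var y = s.var y) ∧ s'.arr = s.arr := by
  induction k with
  | zero =>
    intro s h4 h7 h5 h31 h3 hlt
    have : s.var 2 < 2 ^ s.var 3 := Nat.size_le.1 (by omega)
    exact (Runs.loop_done (by omega) ⟨by omega, h3, fun _ _ => rfl, rfl⟩).cost_le (by omega)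
  | succ k ih =>
    intro s h4 h7 h5 h31 h3 hlt
    by_cases hle : s.var 2 < 2 ^ s.var 3
    · exact (Runs.loop_done (by omega) ⟨Nat.size_le.2 hle, h3, fun _ _ => rfl, rfl⟩).cost_le
        (by omega)
    · have hlt' : s.var 3 < (s.var 2).size := Nat.lt_size.2 (by omega)
      have z4 : (s.var 4).size = s.var 3 + 1 := by rw [h4, Nat.size_pow]
      have z3 := size_le_self (s.var 3)
      have z33 := size_add_le (s.var 3) (s.var 3)
      have z44 := size_mul_le (s.var 4) (s.var 4)
      have z5 : (s.var 5).size ≤ (s.var 2).size + 1 := by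
        have e1 : s.var 5 ≤ s.var 2 := by
          have := Nat.one_le_two_pow (n := s.var 3)
          omega
        exact (Nat.size_le_size e1).trans (by omega)
      have z7 : (s.var 7).size ≤ (s.var 2).size + 2 := by
        rw [h7]; exact (size_add_le _ 1).trans (by simp)
      refine (Runs.loop_step (by omega) (Runs.seq (Runs.arith (Runs.seq (Runs.arith (Runs.arith
        ((ih _ ?_ ?_ ?_ ?_ ?_ ?_).mono le_rfl ?_))))))).cost_le ?_
      · simp [ArithOp.apply, h4, pow_add]
      · simp [h7]
      · simp [ArithOp.apply]
      · simp [ArithOp.apply]; omega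
      · simp [ArithOp.apply]; omega
      · simp [ArithOp.apply]
        rw [pow_succ] at hlt
        linarith
      · rintro s' ⟨h1, h2, h3', h4'⟩
        refine ⟨by simpa using h1, by simpa using h2, fun y hy => ?_, by simpa using h4'⟩
        rw [h3' y hy]
        have : y ≠ 3 := by omega
        have : y ≠ 4 := by omega
        have : y ≠ 5 := by omega
        simp [*]
      · simp [ArithOp.apply]
        linarith

/-- If `2 ^ e`, with `e` a power of two, is the first such number that exceeds `v`, then `e ≤ 2 *
v.size + 1`, so the estimate is right up to a factor of about two. At most `lam` squarings are
needed, since `v.size < 2 ^ lam`. -/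
theorem runs_est {ω : ℕ → Bool} {lam : ℕ} (s : Memory) (hs : (2 * (s.var 2).size + 1).size ≤ lam) :
    Runs ω est s (50 * (lam * ((s.var 2).size + 1))) fun s' =>
        Fit lam (s.var 2) (s'.var 3) ∧
        (∀ y, y < 3 ∨ 8 ≤ y → s'.var y = s.var y) ∧ s'.arr = s.arr := by
  have hlam : 1 ≤ lam := le_trans (Nat.size_pos.2 (by omega)) hs
  have hv : (s.var 2).size < 2 ^ lam := by
    have := Nat.size_le.1 hs
    omega
  have z7 : (s.var 2 + 1).size ≤ (s.var 2).size + 2 := (size_add_le _ 1).trans (by simp)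
  have hK : lam ≤ lam * ((s.var 2).size + 1) := Nat.le_mul_of_pos_right _ (by omega)
  have hK' : (s.var 2).size + 1 ≤ lam * ((s.var 2).size + 1) := Nat.le_mul_of_pos_left _ hlam
  refine (Runs.seq (Runs.const (Runs.seq (Runs.const (Runs.seq (Runs.const (Runs.seq (Runs.arith
    (Runs.seq (Runs.arith ((runs_est_loop lam _ ?_ ?_ ?_ ?_ ?_ ?_).mono le_rfl ?_))))))))))).cost_le ?_
  · simp
  · simp [ArithOp.apply]
  · simp [ArithOp.apply]
  · simp
  · simp
  · simpa using hv
  · rintro s' ⟨h1, h2, h3, h4⟩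
    have e2 : ∀ y, y < 3 ∨ 8 ≤ y → s'.var y = s.var y := fun y hy => by
      rw [h3 y hy]
      have : y ≠ 3 := by omega
      have : y ≠ 4 := by omega
      have : y ≠ 5 := by omega
      have : y ≠ 6 := by omega
      have : y ≠ 7 := by omega
      simp [*]
    simp only [Memory.setVar_var] at h1 h2
    norm_num at h1 h2
    exact ⟨⟨h1, h2, (Nat.size_le_size h2).trans hs⟩, e2, by simpa using h4⟩
  · simp [ArithOp.apply]
    have e1 : Nat.size 2 = 2 := by decide
    rw [e1]
    nlinarith

/-- Subtracts from the fuel, which is variable `10`, the charge for handling the variables `y`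
and `z`. -/
def charge (y z : ℕ) : Prog :=
  .seq (.arith .plus 0 (2 * y + 21) (2 * z + 21)) (.seq (.const 1 1)
    (.seq (.arith .plus 0 0 1) (.arith .minus 10 10 0)))

/-- Copies the variables `2` and `3` to the variable `x` and its size estimate. -/
def writePair (x : ℕ) : Prog :=
  .seq (.const 0 0) (.seq (.arith .plus (2 * x + 20) 2 0) (.arith .plus (2 * x + 21) 3 0))

theorem runs_charge {ω : ℕ → Bool} {lam y z : ℕ} {τ : Memory} (hs : Shadowed lam τ)
    (hF : (τ.var 10).size + 5 ≤ lam) :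
    Runs ω (charge y z) τ (10 * lam) fun τ' =>
      τ'.var 10 = τ.var 10 - (τ.var (2 * y + 21) + τ.var (2 * z + 21) + 1) ∧
      (∀ x, 11 ≤ x → τ'.var x = τ.var x) ∧ τ'.arr = τ.arr := by
  have h1 := (hs.1 y).2.2
  have h2 := (hs.1 z).2.2
  have h3 := size_add_le (τ.var (2 * y + 21)) (τ.var (2 * z + 21))
  have h4 := size_add_le (τ.var (2 * y + 21) + τ.var (2 * z + 21)) 1
  refine Runs.cost_le (Runs.seq (Runs.arith (Runs.seq (Runs.const (Runs.seq (Runs.arith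
    (Runs.arith ⟨?_, ?_, ?_⟩))))))) ?_
  · simp [ArithOp.apply]
  · intro x hx
    have : x ≠ 0 := by omega
    have : x ≠ 1 := by omega
    have : x ≠ 10 := by omega
    simp [*]
  · rfl
  · simp only [Nat.size_one] at h4
    simp [ArithOp.apply]
    omega

theorem runs_writePair {ω : ℕ → Bool} {lam x : ℕ} {τ : Memory} (hs : Shadowed lam τ)
    (hf : Fit lam (τ.var 2) (τ.var 3)) :
    Runs ω (writePair x) τ (3 + (τ.var 2).size + (τ.var 3).size) fun τ' =>
      Shadowed lam τ' ∧ inner τ' = (inner τ).setVar x (τ.var 2) ∧ τ'.var 10 = τ.var 10 := by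
  have hs' : Shadowed lam (τ.setVar 0 0) := hs.congr (fun x hx => by
    have : x ≠ 0 := by omega
    simp [this]) (fun _ _ => rfl)
  have hi' : inner (τ.setVar 0 0) = inner τ := inner_congr (fun x hx => by
    have : x ≠ 0 := by omega
    simp [this]) (fun _ _ => rfl)
  refine (Runs.seq (Runs.const (Runs.seq (Runs.arith (Runs.arith ?_))))).cost_le ?_
  · have h3 : (3 : ℕ) ≠ 2 * x + 20 := by omega
    have h10 : (10 : ℕ) ≠ 2 * x + 20 := by omega
    have h10' : (10 : ℕ) ≠ 2 * x + 21 := by omega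
    simp only [ArithOp.apply, Memory.setVar_var, h3, h10, h10', if_false]
    norm_num
    exact ⟨hs'.setPair hf, by rw [inner_setPair, hi']⟩
  · have h3 : (3 : ℕ) ≠ 2 * x + 20 := by omega
    simp
    omega

/-- The condition of a clocked loop, in variable `11`: there is fuel left and `x` is not zero. -/
def test (x : ℕ) : Prog :=
  .seq (charge x x) (.seq (.const 11 0) (.ite 10 (.ite (2 * x + 20) (.const 11 1) .skip) .skip))

/-- The clocked version of a program. Before an instruction handles a number, an estimate of its
size is subtracted from the fuel; when the fuel is used up, nothing more is done. A load pays twice,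
for the address and then, as the size of the loaded number has been read from its estimate, for that
number. -/
def clk : Prog → Prog
  | .skip => .skip
  | .const x c => .seq (.const 2 c) (.seq (.const 3 c.size) (writePair x))
  | .arith op x y z => .seq (charge y z)
      (.ite 10 (.seq (.arith op 2 (2 * y + 20) (2 * z + 20)) (.seq est (writePair x))) .skip)
  | .load x a y => .seq (charge y y)
      (.ite 10 (.seq (.load 3 (2 * a + 3) (2 * y + 20)) (.seq (.arith .minus 10 10 3)
        (.ite 10 (.seq (.load 2 (2 * a + 2) (2 * y + 20)) (writePair x)) .skip))) .skip)
  | .store a y z => .seq (charge y z)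
      (.ite 10 (.seq (.store (2 * a + 2) (2 * y + 20) (2 * z + 20))
        (.store (2 * a + 3) (2 * y + 20) (2 * z + 21))) .skip)
  | .coin x y => .seq (charge y y)
      (.ite 10 (.seq (.coin 2 (2 * y + 20)) (.seq (.const 3 1) (writePair x))) .skip)
  | .seq p p' => .seq (clk p) (clk p')
  | .ite x p p' => .seq (charge x x) (.ite 10 (.ite (2 * x + 20) (clk p) (clk p')) .skip)
  | .loop x p => .seq (test x) (.loop 11 (.seq (clk p) (test x)))

/-- `ClkSpec ω lam A V W τ`: the program `W` behaves in memory `τ` as a clocked version of the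
program `V`. It halts in any case, at a cost that is bounded in terms of the fuel that it uses, and
it does what `V` does if the fuel suffices. The factor `4` bounds the charge for an instruction by
its cost: an estimate is at most twice the size plus one, and up to two numbers are charged. -/
def ClkSpec (ω : ℕ → Bool) (lam A : ℕ) (V W : Prog) (τ : Memory) : Prop :=
  ∃ τ' c, Exec ω W τ τ' c ∧ Shadowed lam τ' ∧ τ'.var 10 ≤ τ.var 10 ∧
    c ≤ A * (lam * (τ.var 10 - τ'.var 10 + 1)) ∧
    ∀ σ' c₀, Exec ω V (inner τ) σ' c₀ → 4 * c₀ < τ.var 10 →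
      inner τ' = σ' ∧ τ.var 10 ≤ τ'.var 10 + 4 * c₀

section clk

variable {ω : ℕ → Bool} {lam : ℕ} {τ : Memory}

/-- A charge followed by a program that is run only if there is fuel left. -/
theorem clkSpec_charge (hs : Shadowed lam τ) (hF : (τ.var 10).size + 5 ≤ lam) {y z A : ℕ}
    {V W : Prog}
    (hpaid : ∀ σ' c₀, Exec ω V (inner τ) σ' c₀ →
      τ.var (2 * y + 21) + τ.var (2 * z + 21) + 1 ≤ 4 * c₀)
    (hW : ∀ τ₁, Shadowed lam τ₁ → inner τ₁ = inner τ →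
      τ₁.var 10 + (τ.var (2 * y + 21) + τ.var (2 * z + 21) + 1) = τ.var 10 →
      (∀ x, 11 ≤ x → τ₁.var x = τ.var x) → τ₁.arr = τ.arr →
      ∃ τ' c, Exec ω W τ₁ τ' c ∧ Shadowed lam τ' ∧ τ'.var 10 ≤ τ₁.var 10 ∧
        c ≤ A * (lam * (τ.var 10 - τ'.var 10 + 1)) ∧
        ∀ σ' c₀, Exec ω V (inner τ) σ' c₀ → 4 * c₀ < τ.var 10 →
          inner τ' = σ' ∧ τ.var 10 ≤ τ'.var 10 + 4 * c₀) :
    ClkSpec ω lam (A + 20) V (.seq (charge y z) (.ite 10 W .skip)) τ := by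
  obtain ⟨τ₁, c₁, h1, h2, h3, h4, h5⟩ := runs_charge (ω := ω) (y := y) (z := z) hs hF
  have hs1 : Shadowed lam τ₁ := hs.congr (fun x hx => h4 x (by omega)) fun a _ => by rw [h5]
  have hi1 : inner τ₁ = inner τ := inner_congr (fun x hx => h4 x (by omega)) fun a _ => by rw [h5]
  by_cases h0 : τ₁.var 10 = 0
  · refine ⟨τ₁, c₁ + (1 + 1), .seq h1 (.iteFalse h0 (.skip _)), hs1, by omega, ?_, ?_⟩
    · have : lam ≤ lam * (τ.var 10 - τ₁.var 10 + 1) := Nat.le_mul_of_pos_right _ (by omega)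
      nlinarith
    · intro σ' c₀ hσ hc
      have := hpaid σ' c₀ hσ
      omega
  · obtain ⟨τ', c, k1, k2, k3, k4, k5⟩ := hW τ₁ hs1 hi1 (by omega) h4 h5
    refine ⟨τ', _, .seq h1 (.iteTrue h0 k1), k2, by omega, ?_, k5⟩
    have : lam ≤ lam * (τ.var 10 - τ'.var 10 + 1) := Nat.le_mul_of_pos_right _ (by omega)
    have : (τ₁.var 10).size ≤ (τ.var 10).size := Nat.size_le_size (by omega)
    nlinarith

/-- The bound for an instruction that is carried out after its charge has been paid. -/
theorem paid_of_runs {W V : Prog} {τ τ₁ : Memory} {ch b A : ℕ} {σ : Memory}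
    (hpaid : ∀ σ' c₀, Exec ω V (inner τ) σ' c₀ → ch ≤ 4 * c₀)
    (hV : ∀ σ' c₀, Exec ω V (inner τ) σ' c₀ → σ' = σ)
    (hch : τ₁.var 10 + ch = τ.var 10)
    (h : Runs ω W τ₁ b fun τ' => Shadowed lam τ' ∧ inner τ' = σ ∧ τ'.var 10 = τ₁.var 10)
    (hb : b ≤ A * (lam * (ch + 1))) :
    ∃ τ' c, Exec ω W τ₁ τ' c ∧ Shadowed lam τ' ∧ τ'.var 10 ≤ τ₁.var 10 ∧
        c ≤ A * (lam * (τ.var 10 - τ'.var 10 + 1)) ∧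
        ∀ σ' c₀, Exec ω V (inner τ) σ' c₀ → 4 * c₀ < τ.var 10 →
          inner τ' = σ' ∧ τ.var 10 ≤ τ'.var 10 + 4 * c₀ := by
  obtain ⟨τ', c, h1, h2, h3, h4, h5⟩ := h
  refine ⟨τ', c, h1, h3, h5.le, ?_, fun σ' c₀ hσ hc => ⟨by rw [hV _ _ hσ, h4], ?_⟩⟩
  · rw [h5, show τ.var 10 - τ₁.var 10 = ch by omega]
    exact h2.trans hb
  · have := hpaid _ _ hσ
    omega

theorem Shadowed.scratch {τ' : Memory} (hs : Shadowed lam τ) (h : ∀ x, 10 ≤ x → τ'.var x = τ.var x)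
    (h' : τ'.arr = τ.arr) : Shadowed lam τ' :=
  hs.congr (fun x hx => h x (by omega)) fun a _ => by rw [h']

theorem inner_scratch {τ' : Memory} (h : ∀ x, 10 ≤ x → τ'.var x = τ.var x)
    (h' : τ'.arr = τ.arr) : inner τ' = inner τ :=
  inner_congr (fun x hx => h x (by omega)) fun a _ => by rw [h']

/-- Writing the variables `2` and `3` to `x`, when they have been computed without touching the
inner memory. -/
theorem runs_writePair' {x v e : ℕ} {τ' : Memory} (hs : Shadowed lam τ)
    (h : ∀ x, 10 ≤ x → τ'.var x = τ.var x) (h' : τ'.arr = τ.arr) (h2 : τ'.var 2 = v)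
    (h3 : τ'.var 3 = e) (hf : Fit lam v e) :
    Runs ω (writePair x) τ' (3 + v.size + e.size) fun τ'' =>
      Shadowed lam τ'' ∧ inner τ'' = (inner τ).setVar x v ∧ τ''.var 10 = τ.var 10 := by
  subst h2 h3
  refine (runs_writePair (hs.scratch h h') hf).mono le_rfl ?_
  rintro τ'' ⟨k1, k2, k3⟩
  exact ⟨k1, by rw [k2, inner_scratch h h'], by rw [k3, h 10 le_rfl]⟩

theorem clkSpec_const (hs : Shadowed lam τ) (x k : ℕ) (hk : k.size.size ≤ lam) (hlam : 1 ≤ lam) :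
    ClkSpec ω lam (5 + 4 * k.size) (.const x k) (clk (.const x k)) τ := by
  have hz : k.size.size ≤ k.size := size_le_self _
  have key : Runs ω (clk (.const x k)) τ
      (1 + k.size + (1 + k.size.size + (3 + k.size + k.size.size))) fun τ'' =>
      Shadowed lam τ'' ∧ inner τ'' = (inner τ).setVar x k ∧ τ''.var 10 = τ.var 10 := by
    refine Runs.seq (Runs.const (Runs.seq (Runs.const
      (runs_writePair' (v := k) (e := k.size) hs (fun x hx => ?_) rfl ?_ ?_ ⟨le_rfl, by omega, hk⟩))))
    · have : x ≠ 2 := by omega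
      have : x ≠ 3 := by omega
      simp [*]
    · simp
    · simp
  obtain ⟨τ', c, h1, h2, h3, h4, h5⟩ := key
  refine ⟨τ', c, h1, h3, h5.le, ?_, fun σ' c₀ hσ hc => ⟨?_, by omega⟩⟩
  · have : 1 ≤ lam * (τ.var 10 - τ'.var 10 + 1) := Nat.mul_pos hlam (by omega)
    nlinarith
  · cases hσ; exact h4

theorem clkSpec_arith (hs : Shadowed lam τ) (hF : (τ.var 10).size + 5 ≤ lam) (op : ArithOp)
    (x y z : ℕ) : ClkSpec ω lam 220 (.arith op x y z) (clk (.arith op x y z)) τ := by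
  have hy := hs.1 y
  have hz := hs.1 z
  have hpaid : ∀ σ' c₀, Exec ω (.arith op x y z) (inner τ) σ' c₀ →
      τ.var (2 * y + 21) + τ.var (2 * z + 21) + 1 ≤ 4 * c₀ := by
    intro σ' c₀ h
    cases h
    have := hy.2.1
    have := hz.2.1
    simp only [inner]
    omega
  refine clkSpec_charge (A := 200) hs hF hpaid fun τ₁ h1 h2 h3 h4 h5 => ?_
  set v := op.apply ((inner τ).var y) ((inner τ).var z) with hv
  have hvs : v.size ≤ τ.var (2 * y + 21) + τ.var (2 * z + 21) + 1 :=
    (size_apply_le _ _ _).trans (by have := hy.1; have := hz.1; simp only [inner]; omega)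
  have hv2 : (2 * v.size + 1).size ≤ lam := by
    have e1 := Nat.size_le_size (m := 2 * v.size + 1) (n := τ.var 10 + τ.var 10 + 1) (by omega)
    have e2 := size_add_le (τ.var 10 + τ.var 10) 1
    have e3 := size_mul_le 2 (τ.var 10)
    have e4 : Nat.size 2 = 2 := by decide
    rw [Nat.size_one] at e2
    rw [← two_mul] at e1 e2
    omega
  refine paid_of_runs hpaid (σ := (inner τ).setVar x v) (fun σ' c₀ h => by cases h; rfl) h3
    (Runs.seq (b' := 50 * (lam * (v.size + 1)) + (3 + v.size + lam)) (Runs.arith ?_)) ?_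
  · have ev : (τ₁.setVar 2 (op.apply (τ₁.var (2 * y + 20)) (τ₁.var (2 * z + 20)))).var 2 = v := by
      rw [h4 _ (by omega), h4 _ (by omega)]; simp [hv, inner]
    refine Runs.seq ((runs_est (lam := lam) _ (by rw [ev]; exact hv2)).mono (by rw [ev]) ?_)
    rintro τ₂ ⟨k1, k2, k3⟩
    rw [ev] at k1
    have e10 : ∀ x, 10 ≤ x → τ₂.var x = τ₁.var x := fun x hx => by
      rw [k2 x (by omega)]
      have : x ≠ 2 := by omega
      simp [this]
    refine (runs_writePair' (x := x) h1 e10 k3 (by rw [k2 2 (by omega), ev]) rfl k1).mono ?_ ?_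
    · have := k1.2.2; omega
    · rw [h2]; exact fun _ h => h
  · rw [h4 _ (by omega), h4 _ (by omega)]
    have := hy.1
    have := hz.1
    set ch := τ.var (2 * y + 21) + τ.var (2 * z + 21) + 1
    have e1 : lam * (v.size + 1) ≤ lam * (ch + 1) := Nat.mul_le_mul_left _ (by omega)
    have e2 : lam ≤ lam * (ch + 1) := Nat.le_mul_of_pos_right _ (by omega)
    have e3 : ch + 1 ≤ lam * (ch + 1) := Nat.le_mul_of_pos_left _ (by omega)
    omega

theorem clkSpec_coin (hs : Shadowed lam τ) (hF : (τ.var 10).size + 5 ≤ lam)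
    (x y : ℕ) : ClkSpec ω lam 50 (.coin x y) (clk (.coin x y)) τ := by
  have hy := hs.1 y
  have hpaid : ∀ σ' c₀, Exec ω (.coin x y) (inner τ) σ' c₀ →
      τ.var (2 * y + 21) + τ.var (2 * y + 21) + 1 ≤ 4 * c₀ := by
    intro σ' c₀ h
    cases h
    have := hy.2.1
    simp only [inner]
    omega
  refine clkSpec_charge (A := 30) hs hF hpaid fun τ₁ h1 h2 h3 h4 h5 => ?_
  set v := (ω ((inner τ).var y)).toNat with hv
  have hb : ∀ b : Bool, b.toNat.size ≤ 1 := by decide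
  have hvs : v.size ≤ 1 := hb _
  refine paid_of_runs hpaid (σ := (inner τ).setVar x v) (fun σ' c₀ h => by cases h; rfl) h3
    (Runs.seq (b' := 1 + Nat.size 1 + (3 + v.size + Nat.size 1)) (Runs.coin (Runs.seq
      (Runs.const ((runs_writePair' (x := x) (v := v) (e := 1) h1 ?_ ?_ ?_ ?_ ?_).mono le_rfl ?_))))) ?_
  · intro x hx
    have : x ≠ 2 := by omega
    have : x ≠ 3 := by omega
    simp [*]
  · rfl
  · simp [hv, h4, inner]
  · simp
  · exact ⟨hvs, by omega, by simp; omega⟩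
  · rw [h2]; exact fun _ h => h
  · rw [h4 _ (by omega)]
    have := hy.1
    simp only [Nat.size_one]
    set ch := τ.var (2 * y + 21) + τ.var (2 * y + 21) + 1
    have e2 : lam ≤ lam * (ch + 1) := Nat.le_mul_of_pos_right _ (by omega)
    have e3 : ch + 1 ≤ lam * (ch + 1) := Nat.le_mul_of_pos_left _ (by omega)
    omega

theorem clkSpec_store (hs : Shadowed lam τ) (hF : (τ.var 10).size + 5 ≤ lam)
    (a y z : ℕ) : ClkSpec ω lam 50 (.store a y z) (clk (.store a y z)) τ := by
  have hy := hs.1 y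
  have hz := hs.1 z
  have hpaid : ∀ σ' c₀, Exec ω (.store a y z) (inner τ) σ' c₀ →
      τ.var (2 * y + 21) + τ.var (2 * z + 21) + 1 ≤ 4 * c₀ := by
    intro σ' c₀ h
    cases h
    have := hy.2.1
    have := hz.2.1
    simp only [inner]
    omega
  refine clkSpec_charge (A := 30) hs hF hpaid fun τ₁ h1 h2 h3 h4 h5 => ?_
  refine paid_of_runs hpaid (σ := (inner τ).setArr a ((inner τ).var y) ((inner τ).var z))
    (fun σ' c₀ h => by cases h; rfl) h3 (Runs.seq (Runs.store (Runs.store ?_))) ?_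
  · have hi := inner_setPairArr τ₁ a (τ₁.var (2 * y + 20)) (τ₁.var (2 * z + 20)) (τ₁.var (2 * z + 21))
    refine ⟨h1.setPairArr (h1.1 z), ?_, rfl⟩
    rw [h2] at hi
    rw [← h2]
    rw [← h2] at hi
    exact hi
  · simp only [Memory.setArr_var]
    rw [h4 _ (by omega), h4 _ (by omega), h4 _ (by omega)]
    have := hy.1
    have := hz.1
    have := hz.2.2
    set ch := τ.var (2 * y + 21) + τ.var (2 * z + 21) + 1
    have e2 : lam ≤ lam * (ch + 1) := Nat.le_mul_of_pos_right _ (by omega)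
    have e3 : ch + 1 ≤ lam * (ch + 1) := Nat.le_mul_of_pos_left _ (by omega)
    omega

theorem clkSpec_load (hs : Shadowed lam τ) (hF : (τ.var 10).size + 5 ≤ lam)
    (x a y : ℕ) : ClkSpec ω lam 70 (.load x a y) (clk (.load x a y)) τ := by
  have hy := hs.1 y
  have hpaid : ∀ σ' c₀, Exec ω (.load x a y) (inner τ) σ' c₀ →
      τ.var (2 * y + 21) + τ.var (2 * y + 21) + 1 + τ.arr (2 * a + 3) (τ.var (2 * y + 20))
        ≤ 4 * c₀ := by
    intro σ' c₀ h
    cases h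
    have := hy.2.1
    have := (hs.2 a (τ.var (2 * y + 20))).2.1
    simp only [inner]
    omega
  refine clkSpec_charge (A := 50) hs hF (fun σ' c₀ h => le_trans (Nat.le_add_right _ _) (hpaid σ' c₀ h))
    fun τ₁ h1 h2 h3 h4 h5 => ?_
  have ey : τ₁.var (2 * y + 20) = τ.var (2 * y + 20) := h4 _ (by omega)
  set i := τ.var (2 * y + 20) with hi
  set v := τ.arr (2 * a + 2) i with hv
  set e := τ.arr (2 * a + 3) i with he
  have hf : Fit lam v e := hs.2 a i
  have hy1 : i.size ≤ τ.var (2 * y + 21) := hy.1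
  have hF1 : (τ₁.var 10).size ≤ (τ.var 10).size := Nat.size_le_size (by omega)
  -- the memory after the size estimate has been charged
  set τ₂ := (τ₁.setVar 3 e).setVar 10 (τ₁.var 10 - e) with hτ₂
  have g1 : Exec ω (.load 3 (2 * a + 3) (2 * y + 20)) τ₁ (τ₁.setVar 3 e) (1 + i.size + e.size) := by
    have := Exec.load (ω := ω) τ₁ 3 (2 * a + 3) (2 * y + 20)
    rwa [ey, h5] at this
  have g2 : Exec ω (.arith .minus 10 10 3) (τ₁.setVar 3 e) τ₂ (1 + (τ₁.var 10).size + e.size) := by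
    have := Exec.arith (ω := ω) (τ₁.setVar 3 e) .minus 10 10 3
    simpa [ArithOp.apply, hτ₂] using this
  have h20 : ∀ x, 20 ≤ x → τ₂.var x = τ₁.var x := fun x hx => by
    have : x ≠ 3 := by omega
    have : x ≠ 10 := by omega
    simp [*]
  have hs2 : Shadowed lam τ₂ := h1.congr h20 fun _ _ => rfl
  have hi2 : inner τ₂ = inner τ := (inner_congr h20 fun _ _ => rfl).trans h2
  have f2 : τ₂.var 10 = τ₁.var 10 - e := by simp [hτ₂]
  have hfe := hf.2.2
  set ch := τ.var (2 * y + 21) + τ.var (2 * y + 21) + 1 with hch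
  by_cases h0 : τ₁.var 10 - e = 0
  · refine ⟨τ₂, _, .seq g1 (.seq g2 (.iteFalse (by rw [f2, h0]) (.skip _))), hs2, by omega, ?_, ?_⟩
    · rw [f2, h0]
      have e2 : lam ≤ lam * (τ.var 10 - 0 + 1) := Nat.le_mul_of_pos_right _ (by omega)
      have e3 : τ.var 10 - 0 + 1 ≤ lam * (τ.var 10 - 0 + 1) := Nat.le_mul_of_pos_left _ (by omega)
      omega
    · intro σ' c₀ hσ hc
      have := hpaid σ' c₀ hσ
      omega
  · have g3 : Runs ω (.seq (.load 2 (2 * a + 2) (2 * y + 20)) (writePair x)) τ₂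
        (1 + i.size + v.size + (3 + v.size + e.size)) fun τ'' =>
          Shadowed lam τ'' ∧ inner τ'' = (inner τ).setVar x v ∧ τ''.var 10 = τ₂.var 10 := by
      have e1 : τ₂.var (2 * y + 20) = i := by rw [h20 _ (by omega), ey]
      have e2 : τ₂.arr (2 * a + 2) i = v := by simp [hτ₂, h5, hv]
      refine (Runs.seq (Runs.load ((runs_writePair' (x := x) (v := v) (e := e) hs2 ?_ ?_ ?_ ?_ hf).mono
        le_rfl ?_))).cost_le ?_
      · intro x hx
        have : x ≠ 2 := by omega
        simp [this]
      · rfl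
      · simp [e1, e2]
      · simp [hτ₂]
      · rw [hi2]; exact fun _ h => h
      · rw [e1, e2]
    obtain ⟨τ', c, k1, k2, k3, k4, k5⟩ := g3
    refine ⟨τ', _, .seq g1 (.seq g2 (.iteTrue (by rw [f2]; exact h0) k1)), k3, by omega, ?_, ?_⟩
    · have e1 : τ.var 10 - τ'.var 10 = ch + e := by omega
      have e4 : (τ₂.var 10).size ≤ (τ.var 10).size := Nat.size_le_size (by omega)
      have := hf.1
      rw [e1]
      have e2 : lam ≤ lam * (ch + e + 1) := Nat.le_mul_of_pos_right _ (by omega)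
      have e3 : ch + e + 1 ≤ lam * (ch + e + 1) := Nat.le_mul_of_pos_left _ (by omega)
      omega
    · intro σ' c₀ hσ hc
      have := hpaid σ' c₀ hσ
      refine ⟨?_, by omega⟩
      cases hσ
      exact k4

theorem clkSpec_seq {A A' : ℕ} {V V' W W' : Prog} (hF : (τ.var 10).size + 5 ≤ lam)
    (h : ClkSpec ω lam A V W τ)
    (h' : ∀ τ', Shadowed lam τ' → (τ'.var 10).size + 5 ≤ lam → ClkSpec ω lam A' V' W' τ') :
    ClkSpec ω lam (A + A') (.seq V V') (.seq W W') τ := by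
  obtain ⟨τ₁, c₁, a1, a2, a3, a4, a5⟩ := h
  have hF1 : (τ₁.var 10).size ≤ (τ.var 10).size := Nat.size_le_size a3
  obtain ⟨τ₂, c₂, b1, b2, b3, b4, b5⟩ := h' τ₁ a2 (by omega)
  refine ⟨τ₂, _, .seq a1 b1, b2, by omega, ?_, ?_⟩
  · have e1 : A * (lam * (τ.var 10 - τ₁.var 10 + 1)) ≤ A * (lam * (τ.var 10 - τ₂.var 10 + 1)) := by
      gcongr
    have e2 : A' * (lam * (τ₁.var 10 - τ₂.var 10 + 1)) ≤ A' * (lam * (τ.var 10 - τ₂.var 10 + 1)) := by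
      gcongr
    rw [add_mul]
    omega
  · intro σ' c₀ hσ hc
    cases hσ with
    | seq k k' =>
      obtain ⟨rfl, d2⟩ := a5 _ _ k (by omega)
      obtain ⟨rfl, d4⟩ := b5 _ _ k' (by omega)
      exact ⟨rfl, by omega⟩

theorem clkSpec_ite {A A' x : ℕ} {V V' W W' : Prog} (hs : Shadowed lam τ)
    (hF : (τ.var 10).size + 5 ≤ lam)
    (h : ∀ τ', Shadowed lam τ' → (τ'.var 10).size + 5 ≤ lam → ClkSpec ω lam A V W τ')
    (h' : ∀ τ', Shadowed lam τ' → (τ'.var 10).size + 5 ≤ lam → ClkSpec ω lam A' V' W' τ') :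
    ClkSpec ω lam (A + A' + 30) (.ite x V V')
      (.seq (charge x x) (.ite 10 (.ite (2 * x + 20) W W') .skip)) τ := by
  have hx := hs.1 x
  have hpaid : ∀ σ' c₀, Exec ω (.ite x V V') (inner τ) σ' c₀ →
      τ.var (2 * x + 21) + τ.var (2 * x + 21) + 1 ≤ 4 * c₀ := by
    intro σ' c₀ h
    have := hx.2.1
    cases h with
    | iteTrue _ _ => simp only [inner]; omega
    | iteFalse h0 _ =>
      simp only [inner] at h0
      rw [h0] at this
      simp at this
      omega
  refine clkSpec_charge (A := A + A' + 10) hs hF hpaid fun τ₁ h1 h2 h3 h4 h5 => ?_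
  have ex : τ₁.var (2 * x + 20) = (inner τ).var x := h4 _ (by omega)
  have hF1 : (τ₁.var 10).size ≤ (τ.var 10).size := Nat.size_le_size (by omega)
  have hx1 : ((inner τ).var x).size ≤ τ.var (2 * x + 21) := hx.1
  have hx2 : τ.var (2 * x + 21) ≤ 2 * ((inner τ).var x).size + 1 := hx.2.1
  have cost : ∀ (A₁ c : ℕ) (τ' : Memory), τ'.var 10 ≤ τ₁.var 10 → A₁ ≤ A + A' →
      c ≤ A₁ * (lam * (τ₁.var 10 - τ'.var 10 + 1)) →
      1 + ((inner τ).var x).size + c ≤ (A + A' + 10) * (lam * (τ.var 10 - τ'.var 10 + 1)) := by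
    intro A₁ c τ' hle hA hc
    have e1 : A₁ * (lam * (τ₁.var 10 - τ'.var 10 + 1)) ≤
        (A + A') * (lam * (τ.var 10 - τ'.var 10 + 1)) := by
      gcongr
      omega
    have e2 : τ.var 10 - τ'.var 10 + 1 ≤ lam * (τ.var 10 - τ'.var 10 + 1) :=
      Nat.le_mul_of_pos_left _ (by omega)
    rw [add_mul]
    omega
  by_cases h0 : (inner τ).var x = 0
  · obtain ⟨τ', c, b1, b2, b3, b4, b5⟩ := h' τ₁ h1 (by omega)
    refine ⟨τ', _, .iteFalse (by rw [ex]; exact h0) b1, b2, b3, ?_, ?_⟩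
    · exact le_trans (by omega) (cost A' c τ' b3 (by omega) b4)
    · intro σ' c₀ hσ hc
      cases hσ with
      | iteTrue k _ => exact absurd h0 k
      | iteFalse _ k =>
        rw [h0] at hx2
        simp at hx2
        rw [← h2] at k
        obtain ⟨rfl, d⟩ := b5 _ _ k (by omega)
        exact ⟨rfl, by omega⟩
  · obtain ⟨τ', c, b1, b2, b3, b4, b5⟩ := h τ₁ h1 (by omega)
    refine ⟨τ', _, .iteTrue (by rw [ex]; exact h0) b1, b2, b3, ?_, ?_⟩
    · rw [ex]
      exact cost A c τ' b3 (by omega) b4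
    · intro σ' c₀ hσ hc
      cases hσ with
      | iteTrue _ k =>
        rw [← h2] at k
        obtain ⟨rfl, d⟩ := b5 _ _ k (by rw [h2] at *; omega)
        exact ⟨rfl, by rw [h2] at *; omega⟩
      | iteFalse k _ => exact absurd k h0

theorem runs_test (hs : Shadowed lam τ) (hF : (τ.var 10).size + 5 ≤ lam) (x : ℕ) :
    ∃ τ₁ c, Exec ω (test x) τ τ₁ c ∧ Shadowed lam τ₁ ∧ inner τ₁ = inner τ ∧
      τ₁.var 10 = τ.var 10 - (τ.var (2 * x + 21) + τ.var (2 * x + 21) + 1) ∧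
      τ₁.var 11 = (if τ₁.var 10 ≠ 0 ∧ (inner τ).var x ≠ 0 then 1 else 0) ∧
      c ≤ 30 * (lam * (τ.var 10 - τ₁.var 10 + 1)) := by
  obtain ⟨τ₁, c₁, h1, h2, h3, h4, h5⟩ := runs_charge (ω := ω) (y := x) (z := x) hs hF
  have hx := (hs.1 x).1
  have hF1 : (τ₁.var 10).size ≤ (τ.var 10).size := Nat.size_le_size (by omega)
  have ex : τ₁.var (2 * x + 20) = (inner τ).var x := h4 _ (by omega)
  have ex' : τ.var (2 * x + 20) = (inner τ).var x := rfl
  rw [ex'] at hx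
  have e2 : lam ≤ lam * (τ.var 10 - τ₁.var 10 + 1) := Nat.le_mul_of_pos_right _ (by omega)
  have e3 : τ.var 10 - τ₁.var 10 + 1 ≤ lam * (τ.var 10 - τ₁.var 10 + 1) :=
    Nat.le_mul_of_pos_left _ (by omega)
  have fr : ∀ b x, 20 ≤ x → (τ₁.setVar 11 b).var x = τ.var x := fun b x hx => by
    have : x ≠ 11 := by omega
    simp [this, h4 x (by omega)]
  have fr' : ∀ b b' x, 20 ≤ x → ((τ₁.setVar 11 b).setVar 11 b').var x = τ.var x := fun b b' x hx => by
    have : x ≠ 11 := by omega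
    simp [this, h4 x (by omega)]
  have n11 : 2 * x + 20 ≠ 11 := by omega
  have z1 : Nat.size 1 = 1 := by decide
  by_cases h0 : τ₁.var 10 = 0
  · refine ⟨τ₁.setVar 11 0, _, .seq h1 (.seq (.const _ _ _) (.iteFalse (by simpa using h0) (.skip _))),
      hs.congr (fr 0) (fun a _ => by simp [h5]), inner_congr (fr 0) (fun a _ => by simp [h5]),
      by simpa using h3, by simp [h0], ?_⟩
    simp
    omega
  · by_cases hx0 : (inner τ).var x = 0
    · refine ⟨τ₁.setVar 11 0, _, .seq h1 (.seq (.const _ _ _) (.iteTrue (by simpa using h0)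
        (.iteFalse (by simpa [n11, ex] using hx0) (.skip _)))),
        hs.congr (fr 0) (fun a _ => by simp [h5]), inner_congr (fr 0) (fun a _ => by simp [h5]),
        by simpa using h3, by simp [hx0], ?_⟩
      simp
      omega
    · refine ⟨(τ₁.setVar 11 0).setVar 11 1, _, .seq h1 (.seq (.const _ _ _) (.iteTrue (by simpa using h0)
        (.iteTrue (by simpa [n11, ex] using hx0) (.const _ _ _)))),
        hs.congr (fr' 0 1) (fun a _ => by simp [h5]), inner_congr (fr' 0 1) (fun a _ => by simp [h5]),
        by simpa using h3, by simp [hx0, h0], ?_⟩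
      simp [n11, ex, z1]
      omega

/-- The loop halts because the test takes at least one unit of fuel in each turn; the induction is
on the fuel, not on the execution of `V`, which need not halt. -/
theorem clkSpec_loop {A x : ℕ} {V W : Prog}
    (h : ∀ τ', Shadowed lam τ' → (τ'.var 10).size + 5 ≤ lam → ClkSpec ω lam A V W τ') (N : ℕ) :
    ∀ τ, τ.var 10 < N → Shadowed lam τ → (τ.var 10).size + 5 ≤ lam →
    ClkSpec ω lam (A + 80) (.loop x V) (.seq (test x) (.loop 11 (.seq W (test x)))) τ := by
  induction N with
  | zero => intro τ hN; omega
  | succ N ih =>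
    intro τ hN hs hF
    obtain ⟨τ₁, c₁, a1, a2, a3, a4, a5, a6⟩ := runs_test (ω := ω) hs hF x
    have hF1 : (τ₁.var 10).size ≤ (τ.var 10).size := Nat.size_le_size (by omega)
    have hx1 : ((inner τ).var x).size ≤ τ.var (2 * x + 21) := (hs.1 x).1
    have hx2 : τ.var (2 * x + 21) ≤ 2 * ((inner τ).var x).size + 1 := (hs.1 x).2.1
    by_cases hc : τ₁.var 10 ≠ 0 ∧ (inner τ).var x ≠ 0
    · rw [if_pos hc] at a5
      obtain ⟨τ₂, c₂, b1, b2, b3, b4, b5⟩ := h τ₁ a2 (by omega)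
      have hF2 : (τ₂.var 10).size ≤ (τ₁.var 10).size := Nat.size_le_size b3
      obtain ⟨τ₃, c₃, d1, d2, d3, d4, d5⟩ := ih τ₂ (by omega) b2 (by omega)
      cases d1 with
      | @seq _ _ _ τ₂' _ c₄ c₅ k k' =>
        refine ⟨τ₃, _, .seq a1 (.loopStep (by omega) (.seq b1 k) k'), d2, by omega, ?_, ?_⟩
        · rw [a5, Nat.size_one]
          obtain ⟨D₁, hD₁⟩ : ∃ D₁, τ.var 10 = τ₁.var 10 + D₁ + 1 := ⟨τ.var 10 - τ₁.var 10 - 1, by omega⟩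
          obtain ⟨D₂, hD₂⟩ := Nat.exists_eq_add_of_le b3
          obtain ⟨D₃, hD₃⟩ := Nat.exists_eq_add_of_le d3
          rw [show τ.var 10 - τ₁.var 10 + 1 = D₁ + 2 by omega] at a6
          rw [show τ₁.var 10 - τ₂.var 10 + 1 = D₂ + 1 by omega] at b4
          rw [show τ₂.var 10 - τ₃.var 10 + 1 = D₃ + 1 by omega] at d4
          rw [show τ.var 10 - τ₃.var 10 + 1 = D₁ + D₂ + D₃ + 2 by omega]
          have hl : 1 ≤ lam := by omega
          have : c₁ + (c₂ + (c₄ + c₅)) + 3 * lam ≤ 30 * (lam * (D₁ + 2)) + A * (lam * (D₂ + 1)) +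
              (A + 80) * (lam * (D₃ + 1)) + 3 * lam := by omega
          have e : (A + 80) * (lam * (D₁ + D₂ + D₃ + 2)) = 30 * (lam * (D₁ + 2)) + A * (lam * (D₂ + 1)) +
              (A + 80) * (lam * (D₃ + 1)) + 3 * lam + (A * (lam * D₁) + 50 * (lam * D₁) + 80 * (lam * D₂)
               + 17 * lam) := by ring
          rw [e]
          omega
        · intro σ' c₀ hσ hc0
          cases hσ with
          | loopDone k0 => exact absurd k0 hc.2
          | loopStep _ l l' =>
            rw [← a3] at l
            obtain ⟨rfl, m1⟩ := b5 _ _ l (by rw [a3] at *; omega)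
            obtain ⟨rfl, m2⟩ := d5 _ _ l' (by rw [a3] at *; omega)
            exact ⟨rfl, by rw [a3] at *; omega⟩
    · rw [if_neg hc] at a5
      refine ⟨τ₁, _, .seq a1 (.loopDone a5), a2, by omega, ?_, ?_⟩
      · have : 1 ≤ lam * (τ.var 10 - τ₁.var 10 + 1) := Nat.mul_pos (by omega) (by omega)
        nlinarith
      · intro σ' c₀ hσ hc0
        cases hσ with
        | loopDone k0 =>
          rw [k0] at hx2
          simp at hx2
          exact ⟨a3, by omega⟩
        | loopStep k0 l l' =>
          exfalso
          have : τ₁.var 10 = 0 := by tauto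
          omega

/-- Every program can be clocked. -/
theorem exists_clkSpec (V : Prog) : ∃ A, ∀ ω lam τ, A ≤ lam → Shadowed lam τ →
    (τ.var 10).size + 5 ≤ lam → ClkSpec ω lam A V (clk V) τ := by
  induction V with
  | skip =>
    refine ⟨1, fun ω lam τ hl hs hF => ⟨τ, 1, .skip τ, hs, le_rfl, ?_, fun σ' c₀ hσ hc => ?_⟩⟩
    · have : 1 ≤ lam * (τ.var 10 - τ.var 10 + 1) := Nat.mul_pos hl (by omega)
      omega
    · cases hσ; exact ⟨rfl, by omega⟩
  | const x c =>
    refine ⟨5 + 4 * c.size, fun ω lam τ hl hs hF => clkSpec_const hs x c ?_ (by omega)⟩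
    have := size_le_self c.size
    omega
  | arith op x y z => exact ⟨_, fun ω lam τ hl hs hF => clkSpec_arith hs hF op x y z⟩
  | load x a y => exact ⟨_, fun ω lam τ hl hs hF => clkSpec_load hs hF x a y⟩
  | store a y z => exact ⟨_, fun ω lam τ hl hs hF => clkSpec_store hs hF a y z⟩
  | coin x y => exact ⟨_, fun ω lam τ hl hs hF => clkSpec_coin hs hF x y⟩
  | seq p p' ih ih' =>
    obtain ⟨A, h⟩ := ih
    obtain ⟨A', h'⟩ := ih'
    exact ⟨A + A', fun ω lam τ hl hs hF => clkSpec_seq hF (h ω lam τ (by omega) hs hF)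
      fun τ' => h' ω lam τ' (by omega)⟩
  | ite x p p' ih ih' =>
    obtain ⟨A, h⟩ := ih
    obtain ⟨A', h'⟩ := ih'
    exact ⟨A + A' + 30, fun ω lam τ hl hs hF => clkSpec_ite hs hF (fun τ' => h ω lam τ' (by omega))
      fun τ' => h' ω lam τ' (by omega)⟩
  | loop x p ih =>
    obtain ⟨A, h⟩ := ih
    exact ⟨A + 80, fun ω lam τ hl hs hF => clkSpec_loop (fun τ' => h ω lam τ' (by omega)) _ τ
      (Nat.lt_succ_self _) hs hF⟩

end clk

/-! ### Calls of clocked programs -/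

/-- The memory after the list `l` has been written to the beginning of array `0`. -/
def Memory.put (s : Memory) (l : List ℕ) : Memory :=
  ⟨s.var, Function.update s.arr 0 fun i => if h : i < l.length then l[i] else s.arr 0 i⟩

theorem Memory.put_nil (s : Memory) : s.put [] = s := by
  refine Memory.ext' (fun x => rfl) (fun a i => ?_)
  by_cases h : a = 0
  · subst h; simp [Memory.put]
  · simp [Memory.put]

theorem Memory.put_arr_of_ne (s : Memory) (l : List ℕ) {a : ℕ} (h : a ≠ 0) :
    (s.put l).arr a = s.arr a := by simp [Memory.put, h]

theorem Memory.put_concat (s : Memory) (l : List ℕ) (v : ℕ) :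
    s.put (l ++ [v]) = (s.put l).setArr 0 l.length v := by
  refine Memory.ext' (fun x => rfl) (fun a i => ?_)
  by_cases h : a = 0
  · subst h
    simp only [Memory.put, Memory.setArr_arr, Function.update_self, List.length_append,
      List.length_singleton, true_and]
    rcases lt_trichotomy i l.length with hi | hi | hi
    · rw [dif_pos (by omega), if_neg (by omega), dif_pos hi, List.getElem_append_left hi]
    · subst hi; simp
    · rw [dif_neg (by omega), if_neg (by omega), dif_neg (by omega)]
  · simp [Memory.put, Memory.setArr_arr, h]

theorem Memory.input_eq_put (s : Memory) (l : List ℕ) :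
    s.input l = (s.put l).setVar 0 l.length := by
  refine Memory.ext' (fun x => ?_) (fun a i => rfl)
  simp [Memory.put, Memory.input, Function.update_apply]

theorem size_two_mul_add_one_le (a : ℕ) : (2 * a + 1).size ≤ a.size + 1 := by
  rw [Nat.size_le, pow_succ]
  have := Nat.lt_size_self a
  omega

theorem listCost_nil : listCost [] = 0 := rfl
theorem listCost_cons (a : ℕ) (l : List ℕ) : listCost (a :: l) = 1 + a.size + listCost l := by
  simp [listCost]
theorem listCost_append (l l' : List ℕ) : listCost (l ++ l') = listCost l + listCost l' := by
  simp [listCost]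
theorem length_le_listCost (l : List ℕ) : l.length ≤ listCost l := by
  induction l with
  | nil => simp
  | cons a l ih => rw [listCost_cons, List.length_cons]; omega
theorem size_le_listCost {l : List ℕ} {a : ℕ} (h : a ∈ l) : a.size ≤ listCost l := by
  induction l with
  | nil => simp at h
  | cons b l ih =>
    rw [listCost_cons]
    rcases List.mem_cons.1 h with rfl | h
    · omega
    · have := ih h; omega

section

variable {ω : ℕ → Bool} {lam : ℕ}

/-- Copies the input, except its first entry, to the inner memory, with size estimates. -/
def feedLoop : Prog :=
  .loop 13 (.seq (.arith .plus 14 12 15) (.seq (.load 2 0 14) (.seq est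
    (.seq (.store 2 12 2) (.seq (.store 3 12 3) (.seq (.arith .plus 12 12 15)
      (.arith .minus 13 13 15)))))))

/-- The first entry of the input is the fuel, the others are the input of the inner program. -/
def feed : Prog :=
  .seq (.const 15 1) (.seq (.const 12 0) (.seq (.arith .minus 13 0 15) (.seq (.const 16 0)
    (.seq (.load 10 0 16) (.seq feedLoop (.seq (.arith .plus 2 12 16) (.seq est (writePair 0))))))))

theorem runs_feedLoop {σ : Memory} {F : ℕ} (l₂ : List ℕ) : ∀ (l₁ : List ℕ) (τ : Memory),
    (∀ v ∈ l₂, (2 * v.size + 1).size ≤ lam) → (l₁.length + l₂.length + 1).size ≤ lam →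
    Shadowed lam τ → inner τ = σ.put l₁ → τ.var 10 = F → τ.var 12 = l₁.length →
    τ.var 13 = l₂.length → τ.var 15 = 1 → τ.var 16 = 0 →
    (∀ i (h : i < l₂.length), τ.arr 0 (l₁.length + i + 1) = l₂[i]) →
    Runs ω feedLoop τ (100 * (lam * listCost l₂) + 1) fun τ' =>
      Shadowed lam τ' ∧ inner τ' = σ.put (l₁ ++ l₂) ∧ τ'.var 10 = F ∧
      τ'.var 12 = l₁.length + l₂.length ∧ τ'.var 16 = 0 := by
  induction l₂ with
  | nil =>
    intro l₁ τ _ _ h1 h2 h3 h4 h5 h6 h7 _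
    exact (Runs.loop_done h5 ⟨h1, by simpa using h2, h3, by simpa using h4, h7⟩).cost_le (by omega)
  | cons v l₂ ih =>
    intro l₁ τ hv hlen h1 h2 h3 h4 h5 h6 h7 h8
    have hlam : 1 ≤ lam := by
      have := hv v (by simp)
      exact le_trans (Nat.size_pos.2 (by omega)) this
    have hvl := hv v (by simp)
    simp only [List.length_cons] at hlen h5 h8
    have hz : ∀ k, k ≤ l₁.length + (l₂.length + 1) + 1 → k.size ≤ lam := fun k hk =>
      (Nat.size_le_size hk).trans hlen
    have e0 : τ.arr 0 (l₁.length + 1) = v := by simpa using h8 0 (by omega)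
    have hcost : lam * listCost (v :: l₂) = lam * (v.size + 1) + lam * listCost l₂ := by
      rw [listCost_cons]; ring
    have hK : lam ≤ lam * (v.size + 1) := Nat.le_mul_of_pos_right _ (by omega)
    have hK' : v.size + 1 ≤ lam * (v.size + 1) := Nat.le_mul_of_pos_left _ hlam
    refine (Runs.loop_step (b := 90 * (lam * (v.size + 1))) (b' := 100 * (lam * listCost l₂) + 1)
      (by omega) ?_).cost_le ?_
    · refine Runs.cost_le (Runs.seq (Runs.arith (Runs.seq (b' := 60 * (lam * (v.size + 1)) + 20 * lam)
        (Runs.load ?_)))) (b := _ + (_ + _)) ?_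
      · set τ₁ := (τ.setVar 14 (ArithOp.plus.apply (τ.var 12) (τ.var 15))) with hτ₁
        have e1 : τ₁.arr 0 (τ₁.var 14) = v := by simp [hτ₁, ArithOp.apply, h4, h6, e0]
        rw [e1]
        refine (Runs.seq (b := 50 * (lam * (v.size + 1)))
          (b' := 10 * (lam * (v.size + 1)) + 20 * lam) ?_).cost_le (by omega)
        refine (runs_est (lam := lam) _ (by simpa using hvl)).mono (by simp) ?_
        rintro τ₂ ⟨k1, k2, k3⟩
        rw [show (τ₁.setVar 2 v).var 2 = v by simp] at k1
        have f : ∀ y, 10 ≤ y → y ≠ 14 → τ₂.var y = τ.var y := fun y hy hy' => by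
          rw [k2 y (by omega)]
          have : y ≠ 2 := by omega
          simp [hτ₁, this, hy']
        have f2 : τ₂.var 2 = v := by rw [k2 2 (by omega)]; simp
        have ka : τ₂.arr = τ.arr := by rw [k3]; simp [hτ₁]
        have hs2 : Shadowed lam τ₂ := h1.congr (fun x hx => f x (by omega) (by omega))
          fun a _ => by rw [ka]
        have hi2 : inner τ₂ = σ.put l₁ := by
          rw [← h2]
          exact inner_congr (fun x hx => f x (by omega) (by omega)) fun a _ => by rw [ka]
        have f12 := f 12 (by omega) (by omega)
        have f15 := f 15 (by omega) (by omega)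
        have f13 := f 13 (by omega) (by omega)
        set τ₃ := (τ₂.setArr 2 l₁.length v).setArr 3 l₁.length (τ₂.var 3) with hτ₃
        have hs3 : Shadowed lam τ₃ := hs2.setPairArr (a := 0) k1
        have hi3 : inner τ₃ = σ.put (l₁ ++ [v]) := by
          rw [Memory.put_concat, ← hi2]
          exact inner_setPairArr τ₂ 0 l₁.length v (τ₂.var 3)
        refine Runs.cost_le (Runs.seq (Runs.store (Runs.seq (Runs.store (Runs.seq (Runs.arith
          (Runs.arith ?_))))))) (b := _ + (_ + (_ + _))) ?_
        · simp only [Memory.setArr_var]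
          rw [f12, f2, h4]
          rw [← hτ₃]
          have fr : ∀ y, y ≠ 12 → y ≠ 13 → ∀ a b, ((τ₃.setVar 12 a).setVar 13 b).var y = τ₃.var y :=
            fun y h h' a b => by simp [h, h']
          refine (ih (l₁ ++ [v]) _ (fun w hw => hv w (by simp [hw])) ?_ ?_ ?_ ?_ ?_ ?_ ?_ ?_ ?_).mono
            le_rfl ?_
          · simp only [List.length_append, List.length_singleton]; exact hz _ (by omega)
          · exact hs3.congr (fun x hx => fr x (by omega) (by omega) _ _) fun _ _ => rfl
          · rw [← hi3]; exact inner_congr (fun x hx => fr x (by omega) (by omega) _ _) fun _ _ => rfl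
          · rw [fr 10 (by omega) (by omega)]; exact (f 10 (by omega) (by omega)).trans h3
          · simp [hτ₃, ArithOp.apply, f15, h6]
          · simp [hτ₃, ArithOp.apply, f15, h6, f13, h5]
          · rw [fr 15 (by omega) (by omega)]; exact f15.trans h6
          · rw [fr 16 (by omega) (by omega)]; exact (f 16 (by omega) (by omega)).trans h7
          · intro i hi
            have := h8 (i + 1) (by omega)
            simp only [List.getElem_cons_succ] at this
            rw [← this]
            simp only [Memory.setVar_arr, List.length_append, List.length_singleton]
            rw [hτ₃, Memory.setArr_arr_of_ne _ _ _ _ _ (by omega),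
              Memory.setArr_arr_of_ne _ _ _ _ _ (by omega), ka]
            congr 1
            omega
          · rintro τ' ⟨m1, m2, m3, m4, m5⟩
            refine ⟨m1, by simpa using m2, m3, ?_, m5⟩
            rw [m4]; simp; omega
        · have g1 := hz l₁.length (by omega)
          have g2 := hz (l₂.length + 1) (by omega)
          have := k1.2.2
          simp [f12, f2, f15, f13, h4, h5, h6]
          omega
      · have g1 := hz l₁.length (by omega)
        have g2 := hz (l₁.length + 1) (by omega)
        simp [ArithOp.apply, h4, h6, e0]
        omega
    · rw [hcost, h5]
      have := hz (l₂.length + 1) (by omega)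
      omega

theorem inner_input (τ : Memory) (l : List ℕ) : inner (τ.input l) = inner τ :=
  inner_congr (fun x hx => by
    have : x ≠ 0 := by omega
    simp [Memory.input, this]) fun a ha => by
    have : a ≠ 0 := by omega
    simp [Memory.input, this]

theorem Shadowed.input {τ : Memory} (h : Shadowed lam τ) (l : List ℕ) :
    Shadowed lam (τ.input l) :=
  h.congr (fun x hx => by
    have : x ≠ 0 := by omega
    simp [Memory.input, this]) fun a ha => by
    have : a ≠ 0 := by omega
    simp [Memory.input, this]

theorem runs_feed {τ : Memory} {F : ℕ} {l : List ℕ} (hs : Shadowed lam τ)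
    (hF : (F + listCost l + 1).size + 5 ≤ lam) :
    Runs ω feed (τ.input (F :: l)) (300 * (lam * (listCost l + 1))) fun τ' =>
      Shadowed lam τ' ∧ inner τ' = (inner τ).input l ∧ τ'.var 10 = F := by
  have hlen := length_le_listCost l
  have hz : ∀ k, k ≤ F + listCost l + 1 → k.size + 5 ≤ lam := fun k hk =>
    le_trans (Nat.add_le_add_right (Nat.size_le_size hk) 5) hF
  have hl2 : (l.length + 1).size + 5 ≤ lam := hz _ (by omega)
  have hls : ∀ v, v ≤ listCost l → (2 * v + 1).size ≤ lam := fun v hv =>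
    (size_two_mul_add_one_le v).trans (by have := hz v (by omega); omega)
  have hlz := size_le_self l.length
  have hK : lam ≤ lam * (listCost l + 1) := Nat.le_mul_of_pos_right _ (by omega)
  have hK' : lam * listCost l + lam = lam * (listCost l + 1) := by ring
  have hK'' : lam * (l.length.size + 1) ≤ lam * (listCost l + 1) := Nat.mul_le_mul_left _ (by omega)
  have e0 : (τ.input (F :: l)).var 0 = l.length + 1 := by simp [Memory.input]
  have ea0 : (τ.input (F :: l)).arr 0 0 = F := by simp [Memory.input]
  have ea : ∀ i (h : i < l.length), (τ.input (F :: l)).arr 0 (i + 1) = l[i] := fun i h => by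
    simp [Memory.input, h]
  have hsi := hs.input (F :: l)
  have hii := inner_input τ (F :: l)
  set τ₀ := τ.input (F :: l) with hτ₀
  refine (Runs.seq (Runs.const (Runs.seq (Runs.const (Runs.seq (Runs.arith (Runs.seq (Runs.const
    (Runs.seq (b' := 100 * (lam * listCost l) + 1 + (4 * lam + (50 * (lam * (l.length.size + 1)) + 3 * lam)))
      (Runs.load (Runs.seq (Runs.mono (runs_feedLoop (σ := inner τ) (F := F) l [] _
        ?_ ?_ ?_ ?_ ?_ ?_ ?_ ?_ ?_ ?_) le_rfl ?_)))))))))))).cost_le ?_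
  · exact fun v hv => hls _ (size_le_listCost hv)
  · simpa using le_trans (by omega) hl2
  · exact hsi.congr (fun x hx => by
      have : x ≠ 10 := by omega
      have : x ≠ 12 := by omega
      have : x ≠ 13 := by omega
      have : x ≠ 15 := by omega
      have : x ≠ 16 := by omega
      simp [*]) fun _ _ => rfl
  · rw [Memory.put_nil, ← hii]
    exact inner_congr (fun x hx => by
      have : x ≠ 10 := by omega
      have : x ≠ 12 := by omega
      have : x ≠ 13 := by omega
      have : x ≠ 15 := by omega
      have : x ≠ 16 := by omega
      simp [*]) fun _ _ => rfl
  · simp [ea0]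
  · simp
  · simp [ArithOp.apply, e0]
  · simp
  · simp
  · intro i h
    simpa using ea i h
  · rintro τ₁ ⟨h1, h2, h3, h4, h5⟩
    simp only [List.length_nil, zero_add, List.nil_append] at h4 h2
    refine Runs.cost_le (Runs.seq (b' := 50 * (lam * (l.length.size + 1)) + 3 * lam) (Runs.arith ?_)) (b := _ + _) ?_
    · have e2 : ArithOp.plus.apply (τ₁.var 12) (τ₁.var 16) = l.length := by simp [ArithOp.apply, h4, h5]
      rw [e2]
      refine Runs.seq ((runs_est (lam := lam) _ ?_).mono (by simp) ?_)
      · simpa using hls l.length.size (by omega)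
      · rintro τ₂ ⟨k1, k2, k3⟩
        rw [show (τ₁.setVar 2 l.length).var 2 = l.length by simp] at k1
        have f : ∀ y, 10 ≤ y → τ₂.var y = τ₁.var y := fun y hy => by
          rw [k2 y (by omega)]
          have : y ≠ 2 := by omega
          simp [this]
        refine (runs_writePair' (x := 0) (v := l.length) h1 f (by simpa using k3)
          (by rw [k2 2 (by omega)]; simp) rfl k1).mono ?_ ?_
        · have := k1.2.2
          have := hz l.length (by omega)
          omega
        · rintro τ₃ ⟨m1, m2, m3⟩
          exact ⟨m1, by rw [m2, h2, Memory.input_eq_put], by rw [m3, h3]⟩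
    · have := hz l.length (by omega)
      simp [h4, h5]
      omega
  · have := hz F (by omega)
    have := hz (l.length + 1) (by omega)
    simp [e0, ea0]
    omega

/-- The clocked version of a program `V`; the first entry of its input is the fuel, the others are
the input of `V`. -/
def rcall (V : Prog) : Prog := .seq feed (clk V)

/-- The properties of a clocked call: it halts in any case, within time linear in the fuel and the
input, and does what `V` does if the fuel is more than four times the cost of `V`. -/
theorem exists_rcall (V : Prog) : ∃ A, ∀ ω lam τ F l, A ≤ lam → Shadowed lam τ →
    (F + listCost l + 1).size + 5 ≤ lam →
    ∃ τ' c, Exec ω (rcall V) (τ.input (F :: l)) τ' c ∧ Shadowed lam τ' ∧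
      c ≤ A * (lam * (F + listCost l + 1)) ∧ τ'.var 10 ≤ F ∧
      ∀ σ' c₀, Exec ω V ((inner τ).input l) σ' c₀ → 4 * c₀ < F →
        inner τ' = σ' ∧ F ≤ τ'.var 10 + 4 * c₀ := by
  obtain ⟨A, hA⟩ := exists_clkSpec V
  refine ⟨A + 300, fun ω lam τ F l hl hs hF => ?_⟩
  have hz : F.size + 5 ≤ lam :=
    le_trans (Nat.add_le_add_right (Nat.size_le_size (by omega)) 5) hF
  obtain ⟨τ₁, c₁, a1, a2, a3, a4, a5⟩ := runs_feed (ω := ω) hs hF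
  obtain ⟨τ₂, c₂, b1, b2, b3, b4, b5⟩ := hA ω lam τ₁ (by omega) a3 (by rw [a5]; exact hz)
  rw [a5] at b3 b4 b5
  rw [a4] at b5
  refine ⟨τ₂, _, .seq a1 b1, b2, ?_, b3, b5⟩
  have e1 : lam * (F - τ₂.var 10 + 1) ≤ lam * (F + listCost l + 1) := Nat.mul_le_mul_left _ (by omega)
  have e2 : lam * (listCost l + 1) ≤ lam * (F + listCost l + 1) := Nat.mul_le_mul_left _ (by omega)
  nlinarith

/-- The clocked version of a program `V` that outputs one bit; the bit is written to the
variable `12`. The output cell is loaded under the clock, because in a run with too little fuel it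
may hold a number of any size. -/
def rdec (V : Prog) : Prog :=
  .seq (rcall (.seq V (.seq (.const 0 0) (.load 0 1 0))))
    (.seq (.const 12 0) (.seq (charge 0 0) (.ite 10 (.ite 20 (.const 12 1) .skip) .skip)))

/-- The result is `0` or `1` in any case, and it is the output of `V` if the fuel suffices. Loading
and testing the output cell takes less than `24` units of fuel. -/
theorem exists_rdec (V : Prog) : ∃ A, ∀ ω lam τ F l, A ≤ lam → Shadowed lam τ →
    (F + listCost l + 1).size + 5 ≤ lam →
    ∃ τ' c, Exec ω (rdec V) (τ.input (F :: l)) τ' c ∧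
      c ≤ A * (lam * (F + listCost l + 1)) ∧ τ'.var 12 ≤ 1 ∧
      ∀ σ' c₀ (b : Bool), Exec ω V ((inner τ).input l) σ' c₀ → σ'.output = [b.toNat] →
        4 * c₀ + 24 < F → τ'.var 12 = b.toNat := by
  obtain ⟨A, hA⟩ := exists_rcall (.seq V (.seq (.const 0 0) (.load 0 1 0)))
  refine ⟨A + 20, fun ω lam τ F l hl hs hF => ?_⟩
  have hz : F.size + 5 ≤ lam :=
    le_trans (Nat.add_le_add_right (Nat.size_le_size (by omega)) 5) hF
  obtain ⟨τ₁, c₁, a1, a2, a3, a4, a5⟩ := hA ω lam τ F l (by omega) hs hF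
  have hs1 : Shadowed lam (τ₁.setVar 12 0) := a2.congr (fun x hx => by
      have : x ≠ 12 := by omega
      simp [this]) fun _ _ => rfl
  have hF1 : (τ₁.var 10).size ≤ F.size := Nat.size_le_size a4
  obtain ⟨τ₂, c₂, b1, b2, b3, b4, b5⟩ := runs_charge (ω := ω) (y := 0) (z := 0) hs1 (by simp; omega)
  simp only [Memory.setVar_var] at b3
  norm_num at b3
  have b20 : τ₂.var 20 = (inner τ₁).var 0 := by rw [b4 20 (by omega)]; simp [inner]
  have b12 : τ₂.var 12 = 0 := by rw [b4 12 (by omega)]; simp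
  have hb := (a2.1 0).1
  have hb' := (a2.1 0).2.1
  simp only [mul_zero, zero_add] at hb hb'
  have e20 : (inner τ₁).var 0 = τ₁.var 20 := rfl
  have hF2 : (τ₂.var 10).size ≤ F.size := Nat.size_le_size (by omega)
  have hcost : lam + F + 1 ≤ lam * (F + listCost l + 1) + 1 := by nlinarith
  -- what the inner program does if it is given enough fuel
  have hbit : ∀ σ' c₀ (b : Bool), Exec ω V ((inner τ).input l) σ' c₀ → σ'.output = [b.toNat] →
      4 * c₀ + 24 < F → (inner τ₁).var 0 = b.toNat ∧ τ₂.var 10 ≠ 0 := by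
    intro σ' c₀ b hσ ho hc
    have hlen : σ'.var 1 = 1 := by
      have := congrArg List.length ho
      simpa [Memory.output] using this
    have hv : σ'.arr 1 0 = b.toNat := by
      simpa [Memory.output, hlen] using ho
    have hbs : b.toNat.size ≤ 1 := by cases b <;> decide
    have hE : Exec ω (.seq V (.seq (.const 0 0) (.load 0 1 0))) ((inner τ).input l)
        ((σ'.setVar 0 0).setVar 0 (σ'.arr 1 0)) (c₀ + (1 + Nat.size 0 + (1 + Nat.size 0 + (σ'.arr 1 0).size))) := by
      refine .seq hσ (.seq (.const _ _ _) ?_)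
      have := Exec.load (ω := ω) (σ'.setVar 0 0) 0 1 0
      simpa using this
    rw [hv] at hE
    obtain ⟨h1, h2⟩ := a5 _ _ hE (by simp; omega)
    have e1 : (inner τ₁).var 0 = b.toNat := by rw [h1]; simp
    refine ⟨e1, ?_⟩
    rw [b3]
    rw [← e20, e1] at hb'
    simp at h2
    omega
  by_cases h0 : τ₂.var 10 = 0
  · refine ⟨τ₂, _, .seq a1 (.seq (.const _ _ _) (.seq b1 (.iteFalse h0 (.skip _)))), ?_, by omega, ?_⟩
    · simp
      nlinarith
    · intro σ' c₀ b hσ ho hc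
      exact absurd h0 (hbit σ' c₀ b hσ ho hc).2
  · by_cases hv : τ₁.var 20 = 0
    · refine ⟨τ₂, _, .seq a1 (.seq (.const _ _ _) (.seq b1 (.iteTrue h0 (.iteFalse
        (by rw [b20, e20, hv]) (.skip _))))), ?_, by omega, ?_⟩
      · simp
        nlinarith
      · intro σ' c₀ b hσ ho hc
        rw [b12, ← (hbit σ' c₀ b hσ ho hc).1, e20, hv]
    · refine ⟨τ₂.setVar 12 1, _, .seq a1 (.seq (.const _ _ _) (.seq b1 (.iteTrue h0 (.iteTrue
        (by rw [b20, e20]; exact hv) (.const _ _ _))))), ?_, by simp, ?_⟩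
      · rw [b20, e20]
        simp
        have : τ₁.var 21 ≤ F := by omega
        nlinarith
      · intro σ' c₀ b hσ ho hc
        have := (hbit σ' c₀ b hσ ho hc).1
        rw [e20] at this
        cases b
        · simp at this; omega
        · simp

end

/-! ### Instructions of the host -/

/-!
The registers are used as follows.
* `0` and `1`: auxiliary values; `10` and `11`: positions for writing to a virtual machine.
* `12` to `17`: the arguments of `genBlock`.
* `20`: the resulting bit of one round on one pair of machines; `21` to `26`: auxiliary values.
* `30`: the number of the current pair of machines; `31` and `32`: the numbers of these two machines,
  for the reduction and for the dynamic algorithm; `33` and `34`: the position of their block.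
* `35` to `37`: in a round, the blocks and repetitions that remain, and the votes for `1`; `38`: the
  result of the round; `39`: in the preprocessing, the pairs of machines that remain.
* `40` to `57`: parameters that do not change after the preprocessing (see `Params.Holds`); `51` is the
  size of the matrix dimension, and `57` is always `0`, the number of the machine that runs the
  program for the universal request sequence.
-/

section

variable {ω : ℕ → Bool} {lam : ℕ} {X : St} {Q : St → Prop}

theorem view_reg (s : Memory) (y : ℕ) : (view s).reg y = s.var (y + 10) := rfl

/-- Writes the value of an expression to array `0` of the virtual machine whose number is in the
register `m`, at the position given by the register `wp`, and increments `wp`. -/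
def pushE (m wp : ℕ) (e : Ex) : Prog :=
  .seq (e.comp 0) (.seq (cellProg m (wp + 10) 1) (.seq (.store 21 1 0) (.seq (.const 2 1)
    (.arith .plus (wp + 10) (wp + 10) 2))))

theorem ARuns.pushE {m wp : ℕ} {e : Ex} (hlam : 1 ≤ lam) (hX : RegBd lam X.reg) (he : e.depth ≤ 10)
    (h : Q { X with
      reg := Function.update X.reg wp (X.reg wp + 1)
      vm := Function.update X.vm (X.reg m)
        ((X.vm (X.reg m)).setArr 0 (X.reg wp) (e.eval X.reg)) }) :
    ARuns ω (pushE m wp e) X ((e.cc + e.weight + 60) * lam) Q := by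
  rintro s rfl
  refine (Runs.seq ((Ex.runs_comp lam hlam e 0 s hX (by omega)).mono le_rfl ?_) :
    Runs _ _ _ (e.cc * lam + ((e.weight + 60) * lam)) _).cost_le (by nlinarith)
  rintro s1 ⟨h1, h2, h3⟩
  have hr : ∀ y, s1.var (y + 10) = (view s).reg y := fun y => h2 _ (by omega)
  have hsz := Ex.size_eval_le (view s).reg lam hlam hX e
  have hv : view s1 = view s := view_eq_of (fun y hy => h2 y (by omega)) h3
  have g1 := hX m
  have g2 := hX wp
  have g3 := size_cell_le ((view s).reg m) ((view s).reg wp)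
  refine Runs.cost_le (Runs.seq (runs_cellProg (by omega) (Runs.seq (Runs.store (Runs.seq (Runs.const
    (Runs.arith ?_))))))) (b := _ + (_ + (_ + _))) ?_
  · have e0 : (s1.setVar 1 (cell (s1.var (m + 10)) (s1.var (wp + 10)))).var 0 = e.eval (view s).reg := by
      simp [h1]
    have e1 : (s1.setVar 1 (cell (s1.var (m + 10)) (s1.var (wp + 10)))).var 1 =
      cell ((view s).reg m) ((view s).reg wp) := by simp [hr]
    rw [e0, e1]
    convert h using 1
    rw [view_setVar, view_scratch (by norm_num)]
    have := view_storeArr (s1.setVar 1 (cell (s1.var (m + 10)) (s1.var (wp + 10)))) ((view s).reg m) 0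
      ((view s).reg wp) (e.eval (view s).reg)
    simp only [mul_zero, zero_add] at this
    rw [this, view_scratch (by norm_num), hv]
    simp [St.setVM, ArithOp.apply, hr]
  · simp [hr, h1]
    nlinarith

/-- Reads a cell of an array of a virtual machine to a register. -/
def pull (x m a : ℕ) (e : Ex) : Prog :=
  .seq (e.comp 0) (.seq (cellProg m 0 1) (.load (x + 10) (2 * a + 21) 1))

theorem ARuns.pull {x m a : ℕ} {e : Ex} (hlam : 1 ≤ lam) (hX : RegBd lam X.reg) (he : e.depth ≤ 10)
    (hv : ((X.vm (X.reg m)).arr a (e.eval X.reg)).size ≤ lam)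
    (h : Q { X with
      reg := Function.update X.reg x ((X.vm (X.reg m)).arr a (e.eval X.reg)) }) :
    ARuns ω (pull x m a e) X ((e.cc + 12 * e.weight + 40) * lam) Q := by
  rintro s rfl
  refine (Runs.seq ((Ex.runs_comp lam hlam e 0 s hX (by omega)).mono le_rfl ?_) :
    Runs _ _ _ (e.cc * lam + ((12 * e.weight + 40) * lam)) _).cost_le (by nlinarith)
  rintro s1 ⟨h1, h2, h3⟩
  have hr : ∀ y, s1.var (y + 10) = (view s).reg y := fun y => h2 _ (by omega)
  have hsz := Ex.size_eval_le (view s).reg lam hlam hX e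
  have hvw : view s1 = view s := view_eq_of (fun y hy => h2 y (by omega)) h3
  have g1 := hX m
  have g3 := size_cell_le ((view s).reg m) (e.eval (view s).reg)
  have e1 : s1.arr (2 * a + 21) (cell ((view s).reg m) (e.eval (view s).reg)) =
      ((view s).vm ((view s).reg m)).arr a (e.eval (view s).reg) := by
    rw [← hvw, view_vm_arr]
  refine Runs.cost_le (Runs.seq (runs_cellProg (by omega) (Runs.load ?_))) (b := _ + _) ?_
  · convert h using 1
    rw [view_setVar, view_scratch (by norm_num), hvw]
    simp [hr, h1, e1]
  · simp [hr, h1, e1]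
    nlinarith

/-- Reads a cell of the input array of the host to a register. -/
def readInp (x : ℕ) (e : Ex) : Prog := .seq (e.comp 0) (.load (x + 10) 0 0)

theorem ARuns.readInp {x : ℕ} {e : Ex} (hlam : 1 ≤ lam) (hX : RegBd lam X.reg) (he : e.depth ≤ 10)
    (hv : (X.inp (e.eval X.reg)).size ≤ lam)
    (h : Q { X with reg := Function.update X.reg x (X.inp (e.eval X.reg)) }) :
    ARuns ω (readInp x e) X ((e.cc + e.weight + 2) * lam) Q := by
  rintro s rfl
  refine (Runs.seq ((Ex.runs_comp lam hlam e 0 s hX (by omega)).mono le_rfl ?_) :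
    Runs _ _ _ (e.cc * lam + ((e.weight + 2) * lam)) _).cost_le (by nlinarith)
  rintro s1 ⟨h1, h2, h3⟩
  have hsz := Ex.size_eval_le (view s).reg lam hlam hX e
  have hvw : view s1 = view s := view_eq_of (fun y hy => h2 y (by omega)) h3
  have e1 : s1.arr 0 (s1.var 0) = (view s).inp (e.eval (view s).reg) := by
    rw [h1, h3]; rfl
  refine Runs.cost_le (Runs.load ?_) ?_
  · convert h using 1
    rw [view_setVar, hvw, e1]
  · rw [e1, h1]; nlinarith

/-- Writes a register to the variable `0` of a virtual machine. -/
def setLen (m wp : ℕ) : Prog := .store 20 (m + 10) (wp + 10)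

theorem ARuns.setLen {m wp : ℕ} (hlam : 1 ≤ lam) (hX : RegBd lam X.reg)
    (h : Q { X with
      vm := Function.update X.vm (X.reg m) ((X.vm (X.reg m)).setVar 0 (X.reg wp)) }) :
    ARuns ω (setLen m wp) X (3 * lam) Q := by
  rintro s rfl
  have g1 := hX m
  have g2 := hX wp
  simp only [view_reg] at g1 g2
  refine Runs.cost_le (Runs.store ?_) (by omega)
  convert h using 1
  exact view_storeVar s (s.var (m + 10)) 0 (s.var (wp + 10))

/-- Reads a variable of a virtual machine to a register. -/
def getVar (x m v : ℕ) : Prog := .load (x + 10) (2 * v + 20) (m + 10)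

theorem ARuns.getVar {x m v : ℕ} (hlam : 1 ≤ lam) (hX : RegBd lam X.reg)
    (hv : ((X.vm (X.reg m)).var v).size ≤ lam)
    (h : Q { X with reg := Function.update X.reg x ((X.vm (X.reg m)).var v) }) :
    ARuns ω (getVar x m v) X (3 * lam) Q := by
  rintro s rfl
  have g1 := hX m
  simp only [view_reg] at g1
  have e1 : s.arr (2 * v + 20) (s.var (m + 10)) = ((view s).vm ((view s).reg m)).var v := rfl
  refine Runs.cost_le (Runs.load ?_) (by rw [e1]; omega)
  convert h using 1
  rw [view_setVar]
  rfl

/-- Copies a cell of the array `a` of the virtual machine `m` to array `0` of the virtual machine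
`m'`, and increments both positions. -/
def copyElem (m a src m' wp : ℕ) : Prog :=
  .seq (cellProg m (src + 10) 1) (.seq (.load 0 (2 * a + 21) 1) (.seq (cellProg m' (wp + 10) 1)
    (.seq (.store 21 1 0) (.seq (.const 2 1) (.seq (.arith .plus (wp + 10) (wp + 10) 2)
      (.arith .plus (src + 10) (src + 10) 2))))))

theorem ARuns.copyElem {m a src m' wp v : ℕ} (hlam : 1 ≤ lam) (hX : RegBd lam X.reg)
    (hws : wp ≠ src) (hv : (X.vm (X.reg m)).arr a (X.reg src) = v)
    (h : Q { X with
      reg := Function.update (Function.update X.reg wp (X.reg wp + 1)) src (X.reg src + 1)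
      vm := Function.update X.vm (X.reg m')
        ((X.vm (X.reg m')).setArr 0 (X.reg wp) v) }) :
    ARuns ω (copyElem m a src m' wp) X (120 * (lam * (v.size + 1))) Q := by
  rintro s rfl
  have g1 := hX m
  have g2 := hX wp
  have g3 := hX src
  have g4 := hX m'
  have g5 := size_cell_le ((view s).reg m) ((view s).reg src)
  have g6 := size_cell_le ((view s).reg m') ((view s).reg wp)
  simp only [view_reg] at g1 g2 g3 g4 g5 g6
  have e1 : s.arr (2 * a + 21) (cell (s.var (m + 10)) (s.var (src + 10))) = v := hv
  have hK : lam ≤ lam * (v.size + 1) := Nat.le_mul_of_pos_right _ (by omega)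
  have hK' : v.size + 1 ≤ lam * (v.size + 1) := Nat.le_mul_of_pos_left _ hlam
  have hws' : ¬ src = wp := fun h => hws h.symm
  refine Runs.cost_le (Runs.seq (runs_cellProg (by omega) (Runs.seq (Runs.load (Runs.seq
    (runs_cellProg (by omega) (Runs.seq (Runs.store (Runs.seq (Runs.const (Runs.seq (Runs.arith
      (Runs.arith ?_))))))))))))) (b := _ + (_ + (_ + (_ + (_ + (_ + _)))))) ?_
  · convert h using 1
    set s1 := s.setVar 1 (cell (s.var (m + 10)) (s.var (src + 10))) with hs1
    have f1 : s1.arr (2 * a + 21) (s1.var 1) = v := by simp [hs1, e1]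
    rw [f1]
    set s2 := (s1.setVar 0 v).setVar 1 (cell ((s1.setVar 0 v).var (m' + 10)) ((s1.setVar 0 v).var (wp + 10)))
      with hs2
    have f2 : s2.var 1 = cell (s.var (m' + 10)) (s.var (wp + 10)) := by simp [hs2, hs1]
    have f3 : s2.var 0 = v := by simp [hs2]
    have f4 : ∀ y, s2.var (y + 10) = s.var (y + 10) := by simp [hs2, hs1]
    have f5 : view s2 = view s := by
      rw [hs2, view_scratch (by norm_num), view_scratch (by norm_num), hs1, view_scratch (by norm_num)]
    rw [f2, f3, view_setVar, view_setVar, view_scratch (by norm_num)]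
    have := view_storeArr s2 (s.var (m' + 10)) 0 (s.var (wp + 10)) v
    simp only [mul_zero, zero_add] at this
    rw [this, f5]
    simp [St.setVM, ArithOp.apply, f4, hws', view_reg]
  · simp [e1, hws', ArithOp.apply]
    omega

end

/-! ### Writing lists to virtual machines -/

section

variable {ω : ℕ → Bool} {lam : ℕ} {X : St} {Q : St → Prop}

theorem update_self_of_eq {V : ℕ → Memory} {p : ℕ} {τ : Memory} (h : V p = τ) :
    Function.update V p τ = V := by rw [← h, Function.update_eq_self]

/-- The register `x` does not occur in the expression. -/
def Ex.Avoids (x : ℕ) : Ex → Prop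
  | .var y => y ≠ x
  | .num _ => True
  | .op _ a b => a.Avoids x ∧ b.Avoids x

theorem Ex.Avoids.eval {x : ℕ} {e : Ex} (h : e.Avoids x) (r : ℕ → ℕ) (v : ℕ) :
    e.eval (Function.update r x v) = e.eval r := by
  induction e with
  | var y => exact Function.update_of_ne h _ _
  | num k => rfl
  | op o a b iha ihb => simp only [Ex.eval, iha h.1, ihb h.2]

/-- Appends the values of several expressions. -/
def pushEs (m wp : ℕ) : List Ex → Prog
  | [] => .skip
  | e :: es => .seq (pushE m wp e) (pushEs m wp es)

/-- A bound for the cost of `pushEs`. -/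
def pushCost : List Ex → ℕ
  | [] => 1
  | e :: es => e.cc + e.weight + 60 + pushCost es

theorem ARuns.pushEs {m wp : ℕ} (hlam : 1 ≤ lam) (hmw : m ≠ wp) (es : List Ex) :
    ∀ (l : List ℕ) (σ : Memory) (X : St), (∀ e ∈ es, e.depth ≤ 10 ∧ e.Avoids wp) →
      RegBd lam X.reg → X.vm (X.reg m) = σ.put l → X.reg wp = l.length →
      (l.length + es.length).size ≤ lam →
      ∀ Q : St → Prop, Q { X with
        reg := Function.update X.reg wp (l.length + es.length)
        vm := Function.update X.vm (X.reg m) (σ.put (l ++ es.map (Ex.eval X.reg))) } →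
      ARuns ω (pushEs m wp es) X (pushCost es * lam) Q := by
  induction es with
  | nil =>
    intro l σ X _ _ hvm hwp _ Q h
    refine (ARuns.skip ?_).cost_le (by simpa [pushCost] using hlam)
    convert h using 1
    cases X
    simp only [St.mk.injEq, and_true, List.map_nil, List.append_nil, List.length_nil, add_zero]
    exact ⟨by rw [← hwp, Function.update_eq_self], (update_self_of_eq hvm).symm⟩
  | cons e es ih =>
    intro l σ X he hX hvm hwp hsz Q h
    simp only [List.length_cons] at hsz
    refine (ARuns.seq (ARuns.pushE hlam hX (he e (by simp)).1 ?_)).cost_le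
      (b := _ + pushCost es * lam) (by simp only [pushCost]; nlinarith)
    have hm : Function.update X.reg wp (X.reg wp + 1) m = X.reg m := Function.update_of_ne hmw _ _
    refine ih (l ++ [e.eval X.reg]) σ _ (fun e' h' => he e' (by simp [h'])) (hX.update ?_) ?_ ?_ ?_ Q ?_
    · rw [hwp]; exact (Nat.size_le_size (by omega)).trans hsz
    · simp only [hm, Function.update_self]
      rw [hvm, hwp, Memory.put_concat]
    · simp [hwp]
    · simp only [List.length_append, List.length_singleton]
      exact (Nat.size_le_size (by omega)).trans hsz
    · convert h using 1
      have hes : es.map (Ex.eval (Function.update X.reg wp (X.reg wp + 1))) = es.map (Ex.eval X.reg) :=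
        List.map_congr_left fun e' h' => (he e' (by simp [h'])).2.eval _ _
      simp only [hm, hes, Function.update_idem]
      simp [add_assoc, Nat.add_comm 1]

/-- Copies `cnt` many cells from one virtual machine to another. -/
def copyLoop (m a src m' wp cnt : ℕ) : Prog :=
  .loop (cnt + 10) (.seq (copyElem m a src m' wp) (assign cnt (.var cnt - .num 1)))

theorem ARuns.copyLoop {m a src m' wp cnt : ℕ} (hlam : 1 ≤ lam) (h1 : wp ≠ src) (h2 : wp ≠ cnt)
    (h3 : src ≠ cnt) (hm1 : m ≠ wp) (hm2 : m ≠ src) (hm3 : m ≠ cnt) (hm1' : m' ≠ wp)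
    (hm2' : m' ≠ src) (hm3' : m' ≠ cnt) (l₂ : List ℕ) :
    ∀ (l₁ : List ℕ) (σ : Memory) (X : St),
      RegBd lam X.reg → X.reg m ≠ X.reg m' → X.vm (X.reg m') = σ.put l₁ → X.reg wp = l₁.length →
      X.reg cnt = l₂.length → (l₁.length + l₂.length).size ≤ lam →
      (X.reg src + l₂.length).size ≤ lam →
      (∀ i (h : i < l₂.length), (X.vm (X.reg m)).arr a (X.reg src + i) = l₂[i]) →
      ∀ Q : St → Prop, Q { X with
        reg := Function.update (Function.update (Function.update X.reg
          wp (l₁.length + l₂.length)) src (X.reg src + l₂.length)) cnt 0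
        vm := Function.update X.vm (X.reg m') (σ.put (l₁ ++ l₂)) } →
      ARuns ω (copyLoop m a src m' wp cnt) X (200 * (lam * listCost l₂) + 1) Q := by
  induction l₂ with
  | nil =>
    intro l₁ σ X _ _ hvm hwp hcnt _ _ _ Q h
    refine (ARuns.loop_done hcnt ?_).cost_le (by omega)
    convert h using 1
    cases X
    simp only [St.mk.injEq, and_true, List.append_nil, List.length_nil, add_zero] at *
    refine ⟨?_, (update_self_of_eq hvm).symm⟩
    rw [← hwp, Function.update_eq_self, Function.update_eq_self, ← hcnt, Function.update_eq_self]
  | cons v l₂ ih =>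
    intro l₁ σ X hX hpp hvm hwp hcnt hsz hsz' hl Q h
    simp only [List.length_cons] at hsz hsz' hcnt
    have e0 : (X.vm (X.reg m)).arr a (X.reg src) = v := by
      have := hl 0 (by simp)
      rwa [add_zero] at this
    have hcost : lam * listCost (v :: l₂) = lam * (v.size + 1) + lam * listCost l₂ := by
      rw [listCost_cons]; ring
    have hK : lam ≤ lam * (v.size + 1) := Nat.le_mul_of_pos_right _ (by omega)
    have hz : ∀ k, k ≤ l₁.length + (l₂.length + 1) → k.size ≤ lam := fun k hk =>
      (Nat.size_le_size hk).trans hsz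
    refine (ARuns.loop_step (b := 120 * (lam * (v.size + 1)) + 13 * lam)
      (b' := 200 * (lam * listCost l₂) + 1) (by omega) ?_).cost_le ?_
    · refine ARuns.seq (ARuns.copyElem hlam hX h1 e0 ((ARuns.assign hlam ?_ (by simp) ?_).cost_le
        (by simp)))
      · exact (hX.update (hz _ (by omega))).update ((Nat.size_le_size (by omega)).trans hsz')
      set r1 := Function.update (Function.update X.reg wp (X.reg wp + 1)) src (X.reg src + 1) with hr1
      have f1 : r1 cnt = l₂.length + 1 := by simp [hr1, h2.symm, h3.symm, hcnt]
      have f2 : r1 m = X.reg m := by simp [hr1, hm1, hm2]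
      have f3 : r1 m' = X.reg m' := by simp [hr1, hm1', hm2']
      have f4 : r1 wp = l₁.length + 1 := by simp [hr1, h1, hwp]
      have f5 : r1 src = X.reg src + 1 := by simp [hr1]
      have f6 : (Ex.var cnt - Ex.num 1).eval r1 = l₂.length := by simp [f1]
      refine ih (l₁ ++ [v]) σ _ ?_ ?_ ?_ ?_ ?_ ?_ ?_ ?_ Q ?_
      · exact ((hX.update ((Nat.size_le_size (by omega)).trans hsz)).update
          ((Nat.size_le_size (by omega)).trans hsz')).update
          (by rw [f6]; exact (Nat.size_le_size (by omega)).trans hsz)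
      · simp [hm3, hm3', f2, f3, hpp]
      · simp [hm3', f3, hvm, hwp, Memory.put_concat]
      · simp [h2, f4]
      · simp [f1]
      · simp only [List.length_append, List.length_singleton]
        exact (Nat.size_le_size (by omega)).trans hsz
      · simp [h3, f5]
        exact (Nat.size_le_size (by omega)).trans hsz'
      · intro i hi
        have := hl (i + 1) (by simpa using hi)
        simp only [List.getElem_cons_succ] at this
        simp [hm3, h3, f2, f5, hpp, ← this, add_assoc, add_comm]
      · convert h using 1
        simp only [St.mk.injEq, and_true]
        refine ⟨?_, ?_⟩
        · funext y
          simp only [hr1, Function.update_apply, List.length_append, List.length_cons, List.length_nil]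
          split_ifs <;> first | rfl | omega
        · simp [hm3', f3]
    · rw [hcost, hcnt]
      have := hz (l₂.length + 1) (by omega)
      omega

end

section

variable {ω : ℕ → Bool} {lam : ℕ} {r : ℕ → ℕ} {V : ℕ → Memory} {inp : ℕ → ℕ} {Q : St → Prop}
  {p : Prog} {b : ℕ}

theorem Exec.one_le {s s' : Memory} {c : ℕ} (h : Exec ω p s s' c) : 1 ≤ c := by
  induction h <;> omega

/-- The cost of the first program may be subtracted from the budget without a side condition, because
the second program has positive cost. -/
theorem ARuns.sub_seq {p' : Prog} {X : St} {c : ℕ}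
    (h : ARuns ω p X c fun Y => ARuns ω p' Y (b - c) Q) : ARuns ω (.seq p p') X b Q := by
  intro s hs
  obtain ⟨s', c₁, h₁, hc₁, h₂⟩ := h s hs
  obtain ⟨s'', c₂, h₃, hc₂, hQ⟩ := h₂ _ rfl
  have := h₃.one_le
  exact ⟨s'', _, h₁.seq h₃, by omega, hQ⟩

/-- An assignment followed by a program. The new registers `r'` are described by equations, so that
later steps can be computed by rewriting. -/
theorem ARuns.assign_seq {x : ℕ} {e : Ex} (hlam : 1 ≤ lam) (hr : RegBd lam r) (he : e.depth ≤ 9)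
    {v : ℕ} (hev : e.eval r = v) (hv : v.size ≤ lam)
    (h : ∀ r', r' x = v → (∀ y, y ≠ x → r' y = r y) → RegBd lam r' → ARuns ω p ⟨r', V, inp⟩ (b - ((e.cc + e.weight + 2) * lam)) Q) :
    ARuns ω (.seq (DynPred.assign x e) p) ⟨r, V, inp⟩ b Q := by
  subst hev
  exact ARuns.sub_seq (ARuns.assign hlam hr he (h _ (by simp) (fun y hy => by simp [hy]) (hr.update hv)))

theorem ARuns.readInp_seq {x : ℕ} {e : Ex} (hlam : 1 ≤ lam) (hr : RegBd lam r) (he : e.depth ≤ 10)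
    {v : ℕ} (hev : inp (e.eval r) = v) (hv : v.size ≤ lam)
    (h : ∀ r', r' x = v → (∀ y, y ≠ x → r' y = r y) → RegBd lam r' → ARuns ω p ⟨r', V, inp⟩ (b - ((e.cc + e.weight + 2) * lam)) Q) :
    ARuns ω (.seq (DynPred.readInp x e) p) ⟨r, V, inp⟩ b Q := by
  subst hev
  exact ARuns.sub_seq (ARuns.readInp hlam hr he hv (h _ (by simp) (fun y hy => by simp [hy]) (hr.update hv)))

theorem ARuns.pull_seq {x m a : ℕ} {e : Ex} (hlam : 1 ≤ lam) (hr : RegBd lam r) (he : e.depth ≤ 10)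
    {v : ℕ} (hev : (V (r m)).arr a (e.eval r) = v) (hv : v.size ≤ lam)
    (h : ∀ r', r' x = v → (∀ y, y ≠ x → r' y = r y) → RegBd lam r' → ARuns ω p ⟨r', V, inp⟩ (b - ((e.cc + 12 * e.weight + 40) * lam)) Q) :
    ARuns ω (.seq (DynPred.pull x m a e) p) ⟨r, V, inp⟩ b Q := by
  subst hev
  exact ARuns.sub_seq (ARuns.pull hlam hr he hv (h _ (by simp) (fun y hy => by simp [hy]) (hr.update hv)))

theorem ARuns.getVar_seq {x m u : ℕ} (hlam : 1 ≤ lam) (hr : RegBd lam r)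
    {v : ℕ} (hev : (V (r m)).var u = v) (hv : v.size ≤ lam)
    (h : ∀ r', r' x = v → (∀ y, y ≠ x → r' y = r y) → RegBd lam r' → ARuns ω p ⟨r', V, inp⟩ (b - (3 * lam)) Q) :
    ARuns ω (.seq (DynPred.getVar x m u) p) ⟨r, V, inp⟩ b Q := by
  subst hev
  exact ARuns.sub_seq (ARuns.getVar hlam hr hv (h _ (by simp) (fun y hy => by simp [hy]) (hr.update hv)))

theorem ARuns.setLen_seq {m wp : ℕ} (hlam : 1 ≤ lam) (hr : RegBd lam r) {k : ℕ} {σ : Memory}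
    {l : List ℕ} (hm : r m = k) (hV : V k = σ.put l) (hwp : r wp = l.length)
    (h : ∀ V', V' k = σ.input l → (∀ y, y ≠ k → V' y = V y) →
      ARuns ω p ⟨r, V', inp⟩ (b - (3 * lam)) Q) :
    ARuns ω (.seq (DynPred.setLen m wp) p) ⟨r, V, inp⟩ b Q := by
  subst hm
  refine ARuns.sub_seq (ARuns.setLen hlam hr ?_)
  simpa only [hV, hwp, ← Memory.input_eq_put] using
    h (Function.update V (r m) (σ.input l)) (by simp) fun y hy => by simp [hy]

theorem ARuns.pushEs_seq {m wp : ℕ} {es : List Ex} (hlam : 1 ≤ lam) (hr : RegBd lam r) (hmw : m ≠ wp)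
    (he : ∀ e ∈ es, e.depth ≤ 10 ∧ e.Avoids wp) {k : ℕ} {σ : Memory} {l l' : List ℕ} (hm : r m = k)
    (hV : V k = σ.put l) (hwp : r wp = l.length) (hes : es.map (Ex.eval r) = l')
    (hsz : (l ++ l').length.size ≤ lam)
    (h : ∀ r' V', r' wp = (l ++ l').length → (∀ y, y ≠ wp → r' y = r y) → RegBd lam r' →
      V' k = σ.put (l ++ l') → (∀ y, y ≠ k → V' y = V y) →
      ARuns ω p ⟨r', V', inp⟩ (b - (pushCost es * lam)) Q) :
    ARuns ω (.seq (DynPred.pushEs m wp es) p) ⟨r, V, inp⟩ b Q := by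
  subst hm hes
  rw [List.length_append, List.length_map] at *
  exact ARuns.sub_seq (ARuns.pushEs hlam hmw es l σ _ he hr hV hwp hsz _
    (h _ _ (by simp) (fun y hy => by simp [hy]) (hr.update hsz) (by simp)
      fun y hy => by simp [hy]))

theorem ARuns.copyLoop_seq {m a src m' wp cnt : ℕ} (hlam : 1 ≤ lam) (hr : RegBd lam r)
    (h1 : wp ≠ src) (h2 : wp ≠ cnt)
    (h3 : src ≠ cnt) (hm1 : m ≠ wp) (hm2 : m ≠ src) (hm3 : m ≠ cnt) (hm1' : m' ≠ wp)
    (hm2' : m' ≠ src) (hm3' : m' ≠ cnt) {k k' o : ℕ} (hm : r m = k) (hm' : r m' = k') (hkk : k ≠ k')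
    {σ : Memory} {l l' : List ℕ} (hV : V k' = σ.put l) (hwp : r wp = l.length) (ho : r src = o)
    (hcnt : r cnt = l'.length) (hl : ∀ i (h : i < l'.length), (V k).arr a (o + i) = l'[i])
    (hsz : (l ++ l').length.size ≤ lam) (hsz' : (o + l'.length).size ≤ lam)
    (h : ∀ r' V', r' wp = (l ++ l').length → r' src = o + l'.length → r' cnt = 0 →
      (∀ y, y ≠ wp → y ≠ src → y ≠ cnt → r' y = r y) → RegBd lam r' →
      V' k' = σ.put (l ++ l') → (∀ y, y ≠ k' → V' y = V y) → ARuns ω p ⟨r', V', inp⟩ (b - (200 * (lam * listCost l') + 1)) Q) :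
    ARuns ω (.seq (DynPred.copyLoop m a src m' wp cnt) p) ⟨r, V, inp⟩
      b Q := by
  subst hm hm' ho
  rw [List.length_append] at *
  refine ARuns.sub_seq (ARuns.copyLoop hlam h1 h2 h3 hm1 hm2 hm3 hm1' hm2' hm3' l' l σ _ hr hkk hV hwp
    hcnt hsz hsz' hl _ (h _ _ ?_ ?_ ?_ ?_ ?_ (by simp)
      fun y hy => by simp [hy]))
  · simp [h1, h2]
  · simp [h3]
  · simp
  · intro y h1 h2 h3; simp [h1, h2, h3]
  · exact ((hr.update hsz).update hsz').update (by simp)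

theorem ARuns.sim_seq {m k c : ℕ} {W : Prog} {σ τ : Memory} (hr : RegBd lam r)
    (hm : r m = k) (hV : V k = σ) (hW : Exec (coins ω k) W σ τ c)
    (h : ∀ V', V' k = τ → (∀ y, y ≠ k → V' y = V y) → ARuns ω p ⟨r, V', inp⟩ (b - (30 * ((1 + lam) * c))) Q) :
    ARuns ω (.seq (DynPred.sim m W) p) ⟨r, V, inp⟩ b Q := by
  subst hm hV
  refine ARuns.sub_seq ((ARuns.sim hW (h _ (by simp) fun y hy => by simp [hy])).cost_le ?_)
  rw [mul_assoc]
  have : (r m).size ≤ lam := hr m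
  gcongr

/-! ### Writing a block of the input matrix -/

/-- The entry number `z` (row by row) of the block of width `w` with upper left corner `(r₀, c₀)` of
a matrix with `Rn` rows and `n` columns that is written at position `base` of the input; it is `0`
outside the matrix. -/
def blockEntry (inp : ℕ → ℕ) (base w r₀ c₀ Rn n z : ℕ) : ℕ :=
  if r₀ + z / w < Rn ∧ c₀ + z % w < n then inp (base + (r₀ + z / w) * n + (c₀ + z % w)) else 0

/-- Appends a block of the input matrix. The parameters are in the registers `12` to `17` and `40`,
the machine number and the position in the registers `31` and `10`. -/
def genBlock : Prog :=
  .seq (assign 0 (.var 14)) (.loop (0 + 10)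
    (.seq (assign 1 (.var 14 - .var 0))
    (.seq (assign 2 (.var 15 + .var 1 / .var 13))
    (.seq (assign 3 (.var 16 + (.var 1 - .var 1 / .var 13 * .var 13)))
    (.seq (assign 4 ((.var 17 - .var 2) * (.var 40 - .var 3)))
    (.seq (assign 5 (.num 0))
    (.seq (.ite (4 + 10) (readInp 5 (.var 12 + .var 2 * .var 40 + .var 3)) .skip)
    (.seq (pushEs 31 10 [.var 5])
    (assign 0 (.var 0 - .num 1))))))))))

theorem ARuns.genBlock_seq {k base w tot r₀ c₀ Rn n : ℕ} (hlam : 1 ≤ lam) (hr : RegBd lam r)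
    {σ : Memory} {l : List ℕ} (hm : r 31 = k) (hV : V k = σ.put l) (hwp : r 10 = l.length)
    (h12 : r 12 = base) (h13 : r 13 = w) (h14 : r 14 = tot) (h15 : r 15 = r₀) (h16 : r 16 = c₀)
    (h17 : r 17 = Rn) (h40 : r 40 = n) (hsz : (l.length + tot).size ≤ lam)
    (hrow : (r₀ + tot).size ≤ lam) (hcol : (c₀ + tot).size ≤ lam) (hRn : (Rn * n).size ≤ lam)
    (hinp : ∀ i j, i < Rn → j < n → (inp (base + i * n + j)).size ≤ lam)
    (h : ∀ r' V', r' 10 = l.length + tot →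
      (∀ y, 6 ≤ y → y ≠ 10 → r' y = r y) → RegBd lam r' →
      V' k = σ.put (l ++ (List.range tot).map (blockEntry inp base w r₀ c₀ Rn n)) →
      (∀ y, y ≠ k → V' y = V y) →
      ARuns ω p ⟨r', V', inp⟩
        (b - (10 * lam + (tot * (300 * lam) + 1))) Q) :
    ARuns ω (.seq DynPred.genBlock p) ⟨r, V, inp⟩ b Q := by
  have hz : ∀ a, a ≤ l.length + tot → a.size ≤ lam := fun a ha => (Nat.size_le_size ha).trans hsz
  set g := blockEntry inp base w r₀ c₀ Rn n with hg
  let I : ℕ → St → Prop := fun j Y => j ≤ tot ∧ Y.reg 0 = j ∧ Y.inp = inp ∧ RegBd lam Y.reg ∧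
    Y.reg 10 = l.length + (tot - j) ∧ (∀ y, 6 ≤ y → y ≠ 10 → Y.reg y = r y) ∧
    Y.vm = Function.update V k (σ.put (l ++ (List.range (tot - j)).map g))
  refine ARuns.sub_seq (c := 10 * lam + (tot * (300 * lam) + 1)) ?_
  refine ARuns.assign_seq (v := tot) hlam hr (by simp) (by simp [h14]) (hz _ (by omega))
    fun r₁ e1 f1 hr1 => ?_
  refine ((ARuns.countdown I (fun _ => 290 * lam) lam (fun j Y hY => hY.2.1) ?_ tot
    (hz _ (by omega)) ⟨r₁, V, inp⟩ ?_).mono ?_ ?_)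
  · rintro j ⟨r', V', inp'⟩ ⟨hj, h0, hi, hr', h10, hf, hvm⟩
    dsimp only at hi
    subst hi
    dsimp only at hj h0 hr' h10 hf hvm
    obtain ⟨z, hz'⟩ : ∃ z, z = tot - (j + 1) := ⟨_, rfl⟩
    have hzw : z / w ≤ z := Nat.div_le_self _ _
    have hzm : z % w ≤ z := Nat.mod_le _ _
    have hzm' : z - z / w * w = z % w := by rw [mul_comm, Nat.mod_eq_sub_mul_div]
    have g12 := hf 12 (by omega) (by omega)
    have g13 := hf 13 (by omega) (by omega)
    have g14 := hf 14 (by omega) (by omega)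
    have g15 := hf 15 (by omega) (by omega)
    have g16 := hf 16 (by omega) (by omega)
    have g17 := hf 17 (by omega) (by omega)
    have g40 := hf 40 (by omega) (by omega)
    have g31 := hf 31 (by omega) (by omega)
    refine ARuns.assign_seq (v := z) hlam hr' (by simp) (by simp [g14, h14, h0, hz'])
      (hz _ (by omega)) fun r₂ e2 f2 hr2 => ?_
    refine ARuns.assign_seq (v := r₀ + z / w) hlam hr2 (by simp)
      (by simp [e2, f2, g15, h15, g13, h13]) ((Nat.size_le_size (by omega)).trans hrow)
      fun r₃ e3 f3 hr3 => ?_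
    refine ARuns.assign_seq (v := c₀ + z % w) hlam hr3 (by simp)
      (by simp [e2, f2, f3, g16, h16, g13, h13, hzm']) ((Nat.size_le_size (by omega)).trans hcol)
      fun r₄ e4 f4 hr4 => ?_
    refine ARuns.assign_seq (v := (Rn - (r₀ + z / w)) * (n - (c₀ + z % w))) hlam hr4 (by simp)
      (by simp [e4, f4, e3, f3, f2, g17, h17, g40, h40])
      ((Nat.size_le_size (Nat.mul_le_mul (Nat.sub_le _ _) (Nat.sub_le _ _))).trans hRn)
      fun r₅ e5 f5 hr5 => ?_
    refine ARuns.assign_seq (v := 0) hlam hr5 (by simp) (by simp) (by simp)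
      fun r₆ e6 f6 hr6 => ?_
    have hcond : r₆ 4 = 0 ↔ ¬ (r₀ + z / w < Rn ∧ c₀ + z % w < n) := by
      simp only [f6 4 (by omega), e5, Nat.mul_eq_zero]
      omega
    have hgz : (g z).size ≤ lam := by
      simp only [hg, blockEntry]
      split_ifs with hc
      · exact hinp _ _ hc.1 hc.2
      · simp
    refine ARuns.sub_seq (c := 40 * lam) ((ARuns.ite (b := 38 * lam)
      (Q := fun Y => ∃ r₇, Y = ⟨r₇, V', inp'⟩ ∧ r₇ 5 = g z ∧ (∀ y, y ≠ 5 → r₇ y = r₆ y) ∧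
        RegBd lam r₇) ?_ ?_).mono ?_ ?_)
    · intro hc
      have hc' := not_not.1 (hcond.not.1 hc)
      have hv : inp' ((Ex.var 12 + .var 2 * .var 40 + .var 3).eval r₆) = g z := by
        simp [hg, blockEntry, hc', f6, f5, f4, f3, f2, e4, e3, g12, h12, g40, h40]
      exact (ARuns.readInp hlam hr6 (by simp) (by dsimp only; rw [hv]; exact hgz)
        ⟨_, rfl, by dsimp only; rw [hv]; simp, fun y hy => by simp [hy], hr6.update (by dsimp only; rw [hv]; exact hgz)⟩).cost_le
          (by simp only [Ex.cc_add, Ex.cc_var, Ex.weight_var, Ex.cc_mul, Ex.weight_add, Ex.weight_mul]; omega)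
    · intro hc
      refine (ARuns.skip ⟨_, rfl, ?_, fun y hy => rfl, hr6⟩).cost_le (by omega)
      rw [e6]
      simp only [hg, blockEntry, if_neg (hcond.1 hc)]
    · have := hr6 4
      simp only
      omega
    rintro Y ⟨r₇, rfl, e7, f7, hr7⟩
    have k10 : r₇ 10 = (l ++ (List.range (tot - (j + 1))).map g).length := by
      simp [f7, f6, f5, f4, f3, f2, h10]
    have k31 : r₇ 31 = k := by simp [f7, f6, f5, f4, f3, f2, g31, hm]
    refine ARuns.pushEs_seq (l' := [g z]) hlam hr7 (by omega) (by simp [Ex.Avoids]) k31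
      (σ := σ) (l := l ++ (List.range (tot - (j + 1))).map g) (by simp [hvm]) k10
      (by simp [e7]) (hz _ (by simp; omega)) fun r₈ V₈ e8 f8 hr8 v8 w8 => ?_
    have k0 : r₈ 0 = j + 1 := by simp [f8, f7, f6, f5, f4, f3, f2, h0]
    refine (ARuns.assign hlam hr8 (by simp) ?_).cost_le ?_
    · refine ⟨by omega, by simp [k0], rfl, hr8.update ?_, ?_, ?_, ?_⟩
      · simp only [Ex.eval_sub, Ex.eval_var, Ex.eval_num, k0]
        exact hz _ (by omega)
      · simp only [ne_eq, OfNat.ofNat_ne_zero, not_false_eq_true, Function.update_of_ne, e8]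
        simp; omega
      · intro y hy hy'
        simp [show y ≠ 0 by omega, f8 y hy', f7 y (by omega), f6 y (by omega), f5 y (by omega),
          f4 y (by omega), f3 y (by omega), f2 y (by omega), hf y hy hy']
      · have : tot - j = (tot - (j + 1)) + 1 := by omega
        simp [this, List.range_succ, hvm, hz'] at *
        funext y
        by_cases hy : y = k
        · subst hy; simp [v8]
        · simp [w8 y hy, hy]
    · simp [pushCost]
      omega
  · refine ⟨le_rfl, e1, rfl, hr1, ?_, fun y hy _ => f1 y (by omega), ?_⟩
    · simp [f1, hwp]
    · simp [update_self_of_eq hV]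
  · simp only [Finset.sum_const, Finset.card_range, smul_eq_mul, Ex.cc_var, Ex.weight_var]
    have : tot * (290 * lam) + tot * (1 + lam) ≤ tot * (300 * lam) := by nlinarith
    omega
  · rintro ⟨r', V', inp'⟩ ⟨_, _, h4, hr', h10, hf, hvm⟩
    dsimp only at h4 hr' h10 hf hvm
    rw [h4, hvm]
    exact h r' _ h10 hf hr' (by simp) fun y hy => by simp [hy]

end

/-! ### Preprocessing one pair of machines -/

theorem Call.exec {ω : ℕ → Bool} {p : Prog} {s s' : Memory} {l o : List ℕ} {c : ℕ}
    (h : Call ω p s l s' o c) : ∃ c', Exec ω p (s.input l) s' c' ∧ s'.output = o ∧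
      listCost l + c' + listCost o = c :=
  ⟨h.choose, h.choose_spec.1, h.choose_spec.2.1.symm, h.choose_spec.2.2.symm⟩

theorem Memory.output_length (s : Memory) : s.output.length = s.var 1 := by simp [Memory.output]

theorem Memory.output_getElem (s : Memory) (i : ℕ) (h : i < s.output.length) :
    s.output[i] = s.arr 1 i := by simp [Memory.output]

/-- Prepares the machines with numbers in the registers `31` and `32` for the block of the matrix in
position given by the registers `33` and `34`: runs the reduction, then passes the data structure
and the prediction on to the dynamic algorithm. The output of the clocked reduction is found in
array `4` of its machine, its length in variable `22`, since this is where the inner array `1` and the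
inner variable `1` are kept. -/
def preJob (Rp Ap : Prog) : Prog :=
  .seq (assign 10 (.num 0))
  (.seq (pushEs 31 10 [.var 53, .num 2, .num 3, .var 42, .var 41, .var 44, .var 42 * .var 41])
  (.seq (assign 12 (.num 4))
  (.seq (assign 13 (.var 41))
  (.seq (assign 14 (.var 42 * .var 41))
  (.seq (assign 15 (.var 33 * .var 42))
  (.seq (assign 16 (.var 34 * .var 41))
  (.seq (assign 17 (.var 40))
  (.seq genBlock
  (.seq (setLen 31 10)
  (.seq (sim 31 (rcall Rp))
  (.seq (assign 11 (.num 0))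
  (.seq (getVar 23 31 22)
  (.seq (pushEs 32 11 [.num 2 + .var 43, .num 1, .var 52, .var 23])
  (.seq (assign 21 (.num 0))
  (.seq (copyLoop 31 4 21 32 11 23)
  (.seq (assign 21 (.var 45))
  (.seq (assign 23 (.var 46))
  (.seq (copyLoop 57 1 21 32 11 23)
  (.seq (setLen 32 11)
  (.seq (sim 32 Ap) .skip))))))))))))))))))))

/-- A bound for the cost of `preJob`. -/
def preJobCost (A lam X : ℕ) : ℕ := (30 * A + 10000) * ((1 + lam) * (1 + lam)) * (X + 1)

set_option maxHeartbeats 1000000 in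
/-- The numbers written before the data structure and the prediction are those that `encList` puts
there: the number `2 + L` of lists, the list `[δ]` with its length, and the length of the encoded
data structure. -/
theorem ARuns.preJob {Rp Ap : Prog} {A : ℕ} {lam : ℕ}
    (hA : ∀ ω lam τ F l, A ≤ lam → Shadowed lam τ → (F + listCost l + 1).size + 5 ≤ lam →
      ∃ τ' c, Exec ω (rcall Rp) (τ.input (F :: l)) τ' c ∧ Shadowed lam τ' ∧
        c ≤ A * (lam * (F + listCost l + 1)) ∧ τ'.var 10 ≤ F ∧
        ∀ σ' c₀, Exec ω Rp ((inner τ).input l) σ' c₀ → 4 * c₀ < F →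
          inner τ' = σ' ∧ F ≤ τ'.var 10 + 4 * c₀)
    {ω : ℕ → Bool} {r : ℕ → ℕ} {V : ℕ → Memory} {inp : ℕ → ℕ} {X kR kA i j n d d1 L n3 ts δ F c₀ cA : ℕ}
    {s₀ sA : Memory} {D oA tail : List ℕ}
    (hAl : A ≤ lam) (hlam : 1 ≤ lam) (hr : RegBd lam r)
    (h31 : r 31 = kR) (h32 : r 32 = kA) (h33 : r 33 = i) (h34 : r 34 = j) (h40 : r 40 = n)
    (h41 : r 41 = d) (h42 : r 42 = d1) (h43 : r 43 = L) (h44 : r 44 = n3) (h45 : r 45 = ts)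
    (h46 : r 46 = tail.length) (h52 : r 52 = δ) (h53 : r 53 = F) (h57 : r 57 = 0)
    (hR : V kR = Memory.blank) (hVA : V kA = Memory.blank) (hne : kR ≠ kA) (hR0 : kR ≠ 0) (hA0 : kA ≠ 0)
    (htail : ∀ x (h : x < tail.length), (V 0).arr 1 (ts + x) = tail[x])
    (hpre : Call (coins ω kR) Rp Memory.blank (encList [[d1, d, n3],
      (List.range (d1 * d)).map (blockEntry inp 4 d (i * d1) (j * d) n n)]) s₀ D c₀)
    (hF : 4 * c₀ < F)
    (hApre : Call (coins ω kA) Ap Memory.blank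
      ((2 + L) :: 1 :: δ :: D.length :: D ++ tail) sA oA cA)
    (hX1 : d1 * d ≤ X) (hX2 : F + c₀ + 1 ≤ X) (hX3 : listCost tail ≤ X) (hX4 : cA ≤ X)
    (hinp : ∀ i j, i < n → j < n → (inp (4 + i * n + j)).size ≤ lam)
    (hXl : (4 * X + L + δ + ts + n * n + i * d1 + j * d + 10).size + 5 ≤ lam) :
    ARuns ω (DynPred.preJob Rp Ap) ⟨r, V, inp⟩ (preJobCost A lam X) fun Y =>
      ∃ r' V', Y = ⟨r', V', inp⟩ ∧ RegBd lam r' ∧ (∀ y, 30 ≤ y → r' y = r y) ∧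
        Shadowed lam (V' kR) ∧ inner (V' kR) = s₀ ∧ V' kA = sA ∧
        ∀ y, y ≠ kR → y ≠ kA → V' y = V y := by
  obtain ⟨c₀', hex, hout, hc₀⟩ := hpre.exec
  obtain ⟨cA', hexA, _, hcA⟩ := hApre.exec
  set blk := (List.range (d1 * d)).map (blockEntry inp 4 d (i * d1) (j * d) n n) with hblk
  have hlen : blk.length = d1 * d := by simp [hblk]
  have hz : ∀ a, a ≤ 4 * X + L + δ + ts + n * n + i * d1 + j * d + 10 → a.size ≤ lam := fun a ha =>
    (Nat.size_le_size ha).trans (by omega)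
  have hDl := length_le_listCost D
  have htl := length_le_listCost tail
  refine ARuns.assign_seq (v := 0) hlam hr (by simp) (by simp) (by simp) fun r₁ e1 f1 hr1 => ?_
  refine ARuns.pushEs_seq (k := kR) (σ := Memory.blank) (l := []) (l' := [F, 2, 3, d1, d, n3, d1 * d])
    hlam hr1 (by omega)
    (by simp [Ex.Avoids]) (by simp [f1, h31]) (by rw [hR, Memory.put_nil]) (by simp [e1])
    (by simp [f1, h53, h42, h41, h44]) (hz _ (by simp)) fun r₂ V₂ e2 f2 hr2 v2 w2 => ?_
  simp only [List.nil_append] at e2 v2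
  refine ARuns.assign_seq (v := 4) hlam hr2 (by simp) (by simp) (hz _ (by omega))
    fun r₃ e3 f3 hr3 => ?_
  refine ARuns.assign_seq (v := d) hlam hr3 (by simp) (by simp [f1, f2, f3, h41])
    (by rw [← h41]; exact hr 41) fun r₄ e4 f4 hr4 => ?_
  refine ARuns.assign_seq (v := d1 * d) hlam hr4 (by simp) (by simp [f1, f2, f3, f4, h41, h42])
    (hz _ (by omega)) fun r₅ e5 f5 hr5 => ?_
  refine ARuns.assign_seq (v := i * d1) hlam hr5 (by simp) (by simp [f1, f2, f3, f4, f5, h33, h42])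
    (hz _ (by omega)) fun r₆ e6 f6 hr6 => ?_
  refine ARuns.assign_seq (v := j * d) hlam hr6 (by simp)
    (by simp [f1, f2, f3, f4, f5, f6, h34, h41])
    (hz _ (by omega)) fun r₇ e7 f7 hr7 => ?_
  refine ARuns.assign_seq (v := n) hlam hr7 (by simp) (by simp [f1, f2, f3, f4, f5, f6, f7, h40])
    (by rw [← h40]; exact hr 40) fun r₈ e8 f8 hr8 => ?_
  refine ARuns.genBlock_seq (k := kR) (σ := Memory.blank) (l := [F, 2, 3, d1, d, n3, d1 * d])
    (base := 4) (w := d) (tot := d1 * d) (r₀ := i * d1) (c₀ := j * d) (Rn := n) (n := n)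
    hlam hr8 (by simp [f1, f2, f3, f4, f5, f6, f7, f8, h31]) v2
    (by simp [f3, f4, f5, f6, f7, f8, e2]) (by simp [f4, f5, f6, f7, f8, e3])
    (by simp [f5, f6, f7, f8, e4]) (by simp [f6, f7, f8, e5]) (by simp [f7, f8, e6])
    (by simp [f8, e7]) (by simp [e8]) (by simp [f1, f2, f3, f4, f5, f6, f7, f8, h40])
    (hz _ (by simp; omega)) (hz _ (by omega)) (hz _ (by omega)) (hz _ (by omega)) hinp
    fun r₉ V₉ e9 f9 hr9 v9 w9 => ?_
  have g9 : ∀ y, 30 ≤ y → r₉ y = r y := fun y hy => by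
    rw [f9 y (by omega) (by omega), f8 y (by omega), f7 y (by omega), f6 y (by omega),
      f5 y (by omega), f4 y (by omega), f3 y (by omega), f2 y (by omega), f1 y (by omega)]
  have el : [F, 2, 3, d1, d, n3, d1 * d] ++ blk = F :: encList [[d1, d, n3], blk] := by
    simp [encList, hlen]
  rw [← hblk, el] at v9
  refine ARuns.setLen_seq hlam hr9 (by rw [g9 31 (by omega), h31]) v9
    (by rw [e9, ← el, List.length_append, hlen]) fun V₁₀ v10 w10 => ?_
  have hlc : listCost (encList [[d1, d, n3], blk]) ≤ c₀ := by omega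
  obtain ⟨τ, c, x1, x2, x3, x4, x5⟩ := hA (coins ω kR) lam Memory.blank F
    (encList [[d1, d, n3], blk]) hAl (shadowed_blank lam)
    (le_trans (Nat.add_le_add_right (Nat.size_le_size (by omega)) 5) hXl)
  obtain ⟨x5, -⟩ := x5 s₀ c₀' hex (by omega)
  refine ARuns.sim_seq hr9 (by rw [g9 31 (by omega), h31]) v10 x1 fun V₁₁ v11 w11 => ?_
  have y1 : τ.var 22 = D.length := by rw [← hout, Memory.output_length, ← x5]; rfl
  have y2 : ∀ x (h : x < D.length), τ.arr 4 x = D[x] := fun x h => by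
    subst hout
    rw [Memory.output_getElem, ← x5]; rfl
  refine ARuns.assign_seq (v := 0) hlam hr9 (by simp) (by simp) (by simp) fun r₁₂ e12 f12 hr12 => ?_
  refine ARuns.getVar_seq (v := D.length) hlam hr12
    (by rw [f12 31 (by omega), g9 31 (by omega), h31, v11, y1]) (hz _ (by omega))
    fun r₁₃ e13 f13 hr13 => ?_
  have hV11 : V₁₁ kA = Memory.blank := by
    rw [w11 _ hne.symm, w10 _ hne.symm, w9 _ hne.symm, w2 _ hne.symm, hVA]
  refine ARuns.pushEs_seq (k := kA) (σ := Memory.blank) (l := []) (l' := [2 + L, 1, δ, D.length])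
    hlam hr13 (by omega)
    (by simp [Ex.Avoids]) (by simp [f13, f12, g9, h32]) (by rw [hV11, Memory.put_nil])
    (by simp [f13, e12])
    (by simp [f13, f12, g9, h43, h52, e13]) (hz _ (by simp)) fun r₁₄ V₁₄ e14 f14 hr14 v14 w14 => ?_
  refine ARuns.assign_seq (v := 0) hlam hr14 (by simp) (by simp) (by simp) fun r₁₅ e15 f15 hr15 => ?_
  refine ARuns.copyLoop_seq (k := kR) (k' := kA) (o := 0) (σ := Memory.blank)
    (l := [] ++ [2 + L, 1, δ, D.length]) (l' := D) hlam hr15 (by omega) (by omega) (by omega)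
    (by omega) (by omega) (by omega) (by omega) (by omega) (by omega)
    (by simp [f15, f14, f13, f12, g9, h31]) (by simp [f15, f14, f13, f12, g9, h32]) hne v14
    (by simp [f15, e14]) e15 (by simp [f15, f14, e13])
    (fun x h => by rw [w14 _ hne, v11, zero_add, y2 x h]) (hz _ (by simp; omega)) (hz _ (by omega))
    fun r₁₆ V₁₆ e16 e16' e16'' f16 hr16 v16 w16 => ?_
  have g16 : ∀ y, 30 ≤ y → r₁₆ y = r y := fun y hy => by
    rw [f16 y (by omega) (by omega) (by omega), f15 y (by omega), f14 y (by omega),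
      f13 y (by omega), f12 y (by omega), g9 y hy]
  refine ARuns.assign_seq (v := ts) hlam hr16 (by simp) (by simp [g16, h45]) (hz _ (by omega))
    fun r₁₇ e17 f17 hr17 => ?_
  refine ARuns.assign_seq (v := tail.length) hlam hr17 (by simp) (by simp [f17, g16, h46])
    (hz _ (by omega)) fun r₁₈ e18 f18 hr18 => ?_
  refine ARuns.copyLoop_seq (k := 0) (k' := kA) (o := ts) (σ := Memory.blank)
    (l := [] ++ [2 + L, 1, δ, D.length] ++ D) (l' := tail) hlam hr18 (by omega) (by omega) (by omega)
    (by omega) (by omega) (by omega) (by omega) (by omega) (by omega)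
    (by simp [f18, f17, g16, h57]) (by simp [f18, f17, g16, h32]) hA0.symm v16
    (by simp [f18, f17, e16]) (by simp [f18, e17]) (by simp [e18])
    (fun x h => by rw [w16 _ hA0.symm, w14 _ hA0.symm, w11 _ hR0.symm, w10 _ hR0.symm, w9 _ hR0.symm,
      w2 _ hR0.symm, htail x h]) (hz _ (by simp; omega)) (hz _ (by omega))
    fun r₁₉ V₁₉ e19 e19' e19'' f19 hr19 v19 w19 => ?_
  have g19 : ∀ y, 30 ≤ y → r₁₉ y = r y := fun y hy => by
    rw [f19 y (by omega) (by omega) (by omega), f18 y (by omega), f17 y (by omega), g16 y hy]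
  refine ARuns.setLen_seq hlam hr19 (by rw [g19 32 (by omega), h32]) v19 e19
    fun V₂₀ v20 w20 => ?_
  refine ARuns.sim_seq hr19 (by rw [g19 32 (by omega), h32]) v20 (by simpa using hexA)
    fun V₂₁ v21 w21 => ?_
  have hRfin : V₂₁ kR = τ := by
    rw [w21 _ hne, w20 _ hne, w19 _ hne, w16 _ hne, w14 _ hne, v11]
  have hfin : ∀ y, y ≠ kR → y ≠ kA → V₂₁ y = V y := fun y h1 h2 => by
    rw [w21 _ h2, w20 _ h2, w19 _ h2, w16 _ h2, w14 _ h2, w11 _ h1, w10 _ h1, w9 _ h1, w2 _ h1]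
  refine ARuns.cost_le (ARuns.skip ⟨r₁₉, V₂₁, rfl, hr19, g19, by rw [hRfin]; exact x2,
    by rw [hRfin]; exact x5, v21, hfin⟩) ?_
  · simp only [pushCost, Ex.cc_add, Ex.cc_mul, Ex.cc_var, Ex.cc_num, Ex.weight_add, Ex.weight_mul,
      Ex.weight_var, Ex.weight_num, preJobCost]
    obtain ⟨P, hP⟩ : ∃ P, P = (1 + lam) * (1 + lam) * (X + 1) := ⟨_, rfl⟩
    have hlX : ∀ z, z ≤ X + 1 → (1 + lam) * z ≤ P := fun z hz => by
      rw [hP]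
      exact Nat.mul_le_mul (Nat.le_mul_of_pos_left _ (by omega)) hz
    have hlX' : ∀ z, z ≤ X + 1 → lam * z ≤ P := fun z hz =>
      (Nat.mul_le_mul_right _ (by omega)).trans (hlX z hz)
    have b1 : 30 * ((1 + lam) * c) ≤ 30 * A * P := by
      have : lam * (F + listCost (encList [[d1, d, n3], blk]) + 1) ≤ (1 + lam) * (X + 1) :=
        Nat.mul_le_mul (by omega) (by omega)
      have := x3.trans (Nat.mul_le_mul_left A this)
      calc _ ≤ 30 * ((1 + lam) * (A * ((1 + lam) * (X + 1)))) := by gcongr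
        _ = _ := by rw [hP]; ring
    have b2 := hlX cA' (by omega)
    have b3 := hlX' (listCost D) (by omega)
    have b4 := hlX' (listCost tail) (by omega)
    have b5 : d1 * d * (300 * lam) ≤ 300 * P := by
      rw [show d1 * d * (300 * lam) = 300 * (lam * (d1 * d)) by ring]
      exact Nat.mul_le_mul_left _ (hlX' (d1 * d) (by omega))
    have b6 := hlX 1 (by omega)
    rw [mul_assoc, ← hP, Nat.add_mul]
    omega

/-! ### One online round on one pair of machines -/

/-- The concatenation of a list of lists, each one preceded by its length. -/
def frames (L : List (List ℕ)) : List ℕ := L.flatMap fun l => l.length :: l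

theorem encList_eq (L : List (List ℕ)) : encList L = L.length :: frames L := rfl

@[simp] theorem frames_nil : frames [] = [] := rfl

@[simp] theorem frames_cons (l : List ℕ) (L : List (List ℕ)) :
    frames (l :: L) = l.length :: (l ++ frames L) := by simp [frames]

/-- Of the outputs `os` for the encoded requests `ls`, those that were given for queries. -/
def answers : List (List ℕ) → List (List ℕ) → List (List ℕ)
  | l :: ls, o :: os => if l.headI = 0 then answers ls os else o :: answers ls os
  | _, _ => []

theorem Memory.put_cons_cons (s : Memory) (l : List ℕ) (a v w : ℕ) :
    s.put (a :: w :: l) = (s.put (a :: v :: l)).setArr 0 1 w := by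
  refine Memory.ext' (fun _ => rfl) fun b i => ?_
  rw [Memory.setArr_arr]
  by_cases hb : b = 0
  · subst hb
    rcases i with _ | _ | i <;> simp [Memory.put]
  · rw [if_neg (fun h => hb h.1), Memory.put_arr_of_ne _ _ hb, Memory.put_arr_of_ne _ _ hb]

/-- Passes the requests that the reduction has produced on to the dynamic algorithm, and the answers
to the queries back to the machine of the reduction. The register `22` counts the requests that remain,
`21` is the position in the output of the reduction, and `25` counts the answers. A request is a query
if its first entry, in register `24`, is not zero. -/
def reqLoop (Ap : Prog) : Prog :=
  .loop (22 + 10)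
    (.seq (pull 23 31 4 (.var 21))
    (.seq (assign 21 (.var 21 + .num 1))
    (.seq (pull 24 31 4 (.var 21))
    (.seq (assign 10 (.num 0))
    (.seq (copyLoop 31 4 21 32 10 23)
    (.seq (setLen 32 10)
    (.seq (sim 32 Ap)
    (.seq (.ite (24 + 10)
      (.seq (getVar 23 32 1)
      (.seq (pushEs 31 11 [.var 23])
      (.seq (assign 26 (.num 0))
      (.seq (copyLoop 32 1 26 31 11 23)
      (.seq (assign 25 (.var 25 + .num 1)) .skip)))))
      .skip)
    (assign 22 (.var 22 - .num 1))))))))))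

set_option maxHeartbeats 1000000 in
/-- The list `la` is what has been written to the machine of the reduction so far. The cost is
charged to the cost `c` of the dynamic algorithm, which has to read the requests and to write the
answers. -/
theorem ARuns.reqLoop {ω : ℕ → Bool} {lam kR kA : ℕ} {Ap : Prog} {inp : ℕ → ℕ} {τ : Memory}
    (hlam : 1 ≤ lam) (hne : kR ≠ kA) (reqs : List (List ℕ)) :
    ∀ (la : List ℕ) (σ sA : Memory) (os : List (List ℕ)) (c pos nq : ℕ) (r : ℕ → ℕ)
      (V : ℕ → Memory), RegBd lam r → r 31 = kR → r 32 = kA → r 22 = reqs.length → r 21 = pos →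
      r 25 = nq → r 11 = la.length → V kR = τ.put la → V kA = σ →
      CallSeq (coins ω kA) Ap σ reqs sA os c → (∀ l ∈ reqs, l ≠ [] ∧ l.headI ≤ 1) →
      (∀ x (h : x < (frames reqs).length), τ.arr 4 (pos + x) = (frames reqs)[x]) →
      (pos + la.length + nq + 2 * c + 10).size ≤ lam →
      ARuns ω (DynPred.reqLoop Ap) ⟨r, V, inp⟩ (3000 * ((1 + lam) * c) + 1) fun Y =>
        ∃ r' V', Y = ⟨r', V', inp⟩ ∧ RegBd lam r' ∧
          r' 11 = (la ++ frames (answers reqs os)).length ∧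
          r' 25 = nq + (answers reqs os).length ∧ (∀ y, 30 ≤ y → r' y = r y) ∧
          V' kR = τ.put (la ++ frames (answers reqs os)) ∧ V' kA = sA ∧
          ∀ y, y ≠ kR → y ≠ kA → V' y = V y := by
  induction reqs with
  | nil =>
    intro la σ sA os c pos nq r V hr h31 h32 h22 h21 h25 h11 hR hA hcs _ _ hsz
    cases hcs
    exact (ARuns.loop_done h22 ⟨r, V, rfl, hr, by simp [answers, h11], by simp [answers, h25],
      fun _ _ => rfl, by simp [answers, hR], hA, fun _ _ _ => rfl⟩).cost_le (by omega)
  | cons l reqs ih =>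
    intro la σ sA os c pos nq r V hr h31 h32 h22 h21 h25 h11 hR hA hcs hreq hτ hsz
    obtain ⟨hl, hhd⟩ := hreq l (by simp)
    cases hcs with
    | cons hcall hcs =>
      rename_i s' o os c₁ c₂
      obtain ⟨c', hex, hout, hc'⟩ := hcall.exec
      have hex1 := hex.one_le
      have hll := length_le_listCost l
      have hlo := length_le_listCost o
      have hlpos : 1 ≤ l.length := List.length_pos_iff.2 hl
      have hz : ∀ a, a ≤ pos + la.length + nq + 2 * (c₁ + c₂) + 10 → a.size ≤ lam := fun a ha =>
        (Nat.size_le_size ha).trans hsz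
      have t0 : τ.arr 4 pos = l.length := by simpa using hτ 0 (by simp)
      have t1 : ∀ x (h : x < l.length), τ.arr 4 (pos + 1 + x) = l[x] := fun x h => by
        have := hτ (x + 1) (by simp; omega)
        simp only [frames_cons, List.getElem_cons_succ] at this
        rw [List.getElem_append_left h] at this
        rw [← this, add_assoc, add_comm 1]
      have t2 : ∀ x (h : x < (frames reqs).length),
          τ.arr 4 (pos + 1 + l.length + x) = (frames reqs)[x] := fun x h => by
        have := hτ (l.length + x + 1) (by simp; omega)
        simp only [frames_cons, List.getElem_cons_succ] at this
        rw [List.getElem_append_right (by omega)] at this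
        simp only [Nat.add_sub_cancel_left] at this
        rw [← this]
        congr 1
        omega
      have thd : τ.arr 4 (pos + 1) = l.headI := by
        have := t1 0 (by omega)
        rw [add_zero] at this
        rw [this]
        cases l with
        | nil => simp at hl
        | cons a l => rfl
      have hRa : (V kR).arr 4 = τ.arr 4 := by rw [hR, Memory.put_arr_of_ne _ _ (by omega)]
      have hlc : r 22 = reqs.length + 1 := by rw [h22]; rfl
      have hB : 3000 * ((1 + lam) * (c₁ + c₂)) = 3000 * ((1 + lam) * c₁) + 3000 * ((1 + lam) * c₂) := by ring
      have hlam1 : 1 + lam ≤ (1 + lam) * c₁ := Nat.le_mul_of_pos_right _ (by omega)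
      refine (ARuns.loop_step (b := 2900 * ((1 + lam) * c₁)) (b' := 3000 * ((1 + lam) * c₂) + 1)
        (by dsimp only; omega) ?_).cost_le ?_
      · refine ARuns.pull_seq (v := l.length) hlam hr (by simp)
          (by rw [h31, hRa, Ex.eval_var, h21, t0])
          (hz _ (by omega)) fun r₁ e1 f1 hr1 => ?_
        refine ARuns.assign_seq (v := pos + 1) hlam hr1 (by simp) (by simp [f1, h21])
          (hz _ (by omega)) fun r₂ e2 f2 hr2 => ?_
        refine ARuns.pull_seq (v := l.headI) hlam hr2 (by simp)
          (by rw [f2 31 (by omega), f1 31 (by omega), h31, hRa, Ex.eval_var, e2, thd])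
          (hz _ (by omega)) fun r₃ e3 f3 hr3 => ?_
        refine ARuns.assign_seq (v := 0) hlam hr3 (by simp) (by simp)
          (by simp) fun r₄ e4 f4 hr4 => ?_
        refine ARuns.copyLoop_seq (k := kR) (k' := kA) (o := pos + 1) (σ := σ) (l := []) (l' := l)
          hlam hr4 (by omega) (by omega) (by omega)
          (by omega) (by omega) (by omega) (by omega) (by omega) (by omega)
          (by simp [f4, f3, f2, f1, h31]) (by simp [f4, f3, f2, f1, h32]) hne
          (by rw [hA, Memory.put_nil]) (by simp [e4]) (by simp [f4, f3, e2])
          (by simp [f4, f3, f2, e1]) (fun x h => by rw [hRa, t1 x h]) (hz _ (by simp; omega))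
          (hz _ (by omega)) fun r₅ V₅ e5 e5' e5'' f5 hr5 v5 w5 => ?_
        rw [List.nil_append] at v5 e5
        have g5 : ∀ y, 30 ≤ y → r₅ y = r y := fun y hy => by
          rw [f5 y (by omega) (by omega) (by omega), f4 y (by omega), f3 y (by omega),
            f2 y (by omega), f1 y (by omega)]
        refine ARuns.setLen_seq hlam hr5 (by rw [g5 32 (by omega), h32]) v5 e5
          fun V₆ v6 w6 => ?_
        refine ARuns.sim_seq hr5 (by rw [g5 32 (by omega), h32]) v6 hex fun V₇ v7 w7 => ?_
        have hV7 : V₇ kR = τ.put la := by rw [w7 _ hne, w6 _ hne, w5 _ hne, hR]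
        have hV7' : ∀ y, y ≠ kR → y ≠ kA → V₇ y = V y := fun y _ h2 => by
          rw [w7 _ h2, w6 _ h2, w5 _ h2]
        have k24 : r₅ 24 = l.headI := by
          rw [f5 _ (by omega) (by omega) (by omega), f4 _ (by omega), e3]
        have k25 : r₅ 25 = nq := by simp [f5, f4, f3, f2, f1, h25]
        have k11 : r₅ 11 = la.length := by simp [f5, f4, f3, f2, f1, h11]
        have k22 : r₅ 22 = reqs.length + 1 := by simp [f5, f4, f3, f2, f1, hlc]
        refine ARuns.sub_seq (c := 1000 * lam + 200 * (lam * listCost o) + 10)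
          ((ARuns.ite (b := 990 * lam + 200 * (lam * listCost o) + 9)
          (Q := fun Y => ∃ r' V', Y = ⟨r', V', inp⟩ ∧ RegBd lam r' ∧
            r' 11 = (la ++ frames (answers [l] [o])).length ∧
            r' 25 = nq + (answers [l] [o]).length ∧ (∀ y, 30 ≤ y → r' y = r₅ y) ∧
            r' 21 = r₅ 21 ∧ r' 22 = r₅ 22 ∧
            V' kR = τ.put (la ++ frames (answers [l] [o])) ∧ V' kA = s' ∧
            ∀ y, y ≠ kR → y ≠ kA → V' y = V₇ y) ?_ ?_).mono ?_ ?_)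
        · intro hc
          have hc : l.headI ≠ 0 := by rwa [← k24]
          have hans : answers [l] [o] = [o] := by simp [answers, hc]
          simp only [hans, frames_cons, frames_nil, List.append_nil]
          have y1 : (V₇ kA).var 1 = o.length := by rw [v7, ← Memory.output_length, hout]
          refine ARuns.getVar_seq (v := o.length) hlam hr5 (by rw [g5 32 (by omega), h32, y1])
            (hz _ (by omega)) fun r₈ e8 f8 hr8 => ?_
          refine ARuns.pushEs_seq (k := kR) (σ := τ) (l := la) (l' := [o.length]) hlam hr8 (by omega)
            (by simp [Ex.Avoids]) (by simp [f8, g5, h31]) hV7 (by simp [f8, k11])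
            (by simp [e8]) (hz _ (by simp; omega)) fun r₉ V₉ e9 f9 hr9 v9 w9 => ?_
          refine ARuns.assign_seq (v := 0) hlam hr9 (by simp) (by simp) (by simp)
            fun r₁₀ e10 f10 hr10 => ?_
          refine ARuns.copyLoop_seq (k := kA) (k' := kR) (o := 0) (σ := τ) (l := la ++ [o.length])
            (l' := o) hlam hr10 (by omega) (by omega) (by omega)
            (by omega) (by omega) (by omega) (by omega) (by omega) (by omega)
            (by simp [f10, f9, f8, g5, h32]) (by simp [f10, f9, f8, g5, h31]) hne.symm v9
            (by simp [f10, e9]) (by simp [e10]) (by simp [f10, f9, e8])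
            (fun x h => by
              subst hout
              rw [w9 _ hne.symm, v7, zero_add, Memory.output_getElem]) (hz _ (by simp; omega))
            (hz _ (by omega)) fun r₁₁ V₁₁ e11 e11' e11'' f11 hr11 v11 w11 => ?_
          refine ARuns.assign_seq (v := nq + 1) hlam hr11 (by simp)
            (by simp [f11, f10, f9, f8, k25]) (hz _ (by omega)) fun r₁₂ e12 f12 hr12 => ?_
          refine (ARuns.skip ⟨r₁₂, V₁₁, rfl, hr12, ?_, by simp [e12], ?_, ?_, ?_, ?_, ?_, ?_⟩).cost_le ?_
          · simp only [pushCost, Ex.cc_add, Ex.cc_var, Ex.cc_num, Ex.weight_add,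
              Ex.weight_var, Ex.weight_num]
            omega
          · rw [f12 _ (by omega), e11]; simp
          · intro y hy
            rw [f12 y (by omega), f11 y (by omega) (by omega) (by omega), f10 y (by omega),
              f9 y (by omega), f8 y (by omega)]
          · simp [f12, f11, f10, f9, f8]
          · simp [f12, f11, f10, f9, f8]
          · rw [v11]; simp
          · rw [w11 _ hne.symm, w9 _ hne.symm, v7]
          · intro y h1 h2
            rw [w11 _ h1, w9 _ h1]
        · intro hc
          have hc : l.headI = 0 := by rwa [← k24]
          have hans : answers [l] [o] = [] := by simp [answers, hc]
          simp only [hans, frames_nil, List.append_nil]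
          exact (ARuns.skip ⟨r₅, V₇, rfl, hr5, k11, k25, fun _ _ => rfl, rfl, rfl, hV7, v7,
            fun _ _ _ => rfl⟩).cost_le (by omega)
        · have := hr5 24
          dsimp only
          omega
        rintro Y ⟨r', V', rfl, hr', a1, a2, a3, a4, a5, a6, a7, a8⟩
        have hans : answers [l] [o] ++ answers reqs os = answers (l :: reqs) (o :: os) := by
          simp only [answers]
          split_ifs <;> rfl
        have hfr : frames (answers [l] [o]) ++ frames (answers reqs os) =
            frames (answers (l :: reqs) (o :: os)) := by
          rw [← hans]; simp [frames]
        have hal : (frames (answers [l] [o])).length ≤ o.length + 1 ∧ (answers [l] [o]).length ≤ 1 := by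
          simp only [answers]
          split_ifs <;> simp
        refine (ARuns.assign hlam hr' (by simp) ?_).cost_le ?_
        · have he : (Ex.var 22 - Ex.num 1).eval r' = reqs.length := by simp [a5, k22]
          simp only [he]
          have key := ih (la ++ frames (answers [l] [o])) s' sA os c₂ (pos + 1 + l.length)
            (nq + (answers [l] [o]).length) (Function.update r' 22 reqs.length) V'
            (hr'.update ?_) ?_ ?_ ?_ ?_ ?_ ?_ a6 a7 hcs
            (fun l hl => hreq l (by simp [hl])) t2 ((Nat.size_le_size ?_).trans hsz)
          · refine key.mono le_rfl ?_
            rintro Y ⟨r'', V'', rfl, b0, b1, b2, b3, b4, b5, b6⟩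
            rw [List.append_assoc, hfr] at b1 b4
            refine ⟨r'', V'', rfl, b0, b1, ?_, fun y hy => ?_, b4, b5, fun y h1 h2 => ?_⟩
            · rw [b2, ← hans, List.length_append]; omega
            · rw [b3 y hy, Function.update_of_ne (by omega), a3 y hy, g5 y hy]
            · rw [b6 y h1 h2, a8 y h1 h2, hV7' y h1 h2]
          · have := hr5 22
            rw [k22] at this
            exact (Nat.size_le_size (Nat.le_succ _)).trans this
          · simp [a3, g5, h31]
          · simp [a3, g5, h32]
          · simp
          · simp [a4, e5']
          · simp [a2]
          · simp [a1]
          · simp only [List.length_append]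
            omega
        · simp only [Ex.cc_add, Ex.cc_sub, Ex.cc_var, Ex.cc_num, Ex.weight_add, Ex.weight_sub,
            Ex.weight_var, Ex.weight_num]
          have b1 : lam * listCost l + lam * listCost o + (1 + lam) * c' ≤ (1 + lam) * c₁ := by
            have e1 : (1 + lam) * c₁ = (1 + lam) * listCost l + (1 + lam) * c' + (1 + lam) * listCost o := by
              rw [← hc']; ring
            have e2 := Nat.mul_le_mul_right (listCost l) (show lam ≤ 1 + lam by omega)
            have e3 := Nat.mul_le_mul_right (listCost o) (show lam ≤ 1 + lam by omega)
            omega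
          omega
      · have := hr 22
        rw [hB]
        dsimp only
        omega

/-- Computes the bit of one round on one pair of prepared machines, whose numbers are in the
registers `31` and `32`, for the blocks number `33` and `34` of the two vectors; the result is
written to the register `20`. The input for decoding starts with the fuel and the number of answers;
the latter is known only after the loop, so a place for it is reserved. -/
def stepJob (Rp Dp Ap : Prog) : Prog :=
  .seq (assign 10 (.num 0))
  (.seq (pushEs 31 10 [.var 54, .num 2, .var 42])
  (.seq (assign 12 (.num 2))
  (.seq (assign 13 (.var 42))
  (.seq (assign 14 (.var 42))
  (.seq (assign 15 (.num 0))
  (.seq (assign 16 (.var 33 * .var 42))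
  (.seq (assign 17 (.num 1))
  (.seq genBlock
  (.seq (pushEs 31 10 [.var 41])
  (.seq (assign 12 (.num 3 + .var 40))
  (.seq (assign 13 (.var 41))
  (.seq (assign 14 (.var 41))
  (.seq (assign 16 (.var 34 * .var 41))
  (.seq genBlock
  (.seq (setLen 31 10)
  (.seq (sim 31 (rcall Rp))
  (.seq (assign 11 (.num 0))
  (.seq (pushEs 31 11 [.var 55, .num 0])
  (.seq (assign 25 (.num 0))
  (.seq (pull 22 31 4 (.num 0))
  (.seq (assign 21 (.num 1))
  (.seq (reqLoop Ap)
  (.seq (assign 10 (.num 1))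
  (.seq (pushE 31 10 (.var 25))
  (.seq (setLen 31 11)
  (.seq (sim 31 (rdec Dp))
  (.seq (getVar 20 31 12) .skip)))))))))))))))))))))))))))

/-- A bound for the cost of `stepJob`. -/
def stepJobCost (A lam X : ℕ) : ℕ := (60 * A + 20000) * ((1 + lam) * (1 + lam)) * (X + 1)

theorem listCost_frames_answers {ω : ℕ → Bool} {p : Prog} {s s' : Memory} {ls os : List (List ℕ)}
    {c : ℕ} (h : CallSeq ω p s ls s' os c) :
    listCost (frames (answers ls os)) ≤ 2 * c ∧ (answers ls os).length ≤ c := by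
  induction h with
  | nil => simp [answers, listCost_nil]
  | cons h₁ _ ih =>
    rename_i s s' s'' l o ls os c c' _
    obtain ⟨c₁, hex, _, hc⟩ := h₁.exec
    have := hex.one_le
    have h2 := length_le_listCost o
    have h3 := size_le_self o.length
    simp only [answers]
    split_ifs
    · omega
    · simp only [frames_cons, listCost_cons, listCost_append, List.length_cons]
      omega

/-- The `z`-th entry of the part of length `w` starting at `c₀` of the vector of length `n` at position
`base` of the input. -/
def vecBlock (inp : ℕ → ℕ) (base c₀ w n : ℕ) : List ℕ :=
  (List.range w).map (blockEntry inp base w 0 c₀ 1 n)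

set_option maxHeartbeats 2000000 in
/-- The cost bound and the bound for the result hold whether or not the answers of the dynamic
algorithm are correct; the result is `b` whenever decoding these answers would output `b` within the
fuel. -/
theorem ARuns.stepJob {Rp Dp Ap : Prog} {A : ℕ} {lam : ℕ}
    (hA : ∀ ω lam τ F l, A ≤ lam → Shadowed lam τ → (F + listCost l + 1).size + 5 ≤ lam →
      ∃ τ' c, Exec ω (rcall Rp) (τ.input (F :: l)) τ' c ∧ Shadowed lam τ' ∧
        c ≤ A * (lam * (F + listCost l + 1)) ∧ τ'.var 10 ≤ F ∧
        ∀ σ' c₀, Exec ω Rp ((inner τ).input l) σ' c₀ → 4 * c₀ < F →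
          inner τ' = σ' ∧ F ≤ τ'.var 10 + 4 * c₀)
    (hD : ∀ ω lam τ F l, A ≤ lam → Shadowed lam τ → (F + listCost l + 1).size + 5 ≤ lam →
      ∃ τ' c, Exec ω (rdec Dp) (τ.input (F :: l)) τ' c ∧
        c ≤ A * (lam * (F + listCost l + 1)) ∧ τ'.var 12 ≤ 1 ∧
        ∀ σ' c₀ (b : Bool), Exec ω Dp ((inner τ).input l) σ' c₀ → σ'.output = [b.toNat] →
          4 * c₀ + 24 < F → τ'.var 12 = b.toNat)
    {ω : ℕ → Bool} {r : ℕ → ℕ} {V : ℕ → Memory} {inp : ℕ → ℕ} {X kR kA i j n d d1 F F' c₀ cA : ℕ}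
    {s₁ sA sA' : Memory} {reqs os : List (List ℕ)}
    (hAl : A ≤ lam) (hlam : 1 ≤ lam) (hr : RegBd lam r)
    (h31 : r 31 = kR) (h32 : r 32 = kA) (h33 : r 33 = i) (h34 : r 34 = j) (h40 : r 40 = n)
    (h41 : r 41 = d) (h42 : r 42 = d1) (h54 : r 54 = F) (h55 : r 55 = F')
    (hR : Shadowed lam (V kR)) (hVA : V kA = sA) (hne : kR ≠ kA)
    (henc : Call (coins ω kR) Rp (inner (V kR)) (encList [vecBlock inp 2 (i * d1) d1 n,
      vecBlock inp (3 + n) (j * d) d n]) s₁ (encList reqs) c₀)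
    (hF : 4 * c₀ < F) (hreqs : ∀ l ∈ reqs, l ≠ [] ∧ l.headI ≤ 1)
    (hstep : CallSeq (coins ω kA) Ap sA reqs sA' os cA)
    (hX1 : d1 + d ≤ X) (hX2 : F + c₀ + 1 ≤ X) (hX3 : F' + 3 * cA + 2 ≤ X)
    (hinp : ∀ j, j < n → (inp (2 + j)).size ≤ lam ∧ (inp (3 + n + j)).size ≤ lam)
    (hXl : (8 * X + n + i * d1 + j * d + 20).size + 5 ≤ lam) :
    ARuns ω (DynPred.stepJob Rp Dp Ap) ⟨r, V, inp⟩ (stepJobCost A lam X) fun Y =>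
      ∃ r' V', Y = ⟨r', V', inp⟩ ∧ RegBd lam r' ∧ (∀ y, 30 ≤ y → r' y = r y) ∧
        (∀ y, y ≠ kR → y ≠ kA → V' y = V y) ∧ r' 20 ≤ 1 ∧
        ∀ σ' c' (b : Bool), Call (coins ω kR) Dp s₁ (encList (answers reqs os)) σ' [b.toNat] c' →
          4 * c' + 24 < F' → r' 20 = b.toNat := by
  obtain ⟨c₀', hex, hout, hc₀⟩ := henc.exec
  obtain ⟨hans1, hans2⟩ := listCost_frames_answers hstep
  set ub := vecBlock inp 2 (i * d1) d1 n with hub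
  set vb := vecBlock inp (3 + n) (j * d) d n with hvb
  have hul : ub.length = d1 := by simp [hub, vecBlock]
  have hvl : vb.length = d := by simp [hvb, vecBlock]
  have hz : ∀ a, a ≤ 8 * X + n + i * d1 + j * d + 20 → a.size ≤ lam := fun a ha =>
    (Nat.size_le_size ha).trans (by omega)
  have hz5 : ∀ a, a ≤ 8 * X + n + i * d1 + j * d + 20 → a.size + 5 ≤ lam := fun a ha =>
    (Nat.add_le_add_right (Nat.size_le_size ha) 5).trans (by omega)
  refine ARuns.assign_seq (v := 0) hlam hr (by simp) (by simp) (by simp) fun r₁ e1 f1 hr1 => ?_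
  refine ARuns.pushEs_seq (k := kR) (σ := V kR) (l := []) (l' := [F, 2, d1])
    hlam hr1 (by omega)
    (by simp [Ex.Avoids]) (by simp [f1, h31]) (by rw [Memory.put_nil]) (by simp [e1])
    (by simp [f1, h54, h42]) (hz _ (by simp)) fun r₂ V₂ e2 f2 hr2 v2 w2 => ?_
  simp only [List.nil_append] at e2 v2
  refine ARuns.assign_seq (v := 2) hlam hr2 (by simp) (by simp) (hz _ (by omega))
    fun r₃ e3 f3 hr3 => ?_
  refine ARuns.assign_seq (v := d1) hlam hr3 (by simp) (by simp [f1, f2, f3, h42])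
    (hz _ (by omega)) fun r₄ e4 f4 hr4 => ?_
  refine ARuns.assign_seq (v := d1) hlam hr4 (by simp) (by simp [f1, f2, f3, f4, h42])
    (hz _ (by omega)) fun r₅ e5 f5 hr5 => ?_
  refine ARuns.assign_seq (v := 0) hlam hr5 (by simp) (by simp)
    (hz _ (by omega)) fun r₆ e6 f6 hr6 => ?_
  refine ARuns.assign_seq (v := i * d1) hlam hr6 (by simp)
    (by simp [f1, f2, f3, f4, f5, f6, h33, h42])
    (hz _ (by omega)) fun r₇ e7 f7 hr7 => ?_
  refine ARuns.assign_seq (v := 1) hlam hr7 (by simp) (by simp)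
    (hz _ (by omega)) fun r₈ e8 f8 hr8 => ?_
  refine ARuns.genBlock_seq (k := kR) (σ := V kR) (l := [F, 2, d1])
    (base := 2) (w := d1) (tot := d1) (r₀ := 0) (c₀ := i * d1) (Rn := 1) (n := n)
    hlam hr8 (by simp [f1, f2, f3, f4, f5, f6, f7, f8, h31]) v2
    (by simp [f3, f4, f5, f6, f7, f8, e2]) (by simp [f4, f5, f6, f7, f8, e3])
    (by simp [f5, f6, f7, f8, e4]) (by simp [f6, f7, f8, e5]) (by simp [f7, f8, e6])
    (by simp [f8, e7]) (by simp [e8]) (by simp [f1, f2, f3, f4, f5, f6, f7, f8, h40])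
    (hz _ (by simp; omega)) (hz _ (by omega)) (hz _ (by omega)) (hz _ (by omega))
    (fun i' j' hi hj => by
      rw [Nat.lt_one_iff] at hi
      simpa [hi] using (hinp j' hj).1)
    fun r₉ V₉ e9 f9 hr9 v9 w9 => ?_
  have g9 : ∀ y, 30 ≤ y → r₉ y = r y := fun y hy => by
    rw [f9 y (by omega) (by omega), f8 y (by omega), f7 y (by omega), f6 y (by omega),
      f5 y (by omega), f4 y (by omega), f3 y (by omega), f2 y (by omega), f1 y (by omega)]
  have k9 : r₉ 15 = 0 ∧ r₉ 17 = 1 := by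
    rw [f9 _ (by omega) (by omega), f9 _ (by omega) (by omega), e8, f8 _ (by omega),
      f7 _ (by omega), e6]
    exact ⟨rfl, rfl⟩
  rw [show List.map (blockEntry inp 2 d1 0 (i * d1) 1 n) (List.range d1) = ub from rfl] at v9
  refine ARuns.pushEs_seq (k := kR) (σ := V kR) (l := [F, 2, d1] ++ ub) (l' := [d])
    hlam hr9 (by omega)
    (by simp [Ex.Avoids]) (by simp [g9, h31]) v9 (by simp [e9, hul]; omega)
    (by simp [g9, h41]) (hz _ (by simp; omega)) fun s₂ V₁₀ e10 f10 hr10 v10 w10 => ?_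
  refine ARuns.assign_seq (v := 3 + n) hlam hr10 (by simp) (by simp [f10, g9, h40]) (hz _ (by omega))
    fun s₃ e11 f11 hr11 => ?_
  refine ARuns.assign_seq (v := d) hlam hr11 (by simp) (by simp [f10, f11, g9, h41])
    (hz _ (by omega)) fun s₄ e12 f12 hr12 => ?_
  refine ARuns.assign_seq (v := d) hlam hr12 (by simp) (by simp [f10, f11, f12, g9, h41])
    (hz _ (by omega)) fun s₅ e13 f13 hr13 => ?_
  refine ARuns.assign_seq (v := j * d) hlam hr13 (by simp)
    (by simp [f10, f11, f12, f13, g9, h34, h41])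
    (hz _ (by omega)) fun s₆ e14 f14 hr14 => ?_
  refine ARuns.genBlock_seq (k := kR) (σ := V kR) (l := [F, 2, d1] ++ ub ++ [d])
    (base := 3 + n) (w := d) (tot := d) (r₀ := 0) (c₀ := j * d) (Rn := 1) (n := n)
    hlam hr14 (by simp [f10, f11, f12, f13, f14, g9, h31]) v10
    (by simp [f11, f12, f13, f14, e10]) (by simp [f12, f13, f14, e11])
    (by simp [f13, f14, e12]) (by simp [f14, e13]) (by simp [f10, f11, f12, f13, f14, k9])
    (by simp [e14]) (by simp [f10, f11, f12, f13, f14, k9])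
    (by simp [f10, f11, f12, f13, f14, g9, h40])
    (hz _ (by simp; omega)) (hz _ (by omega)) (hz _ (by omega)) (hz _ (by omega))
    (fun i' j' hi hj => by
      rw [Nat.lt_one_iff] at hi
      simpa [hi] using (hinp j' hj).2)
    fun s₇ V₁₁ e15 f15 hr15 v11 w11 => ?_
  have g15 : ∀ y, 30 ≤ y → s₇ y = r y := fun y hy => by
    rw [f15 y (by omega) (by omega), f14 y (by omega), f13 y (by omega), f12 y (by omega),
      f11 y (by omega), f10 y (by omega), g9 y hy]
  have el : [F, 2, d1] ++ ub ++ [d] ++ vb = F :: encList [ub, vb] := by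
    simp [encList, hul, hvl]
  rw [show List.map (blockEntry inp (3 + n) d 0 (j * d) 1 n) (List.range d) = vb from rfl, el] at v11
  refine ARuns.setLen_seq hlam hr15 (by rw [g15 31 (by omega), h31]) v11
    (by simp only [e15, ← el, List.length_append, hvl]) fun V₁₂ v12 w12 => ?_
  obtain ⟨τ, c, x1, x2, x3, x4, x5⟩ := hA (coins ω kR) lam (V kR) F (encList [ub, vb]) hAl hR
    (hz5 _ (by omega))
  obtain ⟨x5, -⟩ := x5 s₁ c₀' hex (by omega)
  refine ARuns.sim_seq hr15 (by rw [g15 31 (by omega), h31]) v12 x1 fun V₁₃ v13 w13 => ?_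
  have y1 : ∀ x (h : x < (encList reqs).length), τ.arr 4 x = (encList reqs)[x] := fun x h => by
    have h' : x < s₁.output.length := by rw [hout]; exact h
    have := Memory.output_getElem s₁ x h'
    simp only [hout] at this
    rw [this, ← x5]; rfl
  have y0 : τ.arr 4 0 = reqs.length := by simpa [encList] using y1 0 (by simp [encList])
  have y2 : ∀ x (h : x < (frames reqs).length), τ.arr 4 (1 + x) = (frames reqs)[x] := fun x h => by
    simpa [encList_eq, add_comm 1] using y1 (x + 1) (by simp [encList_eq, h])
  have hrl : reqs.length ≤ c₀ := by
    have h2 := length_le_listCost (encList reqs)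
    have : reqs.length ≤ (frames reqs).length := by
      simp only [frames, List.length_flatMap]
      clear_value ub vb
      clear * -
      induction reqs with
      | nil => simp
      | cons l reqs ih =>
        simp only [List.length_cons, List.map_cons, List.sum_cons] at ih ⊢
        omega
    have h3 : (encList reqs).length = (frames reqs).length + 1 := by simp [encList_eq]
    omega
  refine ARuns.assign_seq (v := 0) hlam hr15 (by simp) (by simp) (by simp) fun t₁ e16 f16 hr16 => ?_
  refine ARuns.pushEs_seq (k := kR) (σ := τ) (l := []) (l' := [F', 0])
    hlam hr16 (by omega)
    (by simp [Ex.Avoids]) (by simp [f16, g15, h31]) (by rw [Memory.put_nil, v13]) (by simp [e16])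
    (by simp [f16, g15, h55]) (hz _ (by simp)) fun t₂ V₁₄ e17 f17 hr17 v14 w14 => ?_
  simp only [List.nil_append] at e17 v14
  refine ARuns.assign_seq (v := 0) hlam hr17 (by simp) (by simp) (by simp) fun t₃ e18 f18 hr18 => ?_
  refine ARuns.pull_seq (v := reqs.length) hlam hr18 (by simp)
    (by rw [f18 31 (by omega), f17 31 (by omega), f16 31 (by omega), g15 31 (by omega), h31, v14,
      Memory.put_arr_of_ne _ _ (by omega)]; exact y0) (hz _ (by omega)) fun t₄ e19 f19 hr19 => ?_
  refine ARuns.assign_seq (v := 1) hlam hr19 (by simp) (by simp) (hz _ (by omega))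
    fun t₅ e20 f20 hr20 => ?_
  refine ARuns.sub_seq ((ARuns.reqLoop (kR := kR) (kA := kA) (τ := τ) hlam hne reqs [F', 0] sA sA' os cA
    1 0 t₅ V₁₄ hr20 (by simp [f20, f19, f18, f17, f16, g15, h31])
    (by simp [f20, f19, f18, f17, f16, g15, h32]) (by simp [f20, e19]) e20
    (by simp [f20, f19, e18]) (by simp [f20, f19, f18, e17]) v14
    (by rw [w14 _ hne.symm, w13 _ hne.symm, w12 _ hne.symm, w11 _ hne.symm, w10 _ hne.symm,
      w9 _ hne.symm, w2 _ hne.symm, hVA]) hstep hreqs y2 (hz _ (by simp; omega))).mono le_rfl ?_)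
  rintro Y ⟨t₆, V₁₅, rfl, hr21, e21, e21', f21, v15, -, w15⟩
  have g21 : ∀ y, 30 ≤ y → t₆ y = r y := fun y hy => by
    rw [f21 y hy, f20 y (by omega), f19 y (by omega), f18 y (by omega), f17 y (by omega),
      f16 y (by omega), g15 y hy]
  refine ARuns.assign_seq (v := 1) hlam hr21 (by simp) (by simp) (hz _ (by omega))
    fun t₇ e22 f22 hr22 => ?_
  have el' : F' :: (answers reqs os).length :: frames (answers reqs os) =
      F' :: encList (answers reqs os) := rfl
  refine ARuns.sub_seq (ARuns.pushE hlam hr22 (by simp) ?_)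
  have k31 : t₇ 31 = kR := by rw [f22 31 (by omega), g21 31 (by omega), h31]
  have k25 : t₇ 25 = (answers reqs os).length := by rw [f22 25 (by omega), e21', zero_add]
  simp only [k31, e22, Ex.eval_var, k25]
  have hv16 : Function.update V₁₅ kR ((V₁₅ kR).setArr 0 1 (answers reqs os).length) kR =
      τ.put (F' :: encList (answers reqs os)) := by
    rw [Function.update_self, v15, ← el']
    exact (Memory.put_cons_cons τ _ F' 0 _).symm
  have hw16 : ∀ y, y ≠ kR →
      Function.update V₁₅ kR ((V₁₅ kR).setArr 0 1 (answers reqs os).length) y = V₁₅ y :=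
    fun y hy => Function.update_of_ne hy _ _
  generalize Function.update V₁₅ kR ((V₁₅ kR).setArr 0 1 (answers reqs os).length) = V₁₆ at hv16 hw16
  have hr23 : RegBd lam (Function.update t₇ 10 (1 + 1)) := hr22.update (hz _ (by omega))
  refine ARuns.setLen_seq (k := kR) hlam hr23 (by simp [k31]) hv16
    (by simp [f22, e21, encList_eq])
    fun V₁₇ v17 w17 => ?_
  have hlA : listCost (encList (answers reqs os)) ≤ 3 * cA + 1 := by
    rw [encList_eq, listCost_cons]
    have := size_le_self (answers reqs os).length
    omega
  obtain ⟨τ', c', z1, z2, z3, z4⟩ := hD (coins ω kR) lam τ F' (encList (answers reqs os)) hAl x2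
    (hz5 _ (by omega))
  refine ARuns.sim_seq (k := kR) hr23 (by simp [k31]) v17 z1 fun V₁₈ v18 w18 => ?_
  refine ARuns.getVar_seq (v := τ'.var 12) hlam hr23 (by simp [k31, v18]) (hz _ (by omega))
    fun t₈ e24 f24 hr24 => ?_
  have hfin : ∀ y, y ≠ kR → y ≠ kA → V₁₈ y = V y := fun y h1 h2 => by
    rw [w18 _ h1, w17 _ h1, hw16 _ h1, w15 _ h1 h2, w14 _ h1, w13 _ h1, w12 _ h1, w11 _ h1, w10 _ h1,
      w9 _ h1, w2 _ h1]
  have hfr : ∀ y, 30 ≤ y → t₈ y = r y := fun y hy => by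
    rw [f24 y (by omega), Function.update_of_ne (by omega), f22 y (by omega), g21 y hy]
  have hbit : ∀ σ' c' (b : Bool), Call (coins ω kR) Dp s₁ (encList (answers reqs os)) σ' [b.toNat] c' →
      4 * c' + 24 < F' → t₈ 20 = b.toNat := fun σ' c'' b hdec hF' => by
    obtain ⟨c₃, hex3, hout3, hc3⟩ := hdec.exec
    rw [e24]
    exact z4 σ' c₃ b (by rw [x5]; exact hex3) hout3 (by omega)
  refine ARuns.cost_le (ARuns.skip ⟨t₈, V₁₈, rfl, hr24, hfr, hfin, by rw [e24]; exact z3, hbit⟩) ?_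
  · simp only [pushCost, Ex.cc_add, Ex.cc_mul, Ex.cc_var, Ex.cc_num, Ex.weight_add, Ex.weight_mul,
      Ex.weight_var, Ex.weight_num, stepJobCost]
    obtain ⟨P, hP⟩ : ∃ P, P = (1 + lam) * (1 + lam) * (X + 1) := ⟨_, rfl⟩
    have hlX : ∀ z, z ≤ X + 1 → (1 + lam) * z ≤ P := fun z hz => by
      rw [hP]
      exact Nat.mul_le_mul (Nat.le_mul_of_pos_left _ (by omega)) hz
    have hlX' : ∀ z, z ≤ X + 1 → lam * z ≤ P := fun z hz =>
      (Nat.mul_le_mul_right _ (by omega)).trans (hlX z hz)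
    have hcc : ∀ a z, z ≤ X + 1 → a ≤ A * (lam * z) → 30 * ((1 + lam) * a) ≤ 30 * A * P := by
      intro a z hz ha
      have : lam * z ≤ (1 + lam) * (X + 1) := Nat.mul_le_mul (by omega) (by omega)
      have := ha.trans (Nat.mul_le_mul_left A this)
      calc _ ≤ 30 * ((1 + lam) * (A * ((1 + lam) * (X + 1)))) := by gcongr
        _ = _ := by rw [hP]; ring
    have b1 := hcc c _ (by omega) x3
    have b2 := hcc c' _ (by omega) z2
    have b3 := hlX cA (by omega)
    have b4 : d1 * (300 * lam) ≤ 300 * P := by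
      rw [show d1 * (300 * lam) = 300 * (lam * d1) by ring]
      exact Nat.mul_le_mul_left _ (hlX' d1 (by omega))
    have b5 : d * (300 * lam) ≤ 300 * P := by
      rw [show d * (300 * lam) = 300 * (lam * d) by ring]
      exact Nat.mul_le_mul_left _ (hlX' d (by omega))
    have b6 := hlX 1 (by omega)
    have b7 : 60 * A * P = 30 * A * P + 30 * A * P := by ring
    rw [mul_assoc, ← hP, Nat.add_mul, b7]
    clear hcc hlX hlX' hP hz hz5
    omega

/-! ### One online round on all machines -/

/-- The parameters that are computed in the preprocessing and kept in registers: the matrix is an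
`n × n` matrix; a block has `d1` rows and `d` columns; the universal request block consists of `L`
requests, which are encoded by `tl` numbers from position `ts` of the output of the program that
computes it; the reduction is told that there are `n3` rounds; `δ` is the delay, `F1`, `F2`, `F3` is the
fuel for the three programs of the reduction, and `h` is half the number of repetitions. -/
structure Params where
  (n d d1 L n3 ts tl δ F1 F2 F3 h : ℕ)

namespace Params

variable (C : Params)

/-- The number of blocks of rows. -/
def nb1 : ℕ := C.n / C.d1 + 1

/-- The number of blocks of columns. -/
def nb2 : ℕ := C.n / C.d + 1

/-- The number of repetitions. -/
def rep : ℕ := 2 * C.h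

/-- The block of rows of the machine pair number `p`. -/
def rowOf (p : ℕ) : ℕ := p / C.rep / C.nb2 % C.nb1

/-- The block of columns of the machine pair number `p`. -/
def colOf (p : ℕ) : ℕ := p / C.rep % C.nb2

/-- The registers hold the parameters. -/
structure Holds (C : Params) (r : ℕ → ℕ) : Prop where
  h40 : r 40 = C.n
  h41 : r 41 = C.d
  h42 : r 42 = C.d1
  h43 : r 43 = C.L
  h44 : r 44 = C.n3
  h45 : r 45 = C.ts
  h46 : r 46 = C.tl
  h47 : r 47 = C.nb1
  h48 : r 48 = C.nb2
  h49 : r 49 = C.rep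
  h50 : r 50 = C.h
  h52 : r 52 = C.δ
  h53 : r 53 = C.F1
  h54 : r 54 = C.F2
  h55 : r 55 = C.F3
  h57 : r 57 = 0

theorem Holds.congr {C : Params} {r r' : ℕ → ℕ} (h : C.Holds r) (hr : ∀ y, 40 ≤ y → r' y = r y) :
    C.Holds r' := by
  constructor <;> rw [hr _ (by omega)]
  exacts [h.h40, h.h41, h.h42, h.h43, h.h44, h.h45, h.h46, h.h47, h.h48, h.h49, h.h50, h.h52, h.h53,
    h.h54, h.h55, h.h57]

end Params

/-- One round on one pair of machines can be completed: the machine of the reduction, in state `s₀`,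
encodes the two vectors into requests, which the dynamic algorithm, in state `sA`, answers at total
cost at most `W`; if `good` holds, then the answers are decoded to the bit `b`. -/
def RoundSpec (Re Rd As : Prog) (ωR ωA : ℕ → Bool) (s₀ sA : Memory) (ub vb : List ℕ)
    (F2 F3 W : ℕ) (good : Prop) (b : Bool) : Prop :=
  ∃ reqs os s₁ sA' c₀ cA, Call ωR Re s₀ (encList [ub, vb]) s₁ (encList reqs) c₀ ∧ 4 * c₀ < F2 ∧
    (∀ l ∈ reqs, l ≠ [] ∧ l.headI ≤ 1) ∧ CallSeq ωA As sA reqs sA' os cA ∧ cA ≤ W ∧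
    (good → ∃ σ' c', Call ωR Rd s₁ (encList (answers reqs os)) σ' [b.toNat] c' ∧ 4 * c' + 24 < F3)

/-- The pair number `p` of machines, which are the machines `2 p + 1` and `2 p + 2`, is prepared. -/
def Prepared (lam : ℕ) (s₀ sA : ℕ → Memory) (V : ℕ → Memory) (p : ℕ) : Prop :=
  Shadowed lam (V (2 * p + 1)) ∧ inner (V (2 * p + 1)) = s₀ p ∧ V (2 * p + 2) = sA p

/-- Runs one round on the pair of machines number `30` and adds the result to the votes. -/
def voteBody (Re Rd As : Prog) : Prog :=
  .seq (assign 31 (.num 2 * .var 30 + .num 1))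
  (.seq (assign 32 (.num 2 * .var 30 + .num 2))
  (.seq (assign 0 (.var 30 / .var 49))
  (.seq (assign 1 (.var 0 / .var 48))
  (.seq (assign 33 (.var 1 - .var 1 / .var 47 * .var 47))
  (.seq (assign 34 (.var 0 - .var 0 / .var 48 * .var 48))
  (.seq (stepJob Re Rd As)
  (.seq (assign 37 (.var 37 + .var 20))
  (.seq (assign 30 (.var 30 + .num 1))
  (assign 36 (.var 36 - .num 1))))))))))

/-- The vote of all repetitions for one block of the matrix: the block counts as `1` if more than
half of them say so. -/
def blockBody (Re Rd As : Prog) : Prog :=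
  .seq (assign 37 (.num 0))
  (.seq (assign 36 (.var 49))
  (.seq (.loop (36 + 10) (voteBody Re Rd As))
  (.seq (assign 0 (.var 37 - .var 50))
  (.seq (.ite (0 + 10) (assign 38 (.num 1)) .skip)
  (assign 35 (.var 35 - .num 1))))))

/-- One round: the disjunction of the results for all blocks of the matrix. -/
def roundProg (Re Rd As : Prog) : Prog :=
  .seq (assign 38 (.num 0))
  (.seq (assign 35 (.var 47 * .var 48))
  (.loop (35 + 10) (blockBody Re Rd As)))

section

variable {Re Rd As : Prog} {A lam X W : ℕ} {C : Params} {ω : ℕ → Bool} {inp : ℕ → ℕ}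
  {s₀ sA : ℕ → Memory} {good : ℕ → Prop} {w : ℕ → Bool}

/-- The properties of the clocked programs. -/
structure ClockSpec (A : ℕ) (Re Rd : Prog) : Prop where
  call : ∀ ω lam τ F l, A ≤ lam → Shadowed lam τ → (F + listCost l + 1).size + 5 ≤ lam →
      ∃ τ' c, Exec ω (rcall Re) (τ.input (F :: l)) τ' c ∧ Shadowed lam τ' ∧
        c ≤ A * (lam * (F + listCost l + 1)) ∧ τ'.var 10 ≤ F ∧
        ∀ σ' c₀, Exec ω Re ((inner τ).input l) σ' c₀ → 4 * c₀ < F →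
          inner τ' = σ' ∧ F ≤ τ'.var 10 + 4 * c₀
  dec : ∀ ω lam τ F l, A ≤ lam → Shadowed lam τ → (F + listCost l + 1).size + 5 ≤ lam →
      ∃ τ' c, Exec ω (rdec Rd) (τ.input (F :: l)) τ' c ∧
        c ≤ A * (lam * (F + listCost l + 1)) ∧ τ'.var 12 ≤ 1 ∧
        ∀ σ' c₀ (b : Bool), Exec ω Rd ((inner τ).input l) σ' c₀ → σ'.output = [b.toNat] →
          4 * c₀ + 24 < F → τ'.var 12 = b.toNat

/-- Bounds that hold in an online round. -/
structure RoundBounds (A lam X W NB : ℕ) (C : Params) (inp : ℕ → ℕ) : Prop where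
  hA : A ≤ lam
  hlam : 1 ≤ lam
  hX : C.d1 + C.d + 2 * C.F2 + C.F3 + 3 * W + 2 ≤ X
  hinp : ∀ j, j < C.n → (inp (2 + j)).size ≤ lam ∧ (inp (3 + C.n + j)).size ≤ lam
  hXl : (8 * X + C.n + C.nb1 * C.d1 + C.nb2 * C.d + 20).size + 5 ≤ lam
  hNB : (2 * NB + 2).size ≤ lam
  hBl : (C.nb1 * C.nb2).size ≤ lam
  hh : 1 ≤ C.h

theorem Params.rowOf_lt (C : Params) (p : ℕ) : C.rowOf p < C.nb1 := Nat.mod_lt _ (Nat.succ_pos _)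

theorem Params.colOf_lt (C : Params) (p : ℕ) : C.colOf p < C.nb2 := Nat.mod_lt _ (Nat.succ_pos _)

theorem sub_div_mul_self_eq_mod (a b : ℕ) : a - a / b * b = a % b := by
  rw [mul_comm, Nat.mod_eq_sub_mul_div]

/-- A bound for the cost of `voteBody`. -/
def voteCost (A lam X : ℕ) : ℕ := stepJobCost A lam X + 200 * lam

theorem ARuns.voteBody {NB : ℕ} (hcl : ClockSpec A Re Rd) (hb : RoundBounds A lam X W NB C inp)
    {r : ℕ → ℕ} {V : ℕ → Memory} {p N v : ℕ} (hC : C.Holds r) (hr : RegBd lam r)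
    (h30 : r 30 = p) (h36 : r 36 = N) (h37 : r 37 = v) (hp : p < NB) (hv : v < NB)
    (hprep : Prepared lam s₀ sA V p)
    (hround : RoundSpec Re Rd As (coins ω (2 * p + 1)) (coins ω (2 * p + 2)) (s₀ p) (sA p)
      (vecBlock inp 2 (C.rowOf p * C.d1) C.d1 C.n)
      (vecBlock inp (3 + C.n) (C.colOf p * C.d) C.d C.n) C.F2 C.F3 W (good p) (w p)) :
    ARuns ω (DynPred.voteBody Re Rd As) ⟨r, V, inp⟩ (voteCost A lam X) fun Y =>
      ∃ r' V' b, Y = ⟨r', V', inp⟩ ∧ RegBd lam r' ∧ (∀ y, 40 ≤ y → r' y = r y) ∧ r' 30 = p + 1 ∧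
        r' 36 = N - 1 ∧ r' 35 = r 35 ∧ r' 38 = r 38 ∧ r' 37 = v + b ∧ b ≤ 1 ∧
        (good p → b = (w p).toNat) ∧ ∀ y, 2 * p + 2 < y → V' y = V y := by
  obtain ⟨reqs, os, s₁, sA', c₀, cA, henc, hF, hreqs, hstep, hcA, hdec⟩ := hround
  obtain ⟨hp1, hp2, hp3⟩ := hprep
  have hlam := hb.hlam
  have hX := hb.hX
  have hz : ∀ a, a ≤ 2 * NB + 2 → a.size ≤ lam := fun a ha => (Nat.size_le_size ha).trans hb.hNB
  have hi := C.rowOf_lt p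
  have hj := C.colOf_lt p
  have hid : C.rowOf p * C.d1 ≤ C.nb1 * C.d1 := Nat.mul_le_mul_right _ hi.le
  have hjd : C.colOf p * C.d ≤ C.nb2 * C.d := Nat.mul_le_mul_right _ hj.le
  have hd1 : p / C.rep ≤ p := Nat.div_le_self _ _
  have hd2 : p / C.rep / C.nb2 ≤ p / C.rep := Nat.div_le_self _ _
  have hil : C.rowOf p ≤ p := (Nat.mod_le _ _).trans (hd2.trans hd1)
  have hjl : C.colOf p ≤ p := (Nat.mod_le _ _).trans hd1
  refine ARuns.assign_seq (v := 2 * p + 1) hlam hr (by simp) (by simp [h30]) (hz _ (by omega))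
    fun r₁ e1 f1 hr1 => ?_
  refine ARuns.assign_seq (v := 2 * p + 2) hlam hr1 (by simp) (by simp [f1, h30]) (hz _ (by omega))
    fun r₂ e2 f2 hr2 => ?_
  refine ARuns.assign_seq (v := p / C.rep) hlam hr2 (by simp) (by simp [f2, f1, h30, hC.h49])
    (hz _ (by omega)) fun r₃ e3 f3 hr3 => ?_
  refine ARuns.assign_seq (v := p / C.rep / C.nb2) hlam hr3 (by simp)
    (by simp [e3, f3, f2, f1, hC.h48])
    (hz _ (by omega)) fun r₄ e4 f4 hr4 => ?_
  refine ARuns.assign_seq (v := C.rowOf p) hlam hr4 (by simp)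
    (by simp [e4, f4, f3, f2, f1, hC.h47, sub_div_mul_self_eq_mod, Params.rowOf])
    (hz _ (by omega)) fun r₅ e5 f5 hr5 => ?_
  refine ARuns.assign_seq (v := C.colOf p) hlam hr5 (by simp)
    (by simp [e3, f5, f4, f3, f2, f1, hC.h48, sub_div_mul_self_eq_mod, Params.colOf])
    (hz _ (by omega)) fun r₆ e6 f6 hr6 => ?_
  have g6 : ∀ y, 35 ≤ y ∨ y = 30 → r₆ y = r y := fun y hy => by
    rw [f6 y (by omega), f5 y (by omega), f4 y (by omega), f3 y (by omega), f2 y (by omega),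
      f1 y (by omega)]
  have hC6 : C.Holds r₆ := hC.congr fun y hy => g6 y (by omega)
  refine ARuns.sub_seq ((ARuns.stepJob (X := X) (reqs := reqs) (os := os) (kR := 2 * p + 1)
    (kA := 2 * p + 2) (i := C.rowOf p) (j := C.colOf p) (s₁ := s₁) (sA := sA p) (sA' := sA')
    hcl.call hcl.dec hb.hA hlam hr6
    (by simp [f6, f5, f4, f3, f2, e1]) (by simp [f6, f5, f4, f3, e2]) (by simp [f6, e5]) e6
    hC6.h40 hC6.h41 hC6.h42 hC6.h54 hC6.h55 hp1 hp3 (by omega) (by rw [hp2]; exact henc) hF hreqs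
    hstep (by omega) (by omega) (by omega) hb.hinp ?_).mono le_rfl ?_)
  · exact (Nat.add_le_add_right (Nat.size_le_size (by omega)) 5).trans hb.hXl
  rintro Y ⟨r₇, V₇, rfl, hr7, f7, w7, a1, a2⟩
  refine ARuns.assign_seq (v := v + r₇ 20) hlam hr7 (by simp) (by simp [f7, g6, h37])
    (hz _ (by omega)) fun r₈ e8 f8 hr8 => ?_
  refine ARuns.assign_seq (v := p + 1) hlam hr8 (by simp) (by simp [f8, f7, g6, h30])
    (hz _ (by omega)) fun r₉ e9 f9 hr9 => ?_
  have k36 : r₉ 36 = N := by simp [f9, f8, f7, g6, h36]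
  have hN : (Ex.var 36 - Ex.num 1).eval r₉ = N - 1 := by simp [k36]
  refine (ARuns.assign hlam hr9 (by simp) ⟨_, V₇, r₇ 20, rfl, hr9.update ?_, fun y hy => ?_, ?_, ?_, ?_,
    ?_, ?_, a1, fun hg => ?_, fun y hy => w7 y (by omega) (by omega)⟩).cost_le ?_
  · simp only [voteCost, Ex.cc_add, Ex.cc_mul, Ex.cc_sub, Ex.cc_div, Ex.cc_var, Ex.cc_num,
      Ex.weight_add, Ex.weight_mul, Ex.weight_sub, Ex.weight_div, Ex.weight_var, Ex.weight_num]
    omega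
  · rw [hN]
    have := hr9 36
    rw [k36] at this
    exact (Nat.size_le_size (Nat.sub_le _ _)).trans this
  · dsimp only
    rw [Function.update_of_ne (by omega), f9 y (by omega), f8 y (by omega), f7 y (by omega),
      g6 y (by omega)]
  · simp [e9]
  · simp [hN]
  · simp [f9, f8, f7, g6]
  · simp [f9, f8, f7, g6]
  · simp [f9, e8]
  · obtain ⟨σ', c', hd, hc'⟩ := hdec hg
    exact a2 σ' c' _ hd hc'

open Classical in
/-- The number of pairs of machines among the `N` pairs from `p` on that fail. -/
noncomputable def badCount (good : ℕ → Prop) (p N : ℕ) : ℕ :=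
  ((Finset.range N).filter fun x => ¬ good (p + x)).card

theorem badCount_succ (good : ℕ → Prop) (p N : ℕ) [Decidable (good p)] :
    badCount good p (N + 1) = badCount good (p + 1) N + if good p then 0 else 1 := by
  classical
  simp only [badCount, Finset.card_filter, Finset.sum_range_succ', add_zero]
  congr 1
  · refine Finset.sum_congr rfl fun x _ => ?_
    rw [show p + (x + 1) = p + 1 + x by ring]
  · split_ifs <;> rfl

/-- The number of votes for `1` differs by at most the number of failing pairs from what it would be
if all pairs gave the right result `wb`. -/
theorem ARuns.voteLoop {NB : ℕ} (hcl : ClockSpec A Re Rd) (hb : RoundBounds A lam X W NB C inp)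
    (wb : Bool) (N : ℕ) :
    ∀ (r : ℕ → ℕ) (V : ℕ → Memory) (p v : ℕ), C.Holds r → RegBd lam r →
      r 30 = p → r 36 = N → r 37 = v → p + N ≤ NB → v + N ≤ NB →
      (∀ q, p ≤ q → q < p + N → Prepared lam s₀ sA V q) →
      (∀ q, p ≤ q → q < p + N →
        RoundSpec Re Rd As (coins ω (2 * q + 1)) (coins ω (2 * q + 2)) (s₀ q) (sA q)
          (vecBlock inp 2 (C.rowOf q * C.d1) C.d1 C.n)
          (vecBlock inp (3 + C.n) (C.colOf q * C.d) C.d C.n) C.F2 C.F3 W (good q) wb) →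
      ARuns ω (.loop (36 + 10) (DynPred.voteBody Re Rd As)) ⟨r, V, inp⟩
        (N * (voteCost A lam X + 1 + lam) + 1) fun Y =>
        ∃ r' V', Y = ⟨r', V', inp⟩ ∧ RegBd lam r' ∧ (∀ y, 40 ≤ y → r' y = r y) ∧ r' 30 = p + N ∧
          r' 35 = r 35 ∧ r' 38 = r 38 ∧ r' 37 ≤ v + N ∧
          (wb = true → v + N ≤ r' 37 + badCount good p N) ∧
          (wb = false → r' 37 ≤ v + badCount good p N) ∧ ∀ y, 2 * (p + N) < y → V' y = V y := by
  classical
  induction N with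
  | zero =>
    intro r V p v hC hr h30 h36 h37 _ _ _ _
    exact (ARuns.loop_done h36 ⟨r, V, rfl, hr, fun _ _ => rfl, h30, rfl, rfl, by omega,
      fun _ => by omega, fun _ => by omega, fun _ _ => rfl⟩).cost_le (by omega)
  | succ N ih =>
    intro r V p v hC hr h30 h36 h37 hp hv hprep hround
    refine (ARuns.loop_step (by dsimp only; omega) ((ARuns.voteBody hcl hb (w := fun _ => wb) hC hr h30 h36 h37
      (by omega) (by omega) (hprep p le_rfl (by omega)) (hround p le_rfl (by omega))).mono le_rfl
      ?_)).cost_le (b := 1 + (r 36).size + voteCost A lam X + (N * (voteCost A lam X + 1 + lam) + 1)) ?_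
    · rintro Y ⟨r', V', b, rfl, hr', a1, a2, a3, a4, a5, a6, a7, a8, a9⟩
      refine (ih r' V' (p + 1) (v + b) (hC.congr a1) hr' a2 (by omega) a6 (by omega) (by omega)
        (fun q h1 h2 => ?_) fun q h1 h2 => hround q (by omega) (by omega)).mono le_rfl ?_
      · obtain ⟨b1, b2, b3⟩ := hprep q (by omega) (by omega)
        refine ⟨?_, ?_, ?_⟩
        · rwa [a9 _ (by omega)]
        · rwa [a9 _ (by omega)]
        · rwa [a9 _ (by omega)]
      · rintro Y ⟨r'', V'', rfl, hr'', c1, c2, c3, c4, c5, c6, c7, c8⟩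
        have hbc := badCount_succ good p N
        refine ⟨r'', V'', rfl, hr'', fun y hy => (c1 y hy).trans (a1 y hy), by omega, by omega,
          by omega, by omega, fun hwb => ?_, fun hwb => ?_, fun y hy => ?_⟩
        · have := c6 hwb
          subst hwb
          by_cases hg : good p
          · have := a8 hg
            simp only [Bool.toNat_true] at this
            rw [hbc, if_pos hg]; omega
          · rw [hbc, if_neg hg]; omega
        · have := c7 hwb
          subst hwb
          by_cases hg : good p
          · have := a8 hg
            simp only [Bool.toNat_false] at this
            rw [hbc, if_pos hg]; omega
          · rw [hbc, if_neg hg]; omega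
        · rw [c8 y (by omega), a9 y (by omega)]
    · have := hr 36
      rw [Nat.succ_mul]
      omega

/-- A bound for the cost of `blockBody`. -/
def blockCost (A lam X rep : ℕ) : ℕ := rep * (voteCost A lam X + 1 + lam) + 100 * lam

/-- The pairs of machines are used in the order of their numbers, `rep` of them for each block. The
result is correct if for each block less than half of them fail. -/
theorem ARuns.blockLoop {NB : ℕ} (hcl : ClockSpec A Re Rd) (hb : RoundBounds A lam X W NB C inp)
    (E : ℕ) :
    ∀ (r : ℕ → ℕ) (V : ℕ → Memory) (g : ℕ), C.Holds r → RegBd lam r →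
      r 30 = g * C.rep → r 35 = E → r 38 ≤ 1 → (g + E) * C.rep ≤ NB →
      (∀ q, g * C.rep ≤ q → q < (g + E) * C.rep → Prepared lam s₀ sA V q) →
      (∀ q, g * C.rep ≤ q → q < (g + E) * C.rep →
        RoundSpec Re Rd As (coins ω (2 * q + 1)) (coins ω (2 * q + 2)) (s₀ q) (sA q)
          (vecBlock inp 2 (C.rowOf q * C.d1) C.d1 C.n)
          (vecBlock inp (3 + C.n) (C.colOf q * C.d) C.d C.n) C.F2 C.F3 W (good q) (w (q / C.rep))) →
      ARuns ω (.loop (35 + 10) (DynPred.blockBody Re Rd As)) ⟨r, V, inp⟩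
        (E * (blockCost A lam X C.rep + 1 + lam) + 1) fun Y =>
        ∃ r' V', Y = ⟨r', V', inp⟩ ∧ RegBd lam r' ∧ (∀ y, 40 ≤ y → r' y = r y) ∧
          r' 30 = (g + E) * C.rep ∧ r' 38 ≤ 1 ∧
          ((∀ e, e < E → badCount good ((g + e) * C.rep) C.rep < C.h) →
            (r' 38 = 1 ↔ r 38 = 1 ∨ ∃ e, e < E ∧ w (g + e) = true)) ∧
          ∀ y, 2 * ((g + E) * C.rep) < y → V' y = V y := by
  have hlam := hb.hlam
  have hz : ∀ a, a ≤ 2 * NB + 2 → a.size ≤ lam := fun a ha => (Nat.size_le_size ha).trans hb.hNB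
  have hrep : C.rep = 2 * C.h := rfl
  have hh := hb.hh
  induction E with
  | zero =>
    intro r V g hC hr h30 h35 h38 _ _ _
    exact (ARuns.loop_done h35 ⟨r, V, rfl, hr, fun _ _ => rfl, h30, h38, fun _ => by simp,
      fun _ _ => rfl⟩).cost_le (by omega)
  | succ E ih =>
    intro r V g hC hr h30 h35 h38 hNB hprep hround
    have e0 : (g + (E + 1)) * C.rep = (g + 1 + E) * C.rep := by ring
    have e1 : (g + 1) * C.rep = g * C.rep + C.rep := by ring
    have e2 : (g + 1) * C.rep ≤ (g + 1 + E) * C.rep := Nat.mul_le_mul_right _ (by omega)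
    rw [e0] at hNB hprep hround ⊢
    refine (ARuns.loop_step (b := blockCost A lam X C.rep)
      (b' := E * (blockCost A lam X C.rep + 1 + lam) + 1) (by dsimp only; omega) ?_).cost_le ?_
    · refine ARuns.assign_seq (v := 0) hlam hr (by simp) (by simp) (by simp) fun r₁ e1 f1 hr1 => ?_
      refine ARuns.assign_seq (v := C.rep) hlam hr1 (by simp) (by simp [f1, hC.h49]) (hz _ (by omega))
        fun r₂ e2 f2 hr2 => ?_
      have hC2 : C.Holds r₂ := hC.congr fun y hy => by rw [f2 y (by omega), f1 y (by omega)]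
      refine ARuns.sub_seq ((ARuns.voteLoop (good := good) hcl hb (w g) C.rep r₂ V (g * C.rep) 0 hC2 hr2
        (by simp [f2, f1, h30]) e2 (by simp [f2, e1]) (by omega) (by omega)
        (fun q h1 h2 => hprep q h1 (by omega)) fun q h1 h2 => ?_).mono le_rfl ?_)
      · have := hround q h1 (by omega)
        rwa [Nat.div_eq_of_lt_le h1 (by omega)] at this
      rintro Y ⟨r₃, V₃, rfl, hr3, a1, a2, a3, a4, a5, a6, a7, a8⟩
      simp only [zero_add] at a5 a6 a7
      have hC3 : C.Holds r₃ := hC2.congr a1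
      refine ARuns.assign_seq (v := r₃ 37 - C.h) hlam hr3 (by simp) (by simp [hC3.h50])
        (hz _ (by omega)) fun r₄ e4 f4 hr4 => ?_
      have hK : (Ex.num 1).eval r₄ = 1 := rfl
      refine ARuns.sub_seq (c := 1 + lam + 5 * lam) ((ARuns.ite (b := 5 * lam) (Q := fun Y =>
        ∃ r₅, Y = ⟨r₅, V₃, inp⟩ ∧ RegBd lam r₅ ∧ (∀ y, y ≠ 38 → r₅ y = r₄ y) ∧
          r₅ 38 = if C.h < r₃ 37 then 1 else r₄ 38) (fun hc => ?_) fun hc => ?_).mono ?_ ?_)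
      · replace hc : r₄ 0 ≠ 0 := hc
        refine (ARuns.assign hlam hr4 (by simp) ⟨_, rfl, hr4.update ?_, fun y hy => ?_, ?_⟩).cost_le ?_
        · simp only [Ex.cc_num, Ex.weight_num]; omega
        · exact hz _ (by simp)
        · simp [hy]
        · rw [if_pos (by omega)]; simp
      · replace hc : r₄ 0 = 0 := hc
        refine (ARuns.skip ⟨_, rfl, hr4, fun y hy => rfl, ?_⟩).cost_le (by omega)
        rw [if_neg (by omega)]
      · have := hr4 0
        dsimp only; omega
      rintro Y ⟨r₅, rfl, hr5, f5, e5⟩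
      have k35 : r₅ 35 = E + 1 := by simp [f5, f4, a3, f2, f1, h35]
      have k38 : r₄ 38 = r 38 := by simp [f4, a4, f2, f1]
      refine (ARuns.assign hlam hr5 (by simp) ?_).cost_le ?_
      · have he : (Ex.var 35 - Ex.num 1).eval r₅ = E := by simp [k35]
        simp only [he]
        refine (ih (Function.update r₅ 35 E) V₃ (g + 1) ?_ (hr5.update ?_) ?_ (by simp) ?_ ?_ ?_ ?_).mono le_rfl ?_
        · exact hC3.congr fun y hy => by
            rw [Function.update_of_ne (by omega), f5 y (by omega), f4 y (by omega)]
        · have := hr5 35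
          rw [k35] at this
          exact (Nat.size_le_size (Nat.le_succ _)).trans this
        · simp [f5, f4, a2]; ring
        · simp only [ne_eq, Nat.reduceEqDiff, not_false_eq_true, Function.update_of_ne, e5]
          split_ifs <;> omega
        · omega
        · intro q h1 h2
          obtain ⟨b1, b2, b3⟩ := hprep q (by omega) (by omega)
          refine ⟨?_, ?_, ?_⟩
          · rwa [a8 _ (by omega)]
          · rwa [a8 _ (by omega)]
          · rwa [a8 _ (by omega)]
        · intro q h1 h2
          exact hround q (by omega) (by omega)
        · rintro Y ⟨r₆, V₆, rfl, hr6, c1, c2, c3, c4, c5⟩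
          refine ⟨r₆, V₆, rfl, hr6, fun y hy => ?_, c2, c3, fun hbad => ?_, fun y hy => ?_⟩
          · rw [c1 y hy, Function.update_of_ne (by omega), f5 y (by omega), f4 y (by omega), a1 y hy,
              f2 y (by omega), f1 y (by omega)]
          · have h0 := hbad 0 (by omega)
            rw [add_zero] at h0
            rw [c4 fun e he => by
              have := hbad (e + 1) (by omega)
              rwa [show g + (e + 1) = g + 1 + e by ring] at this]
            have hvote : C.h < r₃ 37 ↔ w g = true := by
              cases hw : w g
              · have := a7 hw
                simp; omega
              · have := a6 hw
                simp; omega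
            simp only [ne_eq, Nat.reduceEqDiff, not_false_eq_true, Function.update_of_ne, e5, k38]
            constructor
            · rintro (h | ⟨e, he, h⟩)
              · split_ifs at h with hh
                · exact .inr ⟨0, by omega, by simpa using hvote.1 hh⟩
                · exact .inl h
              · exact .inr ⟨e + 1, by omega, by rwa [show g + (e + 1) = g + 1 + e by ring]⟩
            · rintro (h | ⟨e, he, h⟩)
              · left; split_ifs <;> omega
              · rcases e with _ | e
                · left; rw [if_pos (hvote.2 (by simpa using h))]
                · exact .inr ⟨e, by omega, by rwa [show g + 1 + e = g + (e + 1) by ring]⟩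
          · rw [c5 y (by omega), a8 y (by omega)]
      · simp only [blockCost, Ex.cc_sub, Ex.cc_var, Ex.cc_num,
          Ex.weight_sub, Ex.weight_var, Ex.weight_num]
        omega
    · have := hr 35
      dsimp only
      rw [Nat.succ_mul]
      omega

end

/-! ### Blocks of vectors and matrices -/

/-- The part of length `w` starting at `c₀` of a vector, padded by zeros. -/
def subVec {n : ℕ} (u : Fin n → Bool) (c₀ w : ℕ) : Fin w → Bool :=
  fun z => if h : c₀ + z < n then u ⟨c₀ + z, h⟩ else false

/-- The `w₁ × w₂` block of a matrix with upper left corner `(r₀, c₀)`, padded by zeros. -/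
def subMat {n : ℕ} (M : Matrix (Fin n) (Fin n) Bool) (r₀ c₀ w₁ w₂ : ℕ) :
    Matrix (Fin w₁) (Fin w₂) Bool :=
  fun y z => if h : r₀ + y < n ∧ c₀ + z < n then M ⟨r₀ + y, h.1⟩ ⟨c₀ + z, h.2⟩ else false

theorem vecBlock_eq {n : ℕ} (u : Fin n → Bool) (inp : ℕ → ℕ) (base c₀ w : ℕ)
    (h : ∀ x : Fin n, inp (base + x) = (u x).toNat) :
    vecBlock inp base c₀ w n = bits (subVec u c₀ w) := by
  refine List.ext_getElem (by simp [vecBlock, bits]) fun z hz _ => ?_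
  simp only [vecBlock, List.length_map, List.length_range] at hz
  simp only [vecBlock, bits, List.getElem_map, List.getElem_range, List.getElem_ofFn, blockEntry,
    subVec, Nat.div_eq_of_lt hz, Nat.mod_eq_of_lt hz]
  split_ifs with h1 h2 h2
  · simpa using h ⟨c₀ + z, h2⟩
  · omega
  · omega
  · rfl

theorem map_range_eq_matrixBits {m n : ℕ} (M : Matrix (Fin m) (Fin n) Bool) (f : ℕ → ℕ)
    (h : ∀ (y : Fin m) (z : Fin n), f (y * n + z) = (M y z).toNat) :
    (List.range (m * n)).map f = matrixBits M := by
  have h1 : (List.range (m * n)).map f = List.ofFn fun z : Fin (m * n) => f z :=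
    List.ext_getElem (by simp) fun z _ _ => by simp
  rw [h1, List.ofFn_mul, matrixBits]
  congr 1
  exact congrArg List.ofFn (funext fun y => congrArg List.ofFn (funext fun z => h y z))

theorem matBlock_eq {n : ℕ} (M : Matrix (Fin n) (Fin n) Bool) (inp : ℕ → ℕ) (base r₀ c₀ w₁ w₂ : ℕ)
    (h : ∀ x y : Fin n, inp (base + x * n + y) = (M x y).toNat) :
    (List.range (w₁ * w₂)).map (blockEntry inp base w₂ r₀ c₀ n n) =
      matrixBits (subMat M r₀ c₀ w₁ w₂) := by
  refine map_range_eq_matrixBits _ _ fun y z => ?_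
  have e1 : ((y : ℕ) * w₂ + z) / w₂ = y := by
    rw [mul_comm, Nat.mul_add_div (by have := z.2; omega), Nat.div_eq_of_lt z.2, add_zero]
  have e2 : ((y : ℕ) * w₂ + z) % w₂ = z := by rw [mul_comm, Nat.mul_add_mod, Nat.mod_eq_of_lt z.2]
  simp only [blockEntry, e1, e2, subMat]
  split_ifs with h1
  · exact h ⟨_, h1.1⟩ ⟨_, h1.2⟩
  · rfl

theorem uMv_eq_true {m n : ℕ} (u : Fin m → Bool) (M : Matrix (Fin m) (Fin n) Bool) (v : Fin n → Bool) :
    uMv u M v = true ↔ ∃ i j, u i = true ∧ M i j = true ∧ v j = true := by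
  simp [uMv, and_assoc]

/-- The Boolean product is the disjunction of the products of the blocks. -/
theorem uMv_blocks {n : ℕ} (u v : Fin n → Bool) (M : Matrix (Fin n) (Fin n) Bool) {d₁ d₂ m₁ m₂ : ℕ}
    (hd₁ : 1 ≤ d₁) (hd₂ : 1 ≤ d₂) (hm₁ : n / d₁ < m₁) (hm₂ : n / d₂ < m₂) :
    uMv u M v = true ↔ ∃ i j, i < m₁ ∧ j < m₂ ∧
      uMv (subVec u (i * d₁) d₁) (subMat M (i * d₁) (j * d₂) d₁ d₂) (subVec v (j * d₂) d₂) = true := by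
  simp only [uMv_eq_true]
  constructor
  · rintro ⟨x, y, hu, hM, hv⟩
    have e1 : (x : ℕ) / d₁ * d₁ + x % d₁ = x := Nat.div_add_mod' _ _
    have e2 : (y : ℕ) / d₂ * d₂ + y % d₂ = y := Nat.div_add_mod' _ _
    refine ⟨x / d₁, y / d₂, (Nat.div_le_div_right x.2.le).trans_lt hm₁,
      (Nat.div_le_div_right y.2.le).trans_lt hm₂, ⟨x % d₁, Nat.mod_lt _ hd₁⟩,
      ⟨y % d₂, Nat.mod_lt _ hd₂⟩, ?_, ?_, ?_⟩ <;> simp only [subVec, subMat, e1, e2] <;> simp [hu, hM, hv]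
  · rintro ⟨i, j, _, _, y, z, h1, h2, h3⟩
    simp only [subVec, subMat] at h1 h2 h3
    split_ifs at h1 h2 h3 with a b c
    exact ⟨_, _, h1, h2, h3⟩

/-! ### The online program -/

/-- The online program: one round, after which the result is written to the output. -/
def stepProg (Re Rd As : Prog) : Prog :=
  .seq (roundProg Re Rd As) (.seq (.const 1 1) (.seq (.const 0 0) (.store 1 0 (38 + 10))))

theorem view_input (s : Memory) (l : List ℕ) :
    view (s.input l) = ⟨(view s).reg, (view s).vm, (s.input l).arr 0⟩ := by
  simp only [view, St.mk.injEq, and_true]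
  refine ⟨?_, ?_⟩
  · funext y; simp [Memory.input]
  · funext p
    refine Memory.ext' (fun x => ?_) fun a i => ?_ <;> simp [vmem, Memory.input]

theorem input_arr_zero (s : Memory) (l : List ℕ) (i : ℕ) (h : i < l.length) :
    (s.input l).arr 0 i = l[i] := by simp [Memory.input, h]

theorem encList_pair {n : ℕ} (u v : Fin n → Bool) :
    encList [bits u, bits v] = 2 :: n :: (bits u ++ n :: bits v) := by
  simp [encList, bits]

theorem input_pair {n : ℕ} (s : Memory) (u v : Fin n → Bool) (x : Fin n) :
    (s.input (encList [bits u, bits v])).arr 0 (2 + x) = (u x).toNat ∧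
      (s.input (encList [bits u, bits v])).arr 0 (3 + n + x) = (v x).toNat := by
  have hx := x.2
  have hl : (encList [bits u, bits v]).length = 3 + n + n := by simp [encList, bits]; omega
  constructor
  · rw [input_arr_zero _ _ _ (by omega)]
    simp only [encList_pair, show 2 + (x : ℕ) = x + 1 + 1 by ring, List.getElem_cons_succ]
    rw [List.getElem_append_left (by simp [bits])]
    simp [bits]
  · rw [input_arr_zero _ _ _ (by omega)]
    simp only [encList_pair, show 3 + n + (x : ℕ) = n + x + 1 + 1 + 1 by ring, List.getElem_cons_succ]
    rw [List.getElem_append_right (by simp [bits]; omega)]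
    simp [bits, show n + (x : ℕ) + 1 - n = x + 1 by omega]

/-- A bound for the cost of `stepProg`. -/
def stepProgCost (A lam X E rep : ℕ) : ℕ := E * (blockCost A lam X rep + 1 + lam) + 100 * lam

/-- The memory of the host before a round, when the pairs of machines number `g * rep` and higher have
not been used. -/
def Ready (lam : ℕ) (C : Params) (s₀ sA : ℕ → Memory) (NB g : ℕ) (s : Memory) : Prop :=
  C.Holds (view s).reg ∧ RegBd lam (view s).reg ∧ (view s).reg 30 = g * C.rep ∧
    ∀ q, g * C.rep ≤ q → q < NB → Prepared lam s₀ sA (view s).vm q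

section

variable {Re Rd As : Prog} {A lam X W NB : ℕ} {C : Params} {ω : ℕ → Bool}
  {s₀ sA : ℕ → Memory} {good : ℕ → Prop} {w : ℕ → Bool}

/-- One round. The pairs of machines that belong to later rounds are left untouched, so they remain
ready. -/
theorem call_stepProg (hcl : ClockSpec A Re Rd) {s : Memory} {l : List ℕ}
    (hb : RoundBounds A lam X W NB C ((s.input l).arr 0)) {g : ℕ}
    (hs : Ready lam C s₀ sA NB g s) (hNB : (g + C.nb1 * C.nb2) * C.rep ≤ NB)
    (hround : ∀ q, g * C.rep ≤ q → q < (g + C.nb1 * C.nb2) * C.rep →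
        RoundSpec Re Rd As (coins ω (2 * q + 1)) (coins ω (2 * q + 2)) (s₀ q) (sA q)
          (vecBlock ((s.input l).arr 0) 2 (C.rowOf q * C.d1) C.d1 C.n)
          (vecBlock ((s.input l).arr 0) (3 + C.n) (C.colOf q * C.d) C.d C.n)
          C.F2 C.F3 W (good q) (w (q / C.rep))) :
    ∃ s' o c, Call ω (stepProg Re Rd As) s l s' [o] c ∧
      c ≤ listCost l + stepProgCost A lam X (C.nb1 * C.nb2) C.rep ∧
      Ready lam C s₀ sA NB (g + C.nb1 * C.nb2) s' ∧ o ≤ 1 ∧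
      ((∀ e, e < C.nb1 * C.nb2 → badCount good ((g + e) * C.rep) C.rep < C.h) →
        (o = 1 ↔ ∃ e, e < C.nb1 * C.nb2 ∧ w (g + e) = true)) := by
  obtain ⟨hC, hr, h30, hprep⟩ := hs
  have hlam := hb.hlam
  have main : ARuns ω (roundProg Re Rd As) ⟨(view s).reg, (view s).vm, (s.input l).arr 0⟩
      (C.nb1 * C.nb2 * (blockCost A lam X C.rep + 1 + lam) + 50 * lam) fun Y =>
      C.Holds Y.reg ∧ RegBd lam Y.reg ∧ Y.reg 30 = (g + C.nb1 * C.nb2) * C.rep ∧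
        (∀ q, (g + C.nb1 * C.nb2) * C.rep ≤ q → q < NB → Prepared lam s₀ sA Y.vm q) ∧
        Y.reg 38 ≤ 1 ∧ ((∀ e, e < C.nb1 * C.nb2 → badCount good ((g + e) * C.rep) C.rep < C.h) →
        (Y.reg 38 = 1 ↔ ∃ e, e < C.nb1 * C.nb2 ∧ w (g + e) = true)) := by
    refine ARuns.assign_seq (v := 0) hlam hr (by simp) (by simp) (by simp) fun r₁ e1 f1 hr1 => ?_
    refine ARuns.assign_seq (v := C.nb1 * C.nb2) hlam hr1 (by simp) (by simp [f1, hC.h47, hC.h48])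
      hb.hBl fun r₂ e2 f2 hr2 => ?_
    have hC2 : C.Holds r₂ := hC.congr fun y hy => by rw [f2 y (by omega), f1 y (by omega)]
    refine (ARuns.blockLoop (good := good) (w := w) hcl hb (C.nb1 * C.nb2) r₂ (view s).vm g hC2 hr2
      (by rw [f2 _ (by omega), f1 _ (by omega), h30]) e2
      (by rw [f2 _ (by omega), e1]; omega) hNB (fun q h1 h2 => hprep q h1 (by omega)) hround).mono ?_ ?_
    · simp only [Ex.cc_mul, Ex.cc_var, Ex.cc_num, Ex.weight_mul, Ex.weight_var, Ex.weight_num]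
      omega
    rintro Y ⟨r', V', rfl, hr', a1, a2, a3, a4, a5⟩
    refine ⟨hC2.congr a1, hr', a2, fun q h1 h2 => ?_, a3, fun hbad => ?_⟩
    · obtain ⟨b1, b2, b3⟩ := hprep q (le_trans (Nat.mul_le_mul_right _ (by omega)) h1) h2
      refine ⟨?_, ?_, ?_⟩
      · dsimp only; rwa [a5 _ (by omega)]
      · dsimp only; rwa [a5 _ (by omega)]
      · dsimp only; rwa [a5 _ (by omega)]
    · have := a4 hbad
      rw [f2 _ (by omega), e1] at this
      simpa using this
  obtain ⟨s₁, c₁, hex, hc₁, b1, b2, b3, b4, b5, b6⟩ := main (s.input l) (view_input s l)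
  have hb38 : (s₁.var 48).size ≤ lam := b2 38
  have hrun : Runs ω (.seq (.const 1 1) (.seq (.const 0 0) (.store 1 0 (38 + 10)))) s₁ (4 + lam)
      fun s' => s'.output = [s₁.var 48] ∧ view s' = view s₁ := by
    refine (Runs.seq (Runs.const (Runs.seq (Runs.const (Runs.store ⟨?_, ?_⟩))))).cost_le ?_
    · simp only [Memory.setVar_var]
      norm_num
      omega
    · simp [Memory.output, Memory.setArr_arr]
    · simp only [view, St.mk.injEq]
      refine ⟨funext fun y => by simp, funext fun p => ?_, ?_⟩
      · refine Memory.ext' (fun x => ?_) fun a i => ?_ <;>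
          simp only [vmem] <;> rw [Memory.setArr_arr_of_ne _ _ _ _ _ (by omega)] <;> rfl
      · rw [Memory.setArr_arr_of_ne _ _ _ _ _ (by omega)]; rfl
  obtain ⟨s₂, c₂, hex₂, hc₂, hout, hview⟩ := hrun
  have hsz : s₁.var 48 ≤ 1 := b5
  refine ⟨s₂, s₁.var 48, _, ⟨_, hex.seq hex₂, hout.symm, rfl⟩, ?_, ?_, b5, b6⟩
  · have : (s₁.var 48).size ≤ 1 := (Nat.size_le_size hsz).trans (by simp)
    simp only [listCost_cons, listCost_nil, stepProgCost]
    omega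
  · rw [Ready, hview]
    exact ⟨b1, b2, b3, b4⟩

/-- All rounds. The outputs are correct if in every round and for every block less than half of the
pairs of machines fail. -/
theorem callSeq_stepProg (hcl : ClockSpec A Re Rd) (U V : ℕ → Fin C.n → Bool) (N : ℕ) :
    ∀ (k : ℕ) (s : Memory), (k + N) * (C.nb1 * C.nb2) * C.rep ≤ NB →
      Ready lam C s₀ sA NB (k * (C.nb1 * C.nb2)) s →
      (∀ inp : ℕ → ℕ, (∀ x : Fin C.n, inp (2 + x) ≤ 1 ∧ inp (3 + C.n + x) ≤ 1) →
        RoundBounds A lam X W NB C inp) →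
      (∀ k' < k + N, ∀ e < C.nb1 * C.nb2, ∀ x < C.rep, ∀ q,
        q = (k' * (C.nb1 * C.nb2) + e) * C.rep + x →
        RoundSpec Re Rd As (coins ω (2 * q + 1)) (coins ω (2 * q + 2)) (s₀ q) (sA q)
          (bits (subVec (U k') (C.rowOf q * C.d1) C.d1)) (bits (subVec (V k') (C.colOf q * C.d) C.d))
          C.F2 C.F3 W (good q) (w (k' * (C.nb1 * C.nb2) + e))) →
      ∃ s' os c, CallSeq ω (stepProg Re Rd As) s
          ((List.range' k N).map fun k => encList [bits (U k), bits (V k)]) s' os c ∧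
        c ≤ N * (6 * C.n + 10 * lam + stepProgCost A lam X (C.nb1 * C.nb2) C.rep) ∧
        ((∀ g, g < (k + N) * (C.nb1 * C.nb2) → badCount good (g * C.rep) C.rep < C.h) →
          ∀ b : ℕ → Bool, (∀ k' < k + N, b k' = true ↔
            ∃ e, e < C.nb1 * C.nb2 ∧ w (k' * (C.nb1 * C.nb2) + e) = true) →
          os = (List.range' k N).map fun k => [(b k).toNat]) := by
  induction N with
  | zero =>
    intro k s _ _ _ _
    exact ⟨s, [], 0, .nil s, by omega, fun _ _ _ => rfl⟩
  | succ N ih =>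
    intro k s hNB hs hb hround
    set E := C.nb1 * C.nb2 with hE
    have hlen : ∀ u : Fin C.n → Bool, listCost (bits u) ≤ 2 * C.n := fun u => by
      have : ∀ m (f : Fin m → Bool), listCost (bits f) ≤ 2 * m := by
        intro m
        induction m with
        | zero => intro f; simp [bits, listCost_nil]
        | succ m ihm =>
          intro f
          have := ihm fun i => f i.succ
          simp only [bits, List.ofFn_succ, listCost_cons] at this ⊢
          have : (f 0).toNat.size ≤ 1 := by cases f 0 <;> simp
          omega
      exact this _ u
    have hinp : RoundBounds A lam X W NB C ((s.input (encList [bits (U k), bits (V k)])).arr 0) :=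
      hb _ fun x => by
        rw [(input_pair s (U k) (V k) x).1, (input_pair s (U k) (V k) x).2]
        exact ⟨Bool.toNat_le _, Bool.toNat_le _⟩
    have e1 : k * E + E = (k + 1) * E := by ring
    have hrep1 : 1 ≤ C.rep := by have := hinp.hh; simp only [Params.rep]; omega
    obtain ⟨s', o, c, hcall, hc, hs', ho, hgood⟩ := call_stepProg (As := As) (good := good) (w := w)
      (g := k * E) hcl hinp hs
      (by
        rw [← hE, e1]
        exact le_trans (Nat.mul_le_mul_right _ (Nat.mul_le_mul_right _ (by omega))) hNB)
      (fun q h1 h2 => by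
        rw [vecBlock_eq (U k) _ _ _ _ fun x => (input_pair s (U k) (V k) x).1,
          vecBlock_eq (V k) _ _ _ _ fun x => (input_pair s (U k) (V k) x).2]
        have hq : q = q / C.rep * C.rep + q % C.rep := (Nat.div_add_mod' _ _).symm
        have h3 : k * E ≤ q / C.rep := (Nat.le_div_iff_mul_le hrep1).2 h1
        have h4 : q / C.rep < k * E + E := (Nat.div_lt_iff_lt_mul hrep1).2 h2
        have := hround k (by omega) (q / C.rep - k * E) (by omega) (q % C.rep)
          (Nat.mod_lt _ hrep1) q (by rw [Nat.add_sub_cancel' h3]; exact hq)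
        rwa [Nat.add_sub_cancel' h3] at this)
    rw [← hE, e1] at hs'
    rw [← hE] at hc
    obtain ⟨s'', os, c', hseq, hc', hos⟩ := ih (k + 1) s' (by rw [add_assoc, add_comm 1]; exact hNB) hs' hb
      (fun k' hk' => hround k' (by omega))
    refine ⟨s'', [o] :: os, c + c', ?_, ?_, fun hbad b hbk => ?_⟩
    · rw [List.range'_succ, List.map_cons]
      exact .cons hcall hseq
    · have h1 := hlen (U k)
      have h2 := hlen (V k)
      have h3 : listCost (encList [bits (U k), bits (V k)]) ≤ 4 * C.n + 2 * C.n.size + 10 := by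
        rw [encList_pair]
        simp only [listCost_cons, listCost_append]
        have : Nat.size 2 = 2 := by decide
        omega
      have h4 := size_le_self C.n
      have h5 := hinp.hlam
      rw [Nat.succ_mul]
      omega
    · rw [List.range'_succ, List.map_cons, hos (fun g hg => hbad g (by
        rwa [add_assoc, add_comm 1] at hg)) b fun k' hk' => hbk k' (by omega)]
      congr 2
      have h1 := hgood fun e he => hbad _ (by
        have : (k + 1) * E ≤ (k + (N + 1)) * E := Nat.mul_le_mul_right _ (by omega)
        omega)
      rw [← hE, ← hbk k (by omega)] at h1
      cases hbv : b k <;> simp [hbv] at h1 ⊢ <;> omega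

end

/-! ### The preprocessing program -/

/-- Prepares the pair of machines whose number is by one smaller than register `39`, and decrements
that register. -/
def prepBody (Rp Ap : Prog) : Prog :=
  .seq (assign 30 (.var 39 - .num 1))
  (.seq (assign 31 (.num 2 * .var 30 + .num 1))
  (.seq (assign 32 (.num 2 * .var 30 + .num 2))
  (.seq (assign 0 (.var 30 / .var 49))
  (.seq (assign 1 (.var 0 / .var 48))
  (.seq (assign 33 (.var 1 - .var 1 / .var 47 * .var 47))
  (.seq (assign 34 (.var 0 - .var 0 / .var 48 * .var 48))
  (.seq (preJob Rp Ap)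
  (assign 39 (.var 39 - .num 1)))))))))

/-- The preprocessing of one pair of machines succeeds: the reduction produces a data structure `D`,
which is passed, with the header and the `tail` of the prediction, to the dynamic algorithm. -/
def PrepSpec (Rp Ap : Prog) (ωR ωA : ℕ → Bool) (s₀ sA : Memory) (C : Params) (blk tail : List ℕ)
    (W : ℕ) : Prop :=
  ∃ D c₀ oA cA, Call ωR Rp Memory.blank (encList [[C.d1, C.d, C.n3], blk]) s₀ D c₀ ∧ 4 * c₀ < C.F1 ∧
    Call ωA Ap Memory.blank ((2 + C.L) :: 1 :: C.δ :: D.length :: D ++ tail) sA oA cA ∧ cA ≤ W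

/-- Bounds that hold in the preprocessing. -/
structure PrepBounds (A lam X W NB : ℕ) (C : Params) (tail : List ℕ) (inp : ℕ → ℕ) : Prop where
  hA : A ≤ lam
  hlam : 1 ≤ lam
  hX : C.d1 * C.d + 2 * C.F1 + listCost tail + W + 1 ≤ X
  hinp : ∀ i j, i < C.n → j < C.n → (inp (4 + i * C.n + j)).size ≤ lam
  hXl : (4 * X + C.L + C.δ + C.ts + C.n * C.n + C.nb1 * C.d1 + C.nb2 * C.d + 10).size + 5 ≤ lam
  hNB : (2 * NB + 2).size ≤ lam

section

variable {Rp Ap : Prog} {A lam X W NB : ℕ} {C : Params} {ω : ℕ → Bool} {inp : ℕ → ℕ}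
  {s₀ sA : ℕ → Memory} {tail : List ℕ}

theorem ARuns.prepBody
    (hcl : ∀ ω lam τ F l, A ≤ lam → Shadowed lam τ → (F + listCost l + 1).size + 5 ≤ lam →
      ∃ τ' c, Exec ω (rcall Rp) (τ.input (F :: l)) τ' c ∧ Shadowed lam τ' ∧
        c ≤ A * (lam * (F + listCost l + 1)) ∧ τ'.var 10 ≤ F ∧
        ∀ σ' c₀, Exec ω Rp ((inner τ).input l) σ' c₀ → 4 * c₀ < F →
          inner τ' = σ' ∧ F ≤ τ'.var 10 + 4 * c₀)
    (hb : PrepBounds A lam X W NB C tail inp) {r : ℕ → ℕ} {V : ℕ → Memory} {p : ℕ}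
    (hC : C.Holds r) (htl : C.tl = tail.length) (hr : RegBd lam r) (h39 : r 39 = p + 1) (hp : p < NB)
    (hR : V (2 * p + 1) = Memory.blank) (hVA : V (2 * p + 2) = Memory.blank)
    (htail : ∀ x (h : x < tail.length), (V 0).arr 1 (C.ts + x) = tail[x])
    (hspec : PrepSpec Rp Ap (coins ω (2 * p + 1)) (coins ω (2 * p + 2)) (s₀ p) (sA p) C
      ((List.range (C.d1 * C.d)).map
        (blockEntry inp 4 C.d (C.rowOf p * C.d1) (C.colOf p * C.d) C.n C.n)) tail W) :
    ARuns ω (DynPred.prepBody Rp Ap) ⟨r, V, inp⟩ (preJobCost A lam X + 200 * lam) fun Y =>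
      ∃ r' V', Y = ⟨r', V', inp⟩ ∧ RegBd lam r' ∧ (∀ y, 40 ≤ y → r' y = r y) ∧ r' 39 = p ∧
        Prepared lam s₀ sA V' p ∧ ∀ y, y ≠ 2 * p + 1 → y ≠ 2 * p + 2 → V' y = V y := by
  obtain ⟨D, c₀, oA, cA, hpre, hF, hApre, hcA⟩ := hspec
  have hlam := hb.hlam
  have hX := hb.hX
  have hz : ∀ a, a ≤ 2 * NB + 2 → a.size ≤ lam := fun a ha => (Nat.size_le_size ha).trans hb.hNB
  have hid : C.rowOf p * C.d1 ≤ C.nb1 * C.d1 := Nat.mul_le_mul_right _ (C.rowOf_lt p).le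
  have hjd : C.colOf p * C.d ≤ C.nb2 * C.d := Nat.mul_le_mul_right _ (C.colOf_lt p).le
  have hd1 : p / C.rep ≤ p := Nat.div_le_self _ _
  have hd2 : p / C.rep / C.nb2 ≤ p / C.rep := Nat.div_le_self _ _
  have hil : C.rowOf p ≤ p := (Nat.mod_le _ _).trans (hd2.trans hd1)
  have hjl : C.colOf p ≤ p := (Nat.mod_le _ _).trans hd1
  refine ARuns.assign_seq (v := p) hlam hr (by simp) (by simp [h39]) (hz _ (by omega))
    fun r₀ e0 f0 hr0 => ?_
  refine ARuns.assign_seq (v := 2 * p + 1) hlam hr0 (by simp) (by simp [e0]) (hz _ (by omega))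
    fun r₁ e1 f1 hr1 => ?_
  refine ARuns.assign_seq (v := 2 * p + 2) hlam hr1 (by simp) (by simp [f1, e0]) (hz _ (by omega))
    fun r₂ e2 f2 hr2 => ?_
  refine ARuns.assign_seq (v := p / C.rep) hlam hr2 (by simp) (by simp [f2, f1, f0, e0, hC.h49])
    (hz _ (by omega)) fun r₃ e3 f3 hr3 => ?_
  refine ARuns.assign_seq (v := p / C.rep / C.nb2) hlam hr3 (by simp)
    (by simp [e3, f3, f2, f1, f0, hC.h48])
    (hz _ (by omega)) fun r₄ e4 f4 hr4 => ?_
  refine ARuns.assign_seq (v := C.rowOf p) hlam hr4 (by simp)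
    (by simp [e4, f4, f3, f2, f1, f0, hC.h47, sub_div_mul_self_eq_mod, Params.rowOf])
    (hz _ (by omega)) fun r₅ e5 f5 hr5 => ?_
  refine ARuns.assign_seq (v := C.colOf p) hlam hr5 (by simp)
    (by simp [e3, f5, f4, f3, f2, f1, f0, hC.h48, sub_div_mul_self_eq_mod, Params.colOf])
    (hz _ (by omega)) fun r₆ e6 f6 hr6 => ?_
  have g6 : ∀ y, 35 ≤ y → r₆ y = r y := fun y hy => by
    rw [f6 y (by omega), f5 y (by omega), f4 y (by omega), f3 y (by omega), f2 y (by omega),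
      f1 y (by omega), f0 y (by omega)]
  have hC6 : C.Holds r₆ := hC.congr fun y hy => g6 y (by omega)
  refine ARuns.sub_seq ((ARuns.preJob (X := X) (kR := 2 * p + 1) (kA := 2 * p + 2)
    (i := C.rowOf p) (j := C.colOf p) (s₀ := s₀ p) (sA := sA p) (tail := tail)
    hcl hb.hA hlam hr6
    (by simp [f6, f5, f4, f3, f2, e1]) (by simp [f6, f5, f4, f3, e2]) (by simp [f6, e5]) e6
    hC6.h40 hC6.h41 hC6.h42 hC6.h43 hC6.h44 hC6.h45 (by rw [hC6.h46, htl]) hC6.h52 hC6.h53 hC6.h57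
    hR hVA (by omega) (by omega) (by omega) htail hpre hF hApre (by omega) (by omega) (by omega)
    (by omega) hb.hinp ?_).mono le_rfl ?_)
  · exact (Nat.add_le_add_right (Nat.size_le_size (by omega)) 5).trans hb.hXl
  rintro Y ⟨r₇, V₇, rfl, hr7, f7, a1, a2, a3, a4⟩
  have k39 : (Ex.var 39 - Ex.num 1).eval r₇ = p := by simp [f7, g6, h39]
  refine (ARuns.assign hlam hr7 (by simp) ⟨_, V₇, rfl, hr7.update ?_, fun y hy => ?_, ?_,
    ⟨a1, a2, a3⟩, a4⟩).cost_le ?_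
  · simp only [Ex.cc_add, Ex.cc_mul, Ex.cc_sub, Ex.cc_div, Ex.cc_var, Ex.cc_num,
      Ex.weight_add, Ex.weight_mul, Ex.weight_sub, Ex.weight_div, Ex.weight_var, Ex.weight_num]
    omega
  · exact k39 ▸ hz _ (by omega)
  · dsimp only
    rw [Function.update_of_ne (by omega), f7 y (by omega), g6 y (by omega)]
  · simp [k39]

theorem ARuns.prepLoop
    (hcl : ∀ ω lam τ F l, A ≤ lam → Shadowed lam τ → (F + listCost l + 1).size + 5 ≤ lam →
      ∃ τ' c, Exec ω (rcall Rp) (τ.input (F :: l)) τ' c ∧ Shadowed lam τ' ∧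
        c ≤ A * (lam * (F + listCost l + 1)) ∧ τ'.var 10 ≤ F ∧
        ∀ σ' c₀, Exec ω Rp ((inner τ).input l) σ' c₀ → 4 * c₀ < F →
          inner τ' = σ' ∧ F ≤ τ'.var 10 + 4 * c₀)
    (hb : PrepBounds A lam X W NB C tail inp) (htl : C.tl = tail.length) (N : ℕ) :
    ∀ (r : ℕ → ℕ) (V : ℕ → Memory), C.Holds r → RegBd lam r → r 39 = N → N ≤ NB →
      (∀ y, 1 ≤ y → y ≤ 2 * N → V y = Memory.blank) →
      (∀ x (h : x < tail.length), (V 0).arr 1 (C.ts + x) = tail[x]) →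
      (∀ p < N, PrepSpec Rp Ap (coins ω (2 * p + 1)) (coins ω (2 * p + 2)) (s₀ p) (sA p) C
        ((List.range (C.d1 * C.d)).map
          (blockEntry inp 4 C.d (C.rowOf p * C.d1) (C.colOf p * C.d) C.n C.n)) tail W) →
    ARuns ω (.loop (39 + 10) (DynPred.prepBody Rp Ap)) ⟨r, V, inp⟩
      (N * (preJobCost A lam X + 202 * lam) + 1) fun Y =>
      ∃ r' V', Y = ⟨r', V', inp⟩ ∧ RegBd lam r' ∧ (∀ y, 40 ≤ y → r' y = r y) ∧
        (∀ p < N, Prepared lam s₀ sA V' p) ∧ ∀ y, 2 * N < y → V' y = V y := by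
  have hlam := hb.hlam
  induction N with
  | zero =>
    intro r V hC hr h39 _ _ _ _
    exact (ARuns.loop_done h39 ⟨r, V, rfl, hr, fun _ _ => rfl, by simp,
      fun _ _ => rfl⟩).cost_le (by omega)
  | succ N ih =>
    intro r V hC hr h39 hN hblank htail hspec
    refine (ARuns.loop_step (by dsimp only; omega) ((ARuns.prepBody hcl hb hC htl hr h39 hN
      (hblank _ (by omega) (by omega)) (hblank _ (by omega) (by omega)) htail
      (hspec N (by omega))).mono le_rfl ?_)).cost_le
      (b := 1 + (r 39).size + (preJobCost A lam X + 200 * lam) + (N * (preJobCost A lam X + 202 * lam) + 1)) ?_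
    · rintro Y ⟨r', V', rfl, hr', a1, a2, a3, a4⟩
      refine (ih r' V' (hC.congr a1) hr' a2 (by omega) (fun y h1 h2 => ?_) (fun x h => ?_)
        fun p hp => hspec p (by omega)).mono le_rfl ?_
      · rw [a4 _ (by omega) (by omega), hblank _ (by omega) (by omega)]
      · rw [a4 _ (by omega) (by omega), htail x h]
      · rintro Y ⟨r'', V'', rfl, hr'', b1, b2, b3⟩
        refine ⟨r'', V'', rfl, hr'', fun y hy => (b1 y hy).trans (a1 y hy), fun p hp => ?_,
          fun y hy => ?_⟩
        · rcases Nat.lt_succ_iff_lt_or_eq.1 hp with h | rfl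
          · exact b2 p h
          · obtain ⟨c1, c2, c3⟩ := a3
            refine ⟨?_, ?_, ?_⟩ <;> rwa [b3 _ (by omega)]
        · rw [b3 y (by omega), a4 y (by omega) (by omega)]
    · have := hr 39
      rw [Nat.succ_mul N]
      omega

/-- Counts the register `41` down to the `κ`-th root of the register `40`, rounded down. -/
def rootLoop (κ : ℕ) : Prog :=
  .loop (0 + 10) (.seq (assign 41 (.var 41 - .num 1)) (assign 0 ((Ex.var 41).pow κ - .var 40)))

/-- The cost of the assignment `x := e` is at most `e.cost * lam` if all registers have size at most `lam`. -/
def Ex.cost (e : Ex) : ℕ := e.cc + e.weight + 2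

theorem ARuns.rootLoop {κ n d : ℕ} {V : ℕ → Memory} (hlam : 1 ≤ lam) (h1 : d ^ κ ≤ n)
    (h2 : n < (d + 1) ^ κ) (k : ℕ) :
    ∀ r, RegBd lam r → r 40 = n → r 41 = d + k → r 0 = (d + k) ^ κ - n → ((d + k) ^ κ).size ≤ lam →
      ARuns ω (DynPred.rootLoop κ) ⟨r, V, inp⟩
        (k * (((Ex.var 41).pow κ - .var 40).cost * lam + 20 * lam) + 1) fun Y =>
        ∃ r', Y = ⟨r', V, inp⟩ ∧ RegBd lam r' ∧ r' 41 = d ∧ ∀ y, y ≠ 0 → y ≠ 41 → r' y = r y := by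
  induction k with
  | zero =>
    intro r hr h40 h41 h0 _
    exact (ARuns.loop_done (by dsimp only; rw [h0, add_zero]; omega)
      ⟨r, rfl, hr, h41, fun _ _ _ => rfl⟩).cost_le (by omega)
  | succ k ih =>
    intro r hr h40 h41 h0 hsz
    have hgt : n < (d + (k + 1)) ^ κ := h2.trans_le (Nat.pow_le_pow_left (by omega) _)
    have hsz' : ((d + k) ^ κ).size ≤ lam :=
      (Nat.size_le_size (Nat.pow_le_pow_left (by omega) _)).trans hsz
    refine (ARuns.loop_step (b := ((Ex.var 41).pow κ - .var 40).cost * lam + 15 * lam)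
      (b' := k * (((Ex.var 41).pow κ - .var 40).cost * lam + 20 * lam) + 1)
      (by dsimp only; omega) ?_).cost_le ?_
    · have hsz1 : (d + k).size ≤ lam := by
        have := hr 41
        rw [h41] at this
        exact (Nat.size_le_size (by omega)).trans this
      refine ARuns.assign_seq (v := d + k) hlam hr (by simp) (by simp [h41]) hsz1
        fun r₁ e1 f1 hr1 => ?_
      have he : ((Ex.var 41).pow κ - .var 40).eval r₁ = (d + k) ^ κ - n := by simp [e1, f1, h40]
      refine (ARuns.assign hlam hr1 ?_ ?_).cost_le ?_
      · have := Ex.depth_pow_le (.var 41) κ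
        simp only [Ex.depth_sub, Ex.depth_var] at this ⊢
        omega
      · simp only [he]
        refine (ih _ (hr1.update ((Nat.size_le_size (Nat.sub_le _ _)).trans hsz')) ?_ ?_ ?_ hsz').mono
          le_rfl ?_
        · simp [f1, h40]
        · simp [e1]
        · simp
        · rintro Y ⟨r', rfl, hr', b1, b2⟩
          exact ⟨r', rfl, hr', b1, fun y h1 h2 => by
            rw [b2 y h1 h2, Function.update_of_ne h1, f1 y h2]⟩
      · change ((Ex.var 41).pow κ - .var 40).cost * lam ≤ _ - (3 + 2 + 1 + 1 + 1 + (1 + 1 + 1) + 2) * lam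
        omega
    · have := hr 0
      dsimp only
      rw [Nat.succ_mul k]
      omega

/-- Adds the size of the register `0` to the register `51`, by halving. -/
def sizeLoop : Prog :=
  .loop (0 + 10) (.seq (assign 51 (.var 51 + .num 1)) (assign 0 (.var 0 / .num 2)))

theorem size_div_two {x : ℕ} (hx : x ≠ 0) : x.size = (x / 2).size + 1 := by
  conv_lhs => rw [← Nat.bit_bodd_div2 x]
  rw [Nat.size_bit (by rwa [Nat.bit_bodd_div2]), Nat.div2_val]

theorem ARuns.sizeLoop {V : ℕ → Memory} (hlam : 1 ≤ lam) (N : ℕ) :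
    ∀ x a r, x.size = N → RegBd lam r → r 0 = x → r 51 = a → (a + N).size ≤ lam →
      ARuns ω DynPred.sizeLoop ⟨r, V, inp⟩ (N * (40 * lam) + 1) fun Y =>
        ∃ r', Y = ⟨r', V, inp⟩ ∧ RegBd lam r' ∧ r' 51 = a + N ∧ ∀ y, y ≠ 0 → y ≠ 51 → r' y = r y := by
  induction N with
  | zero =>
    intro x a r hx hr h0 h51 _
    rw [Nat.size_eq_zero] at hx
    exact (ARuns.loop_done (by dsimp only; rw [h0, hx]) ⟨r, rfl, hr, h51, fun _ _ _ => rfl⟩).cost_le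
      (by omega)
  | succ N ih =>
    intro x a r hx hr h0 h51 hsz
    have hx0 : x ≠ 0 := by rintro rfl; simp at hx
    have hx2 := size_div_two hx0
    refine (ARuns.loop_step (b := 30 * lam) (b' := N * (40 * lam) + 1)
      (by dsimp only; omega) ?_).cost_le ?_
    · refine ARuns.assign_seq (v := a + 1) hlam hr (by simp) (by simp [h51])
        ((Nat.size_le_size (by omega)).trans hsz) fun r₁ e1 f1 hr1 => ?_
      have he : (Ex.var 0 / Ex.num 2).eval r₁ = x / 2 := by simp [f1, h0]
      refine (ARuns.assign hlam hr1 (by simp) ?_).cost_le ?_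
      · simp only [he]
        refine (ih (x / 2) (a + 1) _ (by omega) (hr1.update ?_) (by simp) (by simp [e1]) ?_).mono
          le_rfl ?_
        · have := hr 0
          rw [h0] at this
          omega
        · rwa [add_assoc, add_comm 1]
        · rintro Y ⟨r', rfl, hr', b1, b2⟩
          exact ⟨r', rfl, hr', by omega, fun y h1 h2 => by
            rw [b2 y h1 h2, Function.update_of_ne h1, f1 y h2]⟩
      · simp only [Ex.cc_add, Ex.cc_div, Ex.cc_var, Ex.cc_num, Ex.weight_add, Ex.weight_div,
          Ex.weight_var, Ex.weight_num]
        omega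
    · have := hr 0
      dsimp only
      rw [Nat.succ_mul N]
      omega

end

/-- Fuel for the preprocessing of the reduction: more than four times the time that it is allowed. -/
def fuel1 (K : ℕ) : Ex := .num (4 * K) * Ex.pow (.var 41 + .var 44) K + .num 1

/-- Fuel for the encoding of one round. The logarithm in the time bound is replaced by `c₁` times the
size of the matrix dimension, which is computed in register `51`. -/
def fuel2 (K c₁ : ℕ) : Ex :=
  .num (4 * K) * (.var 43 + .var 42 + .var 41) * Ex.pow (.num c₁ * .var 51) K + .num 1

/-- Fuel for the decoding of one round, including the additional fuel that `exists_rdec` asks for. -/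
def fuel3 (K c₁ : ℕ) : Ex := .num (4 * K) * (.var 43 + .num 1) * Ex.pow (.num c₁ * .var 51) K + .num 25

/-- The end of the preprocessing: the remaining parameters are computed and all pairs of machines are
prepared. -/
def prepTail (K cyc c₁ : ℕ) (Rp Ap : Prog) : Prog :=
  .seq (assign 52 (.num (1 + cyc) * .var 43))
  (.seq (assign 47 (.var 40 / .var 42 + .num 1))
  (.seq (assign 48 (.var 40 / .var 41 + .num 1))
  (.seq (assign 51 (.num 0))
  (.seq (assign 0 (.var 40))
  (.seq sizeLoop
  (.seq (assign 50 (.num 60 * .var 51))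
  (.seq (assign 49 (.num 2 * .var 50))
  (.seq (assign 53 (fuel1 K))
  (.seq (assign 54 (fuel2 K c₁))
  (.seq (assign 55 (fuel3 K c₁))
  (.seq (assign 39 (.var 40 * .var 47 * .var 48 * .var 49))
  (.seq (.loop (39 + 10) (prepBody Rp Ap))
  (assign 30 (.num 0))))))))))))))

/-- The preprocessing program, without output: the block width is the `κ`-th root of the input size;
`univ` is run for this width, and `post` extracts the parameters from its result. -/
def prepMain (κ K cyc c₁ : ℕ) (univ post Rp Ap : Prog) : Prog :=
  .seq (readInp 40 (.num 2))
  (.seq (assign 41 (.var 40))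
  (.seq (assign 0 ((Ex.var 41).pow κ - .var 40))
  (.seq (rootLoop κ)
  (.seq (assign 10 (.num 0))
  (.seq (pushEs 57 10 [.var 41])
  (.seq (setLen 57 10)
  (.seq (sim 57 univ)
  (.seq post (prepTail K cyc c₁ Rp Ap)))))))))

/-- The preprocessing program. -/
def preProg (κ K cyc c₁ : ℕ) (univ post Rp Ap : Prog) : Prog :=
  .seq (prepMain κ K cyc c₁ univ post Rp Ap) (.const 1 0)

/-- The parameters are those computed by the preprocessing. -/
structure Params.Computed (K cyc c₁ : ℕ) (C : Params) : Prop where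
  hδ : C.δ = (1 + cyc) * C.L
  hh : C.h = 60 * C.n.size
  h1 : C.F1 = 4 * K * (C.d + C.n3) ^ K + 1
  h2 : C.F2 = 4 * K * (C.L + C.d1 + C.d) * (c₁ * C.n.size) ^ K + 1
  h3 : C.F3 = 4 * K * (C.L + 1) * (c₁ * C.n.size) ^ K + 25

/-- The program `post` computes the parameters of the block `tail` of requests, which is contained in
the output array of the memory `σ`. -/
structure PostSpec (post : Prog) (pc lam : ℕ) (C : Params) (σ : Memory) (tail : List ℕ) : Prop where
  htl : C.tl = tail.length
  htail : ∀ x (h : x < tail.length), σ.arr 1 (C.ts + x) = tail[x]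
  run : ∀ ω r V inp, RegBd lam r → r 57 = 0 → V 0 = σ → ARuns ω post ⟨r, V, inp⟩ (pc * lam) fun Y =>
    ∃ r', Y = ⟨r', V, inp⟩ ∧ RegBd lam r' ∧ r' 42 = C.d1 ∧ r' 43 = C.L ∧ r' 44 = C.n3 ∧
      r' 45 = C.ts ∧ r' 46 = C.tl ∧ r' 40 = r 40 ∧ r' 41 = r 41 ∧ r' 57 = r 57

/-- A bound for the cost of `prepTail`. -/
def prepTailCost (A lam X NB n K cyc c₁ : ℕ) : ℕ :=
  ((fuel1 K).cost + (fuel2 K c₁).cost + (fuel3 K c₁).cost + 3 * cyc + 500) * lam +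
    n.size * (40 * lam) + NB * (preJobCost A lam X + 202 * lam)

section

variable {univ post Rp Ap : Prog} {A lam X W NB K cyc c₁ : ℕ} {C : Params} {ω : ℕ → Bool}
  {inp : ℕ → ℕ} {s₀ sA : ℕ → Memory} {tail : List ℕ}

/-- The machines are still blank before, apart from machine `0`, whose output array contains the
prediction. -/
theorem ARuns.prepTail
    (hcl : ∀ ω lam τ F l, A ≤ lam → Shadowed lam τ → (F + listCost l + 1).size + 5 ≤ lam →
      ∃ τ' c, Exec ω (rcall Rp) (τ.input (F :: l)) τ' c ∧ Shadowed lam τ' ∧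
        c ≤ A * (lam * (F + listCost l + 1)) ∧ τ'.var 10 ≤ F ∧
        ∀ σ' c₀, Exec ω Rp ((inner τ).input l) σ' c₀ → 4 * c₀ < F →
          inner τ' = σ' ∧ F ≤ τ'.var 10 + 4 * c₀)
    (hb : PrepBounds A lam X W NB C tail inp) (hC : C.Computed K cyc c₁) (htl : C.tl = tail.length)
    (hn : 1 ≤ C.n) (hNB : NB = C.n * C.nb1 * C.nb2 * C.rep) (hF : (C.F2 + C.F3).size ≤ lam)
    (r : ℕ → ℕ) (V : ℕ → Memory) (hr : RegBd lam r) (h40 : r 40 = C.n) (h41 : r 41 = C.d)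
    (h42 : r 42 = C.d1) (h43 : r 43 = C.L) (h44 : r 44 = C.n3) (h45 : r 45 = C.ts) (h46 : r 46 = C.tl)
    (h57 : r 57 = 0) (hblank : ∀ y, 1 ≤ y → V y = Memory.blank)
    (htail : ∀ x (h : x < tail.length), (V 0).arr 1 (C.ts + x) = tail[x])
    (hspec : ∀ p < NB, PrepSpec Rp Ap (coins ω (2 * p + 1)) (coins ω (2 * p + 2)) (s₀ p) (sA p) C
      ((List.range (C.d1 * C.d)).map
        (blockEntry inp 4 C.d (C.rowOf p * C.d1) (C.colOf p * C.d) C.n C.n)) tail W) :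
    ARuns ω (DynPred.prepTail K cyc c₁ Rp Ap) ⟨r, V, inp⟩ (prepTailCost A lam X NB C.n K cyc c₁) fun Y =>
      C.Holds Y.reg ∧ RegBd lam Y.reg ∧ Y.reg 30 = 0 ∧ ∀ p < NB, Prepared lam s₀ sA Y.vm p := by
  have hlam := hb.hlam
  have hX := hb.hX
  have hz : ∀ a, a ≤ 2 * NB + 2 → a.size ≤ lam := fun a ha => (Nat.size_le_size ha).trans hb.hNB
  have hz' : ∀ a, a ≤ 4 * X + C.L + C.δ + C.ts + C.n * C.n + C.nb1 * C.d1 + C.nb2 * C.d + 10 →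
    a.size ≤ lam := fun a ha => (Nat.size_le_size ha).trans (by have := hb.hXl; omega)
  have hn1 : 1 ≤ C.nb1 := Nat.succ_pos _
  have hn2 : 1 ≤ C.nb2 := Nat.succ_pos _
  have hnn : C.n ≤ C.n * C.n := Nat.le_mul_of_pos_left _ hn
  have hrepNB : C.rep ≤ NB := by rw [hNB]; exact Nat.le_mul_of_pos_left _ (by positivity)
  have hrep : C.rep = 2 * (60 * C.n.size) := by rw [Params.rep, hC.hh]
  have hnb1 : C.nb1 ≤ C.n + 1 := Nat.succ_le_succ (Nat.div_le_self _ _)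
  have hnb2 : C.nb2 ≤ C.n + 1 := Nat.succ_le_succ (Nat.div_le_self _ _)
  refine ARuns.assign_seq (v := C.δ) hlam hr (by simp) (by simp [h43, hC.hδ]) (hz' _ (by omega))
    fun r₁ e1 f1 hr1 => ?_
  refine ARuns.assign_seq (v := C.nb1) hlam hr1 (by simp) (by simp [f1, h40, h42, Params.nb1])
    (hz' _ (by omega)) fun r₂ e2 f2 hr2 => ?_
  refine ARuns.assign_seq (v := C.nb2) hlam hr2 (by simp) (by simp [f2, f1, h40, h41, Params.nb2])
    (hz' _ (by omega)) fun r₃ e3 f3 hr3 => ?_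
  refine ARuns.assign_seq (v := 0) hlam hr3 (by simp) (by simp)
    (hz' _ (by omega)) fun r₄ e4 f4 hr4 => ?_
  refine ARuns.assign_seq (v := C.n) hlam hr4 (by simp) (by simp [f4, f3, f2, f1, h40])
    (hz' _ (by omega)) fun r₅ e5 f5 hr5 => ?_
  refine ARuns.sub_seq ((ARuns.sizeLoop (V := V) (inp := inp) (ω := ω) hlam C.n.size C.n 0 r₅ rfl hr5 e5
    (by simp [f5, e4]) (hz _ (by omega))).mono le_rfl ?_)
  rintro Y ⟨r₆, rfl, hr6, e6, f6⟩
  rw [zero_add] at e6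
  refine ARuns.assign_seq (v := C.h) hlam hr6 (by simp) (by simp [e6, hC.hh])
    (hz _ (by have := hC.hh; omega)) fun r₇ e7 f7 hr7 => ?_
  refine ARuns.assign_seq (v := C.rep) hlam hr7 (by simp) (by simp [e7, Params.rep])
    (hz _ (by omega)) fun r₈ e8 f8 hr8 => ?_
  have g8 : ∀ y, y ≠ 0 → y ≠ 47 → y ≠ 48 → y ≠ 49 → y ≠ 50 → y ≠ 51 → y ≠ 52 → r₈ y = r y := by
    intro y _ _ _ _ _ _ _
    rw [f8 y (by omega), f7 y (by omega), f6 y (by omega) (by omega), f5 y (by omega),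
      f4 y (by omega), f3 y (by omega), f2 y (by omega), f1 y (by omega)]
  have k51 : r₈ 51 = C.n.size := by rw [f8 _ (by omega), f7 _ (by omega), e6]
  have d1 := Ex.depth_pow_le (.var 41 + .var 44) K
  have d2 := Ex.depth_pow_le (.num c₁ * .var 51) K
  simp only [Ex.depth_add, Ex.depth_mul, Ex.depth_num, Ex.depth_var] at d1 d2
  refine ARuns.assign_seq (v := C.F1) hlam hr8 (by simp [fuel1]; omega)
    (by simp [fuel1, g8, h41, h44, hC.h1]) (hz' _ (by omega)) fun r₉ e9 f9 hr9 => ?_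
  refine ARuns.assign_seq (v := C.F2) hlam hr9 (by simp [fuel2]; omega)
    (by simp [fuel2, f9, g8, h41, h42, h43, k51, hC.h2]) ((Nat.size_le_size (by omega)).trans hF)
    fun r₁₀ e10 f10 hr10 => ?_
  refine ARuns.assign_seq (v := C.F3) hlam hr10 (by simp [fuel3]; omega)
    (by simp [fuel3, f10, f9, g8, h43, k51, hC.h3]) ((Nat.size_le_size (by omega)).trans hF)
    fun r₁₁ e11 f11 hr11 => ?_
  have g47 : r₈ 47 = C.nb1 := by
    simp [f8, f7, f6, f5, f4, f3, e2]
  have g48 : r₈ 48 = C.nb2 := by simp [f8, f7, f6, f5, f4, e3]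
  refine ARuns.assign_seq (v := NB) hlam hr11 (by simp)
    (by simp [f11, f10, f9, g47, g48, e8, g8, h40, hNB]) (hz _ (by omega)) fun r₁₂ e12 f12 hr12 => ?_
  have hC12 : C.Holds r₁₂ := by
    constructor <;> simp [*]
  refine ARuns.sub_seq ((ARuns.prepLoop (s₀ := s₀) (sA := sA) hcl hb htl NB r₁₂ V hC12 hr12 e12 le_rfl
    (fun y h1 _ => hblank y h1) htail hspec).mono le_rfl ?_)
  rintro Y ⟨r₁₃, V₁₃, rfl, hr13, a1, a2, -⟩
  refine (ARuns.assign hlam hr13 (by simp) ⟨(hC12.congr a1).congr fun y hy => ?_, hr13.update (by simp),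
    by simp, a2⟩).cost_le ?_
  · simp only [prepTailCost]
    change _ ≤ _ - (Ex.cost _) * lam - (Ex.cost _) * lam - (Ex.cost _) * lam - (Ex.cost _) * lam -
      (Ex.cost _) * lam - (_ + 1) - (Ex.cost _) * lam - (Ex.cost _) * lam - (fuel1 K).cost * lam -
      (fuel2 K c₁).cost * lam - (fuel3 K c₁).cost * lam - (Ex.cost _) * lam - (_ + 1)
    generalize (fuel1 K).cost = x1
    generalize (fuel2 K c₁).cost = x2
    generalize (fuel3 K c₁).cost = x3
    simp only [Ex.cost, Ex.cc_add, Ex.cc_mul, Ex.cc_div, Ex.cc_var, Ex.cc_num,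
      Ex.weight_add, Ex.weight_mul, Ex.weight_div, Ex.weight_var, Ex.weight_num]
    have y0 : 3 * cyc * lam = 3 * (cyc * lam) := by ring
    simp only [Nat.add_mul, y0]
    omega
  · dsimp only
    rw [Function.update_of_ne (by omega)]

/-- A bound for the cost of `preProg`. -/
def preProgCost (A lam X NB n κ K cyc c₁ pc cu : ℕ) : ℕ :=
  5 * n * n + (((Ex.var 41).pow κ - .var 40).cost + pc + 500) * lam +
    n * (((Ex.var 41).pow κ - .var 40).cost * lam + 20 * lam) +
    30 * ((1 + lam) * cu) + prepTailCost A lam X NB n K cyc c₁ + 100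

theorem input_matrix {n : ℕ} (s : Memory) (M : Matrix (Fin n) (Fin n) Bool) (x y : Fin n) :
    (s.input (encList [[n], matrixBits M])).arr 0 (4 + x * n + y) = (M x y).toNat := by
  have e1 : ∀ a b : ℕ, b < n → (a * n + b) / n = a := fun a b hb => by
    rw [mul_comm, Nat.mul_add_div (by omega), Nat.div_eq_of_lt hb, add_zero]
  have hM := map_range_eq_matrixBits M
    (fun i => if h : i / n < n ∧ i % n < n then (M ⟨i / n, h.1⟩ ⟨i % n, h.2⟩).toNat else 0) fun y z => by
      have e2 : ((y : ℕ) * n + z) % n = z := by rw [mul_comm, Nat.mul_add_mod, Nat.mod_eq_of_lt z.2]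
      simp only [e1 _ _ z.2, e2]
      simp
  have hxy : (x : ℕ) * n + y < n * n := by
    have := x.2
    have := y.2
    nlinarith
  have hl : (encList [[n], matrixBits M]) = 2 :: 1 :: n :: (n * n) :: matrixBits M := by
    simp [encList, ← hM]
  rw [input_arr_zero _ _ _ (by rw [hl, ← hM]; simp; omega), ← List.getD_eq_getElem _ 0, hl, ← hM,
    show 4 + (x : ℕ) * n + y = x * n + y + 1 + 1 + 1 + 1 by ring]
  have e2 : ((x : ℕ) * n + y) % n = y := by rw [mul_comm, Nat.mul_add_mod, Nat.mod_eq_of_lt y.2]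
  simp only [List.getD_cons_succ]
  rw [List.getD_eq_getElem _ 0 (by simpa using hxy)]
  simp only [List.getElem_map, List.getElem_range, e1 _ _ y.2, e2]
  simp

/-- After the preprocessing, all pairs of machines are ready. Machine `0` runs `univ`; its output is
read by `post`. -/
theorem call_preProg {κ pc cu : ℕ} {σu : Memory} {ou : List ℕ} (M : Matrix (Fin C.n) (Fin C.n) Bool)
    (hcl : ∀ ω lam τ F l, A ≤ lam → Shadowed lam τ → (F + listCost l + 1).size + 5 ≤ lam →
      ∃ τ' c, Exec ω (rcall Rp) (τ.input (F :: l)) τ' c ∧ Shadowed lam τ' ∧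
        c ≤ A * (lam * (F + listCost l + 1)) ∧ τ'.var 10 ≤ F ∧
        ∀ σ' c₀, Exec ω Rp ((inner τ).input l) σ' c₀ → 4 * c₀ < F →
          inner τ' = σ' ∧ F ≤ τ'.var 10 + 4 * c₀)
    (hb : ∀ inp : ℕ → ℕ, (∀ i j, i < C.n → j < C.n → inp (4 + i * C.n + j) ≤ 1) →
      PrepBounds A lam X W NB C tail inp) (hC : C.Computed K cyc c₁)
    (hn : 1 ≤ C.n) (hNB : NB = C.n * C.nb1 * C.nb2 * C.rep) (hF : (C.F2 + C.F3).size ≤ lam)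
    (hκ : (C.n ^ κ).size ≤ lam) (hd1 : C.d ^ κ ≤ C.n) (hd2 : C.n < (C.d + 1) ^ κ) (hdn : C.d ≤ C.n)
    (hu : Call (coins ω 0) univ Memory.blank [C.d] σu ou cu)
    (hpost : PostSpec post pc lam C σu tail)
    (hspec : ∀ p < NB, PrepSpec Rp Ap (coins ω (2 * p + 1)) (coins ω (2 * p + 2)) (s₀ p) (sA p) C
      (matrixBits (subMat M (C.rowOf p * C.d1) (C.colOf p * C.d) C.d1 C.d)) tail W) :
    ∃ s c, Call ω (preProg κ K cyc c₁ univ post Rp Ap) Memory.blank (encList [[C.n], matrixBits M]) s [] c ∧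
      c ≤ preProgCost A lam X NB C.n κ K cyc c₁ pc cu ∧ Ready lam C s₀ sA NB 0 s := by
  set l := encList [[C.n], matrixBits M] with hl
  have hl' : l = 2 :: 1 :: C.n :: (matrixBits M).length :: matrixBits M := by simp [hl, encList]
  set inp := (Memory.blank.input l).arr 0 with hinp
  have hM : ∀ x y : Fin C.n, inp (4 + x * C.n + y) = (M x y).toNat := input_matrix _ M
  have hb := hb inp fun i j hi hj => by
    rw [hM ⟨i, hi⟩ ⟨j, hj⟩]; exact Bool.toNat_le _
  have hlam := hb.hlam
  have hX := hb.hX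
  obtain ⟨cu', hexu, houtu, hcu⟩ := hu.exec
  have hz' : ∀ a, a ≤ 4 * X + C.L + C.δ + C.ts + C.n * C.n + C.nb1 * C.d1 + C.nb2 * C.d + 10 →
    a.size ≤ lam := fun a ha => (Nat.size_le_size ha).trans (by have := hb.hXl; omega)
  have hnn : C.n ≤ C.n * C.n := Nat.le_mul_of_pos_left _ hn
  have hv : view (Memory.blank.input l) = ⟨fun _ => 0, fun _ => Memory.blank, inp⟩ := view_input _ l
  have hinp2 : inp 2 = C.n := by
    rw [hinp, input_arr_zero _ _ _ (by rw [hl']; simp)]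
    simp [hl']
  have main : ARuns ω (prepMain κ K cyc c₁ univ post Rp Ap) ⟨fun _ => 0, fun _ => Memory.blank, inp⟩
      ((((Ex.var 41).pow κ - .var 40).cost + pc + 500) * lam +
        C.n * (((Ex.var 41).pow κ - .var 40).cost * lam + 20 * lam) +
        30 * ((1 + lam) * cu) + prepTailCost A lam X NB C.n K cyc c₁ + 10) fun Y =>
      C.Holds Y.reg ∧ RegBd lam Y.reg ∧ Y.reg 30 = 0 ∧ ∀ p < NB, Prepared lam s₀ sA Y.vm p := by
    refine ARuns.readInp_seq (v := C.n) hlam (fun _ => by simp) (by simp) (by simpa using hinp2)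
      (hz' _ (by omega)) fun r₁ e1 f1 hr1 => ?_
    refine ARuns.assign_seq (v := C.n) hlam hr1 (by simp) (by simp [e1])
      (hz' _ (by omega)) fun r₂ e2 f2 hr2 => ?_
    have dp := Ex.depth_pow_le (.var 41) κ
    refine ARuns.assign_seq (v := C.n ^ κ - C.n) hlam hr2
      (by simp only [Ex.depth_sub, Ex.depth_var] at dp ⊢; omega) (by simp [e2, f2, e1])
      ((Nat.size_le_size (Nat.sub_le _ _)).trans hκ) fun r₃ e3 f3 hr3 => ?_
    have e4 : C.d + (C.n - C.d) = C.n := Nat.add_sub_cancel' hdn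
    refine ARuns.sub_seq ((ARuns.rootLoop (ω := ω) (inp := inp) (V := fun _ => Memory.blank)
      hlam hd1 hd2 (C.n - C.d) r₃ hr3 (by simp [f3, f2, e1])
      (by rw [e4, f3 _ (by omega), e2]) (by rw [e4, e3]) (by rwa [e4])).mono le_rfl ?_)
    rintro Y ⟨r₄, rfl, hr4, e4, f4⟩
    refine ARuns.assign_seq (v := 0) hlam hr4 (by simp) (by simp) (by simp) fun r₅ e5 f5 hr5 => ?_
    have k57 : r₅ 57 = 0 := by simp [f5, f4, f3, f2, f1]
    refine ARuns.pushEs_seq (k := 0) (σ := Memory.blank) (l := []) (l' := [C.d]) hlam hr5 (by omega)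
      (by simp [Ex.Avoids]) k57 (by rw [Memory.put_nil]) (by simp [e5]) (by simp [f5, e4])
      (by simpa using hlam) fun r₆ V₆ e6 f6 hr6 v6 w6 => ?_
    refine ARuns.setLen_seq hlam hr6 (by rw [f6 _ (by omega), k57]) v6 e6 fun V₇ v7 w7 => ?_
    refine ARuns.sim_seq hr6 (by rw [f6 _ (by omega), k57]) v7 (by simpa using hexu)
      fun V₈ v8 w8 => ?_
    refine ARuns.sub_seq ((hpost.run ω r₆ V₈ inp hr6 (by rw [f6 _ (by omega), k57]) v8).mono le_rfl ?_)
    rintro Y ⟨r₉, rfl, hr9, a1, a2, a3, a4, a5, a6, a7, a8⟩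
    refine (ARuns.prepTail (s₀ := s₀) (sA := sA) hcl hb hC hpost.htl hn hNB hF r₉ V₈ hr9
      (by simp [a6, f6, f5, f4, f3, f2, e1]) (by simp [a7, f6, f5, e4]) a1 a2 a3 a4 a5
      (by rw [a8, f6 _ (by omega), k57])
      (fun y hy => by rw [w8 y (by omega), w7 y (by omega), w6 y (by omega)])
      (by rw [v8]; exact hpost.htail) fun p hp => ?_).cost_le ?_
    · rw [matBlock_eq M _ _ _ _ _ _ hM]
      exact hspec p hp
    · change _ ≤ _ - _ - _ - ((Ex.var 41).pow κ - .var 40).cost * lam - _ - _ - _ - _ - _ - _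
      simp only [pushCost, Ex.cc_var, Ex.cc_num, Ex.weight_var, Ex.weight_num]
      generalize ((Ex.var 41).pow κ - .var 40).cost = x1
      have h1 : (C.n - C.d) * (x1 * lam + 20 * lam) ≤ C.n * (x1 * lam + 20 * lam) :=
        Nat.mul_le_mul_right _ (Nat.sub_le _ _)
      have h2 : (1 + lam) * cu' ≤ (1 + lam) * cu := Nat.mul_le_mul_left _ (by omega)
      simp only [Nat.add_mul (x1 + pc), Nat.add_mul x1 pc]
      omega
  obtain ⟨s₁, c₁', hex, hc₁, b1, b2, b3, b4⟩ := main _ hv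
  have hview : view (s₁.setVar 1 0) = view s₁ := view_scratch (by omega)
  refine ⟨s₁.setVar 1 0, _, ⟨_, hex.seq (.const s₁ 1 0), by simp [Memory.output], rfl⟩, ?_, ?_⟩
  · have hlc : listCost l ≤ 5 * C.n * C.n + 20 := by
      have h1 : ∀ l' : List ℕ, (∀ a ∈ l', a ≤ 1) → listCost l' ≤ 2 * l'.length := by
        intro l' h
        induction l' with
        | nil => simp [listCost_nil]
        | cons a l' ih =>
          have h1 := ih fun b hb => h b (by simp [hb])
          have h2 : a.size ≤ 1 := (Nat.size_le_size (h a (by simp))).trans (by simp)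
          simp only [listCost_cons, List.length_cons]
          omega
      have h2 : (matrixBits M).length = C.n * C.n := by
        rw [← map_range_eq_matrixBits M (fun i => inp (4 + i)) fun y z => by
          rw [← hM y z, add_assoc]]
        simp
      have h3 := h1 (matrixBits M) fun a ha => by
        simp only [matrixBits, bits, List.mem_flatten, List.mem_ofFn] at ha
        obtain ⟨_, ⟨i, rfl⟩, ha⟩ := ha
        simp only [List.mem_ofFn] at ha
        obtain ⟨j, rfl⟩ := ha
        exact Bool.toNat_le _
      have h4 := size_le_self C.n
      have h5 := size_le_self (C.n * C.n)
      have h6 : Nat.size 2 = 2 := by decide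
      have h7 : Nat.size 1 = 1 := by decide
      simp only [hl', listCost_cons, h2] at h3 ⊢
      rw [mul_assoc]
      omega
    simp only [preProgCost, listCost_nil, Nat.size_zero]
    omega
  · rw [Ready, hview]
    exact ⟨b1, b2, by simp [b3], fun q _ hq => b4 q hq⟩

end

/-! ### Reading the parameters from the universal request sequence -/

theorem Memory.arr_of_output {σ : Memory} {o : List ℕ} (h : σ.output = o) (i : ℕ) (hi : i < o.length) :
    σ.arr 1 i = o[i] := by subst h; exact (Memory.output_getElem σ i hi).symm

/-- Extracts the parameters from the output of `univ`, for fully dynamic reductions. The output is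
`1 + L, 1, d1`, followed by the requests. The reduction is used for a single round. -/
def postFull : Prog :=
  .seq (pull 42 57 1 (.num 2))
  (.seq (pull 43 57 1 (.num 0))
  (.seq (assign 43 (.var 43 - .num 1))
  (.seq (assign 44 (.num 1))
  (.seq (assign 45 (.num 3))
  (.seq (getVar 46 57 1)
  (assign 46 (.var 46 - .num 3)))))))

/-- Extracts the parameters from the output of `univ`, for partially dynamic reductions. The
output is `1 + n3, 1, d1, tl + 1, L`, followed by the requests of the first block, the only one that is
used, and by the other blocks. -/
def postPartial : Prog :=
  .seq (pull 42 57 1 (.num 2))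
  (.seq (pull 44 57 1 (.num 0))
  (.seq (assign 44 (.var 44 - .num 1))
  (.seq (pull 43 57 1 (.num 4))
  (.seq (assign 45 (.num 5))
  (.seq (pull 46 57 1 (.num 3))
  (assign 46 (.var 46 - .num 1)))))))

theorem postSpec_full {lam : ℕ} {C : Params} {σ : Memory} {reqs : List (List ℕ)} (hlam : 2 ≤ lam)
    (hσ : σ.output = encList ([C.d1] :: reqs)) (hL : C.L = reqs.length) (hn3 : C.n3 = 1)
    (hts : C.ts = 3) (htl : C.tl = (frames reqs).length)
    (hs : (C.d1 + C.L + 1 + (C.tl + 3)).size ≤ lam) :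
    PostSpec postFull 1000 lam C σ (frames reqs) := by
  have ho : σ.output = (1 + C.L) :: 1 :: C.d1 :: frames reqs := by
    rw [hσ, encList_eq]; simp [hL, add_comm]
  have hz : ∀ a, a ≤ C.d1 + C.L + 1 + (C.tl + 3) → a.size ≤ lam := fun a ha =>
    (Nat.size_le_size ha).trans hs
  refine ⟨htl, fun x hx => ?_, fun ω r V inp hr h57 hV => ?_⟩
  · rw [Memory.arr_of_output ho _ (by simp; omega)]
    simp [hts, show 3 + x = x + 1 + 1 + 1 by ring]
  · have hl1 : 1 ≤ lam := by omega
    have hlen : σ.var 1 = C.tl + 3 := by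
      rw [← Memory.output_length, ho]; simp [htl]
    refine ARuns.pull_seq (v := C.d1) hl1 hr (by simp)
      (by rw [h57, hV]; simp [Memory.arr_of_output ho 2 (by simp)]) (hz _ (by omega))
      fun r₁ e1 f1 hr1 => ?_
    refine ARuns.pull_seq (v := 1 + C.L) hl1 hr1 (by simp)
      (by rw [f1 _ (by omega), h57, hV]; simp [Memory.arr_of_output ho 0 (by simp)]) (hz _ (by omega))
      fun r₂ e2 f2 hr2 => ?_
    refine ARuns.assign_seq (v := C.L) hl1 hr2 (by simp) (by simp [e2]) (hz _ (by omega))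
      fun r₃ e3 f3 hr3 => ?_
    refine ARuns.assign_seq (v := 1) hl1 hr3 (by simp) (by simp) (hz _ (by omega))
      fun r₄ e4 f4 hr4 => ?_
    refine ARuns.assign_seq (v := 3) hl1 hr4 (by simp) (by simp) (hz _ (by omega))
      fun r₅ e5 f5 hr5 => ?_
    refine ARuns.getVar_seq (v := C.tl + 3) hl1 hr5
      (by rw [f5 _ (by omega), f4 _ (by omega), f3 _ (by omega), f2 _ (by omega), f1 _ (by omega), h57, hV,
        hlen]) (hz _ (by omega)) fun r₆ e6 f6 hr6 => ?_
    have e7 : (Ex.var 46 - Ex.num 3).eval r₆ = C.tl := by simp [e6]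
    refine (ARuns.assign hl1 hr6 (by simp) ?_).cost_le ?_
    · rw [e7]
      refine ⟨_, rfl, hr6.update (hz _ (by omega)), ?_⟩
      simp [f6, f5, f4, f3, f2, f1, e1, e3, e4, e5, hts, hn3]
    · simp only [Ex.cc_sub, Ex.cc_var, Ex.cc_num, Ex.weight_sub, Ex.weight_var, Ex.weight_num]
      omega

theorem postSpec_partial {lam : ℕ} {C : Params} {σ : Memory} {reqs : List (List ℕ)}
    {rest : List (List ℕ)} (hlam : 3 ≤ lam)
    (hσ : σ.output = encList ([C.d1] :: encList reqs :: rest)) (hL : C.L = reqs.length)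
    (hn3 : C.n3 = rest.length + 1)
    (hts : C.ts = 5) (htl : C.tl = (frames reqs).length)
    (hs : (C.d1 + C.L + 5 + C.n3 + (C.tl + 3)).size ≤ lam) :
    PostSpec postPartial 1000 lam C σ (frames reqs) := by
  have ho : σ.output = (1 + C.n3) :: 1 :: C.d1 :: (C.tl + 1) :: C.L :: (frames reqs ++ frames rest) := by
    rw [hσ, encList_eq, encList_eq]; simp [hL, hn3, htl, add_comm]
  have hz : ∀ a, a ≤ C.d1 + C.L + 5 + C.n3 + (C.tl + 3) → a.size ≤ lam := fun a ha =>
    (Nat.size_le_size ha).trans hs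
  refine ⟨htl, fun x hx => ?_, fun ω r V inp hr h57 hV => ?_⟩
  · rw [Memory.arr_of_output ho _ (by simp; omega)]
    simp [hts, show 5 + x = x + 1 + 1 + 1 + 1 + 1 by ring, List.getElem_append_left hx]
  · have hl1 : 1 ≤ lam := by omega
    refine ARuns.pull_seq (v := C.d1) hl1 hr (by simp)
      (by rw [h57, hV]; simp [Memory.arr_of_output ho 2 (by simp)]) (hz _ (by omega))
      fun r₁ e1 f1 hr1 => ?_
    refine ARuns.pull_seq (v := 1 + C.n3) hl1 hr1 (by simp)
      (by rw [f1 _ (by omega), h57, hV]; simp [Memory.arr_of_output ho 0 (by simp)]) (hz _ (by omega))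
      fun r₂ e2 f2 hr2 => ?_
    refine ARuns.assign_seq (v := C.n3) hl1 hr2 (by simp) (by simp [e2]) (hz _ (by omega))
      fun r₃ e3 f3 hr3 => ?_
    refine ARuns.pull_seq (v := C.L) hl1 hr3 (by simp)
      (by rw [f3 _ (by omega), f2 _ (by omega), f1 _ (by omega), h57, hV]
          simp [Memory.arr_of_output ho 4 (by simp)]) (hz _ (by omega))
      fun r₄ e4 f4 hr4 => ?_
    refine ARuns.assign_seq (v := 5) hl1 hr4 (by simp) (by simp) (hz _ (by omega))
      fun r₅ e5 f5 hr5 => ?_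
    refine ARuns.pull_seq (v := C.tl + 1) hl1 hr5 (by simp)
      (by rw [f5 _ (by omega), f4 _ (by omega), f3 _ (by omega), f2 _ (by omega), f1 _ (by omega), h57, hV]
          simp [Memory.arr_of_output ho 3 (by simp)]) (hz _ (by omega)) fun r₆ e6 f6 hr6 => ?_
    have e7 : (Ex.var 46 - Ex.num 1).eval r₆ = C.tl := by simp [e6]
    refine (ARuns.assign hl1 hr6 (by simp) ?_).cost_le ?_
    · rw [e7]
      refine ⟨_, rfl, hr6.update (hz _ (by omega)), ?_⟩
      simp [f6, f5, f4, f3, f2, f1, e1, e3, e4, e5, hts]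
    · simp only [Ex.cc_sub, Ex.cc_var, Ex.cc_num, Ex.weight_sub, Ex.weight_var, Ex.weight_num]
      omega

/-! ### Amplification of the success probability -/

instance : IsProbabilityMeasure coinMeasure := by unfold coinMeasure; infer_instance

/-- The random bits of different virtual machines are independent. -/
theorem map_coins {m : ℕ → ℕ} (hm : Function.Injective m) :
    coinMeasure.map (fun ω x => coins ω (m x)) = Measure.infinitePi fun _ : ℕ => coinMeasure := by
  have hinj : Function.Injective fun a : ℕ × ℕ => cell (m a.1) a.2 := fun a b h => by
    obtain ⟨h1, h2⟩ := cell_inj h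
    exact Prod.ext (hm h1) h2
  have h1 : (fun (ω : ℕ → Bool) x => coins ω (m x)) =
      (MeasurableEquiv.curry ℕ ℕ Bool) ∘ fun ω a => ω (cell (m a.1) a.2) := rfl
  rw [h1, ← Measure.map_map (by fun_prop) (by fun_prop)]
  unfold coinMeasure
  rw [Measure.map_infinitePi_infinitePi_of_inj hinj]
  exact Measure.infinitePi_map_curry fun _ _ => (PMF.uniformOfFintype Bool).toMeasure

open Classical in
/-- Each of `2 h` independent runs fails with probability at most `1 / 3`. The number `Z` of failures
satisfies `E (2 ^ Z) ≤ (4 / 3) ^ (2 h)`, so Markov's inequality shows that it is rarely `h` or more. -/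
theorem infinitePi_card_le {α : Type*} [MeasurableSpace α] {μ : Measure α} [IsProbabilityMeasure μ]
    {T : ℕ → Set α} (hT : ∀ x, MeasurableSet (T x)) (hμ : ∀ x, μ (T x) ≤ 1 / 3) (h : ℕ) :
    Measure.infinitePi (fun _ : ℕ => μ)
      {z | h ≤ ((Finset.range (2 * h)).filter fun x => z x ∈ T x).card} ≤ (8 / 9) ^ h := by
  set ν := Measure.infinitePi (fun _ : ℕ => μ)
  set R := Finset.range (2 * h)
  have hmeas : ∀ t : Finset ℕ, MeasurableSet (Set.pi (t : Set ℕ) T) := fun t =>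
    MeasurableSet.pi t.countable_toSet fun x _ => hT x
  -- The number of sets of failing runs is `2 ^ Z`; this makes its expectation a sum of
  -- probabilities that are products by independence.
  set f : (ℕ → α) → ℝ≥0∞ := fun z => ∑ t ∈ R.powerset, (Set.pi (t : Set ℕ) T).indicator 1 z
  have hf : ∀ z, f z = 2 ^ (R.filter fun x => z x ∈ T x).card := by
    intro z
    have h1 : ∀ t ∈ R.powerset, (Set.pi (t : Set ℕ) T).indicator (1 : (ℕ → α) → ℝ≥0∞) z =
        if t ∈ (R.filter fun x => z x ∈ T x).powerset then 1 else 0 := by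
      intro t ht
      rw [Set.indicator_apply]
      refine if_congr ?_ rfl rfl
      rw [Finset.mem_powerset] at ht ⊢
      exact ⟨fun h x hx => Finset.mem_filter.2 ⟨ht hx, h x hx⟩, fun h x hx =>
        (Finset.mem_filter.1 (h hx)).2⟩
    have h2 : (R.filter fun x => z x ∈ T x).powerset ⊆ R.powerset :=
      Finset.powerset_mono.2 (Finset.filter_subset _ _)
    simp only [f]
    rw [Finset.sum_congr rfl h1, Finset.sum_ite_mem, Finset.inter_eq_right.2 h2]
    simp
  have hint : ∫⁻ z, f z ∂ν ≤ (4 / 3) ^ (2 * h) := by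
    rw [lintegral_finsetSum _ fun t _ => measurable_one.indicator (hmeas t)]
    simp only [lintegral_indicator_one (hmeas _)]
    calc ∑ t ∈ R.powerset, ν (Set.pi (t : Set ℕ) T)
        ≤ ∑ t ∈ R.powerset, (1 / 3 : ℝ≥0∞) ^ t.card * 1 ^ (R.card - t.card) := by
          refine Finset.sum_le_sum fun t _ => ?_
          rw [Measure.infinitePi_pi _ fun x _ => hT x, one_pow, mul_one]
          exact Finset.prod_le_pow_card _ _ _ fun x _ => hμ x
      _ = (4 / 3) ^ (2 * h) := by
          rw [Finset.sum_pow_mul_eq_add_pow, Finset.card_range]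
          congr 1
          rw [show (1 : ℝ≥0∞) = 3 / 3 from (ENNReal.div_self (by simp) (by simp)).symm,
            ENNReal.div_add_div_same, ENNReal.div_self (by simp) (by simp)]
          norm_num
  have hmk := mul_meas_ge_le_lintegral (μ := ν)
    (f := f) (Finset.measurable_sum _ fun t _ => measurable_one.indicator (hmeas t)) (2 ^ h)
  have hset : {z : ℕ → α | h ≤ (R.filter fun x => z x ∈ T x).card} ⊆ {z | 2 ^ h ≤ f z} := fun z hz => by
    rw [Set.mem_ofPred_eq, hf]
    exact pow_le_pow_right₀ (by simp) hz
  have h2 : (2 : ℝ≥0∞) ^ h * ν {z : ℕ → α | h ≤ (R.filter fun x => z x ∈ T x).card} ≤ (4 / 3) ^ (2 * h) := by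
    refine (mul_le_mul_right (measure_mono hset) _).trans (le_trans ?_ hint)
    exact hmk
  have h3 : ((4 : ℝ≥0∞) / 3) ^ (2 * h) = 2 ^ h * (8 / 9) ^ h := by
    rw [pow_mul, ← mul_pow]
    congr 1
    refine (ENNReal.toReal_eq_toReal_iff' (by finiteness) (by finiteness)).1 ?_
    simp only [ENNReal.toReal_pow, ENNReal.toReal_div, ENNReal.toReal_mul, ENNReal.toReal_ofNat]
    norm_num
  rw [h3] at h2
  exact (ENNReal.mul_le_mul_iff_right (by simp) (by finiteness)).1 h2

/-- The probability that half or more of the runs fail in one of `G` groups of `2 h` runs. -/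
theorem coinMeasure_badCount_le {S : ℕ → Set (ℕ → Bool)} (hS : ∀ p, coinMeasure (S p) ≤ 1 / 3)
    (h G : ℕ) : coinMeasure {ω | ∃ g < G, h ≤
      badCount (fun p => coins ω (2 * p + 2) ∉ S p) (g * (2 * h)) (2 * h)} ≤ G * (8 / 9) ^ h := by
  classical
  have key : ∀ g, coinMeasure {ω | h ≤
      badCount (fun p => coins ω (2 * p + 2) ∉ S p) (g * (2 * h)) (2 * h)} ≤ (8 / 9) ^ h := by
    intro g
    -- The sets `S p` need not be measurable, as they come from runs of arbitrary programs.
    set T : ℕ → Set (ℕ → Bool) := fun x => toMeasurable coinMeasure (S (g * (2 * h) + x))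
    have hm : Function.Injective fun x => 2 * (g * (2 * h) + x) + 2 := fun x y hxy => by
      dsimp only at hxy; omega
    have h1 := infinitePi_card_le (μ := coinMeasure) (T := T) (fun x => measurableSet_toMeasurable _ _)
      (fun x => by rw [measure_toMeasurable]; exact hS _) h
    rw [← map_coins hm] at h1
    refine le_trans (le_trans (measure_mono fun ω hω => ?_) (Measure.le_map_apply ?_ _)) h1
    · refine le_trans hω (Finset.card_le_card fun x hx => ?_)
      simp only [Finset.mem_filter, not_not] at hx ⊢
      exact ⟨hx.1, subset_toMeasurable _ _ hx.2⟩
    · exact (measurable_pi_lambda _ fun x => measurable_pi_lambda _ fun y =>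
        measurable_pi_apply _).aemeasurable
  have h2 : {ω | ∃ g < G, h ≤ badCount (fun p => coins ω (2 * p + 2) ∉ S p) (g * (2 * h)) (2 * h)} ⊆
      ⋃ g ∈ Finset.range G, {ω | h ≤
        badCount (fun p => coins ω (2 * p + 2) ∉ S p) (g * (2 * h)) (2 * h)} := by
    rintro ω ⟨g, hg, hω⟩
    simp only [Set.mem_iUnion, Finset.mem_range]
    exact ⟨g, hg, hω⟩
  refine (measure_mono h2).trans ((measure_biUnion_finset_le _ _).trans ?_)
  refine (Finset.sum_le_sum fun g _ => key g).trans ?_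
  simp

/-- The constant `60` in the number of repetitions makes the failure probability small enough for a
union bound over all rounds and blocks. -/
theorem union_bound {n G : ℕ} (hn : 1 ≤ n) (hG : G ≤ n * (n + 1) * (n + 1)) :
    (G : ℝ≥0∞) * (8 / 9) ^ (60 * n.size) ≤ 1 / 3 := by
  set s := n.size
  have h1 : n + 1 ≤ 2 ^ s := Nat.lt_size_self n
  have h2 : n * (n + 1) * (n + 1) ≤ 2 ^ s * 2 ^ s * 2 ^ s := by gcongr; omega
  have h3 : (G : ℝ) ≤ 8 ^ s := by
    have : ((2 : ℝ) ^ s * 2 ^ s * 2 ^ s) = 8 ^ s := by rw [← mul_pow, ← mul_pow]; norm_num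
    rw [← this]
    exact_mod_cast hG.trans h2
  have h4 : ((8 : ℝ) / 9) ^ (60 * s) ≤ (1 / 1024) ^ s := by
    rw [pow_mul]
    exact pow_le_pow_left₀ (by positivity) (by norm_num) _
  have h5 : ((1 : ℝ) / 128) ^ s ≤ 1 / 128 :=
    pow_le_of_le_one (by norm_num) (by norm_num) (by have := Nat.size_pos.2 hn; omega)
  refine (ENNReal.toReal_le_toReal (by finiteness) (by finiteness)).1 ?_
  simp only [ENNReal.toReal_pow, ENNReal.toReal_div, ENNReal.toReal_mul, ENNReal.toReal_ofNat,
    ENNReal.toReal_natCast, ENNReal.toReal_one]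
  calc (G : ℝ) * (8 / 9) ^ (60 * s) ≤ 8 ^ s * (1 / 1024) ^ s := by gcongr
    _ = (1 / 128) ^ s := by rw [← mul_pow]; norm_num
    _ ≤ 1 / 3 := h5.trans (by norm_num)

/-! ### Solving one round with the dynamic algorithm -/

theorem exists_equiv_of_perm {α : Type*} {l l' : List α} (h : l.Perm l') :
    ∃ e : Fin l.length ≃ Fin l'.length, ∀ i, l'[e i] = l[i] := by
  induction h with
  | nil => exact ⟨Equiv.refl _, fun i => i.elim0⟩
  | @cons a l₁ l₂ _ ih =>
    obtain ⟨e, he⟩ := ih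
    refine ⟨(finSuccEquiv _).trans ((Equiv.optionCongr e).trans (finSuccEquiv _).symm), fun i => ?_⟩
    induction i using Fin.cases with
    | zero => simp
    | succ i => simpa using he i
  | swap a b l =>
    refine ⟨Equiv.swap (0 : Fin (l.length + 2)) 1, fun i => ?_⟩
    rcases i with ⟨_ | _ | i, hi⟩
    · simp
    · simp
    · have : Equiv.swap (0 : Fin (l.length + 2)) 1 ⟨i + 1 + 1, hi⟩ = ⟨i + 1 + 1, hi⟩ :=
        Equiv.swap_apply_of_ne_of_ne (by simp [Fin.ext_iff]) (by simp [Fin.ext_iff])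
      simp only [Fin.getElem_fin, this]
      simp
  | trans _ _ ih ih' =>
    obtain ⟨e, he⟩ := ih
    obtain ⟨e', he'⟩ := ih'
    exact ⟨e.trans e', fun i => (he' _).trans (he i)⟩

section

variable {P : DynProblem}

open DynProblem

theorem queryOutputs_append (ρ ρ' : List P.Req) (os os' : List (List ℕ)) (h : ρ.length = os.length) :
    queryOutputs (ρ ++ ρ') (os ++ os') = queryOutputs ρ os ++ queryOutputs ρ' os' := by
  simp [queryOutputs, List.zip_append h]

theorem answers_encReq (ρ : List P.Req) (os : List (List ℕ)) :
    answers (ρ.map encReq) os = queryOutputs ρ os := by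
  induction ρ generalizing os with
  | nil => simp [answers, queryOutputs]
  | cons r ρ ih =>
    cases os with
    | nil => simp [answers, queryOutputs]
    | cons o os =>
      have := ih os
      cases r with
      | inl y => exact this
      | inr q =>
        change o :: answers (ρ.map encReq) os = o :: queryOutputs ρ os
        rw [this]

theorem numQry_inl (y : P.Upd) (ρ : List P.Req) : numQry (.inl y :: ρ) = numQry ρ :=
  List.countP_cons_of_neg (by simp)

theorem numQry_inr (q : P.Qry) (ρ : List P.Req) : numQry (.inr q :: ρ) = numQry ρ + 1 :=
  List.countP_cons_of_pos rfl

theorem numUpd_inl (y : P.Upd) (ρ : List P.Req) : numUpd (.inl y :: ρ) = numUpd ρ + 1 :=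
  List.countP_cons_of_pos rfl

theorem numUpd_inr (q : P.Qry) (ρ : List P.Req) : numUpd (.inr q :: ρ) = numUpd ρ :=
  List.countP_cons_of_neg (by simp)

theorem DynProblem.Correct.length : ∀ {x : P.Inst} {ρ : List P.Req} {as : List (List ℕ)}, Correct x ρ as →
    as.length = numQry ρ
  | _, [], [], _ => rfl
  | _, [], _ :: _, h => h.elim
  | _, .inl y :: ρ, as, h => by
    rw [numQry_inl]
    exact Correct.length (ρ := ρ) (as := as) h
  | _, .inr _ :: _, [], h => h.elim
  | _, .inr q :: ρ, a :: as, h => by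
    rw [numQry_inr, List.length_cons, Correct.length (ρ := ρ) (as := as) h.2]

theorem correct_append : ∀ {x : P.Inst} {ρ ρ' : List P.Req} {as : List (List ℕ)},
    Correct x (ρ ++ ρ') as ↔ ∃ a a', as = a ++ a' ∧ Correct x ρ a ∧ Correct (after x ρ) ρ' a'
  | x, [], ρ', as => by
    refine ⟨fun h => ⟨[], as, rfl, trivial, h⟩, ?_⟩
    rintro ⟨a, a', rfl, h, h'⟩
    cases a with
    | nil => exact h'
    | cons _ _ => exact h.elim
  | x, .inl y :: ρ, ρ', as => correct_append (x := P.apply x y) (ρ := ρ)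
  | x, .inr q :: ρ, ρ', [] => by
    refine ⟨fun h => h.elim, ?_⟩
    rintro ⟨a, a', h, h', -⟩
    obtain ⟨rfl, rfl⟩ := List.append_eq_nil_iff.1 h.symm
    exact h'.elim
  | x, .inr q :: ρ, ρ', a :: as => by
    have ih := correct_append (x := x) (ρ := ρ) (ρ' := ρ') (as := as)
    constructor
    · rintro ⟨h, h'⟩
      obtain ⟨b, b', rfl, h1, h2⟩ := ih.1 h'
      exact ⟨a :: b, b', rfl, ⟨h, h1⟩, h2⟩
    · rintro ⟨b, b', h, h1, h2⟩
      cases b with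
      | nil => exact h1.elim
      | cons c b =>
        obtain ⟨rfl, rfl⟩ := List.cons_eq_cons.1 h
        exact ⟨h1.1, ih.2 ⟨b, b', rfl, h1.2, h2⟩⟩

/-- Correct answers to a sequence of blocks, block by block. -/
theorem DynProblem.Correct.exists_split : ∀ {n : ℕ} {B : Fin n → List P.Req} {x : P.Inst} {as : List (List ℕ)},
    Correct x (List.ofFn B).flatten as →
    ∃ f : Fin n → List (List ℕ), (∀ k, (f k).length = numQry (B k)) ∧ (List.ofFn f).flatten = as
  | 0, B, x, as, h => by
    refine ⟨Fin.elim0, fun k => k.elim0, ?_⟩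
    cases as with
    | nil => rfl
    | cons _ _ => exact h.elim
  | n + 1, B, x, as, h => by
    rw [List.ofFn_succ, List.flatten_cons] at h
    obtain ⟨a, a', rfl, h1, h2⟩ := correct_append.1 h
    obtain ⟨f, hf, rfl⟩ := Correct.exists_split h2
    refine ⟨Fin.cons a f, fun k => ?_, by simp [List.ofFn_succ]⟩
    induction k using Fin.cases with
    | zero => exact h1.length
    | succ k => exact hf k

theorem numUpd_add_numQry (ρ : List P.Req) : numUpd ρ + numQry ρ = ρ.length := by
  induction ρ with
  | nil => rfl
  | cons r ρ ih =>
    cases r with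
    | inl y => rw [numUpd_inl, numQry_inl, List.length_cons]; omega
    | inr q => rw [numUpd_inr, numQry_inr, List.length_cons]; omega

theorem numUpd_perm {ρ ρ' : List P.Req} (h : ρ.Perm ρ') : numUpd ρ = numUpd ρ' := h.countP_eq _

theorem numQry_perm {ρ ρ' : List P.Req} (h : ρ.Perm ρ') : numQry ρ = numQry ρ' := h.countP_eq _

/-- The guarantees of an algorithm with delayed predictions, for a prediction that is a reordering of
at most `δ` requests, or that is exact. -/
def SolvesPerm (P : DynProblem) (A : OnlineAlg) (K N δ U Q : ℕ) : Prop :=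
  ∀ x₀ : P.Inst, P.size x₀ ≤ N → ∀ ρ ρ' : List P.Req, (∀ r ∈ ρ', Possible x₀ r) → ρ.Perm ρ' →
    (ρ.length ≤ δ ∨ ρ = ρ') →
    (∀ ω, ∃ os c₀ c,
      A.Run ω (encList ([δ] :: P.encInst x₀ :: ρ'.map encReq)) (ρ.map encReq) os c₀ c ∧
      c₀ ≤ K * (N + listCost (encList ([δ] :: P.encInst x₀ :: ρ'.map encReq))) ^ K ∧
      c ≤ numUpd ρ * U + numQry ρ * Q) ∧
    coinMeasure {ω | ∃ os c₀ c,
      A.Run ω (encList ([δ] :: P.encInst x₀ :: ρ'.map encReq)) (ρ.map encReq) os c₀ c ∧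
      ¬ Correct x₀ ρ (queryOutputs ρ os)} ≤ 1 / 3

theorem SolvesWithDelayed.solvesPerm {A : OnlineAlg} {N δ U Q : ℕ → ℕ}
    (h : SolvesWithDelayed P A N δ U Q) :
    ∃ K, ∀ m, 1 ≤ m → SolvesPerm P A K (N m) (δ m) (U (N m)) (Q (N m)) := by
  obtain ⟨K, h⟩ := h
  refine ⟨K, fun m hm x₀ hx₀ ρ ρ' hpos hperm hlen => ?_⟩
  have hl : ρ.length = ρ'.length := hperm.length_eq
  have key : ∃ e : Fin ρ'.length ≃ Fin ρ.length, (∀ i, ρ[e i] = ρ'[i]) ∧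
      ∀ i, |((e.symm i : ℕ) : ℤ) - ((i : ℕ) : ℤ)| ≤ δ m := by
    -- Two positions in a list of length at most `δ` differ by at most `δ`.
    rcases hlen with hlen | rfl
    · obtain ⟨e, he⟩ := exists_equiv_of_perm hperm.symm
      refine ⟨e, he, fun i => ?_⟩
      have h1 := i.2
      have h2 := (e.symm i).2
      rw [abs_le]
      omega
    · exact ⟨Equiv.refl _, fun i => rfl, fun i => by simp⟩
  obtain ⟨e, he, hd⟩ := key
  have h1 : (List.ofFn fun i : Fin ρ'.length => ρ'[i]) = ρ' := List.ofFn_get ρ'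
  have h2 : (List.ofFn fun i : Fin ρ'.length => ρ[(i : ℕ)]'(by rw [hl]; exact i.2)) = ρ :=
    List.ext_getElem (by simp [hl]) fun i _ _ => by simp
  have := h m hm x₀ hx₀ ρ'.length (fun i => ρ'[i])
    {fun i : Fin ρ'.length => ρ[(i : ℕ)]'(by rw [hl]; exact i.2)} (fun i => hpos _ (List.getElem_mem _))
    (by
      rintro _ rfl
      exact ⟨e.trans (finCongr hl), fun i => he i, fun i => hd (Fin.cast hl.symm i)⟩) _ rfl
  rwa [h1, h2] at this

/-- Every sequence of possible requests has correct answers. This is not part of the definition of a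
dynamic problem, but follows from the existence of an algorithm. -/
theorem SolvesPerm.exists_correct {A : OnlineAlg} {K N δ U Q : ℕ} (h : SolvesPerm P A K N δ U Q)
    {x₀ : P.Inst} (hx : P.size x₀ ≤ N) {ρ : List P.Req} (hρ : ∀ r ∈ ρ, Possible x₀ r) :
    ∃ as, Correct x₀ ρ as := by
  obtain ⟨h1, h2⟩ := h x₀ hx ρ ρ hρ (.refl _) (.inr rfl)
  by_contra! hcon
  -- Otherwise the algorithm would err with certainty.
  have : {ω | ∃ os c₀ c,
      A.Run ω (encList ([δ] :: P.encInst x₀ :: ρ.map encReq)) (ρ.map encReq) os c₀ c ∧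
      ¬ Correct x₀ ρ (queryOutputs ρ os)} = Set.univ := by
    refine Set.eq_univ_of_forall fun ω => ?_
    obtain ⟨os, c₀, c, h, -, -⟩ := h1 ω
    exact ⟨os, c₀, c, h, hcon _⟩
  rw [this, measure_univ] at h2
  have h3 := (ENNReal.toReal_le_toReal (by finiteness) (by finiteness)).2 h2
  simp at h3
  norm_num at h3

end

section

open DynProblem

variable {P : DynProblem}

theorem Call.det {ω : ℕ → Bool} {p : Prog} {s s₁ s₂ : Memory} {l o₁ o₂ : List ℕ} {c₁ c₂ : ℕ}
    (h₁ : Call ω p s l s₁ o₁ c₁) (h₂ : Call ω p s l s₂ o₂ c₂) : s₁ = s₂ ∧ o₁ = o₂ ∧ c₁ = c₂ := by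
  obtain ⟨c, h, rfl, rfl⟩ := h₁
  obtain ⟨c', h', rfl, rfl⟩ := h₂
  obtain ⟨rfl, rfl⟩ := h.det h'
  exact ⟨rfl, rfl, rfl⟩

/-- The first round of a reduction: the matrix is turned into the data structure `D₀`, the vectors
into the requests `B₀`, and correct answers to these are decoded, within the time bounds. -/
def OneRound (P : DynProblem) (R : RedProgs) (K u q n₁ n₂ n₃ : ℕ)
    (M : Matrix (Fin n₁) (Fin n₂) Bool) (ub : Fin n₁ → Bool) (vb : Fin n₂ → Bool)
    (D₀ : P.Inst) (B₀ : List P.Req) : Prop :=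
  ∀ ω, ∃ s₀ c₀ s' c,
    Call ω R.pre Memory.blank (encList [[n₁, n₂, n₃], matrixBits M]) s₀ (P.encInst D₀) c₀ ∧
    c₀ ≤ K * (n₂ + n₃) ^ K ∧
    Call ω R.enc s₀ (encList [bits ub, bits vb]) s' (encList (B₀.map encReq)) c ∧
    c ≤ K * (u + q + n₁ + n₂) * (Nat.log 2 (n₂ + n₃) + 1) ^ K ∧
    ∀ as, Correct D₀ B₀ as → ∃ σ' c', Call ω R.dec s' (encList as) σ' [(uMv ub M vb).toNat] c' ∧
      c' ≤ K * (q + 1) * (Nat.log 2 (n₂ + n₃) + 1) ^ K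

/-- Since the programs are deterministic, the block of the first round does not depend on the
answers. Correct answers in the first round have to be extended by correct answers in the other
rounds, which exist by assumption. -/
theorem Simulates.oneRound {R : RedProgs} {K u q n₁ n₂ m : ℕ}
    {M : Matrix (Fin n₁) (Fin n₂) Bool} {us : Fin (m + 1) → Fin n₁ → Bool}
    {vs : Fin (m + 1) → Fin n₂ → Bool} {D₀ : P.Inst} {B : Fin (m + 1) → List P.Req}
    (h : Simulates P R K u q n₁ n₂ (m + 1) M us vs D₀ B)
    (hex : ∃ as, Correct D₀ (List.ofFn B).flatten as) :
    OneRound P R K u q n₁ n₂ (m + 1) M (us 0) (vs 0) D₀ (B 0) := by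
  intro ω
  obtain ⟨s₀, c₀, hpre, hc₀, h⟩ := h ω
  obtain ⟨as, has⟩ := hex
  have has' := has
  rw [List.ofFn_succ, List.flatten_cons] at has'
  obtain ⟨a₀, a, -, h0, hrest⟩ := correct_append.1 has'
  obtain ⟨f, hf, hfl⟩ := hrest.exists_split
  -- Any correct answers `b` for the first round, completed by fixed ones for the others.
  have key : ∀ b, Correct D₀ (B 0) b → ∃ s' c c' σ',
      Call ω R.enc s₀ (encList [bits (us 0), bits (vs 0)]) s' (encList ((B 0).map encReq)) c ∧
      c ≤ K * (u + q + n₁ + n₂) * (Nat.log 2 (n₂ + (m + 1)) + 1) ^ K ∧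
      Call ω R.dec s' (encList b) σ' [(uMv (us 0) M (vs 0)).toNat] c' ∧
      c' ≤ K * (q + 1) * (Nat.log 2 (n₂ + (m + 1)) + 1) ^ K := by
    intro b hb
    obtain ⟨s, hs0, hs⟩ := h (Fin.cons b f) (fun k => by
      induction k using Fin.cases with
      | zero => exact hb.length
      | succ k => exact hf k) (by
      rw [List.ofFn_succ, List.flatten_cons, List.ofFn_succ, List.flatten_cons]
      simp only [Fin.cons_zero, Fin.cons_succ]
      exact correct_append.2 ⟨b, _, rfl, hb, by rw [hfl]; exact hrest⟩)
    obtain ⟨s', c, c', h1, h2, h3, h4⟩ := hs 0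
    rw [Fin.val_zero, hs0] at h1
    exact ⟨s', c, c', _, h1, h2, h3, h4⟩
  obtain ⟨s', c, -, -, h1, h2, -, -⟩ := key a₀ h0
  refine ⟨s₀, c₀, s', c, hpre, hc₀, h1, h2, fun b hb => ?_⟩
  obtain ⟨s'', c₂, c', σ', h3, -, h4, h5⟩ := key b hb
  obtain ⟨rfl, -, -⟩ := h1.det h3
  exact ⟨σ', c', h4, h5⟩

/-- The common core of fully and partially dynamic local reducibility: the block `B d` of requests
suffices for one round on a matrix with `rows γ d` rows and `d` columns. The round exists only in the
presence of an algorithm for `P`, which provides correct answers for the rounds that are not used. -/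
structure SingleRound (P : DynProblem) (γ : ℝ) (u q n : ℕ → ℕ → ℕ) (K : ℕ) (R : RedProgs) (post : Prog)
    (B : ℕ → List P.Req) (n3 ts : ℕ → ℕ) (d : ℕ) : Prop where
  univ : ∀ ω, ∃ σ o c, Call ω R.univ Memory.blank [d] σ o c ∧ c ≤ K * d ^ K ∧
    ∀ (lam : ℕ) (C : Params), 3 ≤ lam → C.d1 = rows γ d → C.L = (B d).length → C.n3 = n3 d →
      C.ts = ts d → C.tl = (frames ((B d).map encReq)).length →
      (C.d1 + C.L + 5 + C.n3 + (C.tl + 3)).size ≤ lam →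
      PostSpec post 1000 lam C σ (frames ((B d).map encReq))
  ts_le : ts d ≤ 5
  n3_le : n3 d ≤ K * d ^ K + 1
  tail_le : listCost (frames ((B d).map encReq)) ≤ K * d ^ K
  n_le : n (rows γ d) d ≤ K * d ^ K
  upd : numUpd (B d) = u (rows γ d) d
  qry : numQry (B d) = q (rows γ d) d
  round : ∀ {A : OnlineAlg} {KA N δ UA QA : ℕ}, SolvesPerm P A KA N δ UA QA → n (rows γ d) d ≤ N →
    ∀ (M : Matrix (Fin (rows γ d)) (Fin d) Bool) (ub : Fin (rows γ d) → Bool) (vb : Fin d → Bool),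
      ∃ (D₀ : P.Inst) (B₀ : List P.Req), P.size D₀ = n (rows γ d) d ∧
        (∀ r ∈ B d, Possible D₀ r) ∧ B₀.Subperm (B d) ∧
        OneRound P R K (u (rows γ d) d) (q (rows γ d) d) (rows γ d) d (n3 d) M ub vb D₀ B₀

theorem listCost_le_of_call {ω : ℕ → Bool} {p : Prog} {s s' : Memory} {l o : List ℕ} {c : ℕ}
    (h : Call ω p s l s' o c) : listCost o ≤ c := by
  obtain ⟨c', -, -, rfl⟩ := h; omega

/-- A fully dynamic reduction is used for instances with one round. -/
theorem FullyLocallyReducible.singleRound {γ : ℝ} {u q n : ℕ → ℕ → ℕ} {C : ℕ}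
    (h : FullyLocallyReducible P γ u q n C) :
    ∃ K R B n3 ts, ∀ d, 1 ≤ d → SingleRound P γ u q n K R postFull B n3 ts d := by
  obtain ⟨K, R, B, h⟩ := h
  refine ⟨K, R, B, fun _ => 1, fun _ => 3, fun d hd => ?_⟩
  obtain ⟨h1, h2, h3, h4, -, h6⟩ := h d hd
  refine ⟨fun ω => ?_, by norm_num, by omega, ?_, h2, h3, h4, ?_⟩
  · obtain ⟨σ, c, hcall, hc⟩ := h1 ω
    refine ⟨σ, _, c, hcall, hc, fun lam C hlam e1 e2 e3 e4 e5 hs => ?_⟩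
    obtain ⟨_, _, hout, _⟩ := hcall.exec
    exact postSpec_full (by omega) (by rw [hout, e1]) (by rw [e2, List.length_map]) e3 e4 e5
      ((Nat.size_le_size (by omega)).trans hs)
  · obtain ⟨σ, c, hcall, hc⟩ := h1 fun _ => false
    refine le_trans ?_ ((listCost_le_of_call hcall).trans hc)
    rw [encList_eq, frames_cons]
    simp only [listCost_cons, listCost_append]
    omega
  · intro A KA N δ UA QA hA hN M ub vb
    obtain ⟨D₀, B', hsize, hpos, hsub, hsim⟩ := h6 1 le_rfl M (fun _ => ub) fun _ => vb
    refine ⟨D₀, B' 0, hsize, hpos, hsub 0, ?_⟩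
    refine Simulates.oneRound (m := 0) hsim (hA.exists_correct (hsize.trans_le hN) fun r hr => ?_)
    obtain ⟨l, hl, hr⟩ := List.mem_flatten.1 hr
    obtain ⟨k, rfl⟩ := List.mem_ofFn.1 hl
    exact hpos r ((hsub k).subset hr)

/-- A partially dynamic reduction has a prescribed number of rounds; only the first one is used, and
the vectors of the others are irrelevant. -/
theorem PartiallyLocallyReducible.singleRound {γ : ℝ} {u q n : ℕ → ℕ → ℕ}
    (h : PartiallyLocallyReducible P γ u q n) :
    ∃ K R B n3 ts, ∀ d, 1 ≤ d → SingleRound P γ u q n K R postPartial B n3 ts d := by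
  obtain ⟨K, R, ν, B, h⟩ := h
  refine ⟨K, R, fun d => if hd : 1 ≤ d then B d ⟨0, (h d hd).1⟩ else [], ν, fun _ => 5, fun d hd => ?_⟩
  obtain ⟨h0, h1, h2, h3, -, h6⟩ := h d hd
  have hB : (if hd : 1 ≤ d then B d ⟨0, (h d hd).1⟩ else []) = B d ⟨0, h0⟩ := dif_pos hd
  have hofFn : ∃ rest, (List.ofFn fun k => encList ((B d k).map encReq)) =
      encList ((B d ⟨0, h0⟩).map encReq) :: rest ∧ ν d = rest.length + 1 := by
    have : ∀ (m : ℕ) (hm : 0 < m) (f : Fin m → List ℕ), ∃ rest, List.ofFn f = f ⟨0, hm⟩ :: rest ∧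
        m = rest.length + 1 := by
      rintro (_ | m) hm f
      · omega
      · exact ⟨_, List.ofFn_succ, by simp⟩
    exact this _ h0 _
  obtain ⟨rest, hrest, hν⟩ := hofFn
  rw [hrest] at h1
  refine ⟨fun ω => ?_, le_rfl, ?_, ?_, h2, by rw [hB]; exact (h3 _).1, by rw [hB]; exact (h3 _).2, ?_⟩
  · obtain ⟨σ, c, hcall, hc⟩ := h1 ω
    refine ⟨σ, _, c, hcall, hc, fun lam C hlam e1 e2 e3 e4 e5 hs => ?_⟩
    obtain ⟨_, _, hout, _⟩ := hcall.exec
    rw [hB] at e2 e5 ⊢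
    exact postSpec_partial hlam (by rw [hout, e1]) (by rw [e2, List.length_map]) (by rw [e3, hν]) e4 e5 hs
  · obtain ⟨σ, c, hcall, hc⟩ := h1 fun _ => false
    have h4 := (listCost_le_of_call hcall).trans hc
    have h5 : rest.length ≤ listCost (frames rest) := by
      clear * -
      induction rest with
      | nil => simp
      | cons a l ih => rw [frames_cons, List.length_cons, listCost_cons, listCost_append]; omega
    rw [encList_eq, frames_cons, frames_cons] at h4
    simp only [listCost_cons, listCost_append] at h4
    omega
  · obtain ⟨σ, c, hcall, hc⟩ := h1 fun _ => false
    rw [hB]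
    refine le_trans ?_ ((listCost_le_of_call hcall).trans hc)
    rw [encList_eq, frames_cons, frames_cons, encList_eq]
    simp only [listCost_cons, listCost_append]
    omega
  · intro A KA N δ UA QA hA hN M ub vb
    obtain ⟨D₀, B', hsize, hpos, hperm, hsim⟩ := h6 M (fun _ => ub) fun _ => vb
    refine ⟨D₀, B' ⟨0, h0⟩, hsize, by rw [hB]; exact hpos _, by rw [hB]; exact (hperm _).subperm, ?_⟩
    have hex := hA.exists_correct (hsize.trans_le hN) (ρ := (List.ofFn B').flatten) fun r hr => by
      obtain ⟨l, hl, hr⟩ := List.mem_flatten.1 hr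
      obtain ⟨k, rfl⟩ := List.mem_ofFn.1 hl
      exact hpos k r ((hperm k).subset hr)
    clear hpos hperm hrest h3 hB h6 h1 h2 hν
    revert hsim hex
    generalize ν d = m at *
    cases m with
    | zero => omega
    | succ m => exact fun hsim hex => hsim.oneRound hex

end

section

open DynProblem

variable {P : DynProblem}

theorem CallSeq.of_append {ω : ℕ → Bool} {p : Prog} : ∀ {ls₁ ls₂ : List (List ℕ)} {s s' : Memory}
    {os : List (List ℕ)} {c : ℕ}, CallSeq ω p s (ls₁ ++ ls₂) s' os c →
    ∃ s₁ os₁ os₂ c₁, CallSeq ω p s ls₁ s₁ os₁ c₁ ∧ os = os₁ ++ os₂ ∧ c₁ ≤ c ∧ ls₁.length = os₁.length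
  | [], ls₂, s, s', os, c, _ => ⟨s, [], os, 0, .nil s, rfl, Nat.zero_le _, rfl⟩
  | l :: ls₁, ls₂, s, s', os, c, h => by
    cases h with
    | cons h1 h2 =>
      obtain ⟨s₁, os₁, os₂, c₁, h3, rfl, h4, h5⟩ := CallSeq.of_append h2
      exact ⟨s₁, _ :: os₁, os₂, _, .cons h1 h3, rfl, by omega, by simp [h5]⟩

theorem headI_encReq (r : P.Req) : encReq r ≠ [] ∧ (encReq r).headI ≤ 1 := by
  cases r <;> simp [encReq]

/-- One round of a block of the matrix on one pair of machines. The dynamic algorithm gets the whole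
block of requests as its prediction. The requests of the round come first, followed by the unused
ones; this is a reordering of the prediction, and it is short enough to be `δ`-delayed. -/
theorem SingleRound.exists_specs {γ : ℝ} {u q n : ℕ → ℕ → ℕ} {K cyc c₁ KA N UA QA Wp W : ℕ}
    {R : RedProgs} {post : Prog} {B : ℕ → List P.Req} {n3 ts : ℕ → ℕ} {C : Params} {A : OnlineAlg}
    (h : SingleRound P γ u q n K R post B n3 ts C.d) (hd1 : C.d1 = rows γ C.d) (hn3 : C.n3 = n3 C.d)
    (hL : C.L = (B C.d).length) (hC : C.Computed K cyc c₁)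
    (hc₁ : Nat.log 2 (C.d + C.n3) + 1 ≤ c₁ * C.n.size)
    (hA : SolvesPerm P A KA N C.δ UA QA) (hN : n (rows γ C.d) C.d ≤ N)
    (hWp : KA * (N + (2 * C.F1 + C.L + C.δ + 10 + listCost (frames ((B C.d).map encReq)))) ^ KA ≤ Wp)
    (hW : u (rows γ C.d) C.d * UA + q (rows γ C.d) C.d * QA ≤ W)
    (M : Matrix (Fin C.d1) (Fin C.d) Bool) (ub : Fin C.d1 → Bool) (vb : Fin C.d → Bool) :
    ∃ (s₀ sA : (ℕ → Bool) → Memory) (S : Set (ℕ → Bool)), coinMeasure S ≤ 1 / 3 ∧ ∀ ωR ωA,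
      PrepSpec R.pre A.pre ωR ωA (s₀ ωR) (sA ωA) C (matrixBits M) (frames ((B C.d).map encReq)) Wp ∧
      RoundSpec R.enc R.dec A.step ωR ωA (s₀ ωR) (sA ωA) (bits ub) (bits vb) C.F2 C.F3 W (ωA ∉ S)
        (uMv ub M vb) := by
  obtain ⟨nn, d, d1, L, n3', ts', tl, δ, F1, F2, F3, hh⟩ := C
  obtain ⟨hδ, -, h1, h2, h3⟩ := hC
  dsimp only at *
  subst hd1 hn3 hL
  obtain ⟨D₀, B₀, hsize, hpos, hsub, hround⟩ := h.round hA hN M ub vb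
  -- The requests of the block that are not used in the round.
  obtain ⟨rest, hperm⟩ : ∃ rest, (B₀ ++ rest).Perm (B d) := by
    obtain ⟨l, hl, hls⟩ := hsub
    obtain ⟨rest, hr⟩ := hls.exists_perm_append
    exact ⟨rest, (hl.symm.append_right rest).trans hr.symm⟩
  have hlen : (B₀ ++ rest).length ≤ δ := by
    rw [hperm.length_eq, hδ]; exact Nat.le_mul_of_pos_left _ (by omega)
  obtain ⟨hrun, hS⟩ := hA D₀ (hsize.trans_le hN) (B₀ ++ rest) (B d) hpos hperm (.inl hlen)
  rw [numUpd_perm hperm, numQry_perm hperm, h.upd, h.qry] at hrun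
  set S := {ω | ∃ os c₀ c, A.Run ω (encList ([δ] :: P.encInst D₀ :: (B d).map encReq))
    ((B₀ ++ rest).map encReq) os c₀ c ∧ ¬ Correct D₀ (B₀ ++ rest) (queryOutputs (B₀ ++ rest) os)}
  choose s₀ c₀ s' c hpre hc₀ henc hc hdec using hround
  choose os cp co hr hcp hco using hrun
  choose sA oA sA' hAp hAs using hr
  refine ⟨s₀, sA, S, hS, fun ωR ωA => ⟨?_, ?_⟩⟩
  · have e1 : encList ([δ] :: P.encInst D₀ :: (B d).map encReq) =
        (2 + (B d).length) :: 1 :: δ :: (P.encInst D₀).length :: P.encInst D₀ ++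
          frames ((B d).map encReq) := by
      rw [encList_eq, frames_cons, frames_cons]
      simp only [List.length_cons, List.length_nil, List.length_map, List.cons_append, List.nil_append,
        show (B d).length + 1 + 1 = 2 + (B d).length by ring]
    refine ⟨P.encInst D₀, c₀ ωR, oA ωA, cp ωA, hpre ωR, ?_, by rw [← e1]; exact hAp ωA, ?_⟩
    · have := hc₀ ωR
      dsimp only
      rw [h1, mul_assoc]
      omega
    · refine (hcp ωA).trans (le_trans ?_ hWp)
      gcongr
      have a1 := size_le_self (2 + (B d).length)
      have a2 := size_le_self δ
      have a3 := size_le_self (P.encInst D₀).length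
      have a4 := (listCost_le_of_call (hpre ωR)).trans (hc₀ ωR)
      have a5 := length_le_listCost (P.encInst D₀)
      have a6 : Nat.size 1 = 1 := by decide
      rw [e1]
      simp only [listCost_cons, listCost_append, List.cons_append]
      rw [h1, mul_assoc]
      omega
  · have hseq := hAs ωA
    rw [List.map_append] at hseq
    -- The unused requests are never asked: an initial part of the run is a run on the requests of
    -- the round.
    obtain ⟨s₁, os₁, os₂, c₁', b1, b2, b3, b4⟩ := hseq.of_append
    rw [List.length_map] at b4
    have hpow : (Nat.log 2 (d + n3 d) + 1) ^ K ≤ (c₁ * nn.size) ^ K := Nat.pow_le_pow_left hc₁ K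
    have hL := numUpd_add_numQry (B d)
    rw [h.upd, h.qry] at hL
    refine ⟨B₀.map encReq, os₁, s' ωR, s₁, c ωR, c₁', henc ωR, ?_, ?_, b1,
      b3.trans ((hco ωA).trans hW), fun hgood => ?_⟩
    · have a1 := (hc ωR).trans (Nat.mul_le_mul_left _ hpow)
      rw [hL] at a1
      rw [h2, mul_assoc 4, mul_assoc 4]
      omega
    · intro l hl
      obtain ⟨r, -, rfl⟩ := List.mem_map.1 hl
      exact headI_encReq r
    · have hcorr : Correct D₀ (B₀ ++ rest) (queryOutputs (B₀ ++ rest) (os ωA)) := by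
        by_contra hcon
        exact hgood ⟨os ωA, cp ωA, co ωA, ⟨sA ωA, oA ωA, sA' ωA, hAp ωA, hAs ωA⟩, hcon⟩
      obtain ⟨a, a', ha, hca, -⟩ := correct_append.1 hcorr
      have hn : numQry B₀ = (queryOutputs B₀ os₁).length := by
        clear * - b4
        induction B₀ generalizing os₁ with
        | nil => rfl
        | cons r ρ ih =>
          cases os₁ with
          | nil => simp at b4
          | cons o os =>
            have := ih os (by simpa using b4)
            cases r with
            | inl y => rw [numQry_inl, this]; rfl
            | inr y => rw [numQry_inr, this]; rfl
      rw [b2, queryOutputs_append _ _ _ _ b4] at ha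
      obtain ⟨rfl, -⟩ := List.append_inj ha (by rw [← hn, hca.length])
      obtain ⟨σ', c', a1, a2⟩ := hdec ωR _ hca
      rw [answers_encReq]
      refine ⟨σ', c', a1, ?_⟩
      have a3 : K * (q (rows γ d) d + 1) * (Nat.log 2 (d + n3 d) + 1) ^ K ≤
          K * ((B d).length + 1) * (c₁ * nn.size) ^ K := by gcongr; omega
      rw [h3, mul_assoc 4, mul_assoc 4]
      omega

end

/-! ### The algorithm for OuMv -/

theorem CallSeq.det {ω : ℕ → Bool} {p : Prog} {s s₁ : Memory} {ls os₁ : List (List ℕ)} {c₁ : ℕ}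
    (h₁ : CallSeq ω p s ls s₁ os₁ c₁) : ∀ {s₂ : Memory} {os₂ : List (List ℕ)} {c₂ : ℕ},
    CallSeq ω p s ls s₂ os₂ c₂ → os₁ = os₂ := by
  induction h₁ with
  | nil => intro s₂ os₂ c₂ h; cases h; rfl
  | cons h _ ih =>
    intro s₂ os₂ c₂ h'
    cases h' with
    | cons k k' =>
      obtain ⟨rfl, rfl, rfl⟩ := h.det k
      rw [ih k']

theorem OnlineAlg.Run.det {A : OnlineAlg} {ω : ℕ → Bool} {l : List ℕ} {ls os₁ os₂ : List (List ℕ)}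
    {a₁ a₂ b₁ b₂ : ℕ} (h₁ : A.Run ω l ls os₁ a₁ b₁) (h₂ : A.Run ω l ls os₂ a₂ b₂) : os₁ = os₂ := by
  obtain ⟨s, o, s', h, hs⟩ := h₁
  obtain ⟨t, o', t', k, ks⟩ := h₂
  obtain ⟨rfl, -, -⟩ := h.det k
  exact hs.det ks

/-- The algorithm for OuMv that is built from a local reduction and an algorithm with predictions. -/
def ouMvAlg (κ K cyc c₁ : ℕ) (R : RedProgs) (post : Prog) (A : OnlineAlg) : OnlineAlg where
  pre := preProg κ K cyc c₁ R.univ post R.pre A.pre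
  step := stepProg R.enc R.dec A.step

/-- The product for the block number `e` of the matrix in round `k`, as a function of
`g = k * (nb1 * nb2) + e`. -/
def blockProduct (C : Params) (U V : ℕ → Fin C.n → Bool) (M : Matrix (Fin C.n) (Fin C.n) Bool) (g : ℕ) :
    Bool :=
  uMv (subVec (U (g / (C.nb1 * C.nb2))) (g / C.nb2 % C.nb1 * C.d1) C.d1)
    (subMat M (g / C.nb2 % C.nb1 * C.d1) (g % C.nb2 * C.d) C.d1 C.d)
    (subVec (V (g / (C.nb1 * C.nb2))) (g % C.nb2 * C.d) C.d)

theorem uMv_eq_blockProduct {C : Params} (hd1 : 1 ≤ C.d1) (hd : 1 ≤ C.d) (U V : ℕ → Fin C.n → Bool)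
    (M : Matrix (Fin C.n) (Fin C.n) Bool) (k : ℕ) :
    uMv (U k) M (V k) = true ↔ ∃ e, e < C.nb1 * C.nb2 ∧
      blockProduct C U V M (k * (C.nb1 * C.nb2) + e) = true := by
  have hn1 : 0 < C.nb1 := Nat.succ_pos _
  have hn2 : 0 < C.nb2 := Nat.succ_pos _
  have hlt : ∀ i j, i < C.nb1 → j < C.nb2 → i * C.nb2 + j < C.nb1 * C.nb2 := fun i j hi hj => by
    nlinarith
  have key : ∀ i j, i < C.nb1 → j < C.nb2 →
      (k * (C.nb1 * C.nb2) + (i * C.nb2 + j)) / (C.nb1 * C.nb2) = k ∧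
      (k * (C.nb1 * C.nb2) + (i * C.nb2 + j)) / C.nb2 % C.nb1 = i ∧
      (k * (C.nb1 * C.nb2) + (i * C.nb2 + j)) % C.nb2 = j := by
    intro i j hi hj
    have e1 := hlt i j hi hj
    have e2 : k * (C.nb1 * C.nb2) + (i * C.nb2 + j) = C.nb2 * (C.nb1 * k + i) + j := by ring
    refine ⟨?_, ?_, ?_⟩
    · rw [mul_comm k, Nat.mul_add_div (by positivity), Nat.div_eq_of_lt e1, add_zero]
    · rw [e2, Nat.mul_add_div hn2, Nat.div_eq_of_lt hj, add_zero, Nat.mul_add_mod, Nat.mod_eq_of_lt hi]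
    · rw [e2, Nat.mul_add_mod, Nat.mod_eq_of_lt hj]
  rw [uMv_blocks (U k) (V k) M hd1 hd (Nat.lt_succ_self (C.n / C.d1)) (Nat.lt_succ_self (C.n / C.d))]
  constructor
  · rintro ⟨i, j, hi, hj, h⟩
    obtain ⟨h1, h2, h3⟩ := key i j hi hj
    exact ⟨i * C.nb2 + j, hlt i j hi hj, by rw [blockProduct, h1, h2, h3]; exact h⟩
  · rintro ⟨e, he, h⟩
    have hi : e / C.nb2 < C.nb1 := (Nat.div_lt_iff_lt_mul hn2).2 he
    have hj : e % C.nb2 < C.nb2 := Nat.mod_lt _ hn2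
    obtain ⟨h1, h2, h3⟩ := key _ _ hi hj
    rw [Nat.div_add_mod'] at h1 h2 h3
    rw [blockProduct, h1, h2, h3] at h
    exact ⟨_, _, hi, hj, h⟩

open DynProblem in
/-- The algorithm for OuMv, for one size of the matrix and for any parameters that satisfy the
necessary bounds. It halts within the time bound for all random bits, and it is correct with
probability at least `2 / 3`. -/
theorem run_ouMvAlg {P : DynProblem} {γ : ℝ} {u q n : ℕ → ℕ → ℕ}
    {K cyc c₁ κ KA N UA QA Wp W Ac lam Xp Xr NB : ℕ}
    {R : RedProgs} {post : Prog} {B : ℕ → List P.Req} {n3 ts : ℕ → ℕ} {C : Params} {A : OnlineAlg}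
    (h : SingleRound P γ u q n K R post B n3 ts C.d) (hd1 : C.d1 = rows γ C.d) (hn3 : C.n3 = n3 C.d)
    (hL : C.L = (B C.d).length) (hts : C.ts = ts C.d)
    (htl : C.tl = (frames ((B C.d).map encReq)).length) (hC : C.Computed K cyc c₁)
    (hc₁ : Nat.log 2 (C.d + C.n3) + 1 ≤ c₁ * C.n.size)
    (hA : SolvesPerm P A KA N C.δ UA QA) (hN : n (rows γ C.d) C.d ≤ N)
    (hWp : KA * (N + (2 * C.F1 + C.L + C.δ + 10 + listCost (frames ((B C.d).map encReq)))) ^ KA ≤ Wp)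
    (hW : u (rows γ C.d) C.d * UA + q (rows γ C.d) C.d * QA ≤ W)
    (hcl : ∀ ω lam τ F l, Ac ≤ lam → Shadowed lam τ → (F + listCost l + 1).size + 5 ≤ lam →
      ∃ τ' c, Exec ω (rcall R.pre) (τ.input (F :: l)) τ' c ∧ Shadowed lam τ' ∧
        c ≤ Ac * (lam * (F + listCost l + 1)) ∧ τ'.var 10 ≤ F ∧
        ∀ σ' c₀, Exec ω R.pre ((inner τ).input l) σ' c₀ → 4 * c₀ < F →
          inner τ' = σ' ∧ F ≤ τ'.var 10 + 4 * c₀)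
    (hcs : ClockSpec Ac R.enc R.dec)
    (hb1 : ∀ inp : ℕ → ℕ, (∀ i j, i < C.n → j < C.n → inp (4 + i * C.n + j) ≤ 1) →
      PrepBounds Ac lam Xp Wp NB C (frames ((B C.d).map encReq)) inp)
    (hb2 : ∀ inp : ℕ → ℕ, (∀ x : Fin C.n, inp (2 + x) ≤ 1 ∧ inp (3 + C.n + x) ≤ 1) →
      RoundBounds Ac lam Xr W NB C inp)
    (hn : 1 ≤ C.n) (hd : 1 ≤ C.d) (hd1' : 1 ≤ C.d1) (hNB : NB = C.n * C.nb1 * C.nb2 * C.rep)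
    (hF : (C.F2 + C.F3).size ≤ lam)
    (hκ : (C.n ^ κ).size ≤ lam) (hdκ : C.d ^ κ ≤ C.n) (hdκ' : C.n < (C.d + 1) ^ κ) (hdn : C.d ≤ C.n)
    (hlam : 3 ≤ lam) (hpost : (C.d1 + C.L + 5 + C.n3 + (C.tl + 3)).size ≤ lam)
    (M : Matrix (Fin C.n) (Fin C.n) Bool) (us vs : Fin C.n → Fin C.n → Bool) :
    (∀ ω, ∃ os c₀ c, (ouMvAlg κ K cyc c₁ R post A).Run ω (encList [[C.n], matrixBits M])
        (List.ofFn fun k => encList [bits (us k), bits (vs k)]) os c₀ c ∧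
      c₀ ≤ preProgCost Ac lam Xp NB C.n κ K cyc c₁ 1000 (K * C.d ^ K) ∧
      c ≤ C.n * (6 * C.n + 10 * lam + stepProgCost Ac lam Xr (C.nb1 * C.nb2) C.rep)) ∧
    coinMeasure {ω | ∃ os c₀ c,
      (ouMvAlg κ K cyc c₁ R post A).Run ω (encList [[C.n], matrixBits M])
        (List.ofFn fun k => encList [bits (us k), bits (vs k)]) os c₀ c ∧
      os ≠ List.ofFn fun k => [(uMv (us k) M (vs k)).toNat]} ≤ 1 / 3 := by
  set U : ℕ → Fin C.n → Bool := fun k => if hk : k < C.n then us ⟨k, hk⟩ else fun _ => false with hU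
  set V : ℕ → Fin C.n → Bool := fun k => if hk : k < C.n then vs ⟨k, hk⟩ else fun _ => false with hV
  have hUk : ∀ k : Fin C.n, U k = us k := fun k => by simp [hU]
  have hVk : ∀ k : Fin C.n, V k = vs k := fun k => by simp [hV]
  -- The round in which the pair number `p` of machines is used is `p / C.rep / (C.nb1 * C.nb2)`.
  have hspec := fun p : ℕ => h.exists_specs hd1 hn3 hL hC hc₁ hA hN hWp hW
    (subMat M (C.rowOf p * C.d1) (C.colOf p * C.d) C.d1 C.d)
    (subVec (U (p / C.rep / (C.nb1 * C.nb2))) (C.rowOf p * C.d1) C.d1)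
    (subVec (V (p / C.rep / (C.nb1 * C.nb2))) (C.colOf p * C.d) C.d)
  choose s₀ sA S hS hspec using hspec
  set E := C.nb1 * C.nb2 with hE
  have hrep : 1 ≤ C.rep := by
    have := Nat.size_pos.2 hn
    rw [Params.rep, hC.hh]; omega
  have hls : (List.range' 0 C.n).map (fun k => encList [bits (U k), bits (V k)]) =
      List.ofFn fun k : Fin C.n => encList [bits (us k), bits (vs k)] := by
    refine List.ext_getElem (by simp) fun i h1 _ => ?_
    have hi : i < C.n := by simpa using h1
    simp [← hUk, ← hVk]
  have hos : (List.range' 0 C.n).map (fun k => [(uMv (U k) M (V k)).toNat]) =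
      List.ofFn fun k : Fin C.n => [(uMv (us k) M (vs k)).toNat] := by
    refine List.ext_getElem (by simp) fun i h1 _ => ?_
    have hi : i < C.n := by simpa using h1
    simp [← hUk, ← hVk]
  -- The outputs are correct unless, for some round and block, half of the repetitions or more
  -- fail.
  have main : ∀ ω, ∃ os c₀ c, (ouMvAlg κ K cyc c₁ R post A).Run ω (encList [[C.n], matrixBits M])
        (List.ofFn fun k => encList [bits (us k), bits (vs k)]) os c₀ c ∧
      c₀ ≤ preProgCost Ac lam Xp NB C.n κ K cyc c₁ 1000 (K * C.d ^ K) ∧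
      c ≤ C.n * (6 * C.n + 10 * lam + stepProgCost Ac lam Xr (C.nb1 * C.nb2) C.rep) ∧
      ((∀ g, g < C.n * E → badCount (fun p => coins ω (2 * p + 2) ∉ S p) (g * C.rep) C.rep < C.h) →
        os = List.ofFn fun k => [(uMv (us k) M (vs k)).toNat]) := by
    intro ω
    obtain ⟨σu, ou, cu, hu, hcu, hpo⟩ := h.univ (coins ω 0)
    obtain ⟨s, c₀, hcall, hc₀, hready⟩ := call_preProg (C := C) (ω := ω)
      (s₀ := fun p => s₀ p (coins ω (2 * p + 1))) (sA := fun p => sA p (coins ω (2 * p + 2)))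
      (Rp := R.pre) (Ap := A.pre) M hcl hb1 hC hn hNB hF hκ hdκ hdκ' hdn hu
      (hpo lam C hlam hd1 hL hn3 hts htl hpost) fun p _ => (hspec p _ _).1
    obtain ⟨s', os, c, hseq, hc, hgood⟩ := callSeq_stepProg (As := A.step) (ω := ω)
      (good := fun p => coins ω (2 * p + 2) ∉ S p) (w := blockProduct C U V M) hcs U V C.n 0 s
      (by rw [hNB, zero_add, ← hE, hE, ← mul_assoc]) (by simpa using hready) hb2
      (fun k' _ e he x hx p hp => by
        have hg : p / C.rep = k' * E + e := by
          rw [hp, mul_comm, Nat.mul_add_div hrep, Nat.div_eq_of_lt hx, add_zero]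
        have hk : (k' * E + e) / E = k' := by
          rw [mul_comm, Nat.mul_add_div (by omega), Nat.div_eq_of_lt he, add_zero]
        have h1 := (hspec p (coins ω (2 * p + 1)) (coins ω (2 * p + 2))).2
        have h2 : blockProduct C U V M (k' * E + e) =
            uMv (subVec (U (p / C.rep / E)) (C.rowOf p * C.d1) C.d1)
              (subMat M (C.rowOf p * C.d1) (C.colOf p * C.d) C.d1 C.d)
              (subVec (V (p / C.rep / E)) (C.colOf p * C.d) C.d) := by
          rw [← hg]; rfl
        rw [← hE, h2]
        rwa [hg, hk] at h1 ⊢)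
    rw [hls] at hseq
    rw [zero_add] at hgood
    refine ⟨os, c₀, c, ⟨s, [], s', hcall, hseq⟩, hc₀.trans ?_, hc, fun hbad => ?_⟩
    · unfold preProgCost
      gcongr
    · exact (hgood hbad (fun k => uMv (U k) M (V k)) fun k _ =>
        uMv_eq_blockProduct hd1' hd U V M k).trans hos
  refine ⟨fun ω => ?_, ?_⟩
  · obtain ⟨os, c₀, c, h1, h2, h3, -⟩ := main ω
    exact ⟨os, c₀, c, h1, h2, h3⟩
  · have hG : C.n * E ≤ C.n * (C.n + 1) * (C.n + 1) := by
      rw [hE, mul_assoc]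
      exact Nat.mul_le_mul_left _ (Nat.mul_le_mul (Nat.succ_le_succ (Nat.div_le_self _ _))
        (Nat.succ_le_succ (Nat.div_le_self _ _)))
    refine le_trans (measure_mono ?_) ((coinMeasure_badCount_le hS C.h (C.n * E)).trans
      (by rw [hC.hh]; exact union_bound hn hG))
    rintro ω ⟨os, c₀, c, hrun, hne⟩
    obtain ⟨os', c₀', c', hrun', -, -, hgood⟩ := main ω
    by_contra hcon
    refine hne ?_
    rw [hrun.det hrun']
    refine hgood fun g hg => ?_
    by_contra hle
    exact hcon ⟨g, hg, not_lt.1 hle⟩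

/-! ### Block width and instance size -/

section

open Filter Topology

variable {γ t : ℝ}

theorem rows_le (γ : ℝ) (d : ℕ) : (rows γ d : ℝ) ≤ (d : ℝ) ^ γ :=
  Nat.floor_le (by positivity)

theorem one_le_rows (hγ : 0 < γ) {d : ℕ} (hd : 1 ≤ d) : 1 ≤ rows γ d :=
  (Nat.one_le_floor_iff _).2 (Real.one_le_rpow (by exact_mod_cast hd) hγ.le)

theorem rpow_le_two_mul_rows (hγ : 0 < γ) {d : ℕ} (hd : 1 ≤ d) : (d : ℝ) ^ γ ≤ 2 * rows γ d := by
  have h1 : (1 : ℝ) ≤ rows γ d := by exact_mod_cast one_le_rows hγ hd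
  have h2 : (d : ℝ) ^ γ < rows γ d + 1 := Nat.lt_floor_add_one _
  linarith

theorem rows_mono (hγ : 0 < γ) : Monotone (rows γ) := fun a b h => by
  refine Nat.floor_le_floor ?_
  gcongr

theorem exists_lt_rows (hγ : 0 < γ) (N : ℕ) : ∃ d₀, ∀ d, d₀ ≤ d → N < rows γ d := by
  have h : Tendsto (fun d : ℕ => (d : ℝ) ^ γ) atTop atTop :=
    (tendsto_rpow_atTop hγ).comp tendsto_natCast_atTop_atTop
  obtain ⟨d₀, hd₀⟩ := (h.eventually_ge_atTop ((N : ℝ) + 1)).exists_forall_of_atTop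
  refine ⟨d₀, fun d hd => ?_⟩
  have := hd₀ d hd
  exact Nat.lt_of_succ_le (Nat.le_floor (by push_cast; exact this))

/-- Every width `d` occurs for some parameter `m` of the algorithm with predictions, and `m` is
bounded by a polynomial in `d`. This is where `t < 1` is used: no value of `⌊m ^ t⌋` is skipped. -/
theorem exists_dTwo_eq (ht₀ : 0 < t) (ht₁ : t < 1) {d : ℕ} (hd : 1 ≤ d) :
    ∃ m, d ≤ m ∧ dTwo t m = d ∧ (m : ℝ) ≤ 2 * (d : ℝ) ^ (1 / t) := by
  have hd' : (1 : ℝ) ≤ d := by exact_mod_cast hd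
  have h1 : (1 : ℝ) ≤ (d : ℝ) ^ (1 / t) := Real.one_le_rpow hd' (by positivity)
  have hpow : ((d : ℝ) ^ (1 / t)) ^ t = d := by
    rw [← Real.rpow_mul (by positivity), one_div_mul_cancel ht₀.ne', Real.rpow_one]
  have hm1 := Nat.ceil_lt_add_one (a := (d : ℝ) ^ (1 / t)) (by positivity)
  have hm2 := Nat.le_ceil ((d : ℝ) ^ (1 / t))
  set m := ⌈(d : ℝ) ^ (1 / t)⌉₊
  refine ⟨m, ?_, ?_, by linarith⟩
  · have : (d : ℝ) ^ (1 : ℝ) ≤ (d : ℝ) ^ (1 / t) :=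
      Real.rpow_le_rpow_of_exponent_le hd' (by rw [le_div_iff₀ ht₀]; linarith)
    rw [Real.rpow_one] at this
    exact_mod_cast this.trans hm2
  · rw [dTwo, Nat.floor_eq_iff (by positivity)]
    constructor
    · calc (d : ℝ) = ((d : ℝ) ^ (1 / t)) ^ t := hpow.symm
        _ ≤ (m : ℝ) ^ t := by gcongr
    -- The function `x ^ t` is subadditive as `t ≤ 1`, so it grows by at most `1` from `m - 1` to
    -- `m`.
    · have hm3 : (0 : ℝ) ≤ m - 1 := by linarith
      calc (m : ℝ) ^ t = ((m - 1) + 1 : ℝ) ^ t := by ring_nf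
        _ ≤ (m - 1 : ℝ) ^ t + 1 ^ t := Real.rpow_add_le_add_rpow hm3 zero_le_one ht₀.le ht₁.le
        _ < ((d : ℝ) ^ (1 / t)) ^ t + 1 ^ t := by
          gcongr
          linarith
        _ = d + 1 := by rw [hpow, Real.one_rpow]

/-- Every `n` is between consecutive `κ`-th powers. -/
theorem exists_root {κ n : ℕ} (hκ : 1 ≤ κ) (hn : 1 ≤ n) : ∃ d, 1 ≤ d ∧ d ^ κ ≤ n ∧ n < (d + 1) ^ κ := by
  have hex : ∃ d, n < (d + 1) ^ κ := ⟨n, lt_of_lt_of_le (Nat.lt_succ_self n) (Nat.le_self_pow (by omega) _)⟩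
  classical
  refine ⟨Nat.find hex, ?_, ?_, Nat.find_spec hex⟩
  · by_contra h
    have h0 : Nat.find hex = 0 := by omega
    have := Nat.find_spec hex
    rw [h0] at this
    simp at this
    omega
  · by_contra h
    rcases Nat.eq_zero_or_pos (Nat.find hex) with h0 | h0
    · rw [h0] at h
      simp [show κ ≠ 0 by omega] at h
    · have := Nat.find_min hex (m := Nat.find hex - 1) (by omega)
      rw [Nat.sub_add_cancel h0] at this
      omega

/-! ### The time per round -/

/-- Dividing by the number of rounds, which can be arbitrarily large. -/
theorem PolyLower.le {w g₁ g₂ : ℕ → ℕ} {c₁ c₂ : ℝ}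
    (h : PolyLower (fun n₂ n₃ => n₃ * w n₂) g₁ g₂ c₁ c₂ 1) :
    ∃ (ε C : ℝ) (N : ℕ), 0 < ε ∧ 0 < C ∧ ∀ m, N < g₁ m → N < g₂ m → (w m : ℝ) ≤
      C * ((g₁ m : ℝ) ^ (c₁ - ε) * (g₂ m : ℝ) ^ c₂ + (g₁ m : ℝ) ^ c₁ * (g₂ m : ℝ) ^ (c₂ - ε)) := by
  obtain ⟨ε, C, N, hε, hC, h⟩ := h
  refine ⟨ε, C, N, hε, hC, fun m h1 h2 => ?_⟩
  set a := (g₁ m : ℝ) ^ (c₁ - ε) * (g₂ m : ℝ) ^ c₂ + (g₁ m : ℝ) ^ c₁ * (g₂ m : ℝ) ^ (c₂ - ε) with ha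
  set b := (g₁ m : ℝ) ^ c₁ * (g₂ m : ℝ) ^ c₂ with hb
  have hlim : Tendsto (fun x : ℕ => C * (a + b * (x : ℝ) ^ (-ε))) atTop (𝓝 (C * (a + b * 0))) :=
    (((tendsto_rpow_neg_atTop hε).comp tendsto_natCast_atTop_atTop).const_mul b |>.const_add a).const_mul C
  rw [mul_zero, add_zero] at hlim
  refine ge_of_tendsto hlim ?_
  filter_upwards [eventually_gt_atTop N, eventually_gt_atTop 0] with x hx hx0
  have hx0' : (0 : ℝ) < x := by exact_mod_cast hx0
  have := h m x h1 h2 hx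
  push_cast at this
  rw [Real.rpow_one, Real.rpow_sub hx0', Real.rpow_one] at this
  rw [Real.rpow_neg hx0'.le]
  refine le_of_mul_le_mul_left (this.trans (le_of_eq ?_)) hx0'
  rw [ha, hb]
  ring

/-- A bound of polynomially lower order in terms of a single parameter. -/
theorem exists_exponent (hγ : 0 < γ) {c : ℝ} (hc : 0 < c) {w : ℕ → ℝ} {ε C : ℝ} {N : ℕ} (hε : 0 < ε)
    (hC : 0 < C) {x : ℕ → ℕ} (hx : ∀ d, d ≤ x d)
    (h : ∀ d, N < rows γ (x d) → N < x d → w d ≤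
      C * ((rows γ (x d) : ℝ) ^ (c - ε) * (x d : ℝ) ^ c + (rows γ (x d) : ℝ) ^ c * (x d : ℝ) ^ (c - ε))) :
    ∃ (η C' : ℝ) (d₀ : ℕ), 0 < η ∧ 0 < C' ∧ η ≤ c * γ ∧ η ≤ c ∧ ∀ d, d₀ ≤ d →
      w d ≤ C' * (x d : ℝ) ^ (c * (1 + γ) - η) := by
  obtain ⟨d₀, hd₀⟩ := exists_lt_rows hγ N
  -- The exponent `c - ε` may be negative, in which case `rows_le` could not be raised to this
  -- power.
  set ε' := min ε c with hε'
  have h0 : 0 < ε' := lt_min hε hc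
  have hεε : ε' ≤ ε := min_le_left _ _
  have hεc : ε' ≤ c := min_le_right _ _
  set η := ε' * min 1 γ with hη
  have hm : 0 < min 1 γ := lt_min one_pos hγ
  have hη1 : η ≤ ε' := by
    rw [hη]; exact mul_le_of_le_one_right h0.le (min_le_left _ _)
  have hη2 : η ≤ ε' * γ := by
    rw [hη]; exact mul_le_mul_of_nonneg_left (min_le_right _ _) h0.le
  refine ⟨η, 2 * C, max d₀ (N + 1), by positivity, by positivity,
    hη2.trans (by gcongr), hη1.trans hεc, fun d hd => ?_⟩
  have hd1 : d₀ ≤ d := le_trans (le_max_left _ _) hd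
  have hd2 : N + 1 ≤ d := le_trans (le_max_right _ _) hd
  have hxd := hx d
  have hx1 : (1 : ℝ) ≤ x d := by exact_mod_cast (by omega : 1 ≤ x d)
  have hr1 : (1 : ℝ) ≤ rows γ (x d) := by exact_mod_cast one_le_rows hγ (by omega : 1 ≤ x d)
  have hr2 := rows_le γ (x d)
  have hrow : ∀ s : ℝ, 0 ≤ s → (rows γ (x d) : ℝ) ^ s ≤ (x d : ℝ) ^ (γ * s) := fun s hs => by
    rw [Real.rpow_mul (by positivity)]
    exact Real.rpow_le_rpow (by positivity) hr2 hs
  refine (h d (lt_of_lt_of_le (hd₀ d hd1) (rows_mono hγ hxd)) (by omega)).trans ?_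
  have e1 : (rows γ (x d) : ℝ) ^ (c - ε) * (x d : ℝ) ^ c ≤ (x d : ℝ) ^ (c * (1 + γ) - η) := by
    calc (rows γ (x d) : ℝ) ^ (c - ε) * (x d : ℝ) ^ c
        ≤ (rows γ (x d) : ℝ) ^ (c - ε') * (x d : ℝ) ^ c := by
          gcongr
      _ ≤ (x d : ℝ) ^ (γ * (c - ε')) * (x d : ℝ) ^ c := by
          gcongr
          exact hrow _ (by linarith)
      _ = (x d : ℝ) ^ (γ * (c - ε') + c) := (Real.rpow_add (by positivity) _ _).symm
      _ ≤ _ := Real.rpow_le_rpow_of_exponent_le hx1 (by nlinarith)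
  have e2 : (rows γ (x d) : ℝ) ^ c * (x d : ℝ) ^ (c - ε) ≤ (x d : ℝ) ^ (c * (1 + γ) - η) := by
    calc (rows γ (x d) : ℝ) ^ c * (x d : ℝ) ^ (c - ε)
        ≤ (x d : ℝ) ^ (γ * c) * (x d : ℝ) ^ (c - ε') := by
          gcongr
          exact hrow _ hc.le
      _ = (x d : ℝ) ^ (γ * c + (c - ε')) := (Real.rpow_add (by positivity) _ _).symm
      _ ≤ _ := Real.rpow_le_rpow_of_exponent_le hx1 (by nlinarith)
  rw [mul_assoc 2, mul_left_comm 2]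
  refine mul_le_mul_of_nonneg_left ?_ hC.le
  linarith

/-- Both bounds of the theorem mean that the time per round on a block of width `d` is by a polynomial
factor lower than the size of the block. -/
theorem exists_time_bound (hγ : 0 < γ) (ht₀ : 0 < t) {w m : ℕ → ℕ} (hm : ∀ d, 1 ≤ d → d ≤ m d)
    (hmd : ∀ d, 1 ≤ d → dTwo t (m d) = d) (hmb : ∀ d : ℕ, 1 ≤ d → (m d : ℝ) ≤ 2 * (d : ℝ) ^ (1 / t))
    (h : PolyLower (fun n₂ n₃ => n₃ * w n₂) (fun n₂ => dOne γ t n₂) (fun n₂ => dTwo t n₂) 1 1 1 ∨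
      PolyLower (fun n₂ n₃ => n₃ * w n₂) (fun n₂ => rows γ n₂) (fun n₂ => n₂) t t 1) :
    ∃ (η C : ℝ) (d₀ : ℕ), 0 < η ∧ 0 < C ∧ η ≤ γ ∧ η ≤ 1 ∧ ∀ d, d₀ ≤ d →
      (w (m d) : ℝ) ≤ C * (d : ℝ) ^ (1 + γ - η) := by
  rcases h with h | h
  · obtain ⟨ε, C, N, hε, hC, h⟩ := h.le
    obtain ⟨η, C', d₀, h1, h2, h3, h4, h5⟩ := exists_exponent hγ one_pos
      (w := fun d => if 1 ≤ d then (w (m d) : ℝ) else 0) hε hC (x := fun d => d) (fun d => le_rfl)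
      (N := N) fun d hd1 hd2 => by
        have hd : 1 ≤ d := by omega
        rw [if_pos hd]
        have := h (m d)
        rw [dOne, hmd d hd] at this
        exact this hd1 hd2
    refine ⟨η, C', max d₀ 1, h1, h2, by linarith, h4, fun d hd => ?_⟩
    have := h5 d (le_trans (le_max_left _ _) hd)
    rwa [if_pos (le_trans (le_max_right _ _) hd), one_mul] at this
  · obtain ⟨ε, C, N, hε, hC, h⟩ := h.le
    obtain ⟨η, C', d₀, h1, h2, h3, h4, h5⟩ := exists_exponent hγ ht₀
      (w := fun d => if 1 ≤ d then (w (m d) : ℝ) else 0) hε hC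
      (x := fun d => if 1 ≤ d then m d else d) (fun d => by
        split_ifs with hd
        · exact hm d hd
        · exact le_rfl)
      (N := N) fun d hd1 hd2 => by
        by_cases hd : 1 ≤ d
        · rw [if_pos hd] at hd1 hd2 ⊢
          rw [if_pos hd]
          exact h (m d) hd1 hd2
        · rw [if_neg hd] at hd2; omega
    have hs : 0 ≤ t * (1 + γ) - η := by nlinarith
    refine ⟨η / t, C' * 2 ^ (t * (1 + γ) - η), max d₀ 1, by positivity, by positivity,
      by rwa [div_le_iff₀ ht₀, mul_comm], by rwa [div_le_one ht₀], fun d hd => ?_⟩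
    have hd1 : 1 ≤ d := le_trans (le_max_right _ _) hd
    have h6 := h5 d (le_trans (le_max_left _ _) hd)
    rw [if_pos hd1, if_pos hd1] at h6
    refine h6.trans ?_
    rw [mul_assoc]
    refine mul_le_mul_of_nonneg_left ?_ h2.le
    refine (Real.rpow_le_rpow (by positivity) (hmb d hd1) hs).trans ?_
    rw [Real.mul_rpow (by norm_num) (by positivity), ← Real.rpow_mul (by positivity)]
    refine le_of_eq ?_
    congr 2
    field_simp

end

/-! ### Polynomially bounded functions -/

/-- Bounded by a polynomial on the positive integers. -/
def PolyBdd (f : ℕ → ℕ) : Prop := ∃ K, ∀ n, 1 ≤ n → f n ≤ K * n ^ K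

namespace PolyBdd

variable {f g : ℕ → ℕ}

theorem mono (hg : PolyBdd g) (h : ∀ n, 1 ≤ n → f n ≤ g n) : PolyBdd f := by
  obtain ⟨K, hK⟩ := hg
  exact ⟨K, fun n hn => (h n hn).trans (hK n hn)⟩

theorem const (c : ℕ) : PolyBdd fun _ => c :=
  ⟨c, fun _ hn => Nat.le_mul_of_pos_right _ (Nat.pow_pos hn)⟩

theorem id : PolyBdd fun n => n := ⟨1, fun n _ => by simp⟩

theorem add (hf : PolyBdd f) (hg : PolyBdd g) : PolyBdd fun n => f n + g n := by
  obtain ⟨K, hK⟩ := hf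
  obtain ⟨K', hK'⟩ := hg
  refine ⟨K + K', fun n hn => ?_⟩
  have h1 : n ^ K ≤ n ^ (K + K') := Nat.pow_le_pow_right hn (by omega)
  have h2 : n ^ K' ≤ n ^ (K + K') := Nat.pow_le_pow_right hn (by omega)
  calc f n + g n ≤ K * n ^ (K + K') + K' * n ^ (K + K') :=
        add_le_add ((hK n hn).trans (Nat.mul_le_mul_left _ h1)) ((hK' n hn).trans (Nat.mul_le_mul_left _ h2))
    _ = _ := by ring

theorem mul (hf : PolyBdd f) (hg : PolyBdd g) : PolyBdd fun n => f n * g n := by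
  obtain ⟨K, hK⟩ := hf
  obtain ⟨K', hK'⟩ := hg
  refine ⟨K * K' + K + K', fun n hn => ?_⟩
  calc f n * g n ≤ (K * n ^ K) * (K' * n ^ K') := Nat.mul_le_mul (hK n hn) (hK' n hn)
    _ = K * K' * n ^ (K + K') := by ring
    _ ≤ (K * K' + K + K') * n ^ (K * K' + K + K') :=
      Nat.mul_le_mul (by omega) (Nat.pow_le_pow_right hn (by omega))

theorem pow (hf : PolyBdd f) (k : ℕ) : PolyBdd fun n => f n ^ k := by
  induction k with
  | zero => simpa using const 1
  | succ k ih => simpa only [pow_succ] using ih.mul hf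

theorem size : PolyBdd Nat.size := id.mono fun n _ => size_le_self n

theorem comp {d : ℕ → ℕ} (hf : PolyBdd f) (h1 : ∀ n, 1 ≤ n → 1 ≤ d n) (hd : PolyBdd d) :
    PolyBdd fun n => f (d n) := by
  obtain ⟨K, hK⟩ := hf
  exact ((const K).mul (hd.pow K)).mono fun n hn => hK _ (h1 n hn)

theorem of_eventually {n₀ K : ℕ} (h : ∀ n, n₀ ≤ n → f n ≤ K * n ^ K) : PolyBdd f := by
  have h1 : PolyBdd fun n => K * n ^ K + ∑ i ∈ Finset.range n₀, f i :=
    ((const K).mul (id.pow K)).add (const _)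
  refine h1.mono fun n _ => ?_
  by_cases hn : n₀ ≤ n
  · exact (h n hn).trans (Nat.le_add_right _ _)
  · exact (Finset.single_le_sum (fun i _ => Nat.zero_le (f i)) (Finset.mem_range.2 (not_le.1 hn))).trans
      (Nat.le_add_left _ _)

theorem of_rpow {n₀ : ℕ} {C e : ℝ} (h : ∀ n, n₀ ≤ n → (f n : ℝ) ≤ C * (n : ℝ) ^ e) : PolyBdd f := by
  refine of_eventually (n₀ := max n₀ 1) (K := ⌈C⌉₊ + ⌈e⌉₊) fun n hn => ?_
  have hn1 : 1 ≤ n := le_trans (le_max_right _ _) hn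
  have hn2 : (1 : ℝ) ≤ n := by exact_mod_cast hn1
  have h1 := h n (le_trans (le_max_left _ _) hn)
  have h2 : (n : ℝ) ^ e ≤ (n : ℝ) ^ (⌈C⌉₊ + ⌈e⌉₊) := by
    rw [← Real.rpow_natCast]
    refine Real.rpow_le_rpow_of_exponent_le hn2 ((Nat.le_ceil e).trans ?_)
    push_cast
    exact le_add_of_nonneg_left (Nat.cast_nonneg _)
  have h3 : C ≤ ((⌈C⌉₊ + ⌈e⌉₊ : ℕ) : ℝ) := (Nat.le_ceil C).trans (by push_cast; simp)
  have h4 : (f n : ℝ) ≤ ((⌈C⌉₊ + ⌈e⌉₊ : ℕ) : ℝ) * (n : ℝ) ^ (⌈C⌉₊ + ⌈e⌉₊) := by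
    refine h1.trans ((mul_le_mul_of_nonneg_right h3 (by positivity)).trans ?_)
    exact mul_le_mul_of_nonneg_left h2 (by positivity)
  exact_mod_cast h4

/-- The bit length of a polynomially bounded quantity. -/
theorem size_le (hf : PolyBdd f) : ∃ c, ∀ n, 1 ≤ n → (f n).size ≤ c * n.size := by
  obtain ⟨K, hK⟩ := hf
  refine ⟨K.size + K + 1, fun n hn => ?_⟩
  have hs : 1 ≤ n.size := Nat.size_pos.2 hn
  have hpow : ∀ k, (n ^ k).size ≤ k * n.size + 1 := by
    intro k
    induction k with
    | zero => simp
    | succ k ih =>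
      rw [pow_succ]
      have := size_mul_le (n ^ k) n
      rw [Nat.add_mul]
      omega
  have h1 := (Nat.size_le_size (hK n hn)).trans (size_mul_le _ _)
  have h2 := hpow K
  have h3 : K.size ≤ K.size * n.size := Nat.le_mul_of_pos_right _ hs
  rw [Nat.add_mul, Nat.add_mul]
  omega

end PolyBdd

/-! ### The choice of the parameters -/

/-- All quantities that determine the algorithm, as functions of the size of the matrix. Those that
`Params` has too are named as there; `tc` is the cost of reading the prediction, `N` the size of the
instances, `W` the time of the dynamic algorithm for one round, `K` and `KA` are the constants of the
reduction and of the dynamic algorithm, and `Ac` is the constant of the clocked programs. -/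
structure Choice where
  (K cyc c₁ κ KA Ac : ℕ)
  (d d1 L n3 ts tl tc W N : ℕ → ℕ)

namespace Choice

variable (D : Choice) (n : ℕ)

/-- The delay. -/
def δ : ℕ := (1 + D.cyc) * D.L n

/-- The fuel for the preprocessing of the reduction. -/
def F1 : ℕ := 4 * D.K * (D.d n + D.n3 n) ^ D.K + 1

/-- The fuel for encoding. -/
def F2 : ℕ := 4 * D.K * (D.L n + D.d1 n + D.d n) * (D.c₁ * n.size) ^ D.K + 1

/-- The fuel for decoding. -/
def F3 : ℕ := 4 * D.K * (D.L n + 1) * (D.c₁ * n.size) ^ D.K + 25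

/-- The parameters of the algorithm. -/
def par : Params where
  n := n
  d := D.d n
  d1 := D.d1 n
  L := D.L n
  n3 := D.n3 n
  ts := D.ts n
  tl := D.tl n
  δ := D.δ n
  F1 := D.F1 n
  F2 := D.F2 n
  F3 := D.F3 n
  h := 60 * n.size

/-- A bound for the preprocessing time of the dynamic algorithm. -/
def Wp : ℕ := D.KA * (D.N n + (2 * D.F1 n + D.L n + D.δ n + 10 + D.tc n)) ^ D.KA

/-- The time for preprocessing one pair of machines, up to factors `lam`. -/
def Xp : ℕ := D.d1 n * D.d n + 2 * D.F1 n + D.tc n + D.Wp n + 1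

/-- The time for one round on one pair of machines, up to factors `lam`. -/
def Xr : ℕ := D.d1 n + D.d n + 2 * D.F2 n + D.F3 n + 3 * D.W n + 2

/-- The number of pairs of machines. -/
def NB : ℕ := n * (D.par n).nb1 * (D.par n).nb2 * (D.par n).rep

/-- A bound for all numbers whose bit length must not exceed `lam`. -/
def big : ℕ := 4 * D.Xp n + D.L n + D.δ n + D.ts n + n * n + (D.par n).nb1 * D.d1 n +
  (D.par n).nb2 * D.d n + 8 * D.Xr n + n + 2 * D.NB n + (D.par n).nb1 * (D.par n).nb2 + n ^ D.κ +
  D.n3 n + D.tl n + 40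

/-- A bound for the bit length of all numbers that occur. -/
def lam : ℕ := D.Ac + (D.big n).size + 5

/-- The assumptions on the quantities. -/
structure Admissible : Prop where
  one_le_d : ∀ n, 1 ≤ n → 1 ≤ D.d n
  one_le_d1 : ∀ n, 1 ≤ n → 1 ≤ D.d1 n
  d_le : ∀ n, 1 ≤ n → D.d n ≤ n
  d1_le : ∀ n, 1 ≤ n → D.d1 n ≤ n
  L_le : ∀ n, 1 ≤ n → D.L n ≤ D.W n
  n3 : PolyBdd D.n3
  ts : PolyBdd D.ts
  tl_le : ∀ n, 1 ≤ n → D.tl n ≤ D.tc n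
  tc : PolyBdd D.tc
  W : PolyBdd D.W
  N : PolyBdd D.N

variable {D} {n}

theorem prepBounds {tail : List ℕ} {inp : ℕ → ℕ} (htail : listCost tail = D.tc n)
    (hinp : ∀ i j, i < n → j < n → inp (4 + i * n + j) ≤ 1) :
    PrepBounds D.Ac (D.lam n) (D.Xp n) (D.Wp n) (D.NB n) (D.par n) tail inp := by
  have hz : ∀ a, a ≤ D.big n → a.size + 5 ≤ D.lam n := fun a ha => by
    have := Nat.size_le_size ha
    rw [lam]
    omega
  refine ⟨by rw [lam]; omega, by rw [lam]; omega, ?_, fun i j hi hj => ?_, hz _ ?_, ?_⟩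
  · rw [htail]; exact le_rfl
  · have : (inp (4 + i * n + j)).size ≤ 1 := (Nat.size_le_size (hinp i j hi hj)).trans (by simp)
    change (inp (4 + i * n + j)).size ≤ _
    rw [lam]
    omega
  · simp only [par, big]; omega
  · have := hz (2 * D.NB n + 2) (by simp only [big]; omega)
    omega

theorem roundBounds (hn : 1 ≤ n) {inp : ℕ → ℕ} (hinp : ∀ x : Fin n, inp (2 + x) ≤ 1 ∧ inp (3 + n + x) ≤ 1) :
    RoundBounds D.Ac (D.lam n) (D.Xr n) (D.W n) (D.NB n) (D.par n) inp := by
  have hz : ∀ a, a ≤ D.big n → a.size + 5 ≤ D.lam n := fun a ha => by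
    have := Nat.size_le_size ha
    rw [lam]
    omega
  have h1 : ∀ a, a ≤ 1 → a.size ≤ D.lam n := fun a ha => by
    have : a.size ≤ 1 := (Nat.size_le_size ha).trans (by simp)
    rw [lam]
    omega
  refine ⟨by rw [lam]; omega, by rw [lam]; omega, le_rfl,
    fun j hj => ⟨h1 _ (hinp ⟨j, hj⟩).1, h1 _ (hinp ⟨j, hj⟩).2⟩, hz _ ?_, ?_, ?_, ?_⟩
  · simp only [par, big]; omega
  · have := hz (2 * D.NB n + 2) (by simp only [big]; omega)
    omega
  · have := hz ((D.par n).nb1 * (D.par n).nb2) (by simp only [big]; omega)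
    omega
  · have := Nat.size_pos.2 hn
    simp only [par]
    omega

theorem nb1_le : (D.par n).nb1 ≤ n + 1 := Nat.succ_le_succ (Nat.div_le_self _ _)

theorem nb2_le : (D.par n).nb2 ≤ n + 1 := Nat.succ_le_succ (Nat.div_le_self _ _)

namespace Admissible

theorem polyBdd (h : D.Admissible) : PolyBdd D.F1 ∧ PolyBdd D.NB ∧ PolyBdd D.Wp ∧ PolyBdd D.Xp ∧ PolyBdd D.Xr ∧
    PolyBdd D.big := by
  have hd : PolyBdd D.d := PolyBdd.id.mono h.d_le
  have hd1 : PolyBdd D.d1 := PolyBdd.id.mono h.d1_le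
  have hL : PolyBdd D.L := h.W.mono h.L_le
  have htl : PolyBdd D.tl := h.tc.mono h.tl_le
  have hn3 := h.n3
  have hts := h.ts
  have htc := h.tc
  have hW := h.W
  have hN := h.N
  have hs := PolyBdd.size
  have hnb1 : PolyBdd fun n => (D.par n).nb1 :=
    (PolyBdd.id.add (.const 1)).mono fun n _ => nb1_le
  have hnb2 : PolyBdd fun n => (D.par n).nb2 :=
    (PolyBdd.id.add (.const 1)).mono fun n _ => nb2_le
  have hδ : PolyBdd D.δ := (PolyBdd.const _).mul hL
  have hF1 : PolyBdd D.F1 := ((PolyBdd.const _).mul ((hd.add hn3).pow _)).add (.const _)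
  have hF2 : PolyBdd D.F2 :=
    (((PolyBdd.const _).mul ((hL.add hd1).add hd)).mul (((PolyBdd.const _).mul hs).pow _)).add (.const _)
  have hF3 : PolyBdd D.F3 :=
    (((PolyBdd.const _).mul (hL.add (.const _))).mul (((PolyBdd.const _).mul hs).pow _)).add (.const _)
  have hrep : PolyBdd fun n => (D.par n).rep := (PolyBdd.const _).mul ((PolyBdd.const _).mul hs)
  have hNB : PolyBdd D.NB := ((PolyBdd.id.mul hnb1).mul hnb2).mul hrep
  have hWp : PolyBdd D.Wp := (PolyBdd.const _).mul ((hN.add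
    ((((((PolyBdd.const _).mul hF1).add hL).add hδ).add (.const _)).add htc)).pow _)
  have hXp : PolyBdd D.Xp :=
    ((((hd1.mul hd).add ((PolyBdd.const _).mul hF1)).add htc).add hWp).add (.const _)
  have hXr : PolyBdd D.Xr :=
    ((((hd1.add hd).add ((PolyBdd.const _).mul hF2)).add hF3).add ((PolyBdd.const _).mul hW)).add (.const _)
  refine ⟨hF1, hNB, hWp, hXp, hXr, ?_⟩
  exact (((((((((((((((PolyBdd.const _).mul hXp).add hL).add hδ).add hts).add (PolyBdd.id.mul .id)).add
    (hnb1.mul hd1)).add (hnb2.mul hd)).add ((PolyBdd.const _).mul hXr)).add .id).add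
    ((PolyBdd.const _).mul hNB)).add (hnb1.mul hnb2)).add (PolyBdd.id.pow _)).add hn3).add htl).add
    (.const _)

theorem exists_lam_le (h : D.Admissible) : ∃ c, ∀ n, 1 ≤ n → D.lam n ≤ c * n.size := by
  obtain ⟨c, hc⟩ := h.polyBdd.2.2.2.2.2.size_le
  refine ⟨c + D.Ac + 5, fun n hn => ?_⟩
  have hs : 1 ≤ n.size := Nat.size_pos.2 hn
  have := hc n hn
  have h1 : D.Ac ≤ D.Ac * n.size := Nat.le_mul_of_pos_right _ hs
  rw [lam, Nat.add_mul, Nat.add_mul]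
  omega

/-- The preprocessing takes polynomial time. -/
theorem polyBdd_pre (h : D.Admissible) (pc : ℕ) : PolyBdd fun n =>
    preProgCost D.Ac (D.lam n) (D.Xp n) (D.NB n) n D.κ D.K D.cyc D.c₁ pc (D.K * D.d n ^ D.K) := by
  obtain ⟨-, hNB, -, hXp, -, -⟩ := h.polyBdd
  have hd : PolyBdd D.d := PolyBdd.id.mono h.d_le
  have hs := PolyBdd.size
  have hlam : PolyBdd D.lam := by
    obtain ⟨c, hc⟩ := h.exists_lam_le
    exact ((PolyBdd.const c).mul hs).mono hc
  have hjob : PolyBdd fun n => preJobCost D.Ac (D.lam n) (D.Xp n) :=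
    ((PolyBdd.const _).mul (((PolyBdd.const 1).add hlam).mul ((PolyBdd.const 1).add hlam))).mul
      (hXp.add (.const _))
  have htail : PolyBdd fun n => prepTailCost D.Ac (D.lam n) (D.Xp n) (D.NB n) n D.K D.cyc D.c₁ :=
    (((PolyBdd.const _).mul hlam).add (hs.mul ((PolyBdd.const _).mul hlam))).add
      (hNB.mul (hjob.add ((PolyBdd.const _).mul hlam)))
  exact ((((((PolyBdd.const 5).mul .id).mul .id).add ((PolyBdd.const _).mul hlam)).add
    (PolyBdd.id.mul (((PolyBdd.const _).mul hlam).add ((PolyBdd.const _).mul hlam)))).add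
    ((PolyBdd.const _).mul (((PolyBdd.const 1).add hlam).mul ((PolyBdd.const _).mul (hd.pow _)))) |>.add
    htail).add (.const _)

/-- The time for one round is, up to polylogarithmic factors, the number of blocks of the matrix
times the time for a round on one block. -/
theorem exists_online_le (h : D.Admissible) : ∃ c k, ∀ n, 1 ≤ n →
    6 * n + 10 * D.lam n +
      stepProgCost D.Ac (D.lam n) (D.Xr n) ((D.par n).nb1 * (D.par n).nb2) (D.par n).rep ≤
    c * ((D.par n).nb1 * (D.par n).nb2 * (D.W n + D.d1 n + D.d n)) * n.size ^ k := by
  obtain ⟨c, hc⟩ := h.exists_lam_le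
  set x := 12 * D.K * D.c₁ ^ D.K + 33
  set v := (60 * D.Ac + 20000) * (2 * (1 + c) * (2 * (1 + c))) * x + 202 * (1 + c)
  set b := 120 * v + 102 * (1 + c)
  refine ⟨6 + 110 * (1 + c) + b, D.K + 3, fun n hn => ?_⟩
  have hs : 1 ≤ n.size := Nat.size_pos.2 hn
  have hd := h.one_le_d n hn
  have hL := h.L_le n hn
  have hlam : D.lam n ≤ (1 + c) * n.size := (hc n hn).trans (Nat.mul_le_mul_right _ (by omega))
  have hlam1 : 1 + D.lam n ≤ 2 * (1 + c) * n.size := by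
    have : 1 * 1 ≤ (1 + c) * n.size := Nat.mul_le_mul (by omega) hs
    rw [mul_assoc]
    omega
  set s := n.size
  set Z := D.W n + D.d1 n + D.d n with hZ
  have hZ1 : 1 ≤ Z := by omega
  set E := (D.par n).nb1 * (D.par n).nb2 with hE
  have hE1 : 1 ≤ E := Nat.mul_pos (Nat.succ_pos _) (Nat.succ_pos _)
  have hsK : 1 ≤ s ^ D.K := Nat.one_le_pow _ _ hs
  have hZs : 1 ≤ Z * s ^ D.K := Nat.mul_pos hZ1 hsK
  have hX : D.Xr n + 1 ≤ x * (Z * s ^ D.K) := by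
    have h1 : D.F2 n ≤ 4 * (D.K * D.c₁ ^ D.K * (Z * s ^ D.K)) + 1 := by
      have : D.L n + D.d1 n + D.d n ≤ Z := by omega
      calc D.F2 n ≤ 4 * D.K * Z * (D.c₁ * s) ^ D.K + 1 := by unfold F2; gcongr
        _ = _ := by rw [mul_pow]; ring
    have h2 : D.F3 n ≤ 4 * (D.K * D.c₁ ^ D.K * (Z * s ^ D.K)) + 25 := by
      have : D.L n + 1 ≤ Z := by omega
      calc D.F3 n ≤ 4 * D.K * Z * (D.c₁ * s) ^ D.K + 25 := by unfold F3; gcongr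
        _ = _ := by rw [mul_pow]; ring
    have h3 : Z ≤ Z * s ^ D.K := Nat.le_mul_of_pos_right _ hsK
    have h4 : x * (Z * s ^ D.K) = 12 * (D.K * D.c₁ ^ D.K * (Z * s ^ D.K)) + 33 * (Z * s ^ D.K) := by
      simp only [x]; ring
    rw [h4, Xr]
    omega
  have pmono : ∀ i j, i ≤ j → s ^ i ≤ s ^ j := fun i j hij => Nat.pow_le_pow_right hs hij
  have hsle : ∀ i, 1 ≤ i → s ≤ Z * s ^ i := fun i hi =>
    (le_of_eq (pow_one s).symm).trans ((pmono 1 i hi).trans (Nat.le_mul_of_pos_left _ hZ1))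
  have hv : voteCost D.Ac (D.lam n) (D.Xr n) + 1 + D.lam n ≤ v * (Z * s ^ (D.K + 2)) := by
    have h1 : stepJobCost D.Ac (D.lam n) (D.Xr n) ≤
        (60 * D.Ac + 20000) * (2 * (1 + c) * (2 * (1 + c))) * x * (Z * s ^ (D.K + 2)) := by
      calc stepJobCost D.Ac (D.lam n) (D.Xr n)
          ≤ (60 * D.Ac + 20000) * (2 * (1 + c) * s * (2 * (1 + c) * s)) * (x * (Z * s ^ D.K)) := by
            unfold stepJobCost; gcongr
        _ = _ := by ring
    have h2 : (1 + c) * s ≤ (1 + c) * (Z * s ^ (D.K + 2)) := Nat.mul_le_mul_left _ (hsle _ (by omega))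
    have h4 : v * (Z * s ^ (D.K + 2)) = (60 * D.Ac + 20000) * (2 * (1 + c) * (2 * (1 + c))) * x *
        (Z * s ^ (D.K + 2)) + 202 * ((1 + c) * (Z * s ^ (D.K + 2))) := by simp only [v]; ring
    rw [h4, voteCost]
    rw [mul_assoc 2] at hlam1
    omega
  have hb : blockCost D.Ac (D.lam n) (D.Xr n) (D.par n).rep + 1 + D.lam n ≤ b * (Z * s ^ (D.K + 3)) := by
    have hrep : (D.par n).rep = 120 * s := by simp only [Params.rep, par]; omega
    have h1 : (D.par n).rep * (voteCost D.Ac (D.lam n) (D.Xr n) + 1 + D.lam n) ≤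
        120 * (v * (Z * s ^ (D.K + 3))) := by
      rw [hrep]
      calc 120 * s * (voteCost D.Ac (D.lam n) (D.Xr n) + 1 + D.lam n)
          ≤ 120 * s * (v * (Z * s ^ (D.K + 2))) := Nat.mul_le_mul_left _ hv
        _ = _ := by ring
    have h2 : (1 + c) * s ≤ (1 + c) * (Z * s ^ (D.K + 3)) := Nat.mul_le_mul_left _ (hsle _ (by omega))
    have h4 : b * (Z * s ^ (D.K + 3)) = 120 * (v * (Z * s ^ (D.K + 3))) +
        102 * ((1 + c) * (Z * s ^ (D.K + 3))) := by simp only [b]; ring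
    rw [h4, blockCost]
    rw [mul_assoc 2] at hlam1
    omega
  -- The time for reading the two vectors is dominated by the total width of the blocks.
  have hnE : n ≤ E * Z := by
    have h1 : n < (D.par n).nb2 * D.d n := by
      simpa [Params.nb2, par, mul_comm] using Nat.lt_mul_div_succ n hd
    have h2 : (D.par n).nb2 ≤ E := Nat.le_mul_of_pos_left _ (Nat.succ_pos _)
    exact h1.le.trans (Nat.mul_le_mul h2 (by omega))
  have hs3 : 1 ≤ s ^ (D.K + 3) := Nat.one_le_pow _ _ hs
  have h1 : E * (blockCost D.Ac (D.lam n) (D.Xr n) (D.par n).rep + 1 + D.lam n) ≤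
      b * (E * Z * s ^ (D.K + 3)) := by
    calc _ ≤ E * (b * (Z * s ^ (D.K + 3))) := Nat.mul_le_mul_left _ hb
      _ = _ := by ring
  have h2 : (1 + c) * s ≤ (1 + c) * (E * Z * s ^ (D.K + 3)) := by
    refine Nat.mul_le_mul_left _ ((hsle (D.K + 3) (by omega)).trans ?_)
    rw [mul_assoc]
    exact Nat.le_mul_of_pos_left _ hE1
  have h3 : E * Z ≤ E * Z * s ^ (D.K + 3) := Nat.le_mul_of_pos_right _ hs3
  have h4 : (6 + 110 * (1 + c) + b) * (E * Z) * s ^ (D.K + 3) = 6 * (E * Z * s ^ (D.K + 3)) +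
      110 * ((1 + c) * (E * Z * s ^ (D.K + 3))) + b * (E * Z * s ^ (D.K + 3)) := by ring
  rw [h4, stepProgCost]
  omega

end Admissible

end Choice

/-! ### The running time for OuMv -/

theorem log_add_one_le_size {x : ℕ} (hx : 1 ≤ x) : Nat.log 2 x + 1 ≤ x.size :=
  Nat.lt_size.2 (Nat.pow_log_le_self 2 (by omega))

/-- Polylogarithmic factors are dominated by every power. -/
theorem exists_size_pow_le (k : ℕ) {ε : ℝ} (hε : 0 < ε) :
    ∃ c : ℝ, 0 < c ∧ ∀ n : ℕ, 1 ≤ n → (n.size : ℝ) ^ k ≤ c * (n : ℝ) ^ ε := by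
  set e := ε / (k + 1) with he
  have he0 : 0 < e := by positivity
  have hl2 : 0 < Real.log 2 := Real.log_pos (by norm_num)
  set a := 1 / (e * Real.log 2) + 1 with ha
  have ha0 : 0 < a := by positivity
  refine ⟨a ^ k, by positivity, fun n hn => ?_⟩
  have hn1 : (1 : ℝ) ≤ n := by exact_mod_cast hn
  have h1 : (n.size : ℝ) ≤ a * (n : ℝ) ^ e := by
    have hs : 1 ≤ n.size := Nat.size_pos.2 hn
    have h2 : 2 ^ (n.size - 1) ≤ n := Nat.lt_size.1 (by omega)
    have h3 : ((n.size - 1 : ℕ) : ℝ) * Real.log 2 ≤ Real.log n := by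
      rw [← Real.log_pow]
      exact Real.log_le_log (by positivity) (by exact_mod_cast h2)
    have h4 := Real.log_le_rpow_div (x := (n : ℝ)) (by positivity) he0
    have h5 : (1 : ℝ) ≤ (n : ℝ) ^ e := Real.one_le_rpow hn1 he0.le
    rw [Nat.cast_sub hs, Nat.cast_one] at h3
    have h6 : (n.size : ℝ) - 1 ≤ (n : ℝ) ^ e / e / Real.log 2 := by
      rw [le_div_iff₀ hl2]; exact h3.trans h4
    calc (n.size : ℝ) ≤ (n : ℝ) ^ e / e / Real.log 2 + (n : ℝ) ^ e := by linarith
      _ = a * (n : ℝ) ^ e := by rw [ha]; field_simp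
  calc (n.size : ℝ) ^ k ≤ (a * (n : ℝ) ^ e) ^ k := by gcongr
    _ = a ^ k * (n : ℝ) ^ (e * k) := by rw [mul_pow, ← Real.rpow_mul_natCast (by positivity)]
    _ ≤ a ^ k * (n : ℝ) ^ ε := by
      gcongr
      rw [he, div_mul_eq_mul_div, div_le_iff₀ (by positivity)]
      nlinarith

/-- There are about `n ^ 2 / d ^ (1 + γ)` blocks, and a round on one block takes time `d ^ (1 + γ - η)`. As
`d` is about `n ^ (1 / κ)`, a polynomial factor is saved. -/
theorem blocks_mul_time_le {γ η C₀ : ℝ} {κ n d d1 : ℕ} {W : ℝ} (hγ : 0 < γ) (hκ : 1 ≤ κ) (hη : 0 < η)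
    (hηγ : η ≤ γ) (hη1 : η ≤ 1) (hC₀ : 0 < C₀) (hd : 1 ≤ d) (hd1 : d1 = rows γ d) (hdn : d ≤ n)
    (hd1n : d1 ≤ n) (hdκ : n < (d + 1) ^ κ) (hW₀ : 0 ≤ W) (hW : W ≤ C₀ * (d : ℝ) ^ (1 + γ - η)) :
    ((n / d1 + 1 : ℕ) * (n / d + 1 : ℕ) : ℝ) * (W + d1 + d) ≤
      8 * (C₀ + 2) * 2 ^ η * (n : ℝ) ^ (2 - η / κ) := by
  have hdr : (1 : ℝ) ≤ d := by exact_mod_cast hd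
  have hnr : (1 : ℝ) ≤ n := by exact_mod_cast hd.trans hdn
  have hd1' : 1 ≤ d1 := hd1 ▸ one_le_rows hγ hd
  have hd1r : (1 : ℝ) ≤ d1 := by exact_mod_cast hd1'
  have hblock : ∀ w : ℕ, 1 ≤ w → w ≤ n → ((n / w + 1 : ℕ) : ℝ) ≤ 2 * n / w := by
    intro w hw hwn
    have hw0 : (0 : ℝ) < w := by exact_mod_cast hw
    have h1 : ((n / w : ℕ) : ℝ) ≤ n / w := Nat.cast_div_le
    have h2 : (1 : ℝ) ≤ n / w := by rw [le_div_iff₀ hw0, one_mul]; exact_mod_cast hwn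
    push_cast
    rw [mul_div_assoc]
    linarith
  have hZ : W + d1 + d ≤ (C₀ + 2) * (d : ℝ) ^ (1 + γ - η) := by
    have h1 : (d1 : ℝ) ≤ (d : ℝ) ^ (1 + γ - η) := by
      rw [hd1]
      exact (rows_le γ d).trans (Real.rpow_le_rpow_of_exponent_le hdr (by linarith))
    have h2 : (d : ℝ) ≤ (d : ℝ) ^ (1 + γ - η) := by
      conv_lhs => rw [← Real.rpow_one (d : ℝ)]
      exact Real.rpow_le_rpow_of_exponent_le hdr (by linarith)
    linarith
  have hrow : (d : ℝ) ^ γ ≤ 2 * d1 := by rw [hd1]; exact rpow_le_two_mul_rows hγ hd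
  have hroot : (n : ℝ) ^ (1 / (κ : ℝ)) ≤ 2 * d := by
    have hκ0 : (κ : ℝ) ≠ 0 := by positivity
    have h1 : (n : ℝ) ≤ (2 * d : ℝ) ^ κ := by
      have : n ≤ (2 * d) ^ κ := hdκ.le.trans (Nat.pow_le_pow_left (by omega) _)
      exact_mod_cast this
    calc (n : ℝ) ^ (1 / (κ : ℝ)) ≤ ((2 * d : ℝ) ^ κ) ^ (1 / (κ : ℝ)) := by gcongr
      _ = 2 * d := by
        rw [← Real.rpow_natCast, ← Real.rpow_mul (by positivity), mul_one_div_cancel hκ0, Real.rpow_one]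
  have hdη : (d : ℝ) ^ (-η) ≤ 2 ^ η * (n : ℝ) ^ (-(η / κ)) := by
    have h1 : (n : ℝ) ^ (η / κ) ≤ 2 ^ η * (d : ℝ) ^ η := by
      rw [← Real.mul_rpow (by norm_num) (by positivity), div_eq_mul_one_div, mul_comm,
        Real.rpow_mul (by positivity)]
      exact Real.rpow_le_rpow (by positivity) hroot hη.le
    rw [Real.rpow_neg (by positivity), Real.rpow_neg (by positivity), ← div_eq_mul_inv, inv_eq_one_div,
      div_le_div_iff₀ (by positivity) (by positivity), one_mul]
    exact h1
  have hsplit : (d : ℝ) ^ (1 + γ - η) = d * (d : ℝ) ^ γ * (d : ℝ) ^ (-η) := by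
    rw [sub_eq_add_neg, Real.rpow_add (by positivity), Real.rpow_add (by positivity), Real.rpow_one]
  calc ((n / d1 + 1 : ℕ) * (n / d + 1 : ℕ) : ℝ) * (W + d1 + d)
      ≤ ((2 * n / d1) * (2 * n / d)) * ((C₀ + 2) * (d : ℝ) ^ (1 + γ - η)) := by
        exact mul_le_mul (mul_le_mul (hblock _ hd1' hd1n) (hblock _ hd hdn) (by positivity)
          (by positivity)) hZ (by positivity) (by positivity)
    _ ≤ ((2 * n / d1) * (2 * n / d)) * ((C₀ + 2) * (d * (2 * d1) * (2 ^ η * (n : ℝ) ^ (-(η / κ))))) := by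
        rw [hsplit]
        gcongr
    _ = 8 * (C₀ + 2) * 2 ^ η * ((n : ℝ) ^ (2 : ℝ) * (n : ℝ) ^ (-(η / κ))) := by
        rw [Real.rpow_two]
        field_simp
        ring
    _ = _ := by rw [← Real.rpow_add (by positivity), ← sub_eq_add_neg]

theorem CallSeq.length_le {ω : ℕ → Bool} {p : Prog} {s s' : Memory} {ls os : List (List ℕ)} {c : ℕ}
    (h : CallSeq ω p s ls s' os c) : ls.length ≤ c := by
  induction h with
  | nil => exact le_rfl
  | cons h _ ih =>
    obtain ⟨c', hex, -, rfl⟩ := h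
    have := hex.one_le
    rw [List.length_cons]
    omega

section

open DynProblem

variable {P : DynProblem}

/-- Since every request costs at least one, the block is not longer than the time for it. -/
theorem SingleRound.length_le {γ : ℝ} {u q n : ℕ → ℕ → ℕ} {K KA N δ UA QA d : ℕ}
    {R : RedProgs} {post : Prog} {B : ℕ → List P.Req} {n3 ts : ℕ → ℕ} {A : OnlineAlg}
    (h : SingleRound P γ u q n K R post B n3 ts d) (hA : SolvesPerm P A KA N δ UA QA)
    (hN : n (rows γ d) d ≤ N) :
    (B d).length ≤ u (rows γ d) d * UA + q (rows γ d) d * QA := by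
  obtain ⟨D₀, B₀, hsize, hpos, -, -⟩ := h.round hA hN (fun _ _ => false) (fun _ => false) fun _ => false
  obtain ⟨hrun, -⟩ := hA D₀ (hsize.trans_le hN) (B d) (B d) hpos (.refl _) (.inr rfl)
  obtain ⟨os, c₀, c, ⟨_, _, _, _, hseq⟩, -, hc⟩ := hrun fun _ => false
  rw [h.upd, h.qry] at hc
  have := hseq.length_le
  rw [List.length_map] at this
  omega

/-- A local reduction and an algorithm with predictions give an algorithm for OuMv. -/
theorem SingleRound.exists_solvesOuMv {γ t : ℝ} (hγ : 0 < γ) (ht₀ : 0 < t) (ht₁ : t < 1)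
    {u q n : ℕ → ℕ → ℕ} (hn : ∀ a a' b b' : ℕ, a ≤ a' → b ≤ b' → n a b ≤ n a' b') {cyc : ℕ}
    {K : ℕ} {R : RedProgs} {post : Prog} {B : ℕ → List P.Req} {n3 ts : ℕ → ℕ}
    (hsr : ∀ d, 1 ≤ d → SingleRound P γ u q n K R post B n3 ts d) {U Q : ℕ → ℕ} {A : OnlineAlg}
    (hA : SolvesWithDelayed P A (fun n₂ => n (rows γ n₂) n₂)
      (fun n₂ => (1 + cyc) * (u (dOne γ t n₂) (dTwo t n₂) + q (dOne γ t n₂) (dTwo t n₂))) U Q)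
    (hlow : PolyLower (fun n₂ n₃ => n₃ * (u (dOne γ t n₂) (dTwo t n₂) * U (n (rows γ n₂) n₂) +
          q (dOne γ t n₂) (dTwo t n₂) * Q (n (rows γ n₂) n₂)))
          (fun n₂ => dOne γ t n₂) (fun n₂ => dTwo t n₂) 1 1 1 ∨
      PolyLower (fun n₂ n₃ => n₃ * (u (dOne γ t n₂) (dTwo t n₂) * U (n (rows γ n₂) n₂) +
          q (dOne γ t n₂) (dTwo t n₂) * Q (n (rows γ n₂) n₂)))
          (fun n₂ => rows γ n₂) (fun n₂ => n₂) t t 1) :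
    ∃ ε : ℝ, 0 < ε ∧ ∃ A', SolvesOuMv A' (3 - ε) := by
  obtain ⟨KA, hA⟩ := hA.solvesPerm
  -- The parameter for which the dynamic algorithm is used on blocks of width `d`.
  have hm : ∀ d, ∃ m, 1 ≤ d → d ≤ m ∧ dTwo t m = d ∧ (m : ℝ) ≤ 2 * (d : ℝ) ^ (1 / t) := fun d => by
    by_cases hd : 1 ≤ d
    · obtain ⟨m, hm⟩ := exists_dTwo_eq ht₀ ht₁ hd
      exact ⟨m, fun _ => hm⟩
    · exact ⟨0, fun h => absurd h hd⟩
  choose m hm using hm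
  set w : ℕ → ℕ := fun n₂ => u (dOne γ t n₂) (dTwo t n₂) * U (n (rows γ n₂) n₂) +
    q (dOne γ t n₂) (dTwo t n₂) * Q (n (rows γ n₂) n₂) with hw
  obtain ⟨η, C₀, d₀, hη, hC₀, hηγ, hη1, hwle⟩ := exists_time_bound hγ ht₀ (w := w)
    (fun d hd => (hm d hd).1) (fun d hd => (hm d hd).2.1) (fun d hd => (hm d hd).2.2) hlow
  -- With this exponent, blocks of width at most `n ^ (1 / κ)` have at most `n` rows.
  set κ := ⌈γ⌉₊ + 1 with hκ
  have hκ1 : 1 ≤ κ := by omega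
  have hr : ∀ k, ∃ d, 1 ≤ k → 1 ≤ d ∧ d ^ κ ≤ k ∧ k < (d + 1) ^ κ := fun k => by
    by_cases hk : 1 ≤ k
    · obtain ⟨d, hd⟩ := exists_root hκ1 hk
      exact ⟨d, fun _ => hd⟩
    · exact ⟨0, fun h => absurd h hk⟩
  choose r hr using hr
  have hr1 : ∀ k, 1 ≤ k → 1 ≤ r k := fun k hk => (hr k hk).1
  have hrle : ∀ k, 1 ≤ k → r k ≤ k := fun k hk =>
    (Nat.le_self_pow (by omega) _).trans (hr k hk).2.1
  have hrp : PolyBdd r := PolyBdd.id.mono hrle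
  have hn3 : PolyBdd fun k => n3 (r k) :=
    PolyBdd.comp (f := n3) ⟨K + 1, fun d hd => (hsr d hd).n3_le.trans (by
      have h1 : d ^ K ≤ d ^ (K + 1) := Nat.pow_le_pow_right hd (by omega)
      have h2 : 1 ≤ d ^ (K + 1) := Nat.one_le_pow _ _ hd
      have h3 : K * d ^ K ≤ K * d ^ (K + 1) := Nat.mul_le_mul_left _ h1
      rw [Nat.add_mul]; omega)⟩ hr1 hrp
  obtain ⟨c₁, hc₁⟩ := (hrp.add hn3).size_le
  obtain ⟨A1, hA1⟩ := exists_rcall R.pre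
  obtain ⟨A2, hA2⟩ := exists_rcall R.enc
  obtain ⟨A3, hA3⟩ := exists_rdec R.dec
  have hmul : ∀ a b x : ℕ, a ≤ b → a * x ≤ b * x := fun a b x h => Nat.mul_le_mul_right x h
  let D : Choice :=
    { K := K, cyc := cyc, c₁ := c₁, κ := κ, KA := KA, Ac := A1 + A2 + A3
      d := r, d1 := fun k => rows γ (r k), L := fun k => (B (r k)).length, n3 := fun k => n3 (r k)
      ts := fun k => ts (r k), tl := fun k => (frames ((B (r k)).map encReq)).length
      tc := fun k => listCost (frames ((B (r k)).map encReq))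
      W := fun k => w (m (r k)), N := fun k => n (rows γ (m (r k))) (m (r k)) }
  have hw' : ∀ d, 1 ≤ d → w (m d) = u (rows γ d) d * U (n (rows γ (m d)) (m d)) +
      q (rows γ d) d * Q (n (rows γ (m d)) (m d)) := fun d hd => by
    simp only [hw, dOne, (hm d hd).2.1]
  have hnm : ∀ d, 1 ≤ d → n (rows γ d) d ≤ n (rows γ (m d)) (m d) := fun d hd =>
    hn _ _ _ _ (rows_mono hγ (hm d hd).1) (hm d hd).1
  have hδ : ∀ d, 1 ≤ d → (1 + cyc) * (u (dOne γ t (m d)) (dTwo t (m d)) +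
      q (dOne γ t (m d)) (dTwo t (m d))) = (1 + cyc) * (B d).length := fun d hd => by
    rw [dOne, (hm d hd).2.1, ← (hsr d hd).upd, ← (hsr d hd).qry, numUpd_add_numQry]
  have hAd : ∀ d, 1 ≤ d → SolvesPerm P A KA (n (rows γ (m d)) (m d)) ((1 + cyc) * (B d).length)
      (U (n (rows γ (m d)) (m d))) (Q (n (rows γ (m d)) (m d))) := fun d hd => by
    have := hA (m d) (hd.trans (hm d hd).1)
    rwa [hδ d hd] at this
  have hmp : PolyBdd m := PolyBdd.of_rpow (n₀ := 1) fun d hd => (hm d hd).2.2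
  have hadm : D.Admissible :=
    { one_le_d := hr1
      one_le_d1 := fun k hk => one_le_rows hγ (hr1 k hk)
      d_le := hrle
      d1_le := fun k hk => by
        have h1 : (1 : ℝ) ≤ r k := by exact_mod_cast hr1 k hk
        have h2 : (rows γ (r k) : ℝ) ≤ ((r k ^ κ : ℕ) : ℝ) := by
          refine (rows_le γ _).trans ?_
          push_cast
          rw [← Real.rpow_natCast]
          refine Real.rpow_le_rpow_of_exponent_le h1 ((Nat.le_ceil γ).trans ?_)
          rw [hκ]
          push_cast
          linarith
        exact (by exact_mod_cast h2 : rows γ (r k) ≤ r k ^ κ).trans (hr k hk).2.1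
      L_le := fun k hk => by
        have hd := hr1 k hk
        exact ((hsr _ hd).length_le (hAd _ hd) (hnm _ hd)).trans_eq (hw' _ hd).symm
      n3 := hn3
      ts := (PolyBdd.const 5).mono fun k hk => (hsr _ (hr1 k hk)).ts_le
      tl_le := fun k _ => length_le_listCost _
      tc := PolyBdd.comp (f := fun d => listCost (frames ((B d).map encReq)))
        ⟨K, fun d hd => (hsr d hd).tail_le⟩ hr1 hrp
      W := PolyBdd.comp (f := fun d => w (m d)) (PolyBdd.of_rpow hwle) hr1 hrp
      N := PolyBdd.comp (f := fun d => n (rows γ (m d)) (m d))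
        (PolyBdd.comp (f := fun x => n (rows γ x) x) ⟨K, fun d hd => (hsr d hd).n_le⟩
          (fun d hd => hd.trans (hm d hd).1) hmp) hr1 hrp }
  obtain ⟨K₁, hK₁⟩ := hadm.polyBdd_pre 1000
  obtain ⟨c, k, hck⟩ := hadm.exists_online_le
  set ε := η / (2 * κ) with hε
  have hε0 : 0 < ε := by positivity
  obtain ⟨c', hc', hsize⟩ := exists_size_pow_le k hε0
  have honline : ∃ K₂ : ℝ, ∀ x : ℕ, 1 ≤ x → ((x * (6 * x + 10 * D.lam x +
      stepProgCost D.Ac (D.lam x) (D.Xr x) ((D.par x).nb1 * (D.par x).nb2) (D.par x).rep) : ℕ) : ℝ) ≤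
      K₂ * (x : ℝ) ^ (3 - ε) := by
    set f : ℕ → ℕ := fun x => x * (6 * x + 10 * D.lam x +
      stepProgCost D.Ac (D.lam x) (D.Xr x) ((D.par x).nb1 * (D.par x).nb2) (D.par x).rep)
    set a := 8 * (C₀ + 2) * 2 ^ η
    have ha : 0 < a := by positivity
    have hκr : (1 : ℝ) ≤ κ := by exact_mod_cast hκ1
    have hε1 : ε ≤ 1 := by
      rw [hε, div_le_one (by positivity)]; linarith
    have hεκ : η / κ = 2 * ε := by rw [hε]; field_simp
    -- The sum takes care of the matrices that are too small for the bound of `exists_time_bound`.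
    refine ⟨c * a * c' + ∑ i ∈ Finset.range (d₀ ^ κ), (f i : ℝ), fun x hx => ?_⟩
    have hx1 : (1 : ℝ) ≤ x := by exact_mod_cast hx
    have hpow : (1 : ℝ) ≤ (x : ℝ) ^ (3 - ε) := Real.one_le_rpow hx1 (by linarith)
    have hsum : (0 : ℝ) ≤ ∑ i ∈ Finset.range (d₀ ^ κ), (f i : ℝ) :=
      Finset.sum_nonneg fun i _ => Nat.cast_nonneg _
    rw [add_mul]
    by_cases hxd : x < d₀ ^ κ
    · have h1 : (f x : ℝ) ≤ ∑ i ∈ Finset.range (d₀ ^ κ), (f i : ℝ) :=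
        Finset.single_le_sum (f := fun i => (f i : ℝ)) (fun i _ => Nat.cast_nonneg _)
          (Finset.mem_range.2 hxd)
      have h2 : 0 ≤ c * a * c' * (x : ℝ) ^ (3 - ε) := by positivity
      have h3 := le_mul_of_one_le_right hsum hpow
      change (f x : ℝ) ≤ _
      linarith
    · have hd : d₀ ≤ r x := by
        by_contra hlt
        exact hxd ((hr x hx).2.2.trans_le (Nat.pow_le_pow_left (by omega) _))
      have h1 := blocks_mul_time_le hγ hκ1 hη hηγ hη1 hC₀ (hr1 x hx) rfl (hrle x hx)
        (hadm.d1_le x hx) (hr x hx).2.2 (Nat.cast_nonneg _) (hwle _ hd)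
      have h2 := hsize x hx
      have h3 : (f x : ℝ) ≤ x * (c * (((D.par x).nb1 * (D.par x).nb2 : ℝ) *
          (D.W x + D.d1 x + D.d x)) * (x.size : ℝ) ^ k) := by
        have := Nat.mul_le_mul_left x (hck x hx)
        exact_mod_cast this
      have h4 : ((D.par x).nb1 * (D.par x).nb2 : ℝ) * (D.W x + D.d1 x + D.d x) ≤
          a * (x : ℝ) ^ (2 - η / κ) := h1
      have h5 : (f x : ℝ) ≤ c * a * c' * (x : ℝ) ^ (3 - ε) := by
        calc (f x : ℝ) ≤ x * (c * (a * (x : ℝ) ^ (2 - η / κ)) * (c' * (x : ℝ) ^ ε)) := by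
              refine h3.trans ?_
              gcongr
          _ = c * a * c' * ((x : ℝ) ^ (1 : ℝ) * (x : ℝ) ^ (2 - η / κ) * (x : ℝ) ^ ε) := by
              rw [Real.rpow_one]; ring
          _ = c * a * c' * (x : ℝ) ^ (3 - ε) := by
              rw [← Real.rpow_add (by positivity), ← Real.rpow_add (by positivity), hεκ]
              ring_nf
      have h6 : 0 ≤ (∑ i ∈ Finset.range (d₀ ^ κ), (f i : ℝ)) * (x : ℝ) ^ (3 - ε) := by positivity
      change (f x : ℝ) ≤ _
      linarith
  obtain ⟨K₂, hK₂⟩ := honline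
  refine ⟨ε, hε0, ouMvAlg κ K cyc c₁ R post A, K₁ + ⌈K₂⌉₊, fun x hx M us vs => ?_⟩
  have hd := hr1 x hx
  have hbig : ∀ a, a ≤ D.big x → a.size ≤ D.lam x := fun a ha => by
    have := Nat.size_le_size ha
    rw [Choice.lam]
    omega
  obtain ⟨hrun, hprob⟩ := run_ouMvAlg (C := D.par x) (κ := κ) (Ac := D.Ac) (lam := D.lam x)
    (Xp := D.Xp x) (Xr := D.Xr x) (NB := D.NB x) (Wp := D.Wp x) (W := D.W x) (cyc := cyc)
    (c₁ := c₁) (hsr _ hd) rfl rfl rfl rfl rfl ⟨rfl, rfl, rfl, rfl, rfl⟩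
    ((log_add_one_le_size (by have := hd; change 1 ≤ r x + n3 (r x); omega)).trans (hc₁ x hx))
    (hAd _ hd) (hnm _ hd) le_rfl (hw' _ hd).ge
    (fun ω lam τ F l h1 h2 h3 => by
      obtain ⟨τ', c, a1, a2, a3, a4, a5⟩ := hA1 ω lam τ F l (le_trans (by change A1 ≤ A1 + A2 + A3; omega) h1) h2 h3
      exact ⟨τ', c, a1, a2, a3.trans (hmul _ _ _ (by change A1 ≤ A1 + A2 + A3; omega)), a4, a5⟩)
    ⟨fun ω lam τ F l h1 h2 h3 => by
      obtain ⟨τ', c, a1, a2, a3, a4, a5⟩ := hA2 ω lam τ F l (le_trans (by change A2 ≤ A1 + A2 + A3; omega) h1) h2 h3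
      exact ⟨τ', c, a1, a2, a3.trans (hmul _ _ _ (by change A2 ≤ A1 + A2 + A3; omega)), a4, a5⟩,
    fun ω lam τ F l h1 h2 h3 => by
      obtain ⟨τ', c, a1, a3, a4, a5⟩ := hA3 ω lam τ F l (le_trans (by change A3 ≤ A1 + A2 + A3; omega) h1) h2 h3
      exact ⟨τ', c, a1, a3.trans (hmul _ _ _ (by change A3 ≤ A1 + A2 + A3; omega)), a4, a5⟩⟩
    (fun inp hinp => Choice.prepBounds rfl hinp) (fun inp hinp => Choice.roundBounds hx hinp)
    hx hd (hadm.one_le_d1 x hx) rfl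
    (hbig _ (by simp only [Choice.big, Choice.par, Choice.Xr]; omega))
    (hbig _ (by
      change x ^ κ ≤ _
      simp only [Choice.big, D]; omega)) (hr x hx).2.1 (hr x hx).2.2 (hrle x hx)
    (by rw [Choice.lam]; omega)
    (hbig _ (by simp only [Choice.big, Choice.par, Choice.Xr]; omega)) M us vs
  refine ⟨fun ω => ?_, hprob⟩
  obtain ⟨os, c₀, c, h1, h2, h3⟩ := hrun ω
  refine ⟨os, c₀, c, h1, h2.trans ((hK₁ x hx).trans ?_), ?_⟩
  · exact Nat.mul_le_mul (by omega) (Nat.pow_le_pow_right hx (by omega))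
  · refine (Nat.cast_le.2 h3).trans ((hK₂ x hx).trans ?_)
    gcongr
    push_cast
    have := Nat.le_ceil K₂
    have : (0 : ℝ) ≤ K₁ := Nat.cast_nonneg _
    linarith

end

end DynPred

theorem mainTheorem6
    (hOuMv : DynPred.OuMvConjecture)
    (P : DynPred.DynProblem) (γ t : ℝ) (hγ : 0 < γ) (ht₀ : 0 < t) (ht₁ : t < 1)
    (u q n : ℕ → ℕ → ℕ)
    (hn : ∀ a a' b b' : ℕ, a ≤ a' → b ≤ b' → n a b ≤ n a' b')
    (C : ℕ)
    (hP : DynPred.FullyLocallyReducible P γ u q n C ∨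
      (DynPred.PartiallyLocallyReducible P γ u q n ∧ C = 0))
    (U Q : ℕ → ℕ) :
    ¬ ∃ A : DynPred.OnlineAlg,
      DynPred.SolvesWithDelayed P A
        (fun n₂ => n (DynPred.rows γ n₂) n₂)
        (fun n₂ => (1 + C) * (u (DynPred.dOne γ t n₂) (DynPred.dTwo t n₂) +
          q (DynPred.dOne γ t n₂) (DynPred.dTwo t n₂)))
        U Q ∧
      (DynPred.PolyLower
          (fun n₂ n₃ => n₃ *
            (u (DynPred.dOne γ t n₂) (DynPred.dTwo t n₂) * U (n (DynPred.rows γ n₂) n₂) +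
              q (DynPred.dOne γ t n₂) (DynPred.dTwo t n₂) * Q (n (DynPred.rows γ n₂) n₂)))
          (fun n₂ => DynPred.dOne γ t n₂) (fun n₂ => DynPred.dTwo t n₂) 1 1 1 ∨
        DynPred.PolyLower
          (fun n₂ n₃ => n₃ *
            (u (DynPred.dOne γ t n₂) (DynPred.dTwo t n₂) * U (n (DynPred.rows γ n₂) n₂) +
              q (DynPred.dOne γ t n₂) (DynPred.dTwo t n₂) * Q (n (DynPred.rows γ n₂) n₂)))
          (fun n₂ => DynPred.rows γ n₂) (fun n₂ => n₂) t t 1) := by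
  rintro ⟨A, hA, hlow⟩
  have key : ∃ K R post B n3 ts, ∀ d, 1 ≤ d → DynPred.SingleRound P γ u q n K R post B n3 ts d := by
    rcases hP with hP | ⟨hP, -⟩
    · obtain ⟨K, R, B, n3, ts, h⟩ := hP.singleRound
      exact ⟨K, R, _, B, n3, ts, h⟩
    · obtain ⟨K, R, B, n3, ts, h⟩ := hP.singleRound
      exact ⟨K, R, _, B, n3, ts, h⟩
  obtain ⟨K, R, post, B, n3, ts, hsr⟩ := key
  obtain ⟨ε, hε, A', hA'⟩ := DynPred.SingleRound.exists_solvesOuMv hγ ht₀ ht₁ hn hsr hA hlow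
  exact hOuMv ε hε ⟨A', hA'⟩
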